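/- **Conventions.** A (pseudo) double category $\mathcal C$ has objects, arrows $f:A\to A'$ (composed strictly), proarrows $m:A\nrightarrow B$ (composed up to coherent isomorphism; $m\odot n$ is the composite in diagrammatic order and $U_A$ is the unit proarrow) and squares with a left proarrow $m$, a right proarrow $n$, a top arrow $f$ and a bottom arrow $g$; $U_f$ is the unit square of an arrow $f$. A *disk* is a square whose arrow boundaries are identities. Functors are strict in the arrow dimension and pseudo in the proarrow dimension. $\mathcal C^{co}$ is $\mathcal C$ with its proarrows (and hence squares) reversed. A *proarrow-dimension pseudo natural transformation* $t:P\Rightarrow Q$ consists of proarrows $t_A:PA\nrightarrow QA$, squares $t_f$ with left $t_A$, right $t_B$, top $Pf$, bottom $Qf$ that preserve identities and composition of arrows, and invertible disks $t_m:Pm\odot t_B\cong t_A\odot Qm$ that are natural for squares and compatible with composition and units of proarrows. For difunctors $P,Q:\mathcal C^{co}\times\mathcal C\to\mathcal D$, a *proarrow-dimension pseudo dinatural transformation* $t:P\Rightarrow Q$ consists of proarrows $t_A:P(A,A)\nrightarrow Q(A,A)$, squares $t_f$ with left $t_A$, right $t_B$, top $P(f,f)$, bottom $Q(f,f)$ that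 preserve identities and composition of arrows, and, for $m:A\nrightarrow B$, invertible disks $$P(U_B,m)\odot t_B\odot Q(m,U_B)\;\cong\;P(m,U_A)\odot t_A\odot Q(U_A,m)$$ that are natural for squares and compatible with composition and units of proarrows. **Data.** Let $\mathcal C$ be a monoidal double category: $\otimes:\mathcal C\times\mathcal C\to\mathcal C$ is a functor, $I$ is the unit object, and the associator $\alpha$ and the unitors $\lambda,\rho$ are invertible arrow-dimension natural transformations that satisfy the pentagon and triangle equations on arrows and on squares. Let $(-)^*:\mathcal C^{co}\to\mathcal C$ be a functor. Let $\eta$ (a *cap*) be a proarrow-dimension pseudo dinatural transformation from the difunctor constant at $I$ to $(X,Y)\mapsto X^*\otimes Y$, and $\varepsilon$ (a *cup*) one from $(X,Y)\mapsto Y\otimes X^*$ to the difunctor constant at $I$. Thus $\eta_A:I\nrightarrow A^*\otimes A$ and $\varepsilon_A:A\otimes A^*\nrightarrow I$, and for $m:A\nrightarrow B$, so that $m^*:B^*\nrightarrow A^*$, there are invertible disks $$\eta_m:\eta_B\odot(m^*\otimes U_B)\to\eta_A\odot(U_{A^*}\otimes m),\qquad \varepsilon_m:(m\otimes U_{B^*})\odot\varepsilon_B\to(U_A\otimes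 m^*)\odot\varepsilon_A .$$ The *strips* $\iota$ and $\iota^*$ are the dinatural transformations given by the identities of the difunctors $(X,Y)\mapsto Y$ and $(X,Y)\mapsto X^*$. Their object components are $U_A$ and $U_{A^*}$, their arrow components are $U_f$ and $U_{f^*}$, and their disks are identities up to the coherence isomorphisms. Finally, let companion proarrows of the components of $\alpha^{\pm1},\lambda^{\pm1},\rho^{\pm1}$ be given, denoted by a hat. (If $\otimes$ is strictly associative and unital, these may be taken to be unit proarrows; if every arrow of $\mathcal C$ has a companion, as for categories with functors and profunctors, they exist.) **Statement.** There are proarrow-dimension pseudo natural transformations $S:\mathrm{id}_{\mathcal C}\Rightarrow\mathrm{id}_{\mathcal C}$ and $Z:(-)^*\Rightarrow(-)^*$ (between functors $\mathcal C\to\mathcal C$ and $\mathcal C^{co}\to\mathcal C$), the *zigzags*, with the following components. 1. *Object-component proarrows.* $$S_A=\hat\rho^{-1}\odot(\iota_A\otimes\eta_A)\odot\hat\alpha^{-1}\odot(\varepsilon_A\otimes\iota_A)\odot\hat\lambda:A\nrightarrow A,$$ $$Z_A=\hat\lambda^{-1}\odot(\eta_A\otimes\iota^*_A)\odot\hat\alpha\odot(\iota^*_A\otimes\varepsilon_A)\odot\hat\rho:A^*\nrightarrow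 A^* .$$ With the coherence proarrows suppressed, $S_A=(\iota_A\otimes\eta_A)\odot(\varepsilon_A\otimes\iota_A)$ and $Z_A=(\eta_A\otimes\iota^*_A)\odot(\iota^*_A\otimes\varepsilon_A)$. 2. *Arrow-component squares.* For $f:A\to B$, $S_f$ (top and bottom arrow $f$) is the composite in the proarrow dimension of $\iota_f\otimes\eta_f$ and $\varepsilon_f\otimes\iota_f$, and $Z_f$ (top and bottom arrow $f^*$) is that of $\eta_f\otimes\iota^*_f$ and $\iota^*_f\otimes\varepsilon_f$. In both cases the composite also contains, at the coherence proarrows, the squares between companions that correspond to the naturality of $\alpha^{\pm1},\lambda^{\pm1},\rho^{\pm1}$ at $f$ and $f^*$. 3. *Proarrow-component disks.* For $m:A\nrightarrow B$, the invertible disk $S_m:m\odot S_B\to S_A\odot m$ is the composite, in this order, of the interchanger $(m\otimes U)\odot(U\otimes\eta_B)\cong(U\otimes\eta_B)\odot(m\otimes U)$, of $\varepsilon_m\otimes\iota_B$, of $\iota_A\otimes\eta_m$, and of the interchanger $(U\otimes m)\odot(\varepsilon_A\otimes U)\cong(\varepsilon_A\otimes U)\odot(U\otimes m)$. The invertible disk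 $Z_m:Z_B\odot m^*\to m^*\odot Z_A$ is the composite, in this order, of the interchanger $(U\otimes\varepsilon_B)\odot(m^*\otimes U)\cong(m^*\otimes U)\odot(U\otimes\varepsilon_B)$, of $\eta_m\otimes\iota^*_B$, of $\iota^*_A\otimes\varepsilon_m$, and of the interchanger $(\eta_A\otimes U)\odot(U\otimes m^*)\cong(U\otimes m^*)\odot(\eta_A\otimes U)$. Here $\iota,\iota^*$ denote identities, and between these steps proarrows are moved past $\hat\alpha^{\pm1},\hat\lambda^{\pm1},\hat\rho^{\pm1}$ by the disks that correspond to the proarrow components of $\alpha^{\pm1},\lambda^{\pm1},\rho^{\pm1}$. -/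

import Mathlib

open CategoryTheory Bicategory

universe u v w x

/-- A (pseudo) double category. Proarrows `A ⟶ B` (the `CategoryStruct` data) compose weakly,
arrows `Arr A B` compose strictly. A square `φ : Sq m n f g` has proarrow boundary `m` on the left
and `n` on the right, and arrow boundary `f` on the top and `g` on the bottom:
```
   A  --f-->  A'
   |m   φ     |n
   B  --g-->  B'
```
So that laws which only hold up to an equality of boundary arrows can be stated as plain equations,
composition of squares in the arrow dimension takes the boundary arrows of the composite together
with proofs that they are the composites of the given boundary arrows (and similarly for
identity squares). -/
class DoubleCategory (C : Type u) extends CategoryStruct.{v} C where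
  /-- arrows -/
  Arr : C → C → Type w
  /-- identity arrow -/
  aid (A : C) : Arr A A
  /-- composite arrow -/
  acomp {A B E : C} (f : Arr A B) (g : Arr B E) : Arr A E
  aid_acomp {A B : C} (f : Arr A B) : acomp (aid A) f = f
  acomp_aid {A B : C} (f : Arr A B) : acomp f (aid B) = f
  acomp_assoc {A B E F : C} (f : Arr A B) (g : Arr B E) (h : Arr E F) :
    acomp (acomp f g) h = acomp f (acomp g h)
  /-- squares -/
  Sq {A B A' B' : C} (m : A ⟶ B) (n : A' ⟶ B') (f : Arr A A') (g : Arr B B') : Type x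
  /-- identity square of a proarrow -/
  sid {A B : C} (m : A ⟶ B) {f : Arr A A} {g : Arr B B} (hf : f = aid A) (hg : g = aid B) :
    Sq m m f g
  /-- composition of squares in the arrow dimension -/
  scomp {A B A' B' A'' B'' : C} {m : A ⟶ B} {n : A' ⟶ B'} {p : A'' ⟶ B''}
    {f : Arr A A'} {g : Arr B B'} {f' : Arr A' A''} {g' : Arr B' B''}
    (φ : Sq m n f g) (ψ : Sq n p f' g') {f'' : Arr A A''} {g'' : Arr B B''}
    (hf : acomp f f' = f'') (hg : acomp g g' = g'') : Sq m p f'' g''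
  sid_scomp {A B A' B' : C} {m : A ⟶ B} {n : A' ⟶ B'} {f : Arr A A'} {g : Arr B B'}
    (φ : Sq m n f g) : scomp (sid m rfl rfl) φ (aid_acomp f) (aid_acomp g) = φ
  scomp_sid {A B A' B' : C} {m : A ⟶ B} {n : A' ⟶ B'} {f : Arr A A'} {g : Arr B B'}
    (φ : Sq m n f g) : scomp φ (sid n rfl rfl) (acomp_aid f) (acomp_aid g) = φ
  scomp_assoc {A₀ B₀ A₁ B₁ A₂ B₂ A₃ B₃ : C} {m₀ : A₀ ⟶ B₀} {m₁ : A₁ ⟶ B₁} {m₂ : A₂ ⟶ B₂}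
    {m₃ : A₃ ⟶ B₃} {f : Arr A₀ A₁} {g : Arr B₀ B₁} {f' : Arr A₁ A₂} {g' : Arr B₁ B₂}
    {f'' : Arr A₂ A₃} {g'' : Arr B₂ B₃}
    (φ : Sq m₀ m₁ f g) (ψ : Sq m₁ m₂ f' g') (χ : Sq m₂ m₃ f'' g'') :
    scomp (scomp φ ψ rfl rfl) χ (acomp_assoc f f' f'') (acomp_assoc g g' g'') =
      scomp φ (scomp ψ χ rfl rfl) rfl rfl
  /-- unit square of an arrow -/
  unitSq {A B : C} (f : Arr A B) : Sq (𝟙 A) (𝟙 B) f f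
  unitSq_aid (A : C) : unitSq (aid A) = sid (𝟙 A) rfl rfl
  unitSq_acomp {A B E : C} (f : Arr A B) (g : Arr B E) :
    unitSq (acomp f g) = scomp (unitSq f) (unitSq g) rfl rfl
  /-- composition of squares in the proarrow dimension -/
  pcomp {A B E A' B' E' : C} {m : A ⟶ B} {p : B ⟶ E} {n : A' ⟶ B'} {q : B' ⟶ E'}
    {f : Arr A A'} {g : Arr B B'} {h : Arr E E'} (φ : Sq m n f g) (ψ : Sq p q g h) :
    Sq (m ≫ p) (n ≫ q) f h
  pcomp_sid {A B E : C} (m : A ⟶ B) (p : B ⟶ E) :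
    pcomp (sid m rfl rfl) (sid p rfl rfl) = sid (m ≫ p) rfl rfl
  pcomp_scomp {A B E A' B' E' A'' B'' E'' : C} {m : A ⟶ B} {p : B ⟶ E} {n : A' ⟶ B'}
    {q : B' ⟶ E'} {r : A'' ⟶ B''} {s : B'' ⟶ E''} {f : Arr A A'} {g : Arr B B'} {h : Arr E E'}
    {f' : Arr A' A''} {g' : Arr B' B''} {h' : Arr E' E''}
    (φ : Sq m n f g) (ψ : Sq p q g h) (φ' : Sq n r f' g') (ψ' : Sq q s g' h') :
    scomp (pcomp φ ψ) (pcomp φ' ψ') rfl rfl =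
      pcomp (scomp φ φ' rfl rfl) (scomp ψ ψ' rfl rfl)
  /-- associator of proarrow composition, with its inverse -/
  ahom {A B E F : C} (m : A ⟶ B) (n : B ⟶ E) (p : E ⟶ F) :
    Sq ((m ≫ n) ≫ p) (m ≫ n ≫ p) (aid A) (aid F)
  ainv {A B E F : C} (m : A ⟶ B) (n : B ⟶ E) (p : E ⟶ F) :
    Sq (m ≫ n ≫ p) ((m ≫ n) ≫ p) (aid A) (aid F)
  ahom_ainv {A B E F : C} (m : A ⟶ B) (n : B ⟶ E) (p : E ⟶ F) :
    scomp (ahom m n p) (ainv m n p) (aid_acomp _) (aid_acomp _) = sid _ rfl rfl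
  ainv_ahom {A B E F : C} (m : A ⟶ B) (n : B ⟶ E) (p : E ⟶ F) :
    scomp (ainv m n p) (ahom m n p) (aid_acomp _) (aid_acomp _) = sid _ rfl rfl
  ahom_naturality {A B E F A' B' E' F' : C} {m : A ⟶ B} {n : B ⟶ E} {p : E ⟶ F}
    {m' : A' ⟶ B'} {n' : B' ⟶ E'} {p' : E' ⟶ F'}
    {f : Arr A A'} {g : Arr B B'} {h : Arr E E'} {k : Arr F F'}
    (φ : Sq m m' f g) (ψ : Sq n n' g h) (χ : Sq p p' h k) :
    scomp (pcomp (pcomp φ ψ) χ) (ahom m' n' p') (acomp_aid f) (acomp_aid k) =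
      scomp (ahom m n p) (pcomp φ (pcomp ψ χ)) (aid_acomp f) (aid_acomp k)
  /-- left unitor of proarrow composition, with its inverse -/
  lhom {A B : C} (m : A ⟶ B) : Sq (𝟙 A ≫ m) m (aid A) (aid B)
  linv {A B : C} (m : A ⟶ B) : Sq m (𝟙 A ≫ m) (aid A) (aid B)
  lhom_linv {A B : C} (m : A ⟶ B) :
    scomp (lhom m) (linv m) (aid_acomp _) (aid_acomp _) = sid _ rfl rfl
  linv_lhom {A B : C} (m : A ⟶ B) :
    scomp (linv m) (lhom m) (aid_acomp _) (aid_acomp _) = sid _ rfl rfl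
  lhom_naturality {A B A' B' : C} {m : A ⟶ B} {n : A' ⟶ B'} {f : Arr A A'} {g : Arr B B'}
    (φ : Sq m n f g) :
    scomp (pcomp (unitSq f) φ) (lhom n) (acomp_aid f) (acomp_aid g) =
      scomp (lhom m) φ (aid_acomp f) (aid_acomp g)
  /-- right unitor of proarrow composition, with its inverse -/
  rhom {A B : C} (m : A ⟶ B) : Sq (m ≫ 𝟙 B) m (aid A) (aid B)
  rinv {A B : C} (m : A ⟶ B) : Sq m (m ≫ 𝟙 B) (aid A) (aid B)
  rhom_rinv {A B : C} (m : A ⟶ B) :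
    scomp (rhom m) (rinv m) (aid_acomp _) (aid_acomp _) = sid _ rfl rfl
  rinv_rhom {A B : C} (m : A ⟶ B) :
    scomp (rinv m) (rhom m) (aid_acomp _) (aid_acomp _) = sid _ rfl rfl
  rhom_naturality {A B A' B' : C} {m : A ⟶ B} {n : A' ⟶ B'} {f : Arr A A'} {g : Arr B B'}
    (φ : Sq m n f g) :
    scomp (pcomp φ (unitSq g)) (rhom n) (acomp_aid f) (acomp_aid g) =
      scomp (rhom m) φ (aid_acomp f) (aid_acomp g)
  ahom_pentagon {A B E F G : C} (m : A ⟶ B) (n : B ⟶ E) (p : E ⟶ F) (q : F ⟶ G) :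
    scomp (pcomp (ahom m n p) (sid q rfl rfl))
        (scomp (ahom m (n ≫ p) q) (pcomp (sid m rfl rfl) (ahom n p q))
          (aid_acomp _) (aid_acomp _)) (aid_acomp _) (aid_acomp _) =
      scomp (ahom (m ≫ n) p q) (ahom m n (p ≫ q)) (aid_acomp _) (aid_acomp _)
  ahom_triangle {A B E : C} (m : A ⟶ B) (n : B ⟶ E) :
    scomp (ahom m (𝟙 B) n) (pcomp (sid m rfl rfl) (lhom n)) (aid_acomp _) (aid_acomp _) =
      pcomp (rhom m) (sid n rfl rfl)

namespace DoubleCategory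

section

variable {C : Type u} [DoubleCategory.{u, v, w, x} C]

/-- The form of associativity that does not mention boundary arrows. -/
theorem scomp_scomp {A₀ B₀ A₁ B₁ A₂ B₂ A₃ B₃ : C} {m₀ : A₀ ⟶ B₀} {m₁ : A₁ ⟶ B₁} {m₂ : A₂ ⟶ B₂}
    {m₃ : A₃ ⟶ B₃} {f : Arr A₀ A₁} {g : Arr B₀ B₁} {f' : Arr A₁ A₂} {g' : Arr B₁ B₂}
    {f'' : Arr A₂ A₃} {g'' : Arr B₂ B₃}
    (φ : Sq m₀ m₁ f g) (ψ : Sq m₁ m₂ f' g') (χ : Sq m₂ m₃ f'' g'')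
    {k : Arr A₀ A₂} {l : Arr B₀ B₂} {k' : Arr A₁ A₃} {l' : Arr B₁ B₃} {r : Arr A₀ A₃} {s : Arr B₀ B₃}
    (hk : acomp f f' = k) (hl : acomp g g' = l) (hr : acomp k f'' = r) (hs : acomp l g'' = s)
    (hk' : acomp f' f'' = k') (hl' : acomp g' g'' = l')
    (hr' : acomp f k' = r) (hs' : acomp g l' = s) :
    scomp (scomp φ ψ hk hl) χ hr hs = scomp φ (scomp ψ χ hk' hl') hr' hs' := by
  subst hk hl hk' hl' hr' hs'
  exact scomp_assoc φ ψ χ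

theorem pcomp_scomp' {A B E A' B' E' A'' B'' E'' : C} {m : A ⟶ B} {p : B ⟶ E} {n : A' ⟶ B'}
    {q : B' ⟶ E'} {r : A'' ⟶ B''} {s : B'' ⟶ E''} {f : Arr A A'} {g : Arr B B'} {h : Arr E E'}
    {f' : Arr A' A''} {g' : Arr B' B''} {h' : Arr E' E''}
    (φ : Sq m n f g) (ψ : Sq p q g h) (φ' : Sq n r f' g') (ψ' : Sq q s g' h')
    {a : Arr A A''} {b : Arr B B''} {c : Arr E E''}
    (ha : acomp f f' = a) (hb : acomp g g' = b) (hc : acomp h h' = c) :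
    scomp (pcomp φ ψ) (pcomp φ' ψ') ha hc =
      pcomp (scomp φ φ' ha hb) (scomp ψ ψ' hb hc) := by
  subst ha hb hc
  exact pcomp_scomp φ ψ φ' ψ'

/-- Disks: squares whose arrow boundaries are identities. They are the `2`-cells of a bicategory
whose `1`-cells are the proarrows. -/
instance homCategory (A B : C) : Category (A ⟶ B) where
  Hom m n := Sq m n (aid A) (aid B)
  id m := sid m rfl rfl
  comp d e := scomp d e (aid_acomp _) (aid_acomp _)
  id_comp d := sid_scomp d
  comp_id d := scomp_sid d
  assoc d e k := scomp_scomp d e k _ _ _ _ _ _ _ _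

/-- associator of proarrow composition, as an invertible disk -/
def assocIso {A B E F : C} (m : A ⟶ B) (n : B ⟶ E) (p : E ⟶ F) : (m ≫ n) ≫ p ≅ m ≫ n ≫ p :=
  ⟨ahom m n p, ainv m n p, ahom_ainv m n p, ainv_ahom m n p⟩

/-- left unitor of proarrow composition, as an invertible disk -/
def leftIso {A B : C} (m : A ⟶ B) : 𝟙 A ≫ m ≅ m :=
  ⟨lhom m, linv m, lhom_linv m, linv_lhom m⟩

/-- right unitor of proarrow composition, as an invertible disk -/
def rightIso {A B : C} (m : A ⟶ B) : m ≫ 𝟙 B ≅ m :=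
  ⟨rhom m, rinv m, rhom_rinv m, rinv_rhom m⟩

theorem assocIso_naturality {A B E F : C} {m m' : A ⟶ B} {n n' : B ⟶ E} {p p' : E ⟶ F}
    (d : m ⟶ m') (e : n ⟶ n') (k : p ⟶ p') :
    (show (m ≫ n) ≫ p ⟶ (m' ≫ n') ≫ p' from pcomp (pcomp d e) k) =
      (assocIso m n p).hom ≫ (show m ≫ n ≫ p ⟶ m' ≫ n' ≫ p' from pcomp d (pcomp e k)) ≫
        (assocIso m' n' p').inv := by
  rw [← Category.assoc, Iso.eq_comp_inv]
  exact ahom_naturality d e k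

theorem assocIso_naturality' {A B E F : C} {m m' : A ⟶ B} {n n' : B ⟶ E} {p p' : E ⟶ F}
    (d : m ⟶ m') (e : n ⟶ n') (k : p ⟶ p') :
    (show m ≫ n ≫ p ⟶ m' ≫ n' ≫ p' from pcomp d (pcomp e k)) =
      (assocIso m n p).inv ≫ (show (m ≫ n) ≫ p ⟶ (m' ≫ n') ≫ p' from pcomp (pcomp d e) k) ≫
        (assocIso m' n' p').hom := by
  rw [Iso.eq_inv_comp]
  exact (ahom_naturality d e k).symm

instance bicategory : Bicategory C where
  homCategory := homCategory
  whiskerLeft m _ _ d := pcomp (sid m rfl rfl) d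
  whiskerRight d m := pcomp d (sid m rfl rfl)
  associator m n p := assocIso m n p
  leftUnitor m := leftIso m
  rightUnitor m := rightIso m
  whiskerLeft_id m n := pcomp_sid m n
  whiskerLeft_comp m _ _ _ d e := by
    refine Eq.trans ?_ (pcomp_scomp' _ _ _ _ (aid_acomp _) (aid_acomp _) (aid_acomp _)).symm
    rw [sid_scomp]; rfl
  id_whiskerLeft {_ _ m n} d := by
    rw [← Category.assoc]
    refine (Iso.eq_comp_inv (leftIso n)).2 ?_
    refine Eq.trans ?_ (lhom_naturality d)
    rw [unitSq_aid]; rfl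
  comp_whiskerLeft m n _ _ d := by
    rw [← pcomp_sid]
    exact assocIso_naturality (𝟙 m) (𝟙 n) d
  id_whiskerRight m n := pcomp_sid m n
  comp_whiskerRight d e m := by
    refine Eq.trans ?_ (pcomp_scomp' _ _ _ _ (aid_acomp _) (aid_acomp _) (aid_acomp _)).symm
    rw [sid_scomp]; rfl
  whiskerRight_id {_ _ m n} d := by
    rw [← Category.assoc]
    refine (Iso.eq_comp_inv (rightIso n)).2 ?_
    refine Eq.trans ?_ (rhom_naturality d)
    rw [unitSq_aid]; rfl
  whiskerRight_comp d n p := by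
    rw [← pcomp_sid]
    exact assocIso_naturality' d (𝟙 n) (𝟙 p)
  whisker_assoc m _ _ d p := assocIso_naturality (𝟙 m) d (𝟙 p)
  whisker_exchange d e := by
    refine (pcomp_scomp' _ _ _ _ (aid_acomp _) (aid_acomp _) (aid_acomp _)).trans
      (Eq.trans ?_ (pcomp_scomp' _ _ _ _ (aid_acomp _) (aid_acomp _) (aid_acomp _)).symm)
    rw [sid_scomp, sid_scomp, scomp_sid, scomp_sid]
  pentagon m n p q := ahom_pentagon m n p q
  triangle m n := ahom_triangle m n

end

end DoubleCategory

/-- The double category `Co C` has the same objects and arrows as `C`; its proarrows, and with them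
the squares, are reversed. -/
structure Co (C : Type u) where
  /-- the object of `Co C` given by an object of `C` -/
  mk ::
  /-- the underlying object of `C` -/
  un : C

namespace DoubleCategory

section

variable {C : Type u} [DoubleCategory.{u, v, w, x} C]

theorem pentagon_inv' {A B E F G : C} (m : A ⟶ B) (n : B ⟶ E) (p : E ⟶ F) (q : F ⟶ G) :
    m ◁ (α_ n p q).inv ≫ (α_ m (n ≫ p) q).inv ≫ (α_ m n p).inv ▷ q =
      (α_ m n (p ≫ q)).inv ≫ (α_ (m ≫ n) p q).inv := by
  simp

theorem ainv_naturality {A B E F A' B' E' F' : C} {m : A ⟶ B} {n : B ⟶ E} {p : E ⟶ F}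
    {m' : A' ⟶ B'} {n' : B' ⟶ E'} {p' : E' ⟶ F'}
    {f : Arr A A'} {g : Arr B B'} {h : Arr E E'} {k : Arr F F'}
    (φ : Sq m m' f g) (ψ : Sq n n' g h) (χ : Sq p p' h k) :
    scomp (pcomp φ (pcomp ψ χ)) (ainv m' n' p') (acomp_aid f) (acomp_aid k) =
      scomp (ainv m n p) (pcomp (pcomp φ ψ) χ) (aid_acomp f) (aid_acomp k) := by
  have h1 : scomp (pcomp φ (pcomp ψ χ)) (ainv m' n' p') (acomp_aid f) (acomp_aid k) =
      scomp (ainv m n p) (scomp (scomp (ahom m n p) (pcomp φ (pcomp ψ χ))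
        (aid_acomp f) (aid_acomp k)) (ainv m' n' p') (acomp_aid f) (acomp_aid k))
        (aid_acomp f) (aid_acomp k) := by
    rw [← scomp_scomp (ainv m n p) _ _ (aid_acomp f) (aid_acomp k) (acomp_aid f) (acomp_aid k),
      ← scomp_scomp (ainv m n p) (ahom m n p) _ (aid_acomp _) (aid_acomp _) (aid_acomp f)
        (aid_acomp k), ainv_ahom, sid_scomp]
  rw [h1, ← ahom_naturality, scomp_scomp _ _ _ _ _ _ _ (aid_acomp _) (aid_acomp _)
    (acomp_aid f) (acomp_aid k), ahom_ainv, scomp_sid]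

instance : DoubleCategory.{u, v, w, x} (Co C) where
  Hom A B := B.un ⟶ A.un
  id A := 𝟙 A.un
  comp m n := CategoryStruct.comp (obj := C) n m
  Arr A B := Arr A.un B.un
  aid A := aid A.un
  acomp f g := acomp f g
  aid_acomp f := aid_acomp f
  acomp_aid f := acomp_aid f
  acomp_assoc f g h := acomp_assoc f g h
  Sq m n f g := Sq (C := C) m n g f
  sid m _ _ hf hg := sid (C := C) m hg hf
  scomp φ ψ _ _ hf hg := scomp (C := C) φ ψ hg hf
  sid_scomp φ := sid_scomp (C := C) φ
  scomp_sid φ := scomp_sid (C := C) φ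
  scomp_assoc φ ψ χ := scomp_assoc (C := C) φ ψ χ
  unitSq f := unitSq (C := C) f
  unitSq_aid A := unitSq_aid A.un
  unitSq_acomp f g := unitSq_acomp (C := C) f g
  pcomp φ ψ := pcomp (C := C) ψ φ
  pcomp_sid m p := pcomp_sid (C := C) p m
  pcomp_scomp φ ψ φ' ψ' := pcomp_scomp (C := C) ψ φ ψ' φ'
  ahom m n p := ainv (C := C) p n m
  ainv m n p := ahom (C := C) p n m
  ahom_ainv m n p := ainv_ahom (C := C) p n m
  ainv_ahom m n p := ahom_ainv (C := C) p n m
  ahom_naturality φ ψ χ := ainv_naturality (C := C) χ ψ φ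
  lhom m := rhom (C := C) m
  linv m := rinv (C := C) m
  lhom_linv m := rhom_rinv (C := C) m
  linv_lhom m := rinv_rhom (C := C) m
  lhom_naturality φ := rhom_naturality (C := C) φ
  rhom m := lhom (C := C) m
  rinv m := linv (C := C) m
  rhom_rinv m := lhom_linv (C := C) m
  rinv_rhom m := linv_lhom (C := C) m
  rhom_naturality φ := lhom_naturality (C := C) φ
  ahom_pentagon m n p q := pentagon_inv' (C := C) q p n m
  ahom_triangle m n := triangle_assoc_comp_right (B := C) n m

universe u' v' w' x'

end

end DoubleCategory

/-- The objects of a product of double categories. -/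
structure DProd (C : Type u) (D : Type v) where
  /-- the first component -/
  fst : C
  /-- the second component -/
  snd : D

infixr:35 " ×ᵈ " => DProd

namespace DoubleCategory

section

universe u' v' w' x'

variable {C : Type u} [DoubleCategory.{u, v, w, x} C]

instance {D : Type u'} [DoubleCategory.{u', v', w', x'} D] :
    DoubleCategory.{max u u', max v v', max w w', max x x'} (C ×ᵈ D) where
  Hom A B := (A.1 ⟶ B.1) × (A.2 ⟶ B.2)
  id A := (𝟙 A.1, 𝟙 A.2)
  comp m n := (m.1 ≫ n.1, m.2 ≫ n.2)
  Arr A B := Arr A.1 B.1 × Arr A.2 B.2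
  aid A := (aid A.1, aid A.2)
  acomp f g := (acomp f.1 g.1, acomp f.2 g.2)
  aid_acomp f := Prod.ext (aid_acomp f.1) (aid_acomp f.2)
  acomp_aid f := Prod.ext (acomp_aid f.1) (acomp_aid f.2)
  acomp_assoc f g h := Prod.ext (acomp_assoc f.1 g.1 h.1) (acomp_assoc f.2 g.2 h.2)
  Sq m n f g := Sq m.1 n.1 f.1 g.1 × Sq m.2 n.2 f.2 g.2
  sid m _ _ hf hg := (sid m.1 (congrArg Prod.fst hf) (congrArg Prod.fst hg),
    sid m.2 (congrArg Prod.snd hf) (congrArg Prod.snd hg))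
  scomp φ ψ _ _ hf hg :=
    (scomp φ.1 ψ.1 (congrArg Prod.fst hf) (congrArg Prod.fst hg),
      scomp φ.2 ψ.2 (congrArg Prod.snd hf) (congrArg Prod.snd hg))
  sid_scomp φ := Prod.ext (sid_scomp φ.1) (sid_scomp φ.2)
  scomp_sid φ := Prod.ext (scomp_sid φ.1) (scomp_sid φ.2)
  scomp_assoc φ ψ χ := Prod.ext (scomp_assoc φ.1 ψ.1 χ.1) (scomp_assoc φ.2 ψ.2 χ.2)
  unitSq f := (unitSq f.1, unitSq f.2)
  unitSq_aid A := Prod.ext (unitSq_aid A.1) (unitSq_aid A.2)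
  unitSq_acomp f g := Prod.ext (unitSq_acomp f.1 g.1) (unitSq_acomp f.2 g.2)
  pcomp φ ψ := (pcomp φ.1 ψ.1, pcomp φ.2 ψ.2)
  pcomp_sid m p := Prod.ext (pcomp_sid m.1 p.1) (pcomp_sid m.2 p.2)
  pcomp_scomp φ ψ φ' ψ' :=
    Prod.ext (pcomp_scomp φ.1 ψ.1 φ'.1 ψ'.1) (pcomp_scomp φ.2 ψ.2 φ'.2 ψ'.2)
  ahom m n p := (ahom m.1 n.1 p.1, ahom m.2 n.2 p.2)
  ainv m n p := (ainv m.1 n.1 p.1, ainv m.2 n.2 p.2)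
  ahom_ainv m n p := Prod.ext (ahom_ainv m.1 n.1 p.1) (ahom_ainv m.2 n.2 p.2)
  ainv_ahom m n p := Prod.ext (ainv_ahom m.1 n.1 p.1) (ainv_ahom m.2 n.2 p.2)
  ahom_naturality φ ψ χ :=
    Prod.ext (ahom_naturality φ.1 ψ.1 χ.1) (ahom_naturality φ.2 ψ.2 χ.2)
  lhom m := (lhom m.1, lhom m.2)
  linv m := (linv m.1, linv m.2)
  lhom_linv m := Prod.ext (lhom_linv m.1) (lhom_linv m.2)
  linv_lhom m := Prod.ext (linv_lhom m.1) (linv_lhom m.2)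
  lhom_naturality φ := Prod.ext (lhom_naturality φ.1) (lhom_naturality φ.2)
  rhom m := (rhom m.1, rhom m.2)
  rinv m := (rinv m.1, rinv m.2)
  rhom_rinv m := Prod.ext (rhom_rinv m.1) (rhom_rinv m.2)
  rinv_rhom m := Prod.ext (rinv_rhom m.1) (rinv_rhom m.2)
  rhom_naturality φ := Prod.ext (rhom_naturality φ.1) (rhom_naturality φ.2)
  ahom_pentagon m n p q :=
    Prod.ext (ahom_pentagon m.1 n.1 p.1 q.1) (ahom_pentagon m.2 n.2 p.2 q.2)
  ahom_triangle m n := Prod.ext (ahom_triangle m.1 n.1) (ahom_triangle m.2 n.2)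

end

end DoubleCategory

namespace DoubleCategory

universe u' v' w' x' u'' v'' w'' x'' u₃ v₃ w₃ x₃

variable {C : Type u} [DoubleCategory.{u, v, w, x} C]
  {D : Type u'} [DoubleCategory.{u', v', w', x'} D]
  {E : Type u''} [DoubleCategory.{u'', v'', w'', x''} E]

/-- Transport of a square along equalities of its boundary arrows. -/
def scast {A B A' B' : C} {m : A ⟶ B} {n : A' ⟶ B'} {f f' : Arr A A'} {g g' : Arr B B'} :
    f = f' → g = g' → Sq m n f g → Sq m n f' g'
  | rfl, rfl, φ => φ

theorem scomp_scast {A B A' B' A'' B'' : C} {m : A ⟶ B} {n : A' ⟶ B'} {p : A'' ⟶ B''}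
    {f : Arr A A'} {g : Arr B B'} {f' f₁ : Arr A' A''} {g' g₁ : Arr B' B''}
    (φ : Sq m n f g) (ψ : Sq n p f' g') {f'' : Arr A A''} {g'' : Arr B B''}
    (h : f' = f₁) (k : g' = g₁) (hf : acomp f f₁ = f'') (hg : acomp g g₁ = g'') :
    scomp φ (scast h k ψ) hf hg = scomp φ ψ (h ▸ hf) (k ▸ hg) := by
  subst h k; rfl

theorem scast_scomp {A B A' B' A'' B'' : C} {m : A ⟶ B} {n : A' ⟶ B'} {p : A'' ⟶ B''}
    {f f₁ : Arr A A'} {g g₁ : Arr B B'} {f' : Arr A' A''} {g' : Arr B' B''}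
    (φ : Sq m n f g) (ψ : Sq n p f' g') {f'' : Arr A A''} {g'' : Arr B B''}
    (h : f = f₁) (k : g = g₁) (hf : acomp f₁ f' = f'') (hg : acomp g₁ g' = g'') :
    scomp (scast h k φ) ψ hf hg = scomp φ ψ (h ▸ hf) (k ▸ hg) := by
  subst h k; rfl

theorem scast_of_scomp {A B A' B' A'' B'' : C} {m : A ⟶ B} {n : A' ⟶ B'} {p : A'' ⟶ B''}
    {f : Arr A A'} {g : Arr B B'} {f' : Arr A' A''} {g' : Arr B' B''}
    (φ : Sq m n f g) (ψ : Sq n p f' g') {f'' f₁ : Arr A A''} {g'' g₁ : Arr B B''}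
    (hf : acomp f f' = f'') (hg : acomp g g' = g'') (h : f'' = f₁) (k : g'' = g₁) :
    scast h k (scomp φ ψ hf hg) = scomp φ ψ (hf.trans h) (hg.trans k) := by
  subst h k; rfl

theorem scast_sid {A B : C} (m : A ⟶ B) {f f' : Arr A A} {g g' : Arr B B} (hf : f = aid A)
    (hg : g = aid B) (h : f = f') (k : g = g') :
    scast h k (sid m hf hg) = sid m (h ▸ hf) (k ▸ hg) := by
  subst h k; rfl

theorem scast_scast {A B A' B' : C} {m : A ⟶ B} {n : A' ⟶ B'} {f f' f'' : Arr A A'}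
    {g g' g'' : Arr B B'} (h : f = f') (k : g = g') (h' : f' = f'') (k' : g' = g'')
    (φ : Sq m n f g) : scast h' k' (scast h k φ) = scast (h.trans h') (k.trans k') φ := by
  subst h k h' k'; rfl

theorem scast_pcomp {A B E A' B' E' : C} {m : A ⟶ B} {p : B ⟶ E} {n : A' ⟶ B'} {q : B' ⟶ E'}
    {f f' : Arr A A'} {g g' : Arr B B'} {h h' : Arr E E'} (φ : Sq m n f g) (ψ : Sq p q g h)
    (hf : f = f') (hg : g = g') (hh : h = h') :
    pcomp (scast hf hg φ) (scast hg hh ψ) = scast hf hh (pcomp φ ψ) := by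
  subst hf hg hh; rfl

theorem scast_prod {X Y X' Y' : C ×ᵈ D} {m : X ⟶ Y} {n : X' ⟶ Y'} {f f' : Arr X X'}
    {g g' : Arr Y Y'} (h : f = f') (k : g = g') (φ : Sq m n f g) :
    scast h k φ = (scast (congrArg Prod.fst h) (congrArg Prod.fst k) φ.1,
      scast (congrArg Prod.snd h) (congrArg Prod.snd k) φ.2) := by
  subst h k; rfl

variable (C D) in
/-- The underlying data of a functor of double categories, which strictly preserves composition
in the arrow dimension. -/
structure PreFunctor where
  /-- action on objects -/
  obj : C → D
  /-- action on arrows -/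
  amap {A B : C} : Arr A B → Arr (obj A) (obj B)
  /-- action on proarrows -/
  pmap {A B : C} : (A ⟶ B) → (obj A ⟶ obj B)
  /-- action on squares -/
  smap {A B A' B' : C} {m : A ⟶ B} {n : A' ⟶ B'} {f : Arr A A'} {g : Arr B B'} :
    Sq m n f g → Sq (pmap m) (pmap n) (amap f) (amap g)
  amap_aid (A : C) : amap (aid A) = aid (obj A)
  amap_acomp {A B E : C} (f : Arr A B) (g : Arr B E) : amap (acomp f g) = acomp (amap f) (amap g)
  smap_sid {A B : C} (m : A ⟶ B) :
    smap (sid m rfl rfl) = sid (pmap m) (amap_aid A) (amap_aid B)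
  smap_scomp {A B A' B' A'' B'' : C} {m : A ⟶ B} {n : A' ⟶ B'} {p : A'' ⟶ B''}
    {f : Arr A A'} {g : Arr B B'} {f' : Arr A' A''} {g' : Arr B' B''}
    (φ : Sq m n f g) (ψ : Sq n p f' g') :
    smap (scomp φ ψ rfl rfl) =
      scomp (smap φ) (smap ψ) (amap_acomp f f').symm (amap_acomp g g').symm

namespace PreFunctor

/-- The action of a functor on disks. -/
def dmap (F : PreFunctor C D) {A B : C} {m n : A ⟶ B} (d : m ⟶ n) : F.pmap m ⟶ F.pmap n :=
  scast (F.amap_aid A) (F.amap_aid B) (F.smap d)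

theorem smap_scomp' (F : PreFunctor C D) {A B A' B' A'' B'' : C} {m : A ⟶ B} {n : A' ⟶ B'}
    {p : A'' ⟶ B''} {f : Arr A A'} {g : Arr B B'} {f' : Arr A' A''} {g' : Arr B' B''}
    (φ : Sq m n f g) (ψ : Sq n p f' g') {f'' : Arr A A''} {g'' : Arr B B''}
    (hf : acomp f f' = f'') (hg : acomp g g' = g'') :
    F.smap (scomp φ ψ hf hg) = scomp (F.smap φ) (F.smap ψ)
      (by rw [← F.amap_acomp, hf]) (by rw [← F.amap_acomp, hg]) := by
  subst hf hg; exact F.smap_scomp φ ψ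

theorem dmap_id (F : PreFunctor C D) {A B : C} (m : A ⟶ B) : F.dmap (𝟙 m) = 𝟙 (F.pmap m) := by
  change scast _ _ (F.smap (sid m rfl rfl)) = _
  rw [F.smap_sid, scast_sid]; rfl

theorem dmap_comp (F : PreFunctor C D) {A B : C} {m n p : A ⟶ B} (d : m ⟶ n) (e : n ⟶ p) :
    F.dmap (d ≫ e) = F.dmap d ≫ F.dmap e := by
  change scast _ _ (F.smap (scomp d e _ _)) = scomp (scast _ _ _) (scast _ _ _) _ _
  rw [F.smap_scomp', scast_of_scomp, scast_scomp, scomp_scast]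

/-- The action of a functor on invertible disks. -/
@[simps]
def dmapIso (F : PreFunctor C D) {A B : C} {m n : A ⟶ B} (d : m ≅ n) : F.pmap m ≅ F.pmap n where
  hom := F.dmap d.hom
  inv := F.dmap d.inv
  hom_inv_id := by rw [← F.dmap_comp, d.hom_inv_id, F.dmap_id]
  inv_hom_id := by rw [← F.dmap_comp, d.inv_hom_id, F.dmap_id]

end PreFunctor

variable (C D) in
/-- A functor of double categories: strict in the arrow dimension and pseudo in the proarrow
dimension. -/
structure DFunctor extends PreFunctor C D where
  /-- comparison disk for a composite proarrow -/
  mapComp {A B E : C} (m : A ⟶ B) (n : B ⟶ E) : pmap (m ≫ n) ≅ pmap m ≫ pmap n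
  /-- comparison disk for a unit proarrow -/
  mapId (A : C) : pmap (𝟙 A) ≅ 𝟙 (obj A)
  mapComp_naturality {A B E A' B' E' : C} {m : A ⟶ B} {p : B ⟶ E} {n : A' ⟶ B'} {q : B' ⟶ E'}
    {f : Arr A A'} {g : Arr B B'} {h : Arr E E'} (φ : Sq m n f g) (ψ : Sq p q g h) :
    scomp (smap (pcomp φ ψ)) (mapComp n q).hom (acomp_aid _) (acomp_aid _) =
      scomp (mapComp m p).hom (pcomp (smap φ) (smap ψ)) (aid_acomp _) (aid_acomp _)
  mapId_naturality {A B : C} (f : Arr A B) :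
    scomp (smap (unitSq f)) (mapId B).hom (acomp_aid _) (acomp_aid _) =
      scomp (mapId A).hom (unitSq (amap f)) (aid_acomp _) (aid_acomp _)
  dmap_associator {A B E F : C} (m : A ⟶ B) (n : B ⟶ E) (p : E ⟶ F) :
    toPreFunctor.dmap (α_ m n p).hom =
      (mapComp (m ≫ n) p).hom ≫ (mapComp m n).hom ▷ pmap p ≫
        (α_ (pmap m) (pmap n) (pmap p)).hom ≫ pmap m ◁ (mapComp n p).inv ≫
          (mapComp m (n ≫ p)).inv
  dmap_leftUnitor {A B : C} (m : A ⟶ B) :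
    toPreFunctor.dmap (λ_ m).hom =
      (mapComp (𝟙 A) m).hom ≫ (mapId A).hom ▷ pmap m ≫ (λ_ (pmap m)).hom
  dmap_rightUnitor {A B : C} (m : A ⟶ B) :
    toPreFunctor.dmap (ρ_ m).hom =
      (mapComp m (𝟙 B)).hom ≫ pmap m ◁ (mapId B).hom ≫ (ρ_ (pmap m)).hom

namespace DFunctor

theorem dmap_pcomp (F : DFunctor C D) {A B E : C} {m n : A ⟶ B} {p q : B ⟶ E} (d : m ⟶ n)
    (e : p ⟶ q) : F.dmap (show m ≫ p ⟶ n ≫ q from pcomp d e) =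
      (F.mapComp m p).hom ≫ (show F.pmap m ≫ F.pmap p ⟶ F.pmap n ≫ F.pmap q from
        pcomp (F.dmap d) (F.dmap e)) ≫ (F.mapComp n q).inv := by
  rw [← Category.assoc, Iso.eq_comp_inv]
  change scomp (scast _ _ _) _ _ _ = scomp _ (pcomp (scast _ _ _) (scast _ _ _)) _ _
  rw [scast_pcomp, scomp_scast, scast_scomp]
  have := congrArg (scast (F.amap_aid A) (F.amap_aid E)) (F.mapComp_naturality d e)
  rwa [scast_of_scomp, scast_of_scomp] at this

/-- The pseudofunctor between bicategories of proarrows underlying a functor. -/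
@[simps]
def toPseudofunctor (F : DFunctor C D) : Pseudofunctor C D where
  obj := F.obj
  map := F.pmap
  map₂ := F.dmap
  map₂_id := F.dmap_id
  map₂_comp := F.dmap_comp
  mapId := F.mapId
  mapComp := F.mapComp
  map₂_whisker_left m _ _ d := by
    refine (F.dmap_pcomp (𝟙 m) d).trans ?_
    rw [F.dmap_id]; rfl
  map₂_whisker_right d m := by
    refine (F.dmap_pcomp d (𝟙 m)).trans ?_
    rw [F.dmap_id]; rfl
  map₂_associator := F.dmap_associator
  map₂_left_unitor := F.dmap_leftUnitor
  map₂_right_unitor := F.dmap_rightUnitor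

theorem smap_dmap (F : DFunctor C D) {A B A' B' : C} {m : A ⟶ B} {n n' : A' ⟶ B'}
    {f : Arr A A'} {g : Arr B B'} (φ : Sq m n f g) (d : n ⟶ n') :
    scomp (F.smap φ) (F.dmap d) (acomp_aid _) (acomp_aid _) =
      F.smap (scomp φ d (acomp_aid f) (acomp_aid g)) := by
  rw [F.smap_scomp', PreFunctor.dmap, scomp_scast]

theorem dmap_smap (F : DFunctor C D) {A B A' B' : C} {m m' : A ⟶ B} {n : A' ⟶ B'}
    {f : Arr A A'} {g : Arr B B'} (d : m' ⟶ m) (φ : Sq m n f g) :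
    scomp (F.dmap d) (F.smap φ) (aid_acomp _) (aid_acomp _) =
      F.smap (scomp d φ (aid_acomp f) (aid_acomp g)) := by
  rw [F.smap_scomp', PreFunctor.dmap, scast_scomp]

variable (C) in
/-- The identity functor. -/
@[simps!]
def id : DFunctor C C where
  obj A := A
  amap f := f
  pmap m := m
  smap φ := φ
  amap_aid _ := rfl
  amap_acomp _ _ := rfl
  smap_sid _ := rfl
  smap_scomp _ _ := rfl
  mapComp _ _ := Iso.refl _
  mapId _ := Iso.refl _
  mapComp_naturality φ ψ := (scomp_sid (pcomp φ ψ)).trans (sid_scomp _).symm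
  mapId_naturality f := (scomp_sid (unitSq f)).trans (sid_scomp _).symm
  dmap_associator m n p := by
    change (α_ m n p).hom = _
    simp
  dmap_leftUnitor m := by
    change (λ_ m).hom = _
    simp
  dmap_rightUnitor m := by
    change (ρ_ m).hom = _
    simp

theorem _root_.DoubleCategory.PreFunctor.smap_sid' (F : PreFunctor C D) {A B : C} (m : A ⟶ B)
    {f : Arr A A} {g : Arr B B} (hf : f = aid A) (hg : g = aid B) :
    F.smap (sid m hf hg) =
      sid (F.pmap m) ((congrArg F.amap hf).trans (F.amap_aid A))
        ((congrArg F.amap hg).trans (F.amap_aid B)) := by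
  subst hf hg; exact F.smap_sid m

theorem _root_.DoubleCategory.PreFunctor.smap_scast (F : PreFunctor C D) {A B A' B' : C}
    {m : A ⟶ B} {n : A' ⟶ B'} {f f' : Arr A A'} {g g' : Arr B B'} (h : f = f') (k : g = g')
    (φ : Sq m n f g) :
    F.smap (scast h k φ) = scast (congrArg F.amap h) (congrArg F.amap k) (F.smap φ) := by
  subst h k; rfl

/-- Composition of functors on underlying data, `F` first. -/
@[simps]
def _root_.DoubleCategory.PreFunctor.comp (F : PreFunctor C D) (G : PreFunctor D E) :
    PreFunctor C E where
  obj A := G.obj (F.obj A)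
  amap f := G.amap (F.amap f)
  pmap m := G.pmap (F.pmap m)
  smap φ := G.smap (F.smap φ)
  amap_aid A := by rw [F.amap_aid, G.amap_aid]
  amap_acomp f g := by rw [F.amap_acomp, G.amap_acomp]
  smap_sid m := by rw [F.smap_sid, G.smap_sid']
  smap_scomp φ ψ := by rw [F.smap_scomp, G.smap_scomp']

theorem _root_.DoubleCategory.PreFunctor.comp_dmap (F : PreFunctor C D) (G : PreFunctor D E)
    {A B : C} {m n : A ⟶ B} (d : m ⟶ n) : (F.comp G).dmap d = G.dmap (F.dmap d) := by
  rw [PreFunctor.dmap, PreFunctor.dmap, PreFunctor.dmap, G.smap_scast, scast_scast]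
  rfl

theorem comp_mapComp_naturality (F : DFunctor C D) (G : DFunctor D E)
    {A B X A' B' X' : C} {m : A ⟶ B} {p : B ⟶ X} {n : A' ⟶ B'} {q : B' ⟶ X'}
    {f : Arr A A'} {g : Arr B B'} {h : Arr X X'} (φ : Sq m n f g) (ψ : Sq p q g h) :
    scomp (G.smap (F.smap (pcomp φ ψ)))
        (scomp (G.dmap (F.mapComp n q).hom) (G.mapComp (F.pmap n) (F.pmap q)).hom
          (aid_acomp _) (aid_acomp _))
        (acomp_aid (G.amap (F.amap f))) (acomp_aid (G.amap (F.amap h))) =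
      scomp (scomp (G.dmap (F.mapComp m p).hom) (G.mapComp (F.pmap m) (F.pmap p)).hom
          (aid_acomp _) (aid_acomp _))
        (pcomp (G.smap (F.smap φ)) (G.smap (F.smap ψ))) (aid_acomp _) (aid_acomp _) := by
  rw [scomp_scomp (G.dmap (F.mapComp m p).hom) _ _ _ _ _ _ (aid_acomp _) (aid_acomp _)
      (aid_acomp _) (aid_acomp _), ← G.mapComp_naturality,
    ← scomp_scomp _ _ _ (aid_acomp _) (aid_acomp _) (acomp_aid _) (acomp_aid _),
    G.dmap_smap, ← F.mapComp_naturality, ← G.smap_dmap,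
    scomp_scomp _ _ _ _ _ _ _ (aid_acomp _) (aid_acomp _) (acomp_aid _) (acomp_aid _)]

theorem comp_mapId_naturality (F : DFunctor C D) (G : DFunctor D E) {A B : C} (f : Arr A B) :
    scomp (G.smap (F.smap (unitSq f)))
        (scomp (G.dmap (F.mapId B).hom) (G.mapId (F.obj B)).hom (aid_acomp _) (aid_acomp _))
        (acomp_aid (G.amap (F.amap f))) (acomp_aid (G.amap (F.amap f))) =
      scomp (scomp (G.dmap (F.mapId A).hom) (G.mapId (F.obj A)).hom (aid_acomp _) (aid_acomp _))
        (unitSq (G.amap (F.amap f))) (aid_acomp _) (aid_acomp _) := by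
  rw [scomp_scomp (G.dmap (F.mapId A).hom) _ _ _ _ _ _ (aid_acomp _) (aid_acomp _)
      (aid_acomp _) (aid_acomp _), ← G.mapId_naturality,
    ← scomp_scomp _ _ _ (aid_acomp _) (aid_acomp _) (acomp_aid _) (acomp_aid _),
    G.dmap_smap, ← F.mapId_naturality, ← G.smap_dmap,
    scomp_scomp _ _ _ _ _ _ _ (aid_acomp _) (aid_acomp _) (acomp_aid _) (acomp_aid _)]

/-- Composition of functors, `F` first. -/
def comp (F : DFunctor C D) (G : DFunctor D E) : DFunctor C E where
  toPreFunctor := F.toPreFunctor.comp G.toPreFunctor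
  mapComp m n := G.dmapIso (F.mapComp m n) ≪≫ G.mapComp (F.pmap m) (F.pmap n)
  mapId A := G.dmapIso (F.mapId A) ≪≫ G.mapId (F.obj A)
  mapComp_naturality φ ψ := comp_mapComp_naturality F G φ ψ
  mapId_naturality f := comp_mapId_naturality F G f
  dmap_associator m n p := by
    rw [PreFunctor.comp_dmap]
    exact (F.toPseudofunctor.comp G.toPseudofunctor).map₂_associator m n p
  dmap_leftUnitor m := by
    rw [PreFunctor.comp_dmap]
    exact (F.toPseudofunctor.comp G.toPseudofunctor).map₂_left_unitor m
  dmap_rightUnitor m := by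
    rw [PreFunctor.comp_dmap]
    exact (F.toPseudofunctor.comp G.toPseudofunctor).map₂_right_unitor m

variable (C) in
/-- The constant functor. -/
def const (X : D) : DFunctor C D where
  obj _ := X
  amap _ := aid X
  pmap _ := 𝟙 X
  smap _ := sid (𝟙 X) rfl rfl
  amap_aid _ := rfl
  amap_acomp _ _ := (aid_acomp _).symm
  smap_sid _ := rfl
  smap_scomp _ _ := (sid_scomp _).symm
  mapComp _ _ := (λ_ (𝟙 X)).symm
  mapId _ := Iso.refl _
  mapComp_naturality φ ψ := by
    rw [pcomp_sid]
    exact (Category.id_comp (λ_ (𝟙 X)).inv).trans (Category.comp_id _).symm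
  mapId_naturality f := by
    rw [unitSq_aid]
    rfl
  dmap_associator m n p := by
    change 𝟙 (𝟙 X) = (λ_ (𝟙 X)).inv ≫ (λ_ (𝟙 X)).inv ▷ 𝟙 X ≫
      (α_ (𝟙 X) (𝟙 X) (𝟙 X)).hom ≫ 𝟙 X ◁ (λ_ (𝟙 X)).hom ≫ (λ_ (𝟙 X)).hom
    bicategory
  dmap_leftUnitor m := by
    change 𝟙 (𝟙 X) = (λ_ (𝟙 X)).inv ≫ 𝟙 (𝟙 X) ▷ 𝟙 X ≫ (λ_ (𝟙 X)).hom
    simp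
  dmap_rightUnitor m := by
    change 𝟙 (𝟙 X) = (λ_ (𝟙 X)).inv ≫ 𝟙 X ◁ 𝟙 (𝟙 X) ≫ (ρ_ (𝟙 X)).hom
    bicategory

variable (C D) in
/-- The first projection. -/
def fst : DFunctor (C ×ᵈ D) C where
  obj X := X.1
  amap f := f.1
  pmap m := m.1
  smap φ := φ.1
  amap_aid _ := rfl
  amap_acomp _ _ := rfl
  smap_sid _ := rfl
  smap_scomp _ _ := rfl
  mapComp _ _ := Iso.refl _
  mapId _ := Iso.refl _
  mapComp_naturality φ ψ := (id C).mapComp_naturality φ.1 ψ.1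
  mapId_naturality f := (id C).mapId_naturality f.1
  dmap_associator m n p := (id C).dmap_associator m.1 n.1 p.1
  dmap_leftUnitor m := (id C).dmap_leftUnitor m.1
  dmap_rightUnitor m := (id C).dmap_rightUnitor m.1

variable (C D) in
/-- The second projection. -/
def snd : DFunctor (C ×ᵈ D) D where
  obj X := X.2
  amap f := f.2
  pmap m := m.2
  smap φ := φ.2
  amap_aid _ := rfl
  amap_acomp _ _ := rfl
  smap_sid _ := rfl
  smap_scomp _ _ := rfl
  mapComp _ _ := Iso.refl _
  mapId _ := Iso.refl _
  mapComp_naturality φ ψ := (id D).mapComp_naturality φ.2 ψ.2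
  mapId_naturality f := (id D).mapId_naturality f.2
  dmap_associator m n p := (id D).dmap_associator m.2 n.2 p.2
  dmap_leftUnitor m := (id D).dmap_leftUnitor m.2
  dmap_rightUnitor m := (id D).dmap_rightUnitor m.2

/-- An invertible disk of a product double category from its components. -/
def prodIso {X Y : C ×ᵈ D} {m n : X ⟶ Y} (d : m.1 ≅ n.1) (e : m.2 ≅ n.2) : m ≅ n where
  hom := (d.hom, e.hom)
  inv := (d.inv, e.inv)
  hom_inv_id := Prod.ext d.hom_inv_id e.hom_inv_id
  inv_hom_id := Prod.ext d.inv_hom_id e.inv_hom_id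

/-- The functor to a product double category with the given components. -/
def pair (F : DFunctor C D) (G : DFunctor C E) : DFunctor C (D ×ᵈ E) where
  obj A := ⟨F.obj A, G.obj A⟩
  amap f := (F.amap f, G.amap f)
  pmap m := (F.pmap m, G.pmap m)
  smap φ := (F.smap φ, G.smap φ)
  amap_aid A := Prod.ext (F.amap_aid A) (G.amap_aid A)
  amap_acomp f g := Prod.ext (F.amap_acomp f g) (G.amap_acomp f g)
  smap_sid m := Prod.ext (F.smap_sid m) (G.smap_sid m)
  smap_scomp φ ψ := Prod.ext (F.smap_scomp φ ψ) (G.smap_scomp φ ψ)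
  mapComp m n := prodIso (F.mapComp m n) (G.mapComp m n)
  mapId A := prodIso (F.mapId A) (G.mapId A)
  mapComp_naturality φ ψ := Prod.ext (F.mapComp_naturality φ ψ) (G.mapComp_naturality φ ψ)
  mapId_naturality f := Prod.ext (F.mapId_naturality f) (G.mapId_naturality f)
  dmap_associator m n p := by
    rw [PreFunctor.dmap, scast_prod]
    exact Prod.ext (F.dmap_associator m n p) (G.dmap_associator m n p)
  dmap_leftUnitor m := by
    rw [PreFunctor.dmap, scast_prod]
    exact Prod.ext (F.dmap_leftUnitor m) (G.dmap_leftUnitor m)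
  dmap_rightUnitor m := by
    rw [PreFunctor.dmap, scast_prod]
    exact Prod.ext (F.dmap_rightUnitor m) (G.dmap_rightUnitor m)

end DFunctor

end DoubleCategory

namespace DoubleCategory

universe u' v' w' x' u'' v'' w'' x'' u₃ v₃ w₃ x₃

variable {C : Type u} [DoubleCategory.{u, v, w, x} C]
  {D : Type u'} [DoubleCategory.{u', v', w', x'} D]
  {E : Type u''} [DoubleCategory.{u'', v'', w'', x''} E]
  {F : Type u₃} [DoubleCategory.{u₃, v₃, w₃, x₃} F]

namespace DFunctor

/-- The product of two functors. -/
def prodMap (P : DFunctor C D) (Q : DFunctor E F) : DFunctor (C ×ᵈ E) (D ×ᵈ F) :=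
  pair ((fst C E).comp P) ((snd C E).comp Q)

variable (C D E) in
/-- The functor exchanging the factors of a product. -/
def swap : DFunctor (C ×ᵈ D) (D ×ᵈ C) := pair (snd C D) (fst C D)

variable (C D E) in
/-- The functor reassociating a product. -/
def prodAssoc : DFunctor ((C ×ᵈ D) ×ᵈ E) (C ×ᵈ (D ×ᵈ E)) :=
  pair ((fst (C ×ᵈ D) E).comp (fst C D)) (pair ((fst (C ×ᵈ D) E).comp (snd C D)) (snd (C ×ᵈ D) E))

/-- The invertible disk `P r ≅ P p ≫ P q` induced by `r ≅ p ≫ q`. -/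
def mapIsoComp (P : DFunctor C D) {X Y Z : C} {r : X ⟶ Z} {p : X ⟶ Y} {q : Y ⟶ Z}
    (e : r ≅ p ≫ q) : P.pmap r ≅ P.pmap p ≫ P.pmap q :=
  P.dmapIso e ≪≫ P.mapComp p q

/-- The invertible disk `P p ≫ P q ≅ P p' ≫ P q'` induced by `p ≫ q ≅ p' ≫ q'`. -/
def mapCompIso (P : DFunctor C D) {X Y Y' Z : C} {p : X ⟶ Y} {q : Y ⟶ Z} {p' : X ⟶ Y'}
    {q' : Y' ⟶ Z} (e : p ≫ q ≅ p' ≫ q') : P.pmap p ≫ P.pmap q ≅ P.pmap p' ≫ P.pmap q' :=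
  (P.mapComp p q).symm ≪≫ P.dmapIso e ≪≫ P.mapComp p' q'

end DFunctor

/-! ### Natural transformations -/

/-- The object-component proarrows and arrow-component squares of a proarrow-dimension
transformation between functors. -/
structure ProComponents (P Q : DFunctor C D) where
  /-- object-component proarrow -/
  app (A : C) : P.obj A ⟶ Q.obj A
  /-- arrow-component square -/
  appSq {A B : C} (f : Arr A B) : Sq (app A) (app B) (P.amap f) (Q.amap f)

/-- The rest of the structure of a proarrow-dimension pseudo natural transformation with given
object-component proarrows and arrow-component squares: preservation of arrow composition, and
invertible proarrow-component disks which are natural for squares and compatible with proarrow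
composition. -/
structure PseudoNat {P Q : DFunctor C D} (t : ProComponents P Q) where
  appSq_aid (A : C) : t.appSq (aid A) = sid (t.app A) (P.amap_aid A) (Q.amap_aid A)
  appSq_acomp {A B E : C} (f : Arr A B) (g : Arr B E) :
    t.appSq (acomp f g) =
      scomp (t.appSq f) (t.appSq g) (P.amap_acomp f g).symm (Q.amap_acomp f g).symm
  /-- proarrow-component disk -/
  disk {A B : C} (m : A ⟶ B) : P.pmap m ≫ t.app B ≅ t.app A ≫ Q.pmap m
  disk_naturality {A B A' B' : C} {m : A ⟶ B} {n : A' ⟶ B'} {f : Arr A A'} {g : Arr B B'}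
    (φ : Sq m n f g) :
    scomp (pcomp (P.smap φ) (t.appSq g)) (disk n).hom (acomp_aid _) (acomp_aid _) =
      scomp (disk m).hom (pcomp (t.appSq f) (Q.smap φ)) (aid_acomp _) (aid_acomp _)
  disk_id (A : C) :
    (disk (𝟙 A)).hom = (P.mapId A).hom ▷ t.app A ≫ (λ_ (t.app A)).hom ≫ (ρ_ (t.app A)).inv ≫
      t.app A ◁ (Q.mapId A).inv
  disk_comp {A B E : C} (m : A ⟶ B) (n : B ⟶ E) :
    (disk (m ≫ n)).hom = (P.mapComp m n).hom ▷ t.app E ≫ (α_ _ _ _).hom ≫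
      P.pmap m ◁ (disk n).hom ≫ (α_ _ _ _).inv ≫ (disk m).hom ▷ Q.pmap n ≫ (α_ _ _ _).hom ≫
        t.app A ◁ (Q.mapComp m n).inv

/-- An arrow-dimension natural transformation between functors. -/
structure ArrNat (P Q : DFunctor C D) where
  /-- object-component arrow -/
  app (A : C) : Arr (P.obj A) (Q.obj A)
  /-- proarrow-component square -/
  appSq {A B : C} (m : A ⟶ B) : Sq (P.pmap m) (Q.pmap m) (app A) (app B)
  naturality {A B : C} (f : Arr A B) : acomp (P.amap f) (app B) = acomp (app A) (Q.amap f)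
  sq_naturality {A B A' B' : C} {m : A ⟶ B} {n : A' ⟶ B'} {f : Arr A A'} {g : Arr B B'}
    (φ : Sq m n f g) :
    scomp (P.smap φ) (appSq n) (naturality f) (naturality g) = scomp (appSq m) (Q.smap φ) rfl rfl
  appSq_id (A : C) :
    scomp (appSq (𝟙 A)) (Q.mapId A).hom (acomp_aid _) (acomp_aid _) =
      scomp (P.mapId A).hom (unitSq (app A)) (aid_acomp _) (aid_acomp _)
  appSq_comp {A B E : C} (m : A ⟶ B) (n : B ⟶ E) :
    scomp (appSq (m ≫ n)) (Q.mapComp m n).hom (acomp_aid _) (acomp_aid _) =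
      scomp (P.mapComp m n).hom (pcomp (appSq m) (appSq n)) (aid_acomp _) (aid_acomp _)

/-- An invertible arrow-dimension natural transformation between functors. -/
structure ArrNatIso (P Q : DFunctor C D) where
  /-- the transformation -/
  hom : ArrNat P Q
  /-- its inverse -/
  inv : ArrNat Q P
  hom_inv (A : C) : acomp (hom.app A) (inv.app A) = aid (P.obj A)
  inv_hom (A : C) : acomp (inv.app A) (hom.app A) = aid (Q.obj A)
  hom_inv_sq {A B : C} (m : A ⟶ B) :
    scomp (hom.appSq m) (inv.appSq m) (hom_inv A) (hom_inv B) = sid (P.pmap m) rfl rfl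
  inv_hom_sq {A B : C} (m : A ⟶ B) :
    scomp (inv.appSq m) (hom.appSq m) (inv_hom A) (inv_hom B) = sid (Q.pmap m) rfl rfl

/-! ### Dinatural transformations -/

section Difunctor

/-- A proarrow of the product of `Co C` and `C` which is a unit in the first component. -/
def proR (X : C) {A B : C} (m : A ⟶ B) : (⟨Co.mk X, A⟩ : Co C ×ᵈ C) ⟶ ⟨Co.mk X, B⟩ :=
  (𝟙 (Co.mk X), m)

/-- A proarrow of the product of `Co C` and `C` which is a unit in the second component. -/
def proL {A B : C} (m : A ⟶ B) (X : C) : (⟨Co.mk B, X⟩ : Co C ×ᵈ C) ⟶ ⟨Co.mk A, X⟩ :=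
  (m, 𝟙 X)

/-- A pair of arrows, as an arrow of `Co C ×ᵈ C`. -/
def arrLR {X Y A B : C} (g : Arr X Y) (f : Arr A B) :
    Arr (⟨Co.mk X, A⟩ : Co C ×ᵈ C) ⟨Co.mk Y, B⟩ :=
  (g, f)

/-- A square of `Co C ×ᵈ C` which is a unit square in the first component. -/
def sqR {X Y : C} (k : Arr X Y) {A B A' B' : C} {m : A ⟶ B} {n : A' ⟶ B'} {f : Arr A A'}
    {g : Arr B B'} (φ : Sq m n f g) : Sq (proR X m) (proR Y n) (arrLR k f) (arrLR k g) :=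
  (unitSq (C := Co C) (A := Co.mk X) (B := Co.mk Y) k, φ)

/-- A square of `Co C ×ᵈ C` which is a unit square in the second component. -/
def sqL {A B A' B' : C} {m : A ⟶ B} {n : A' ⟶ B'} {f : Arr A A'}
    {g : Arr B B'} (φ : Sq m n f g) {X Y : C} (k : Arr X Y) :
    Sq (proL m X) (proL n Y) (arrLR g k) (arrLR f k) :=
  (φ, unitSq k)

/-- `(1, m ≫ n) ≅ (1, m) ≫ (1, n)` -/
def proRComp (X : C) {A B E : C} (m : A ⟶ B) (n : B ⟶ E) :
    proR X (m ≫ n) ≅ proR X m ≫ proR X n :=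
  DFunctor.prodIso (λ_ (𝟙 (Co.mk X))).symm (Iso.refl (m ≫ n))

/-- `(m ≫ n, 1) ≅ (n, 1) ≫ (m, 1)`, where `m ≫ n` is the composite in `C` -/
def proLComp {A B E : C} (m : A ⟶ B) (n : B ⟶ E) (X : C) :
    proL (m ≫ n) X ≅ proL n X ≫ proL m X :=
  DFunctor.prodIso (Iso.refl _) (λ_ (𝟙 X)).symm

/-- `(1, m) ≫ (n, 1) ≅ (n, 1) ≫ (1, m)`, both being isomorphic to `(n, m)` -/
def proExchange {A B X Y : C} (m : A ⟶ B) (n : X ⟶ Y) :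
    proR Y m ≫ proL n B ≅ proL n A ≫ proR X m :=
  DFunctor.prodIso (m := proR Y m ≫ proL n B) (n := proL n A ≫ proR X m)
    ((λ_ (show Co.mk Y ⟶ Co.mk X from n)) ≪≫ (ρ_ (show Co.mk Y ⟶ Co.mk X from n)).symm)
    ((ρ_ m) ≪≫ (λ_ m).symm)

/-- A proarrow-dimension pseudo dinatural transformation between difunctors. -/
structure Dinat (P Q : DFunctor (Co C ×ᵈ C) D) where
  /-- object-component proarrow -/
  app (A : C) : P.obj ⟨Co.mk A, A⟩ ⟶ Q.obj ⟨Co.mk A, A⟩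
  /-- arrow-component square -/
  appSq {A B : C} (f : Arr A B) : Sq (app A) (app B) (P.amap (arrLR f f)) (Q.amap (arrLR f f))
  appSq_aid (A : C) : appSq (aid A) = sid (app A) (P.amap_aid _) (Q.amap_aid _)
  appSq_acomp {A B E : C} (f : Arr A B) (g : Arr B E) :
    appSq (acomp f g) = scomp (appSq f) (appSq g)
      (P.amap_acomp (arrLR f f) (arrLR g g)).symm (Q.amap_acomp (arrLR f f) (arrLR g g)).symm
  /-- proarrow-component disk -/
  disk {A B : C} (m : A ⟶ B) :
    (P.pmap (proR B m) ≫ app B) ≫ Q.pmap (proL m B) ≅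
      (P.pmap (proL m A) ≫ app A) ≫ Q.pmap (proR A m)
  disk_naturality {A B A' B' : C} {m : A ⟶ B} {n : A' ⟶ B'} {f : Arr A A'} {g : Arr B B'}
    (φ : Sq m n f g) :
    scomp (pcomp (pcomp (P.smap (sqR g φ)) (appSq g)) (Q.smap (sqL φ g))) (disk n).hom
        (acomp_aid _) (acomp_aid _) =
      scomp (disk m).hom (pcomp (pcomp (P.smap (sqL φ f)) (appSq f)) (Q.smap (sqR f φ)))
        (aid_acomp _) (aid_acomp _)
  disk_id (A : C) :
    (disk (𝟙 A)).hom = 𝟙 ((P.pmap (proR A (𝟙 A)) ≫ app A) ≫ Q.pmap (proL (𝟙 A) A))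
  disk_comp {A B E : C} (m : A ⟶ B) (n : B ⟶ E) :
    (disk (m ≫ n)).hom =
      𝟙 ((P.pmap (proR E (m ≫ n)) ≫ app E) ≫ Q.pmap (proL (m ≫ n) E)) ⊗≫
      (P.mapIsoComp (proRComp E m n)).hom ▷ (app E ≫ Q.pmap (proL (m ≫ n) E)) ⊗≫
      (P.pmap (proR E m) ≫ P.pmap (proR E n) ≫ app E) ◁
        (Q.mapIsoComp (proLComp m n E)).hom ⊗≫
      P.pmap (proR E m) ◁ (disk n).hom ▷ Q.pmap (proL m E) ⊗≫
      (P.mapCompIso (proExchange m n)).hom ▷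
        (app B ≫ Q.pmap (proR B n) ≫ Q.pmap (proL m E)) ⊗≫
      (P.pmap (proL n A) ≫ P.pmap (proR B m) ≫ app B) ◁
        (Q.mapCompIso (proExchange n m)).hom ⊗≫
      P.pmap (proL n A) ◁ (disk m).hom ▷ Q.pmap (proR A n) ⊗≫
      (P.mapIsoComp (proLComp m n A)).inv ▷
        (app A ≫ Q.pmap (proR A m) ≫ Q.pmap (proR A n)) ⊗≫
      (P.pmap (proL (m ≫ n) A) ≫ app A) ◁ (Q.mapIsoComp (proRComp A m n)).inv ⊗≫
      𝟙 ((P.pmap (proL (m ≫ n) A) ≫ app A) ≫ Q.pmap (proR A (m ≫ n)))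

theorem proExchange_comp {A B E : C} (m : A ⟶ B) (n : B ⟶ E) :
    (proExchange (m ≫ n) (m ≫ n)).hom =
      (proRComp E m n).hom ▷ proL (m ≫ n) E ≫ (proR E m ≫ proR E n) ◁ (proLComp m n E).hom ≫
      (α_ (proR E m) (proR E n) (proL n E ≫ proL m E)).hom ≫
      proR E m ◁ (α_ (proR E n) (proL n E) (proL m E)).inv ≫
      proR E m ◁ (proExchange n n).hom ▷ proL m E ≫
      proR E m ◁ (α_ (proL n B) (proR B n) (proL m E)).hom ≫
      (α_ (proR E m) (proL n B) (proR B n ≫ proL m E)).inv ≫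
      (proExchange m n).hom ▷ (proR B n ≫ proL m E) ≫
      (proL n A ≫ proR B m) ◁ (proExchange n m).hom ≫
      (α_ (proL n A) (proR B m) (proL m B ≫ proR A n)).hom ≫
      proL n A ◁ (α_ (proR B m) (proL m B) (proR A n)).inv ≫
      proL n A ◁ (proExchange m m).hom ▷ proR A n ≫
      proL n A ◁ (α_ (proL m A) (proR A m) (proR A n)).hom ≫
      (α_ (proL n A) (proL m A) (proR A m ≫ proR A n)).inv ≫
      (proLComp m n A).inv ▷ (proR A m ≫ proR A n) ≫
      proL (m ≫ n) A ◁ (proRComp A m n).inv := by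
  have key : ∀ {B : Type u} [Bicategory.{x, v} B] {a b c : B} (m : a ⟶ b) (n : b ⟶ c),
      (ρ_ (m ≫ n)).hom ≫ (λ_ (m ≫ n)).inv =
      𝟙 (m ≫ n) ▷ 𝟙 c ≫ (m ≫ n) ◁ (λ_ (𝟙 c)).inv ≫ (α_ m n (𝟙 c ≫ 𝟙 c)).hom ≫
      m ◁ (α_ n (𝟙 c) (𝟙 c)).inv ≫ m ◁ ((ρ_ n).hom ≫ (λ_ n).inv) ▷ 𝟙 c ≫
      m ◁ (α_ (𝟙 b) n (𝟙 c)).hom ≫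
      (α_ m (𝟙 b) (n ≫ 𝟙 c)).inv ≫
      ((ρ_ m).hom ≫ (λ_ m).inv) ▷ (n ≫ 𝟙 c) ≫
      (𝟙 a ≫ m) ◁ ((ρ_ n).hom ≫ (λ_ n).inv) ≫
      (α_ (𝟙 a) m (𝟙 b ≫ n)).hom ≫
      𝟙 a ◁ (α_ m (𝟙 b) n).inv ≫ 𝟙 a ◁ ((ρ_ m).hom ≫ (λ_ m).inv) ▷ n ≫
      𝟙 a ◁ (α_ (𝟙 a) m n).hom ≫ (α_ (𝟙 a) (𝟙 a) (m ≫ n)).inv ≫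
      (λ_ (𝟙 a)).hom ▷ (m ≫ n) ≫ 𝟙 a ◁ 𝟙 (m ≫ n) := by
    intros; bicategory
  have key' : ∀ {B : Type u} [Bicategory.{x, v} B] {a b c : B} (n : a ⟶ b) (m : b ⟶ c),
      (λ_ (n ≫ m)).hom ≫ (ρ_ (n ≫ m)).inv =
      (λ_ (𝟙 a)).inv ▷ (n ≫ m) ≫ (𝟙 a ≫ 𝟙 a) ◁ 𝟙 (n ≫ m) ≫ (α_ (𝟙 a) (𝟙 a) (n ≫ m)).hom ≫
      𝟙 a ◁ (α_ (𝟙 a) n m).inv ≫ 𝟙 a ◁ ((λ_ n).hom ≫ (ρ_ n).inv) ▷ m ≫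
      𝟙 a ◁ (α_ n (𝟙 b) m).hom ≫
      (α_ (𝟙 a) n (𝟙 b ≫ m)).inv ≫
      ((λ_ n).hom ≫ (ρ_ n).inv) ▷ (𝟙 b ≫ m) ≫
      (n ≫ 𝟙 b) ◁ ((λ_ m).hom ≫ (ρ_ m).inv) ≫
      (α_ n (𝟙 b) (m ≫ 𝟙 c)).hom ≫
      n ◁ (α_ (𝟙 b) m (𝟙 c)).inv ≫ n ◁ ((λ_ m).hom ≫ (ρ_ m).inv) ▷ 𝟙 c ≫
      n ◁ (α_ m (𝟙 c) (𝟙 c)).hom ≫ (α_ n m (𝟙 c ≫ 𝟙 c)).inv ≫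
      𝟙 (n ≫ m) ▷ (𝟙 c ≫ 𝟙 c) ≫ (n ≫ m) ◁ (λ_ (𝟙 c)).hom := by
    intros; bicategory
  refine Prod.ext ?_ (key m n)
  exact key' (B := Co C) (a := Co.mk E) (b := Co.mk B) (c := Co.mk A) n m

theorem dmap_whiskerLeft (P : DFunctor C D) {A B E : C} (m : A ⟶ B) {n n' : B ⟶ E} (d : n ⟶ n') :
    P.dmap (m ◁ d) = (P.mapComp m n).hom ≫ P.pmap m ◁ P.dmap d ≫ (P.mapComp m n').inv :=
  P.toPseudofunctor.map₂_whisker_left m d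

theorem dmap_whiskerRight (P : DFunctor C D) {A B E : C} {m m' : A ⟶ B} (d : m ⟶ m') (n : B ⟶ E) :
    P.dmap (d ▷ n) = (P.mapComp m n).hom ≫ P.dmap d ▷ P.pmap n ≫ (P.mapComp m' n).inv :=
  P.toPseudofunctor.map₂_whisker_right d n

theorem dmap_associator_inv (P : DFunctor C D) {A B E F : C} (m : A ⟶ B) (n : B ⟶ E) (p : E ⟶ F) :
    P.dmap (α_ m n p).inv =
      (P.mapComp m (n ≫ p)).hom ≫ P.pmap m ◁ (P.mapComp n p).hom ≫
        (α_ (P.pmap m) (P.pmap n) (P.pmap p)).inv ≫ (P.mapComp m n).inv ▷ P.pmap p ≫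
          (P.mapComp (m ≫ n) p).inv := by
  have : P.dmapIso (α_ m n p) = P.mapComp (m ≫ n) p ≪≫ whiskerRightIso (P.mapComp m n) (P.pmap p) ≪≫
    α_ (P.pmap m) (P.pmap n) (P.pmap p) ≪≫ whiskerLeftIso (P.pmap m) (P.mapComp n p).symm ≪≫
     (P.mapComp m (n ≫ p)).symm := Iso.ext (P.dmap_associator m n p)
  have h := congrArg Iso.inv this
  simpa using h

theorem diagonalId_comp (P : DFunctor (Co C ×ᵈ C) D)  {A B E : C} (m : A ⟶ B) (n : B ⟶ E) :
    (ρ_ (P.pmap (proR E (m ≫ n)))).hom ▷ P.pmap (proL (m ≫ n) E) ≫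
     (P.mapCompIso (proExchange (m ≫ n) (m ≫ n))).hom ≫
    (ρ_ (P.pmap (proL (m ≫ n) A))).inv ▷ P.pmap (proR A (m ≫ n)) =
      𝟙 ((P.pmap (proR E (m ≫ n)) ≫ 𝟙 (P.obj ⟨Co.mk E, E⟩)) ≫ P.pmap (proL (m ≫ n) E)) ⊗≫
      (P.mapIsoComp (proRComp E m n)).hom ▷ (𝟙 (P.obj ⟨Co.mk E, E⟩) ≫ P.pmap (proL (m ≫ n) E)) ⊗≫
      (P.pmap (proR E m) ≫ P.pmap (proR E n) ≫ 𝟙 (P.obj ⟨Co.mk E, E⟩)) ◁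
        (P.mapIsoComp (proLComp m n E)).hom ⊗≫
      P.pmap (proR E m) ◁ ((ρ_ (P.pmap (proR E n))).hom ▷ P.pmap (proL n E) ≫
        (P.mapCompIso (proExchange n n)).hom ≫
         (ρ_ (P.pmap (proL n B))).inv ▷ P.pmap (proR B n)) ▷ P.pmap (proL m E) ⊗≫
      (P.mapCompIso (proExchange m n)).hom ▷
        (𝟙 (P.obj ⟨Co.mk B, B⟩) ≫ P.pmap (proR B n) ≫ P.pmap (proL m E)) ⊗≫
      (P.pmap (proL n A) ≫ P.pmap (proR B m) ≫ 𝟙 (P.obj ⟨Co.mk B, B⟩)) ◁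
        (P.mapCompIso (proExchange n m)).hom ⊗≫
      P.pmap (proL n A) ◁ ((ρ_ (P.pmap (proR B m))).hom ▷ P.pmap (proL m B) ≫
        (P.mapCompIso (proExchange m m)).hom ≫
         (ρ_ (P.pmap (proL m A))).inv ▷ P.pmap (proR A m)) ▷ P.pmap (proR A n) ⊗≫
      (P.mapIsoComp (proLComp m n A)).inv ▷
        (𝟙 (P.obj ⟨Co.mk A, A⟩) ≫ P.pmap (proR A m) ≫ P.pmap (proR A n)) ⊗≫
      (P.pmap (proL (m ≫ n) A) ≫ 𝟙 (P.obj ⟨Co.mk A, A⟩)) ◁ (P.mapIsoComp (proRComp A m n)).inv ⊗≫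
      𝟙 ((P.pmap (proL (m ≫ n) A) ≫ 𝟙 (P.obj ⟨Co.mk A, A⟩)) ≫ P.pmap (proR A (m ≫ n))) := by
  have h := congrArg P.dmap (proExchange_comp m n)
  simp only [PreFunctor.dmap_comp, dmap_whiskerLeft, dmap_whiskerRight, dmap_associator_inv,
    DFunctor.dmap_associator, Bicategory.whiskerLeft_comp, Category.assoc, Iso.inv_hom_id_assoc,
    Bicategory.whiskerLeft_inv_hom_assoc] at h
  simp only [DFunctor.mapCompIso, DFunctor.mapIsoComp, Iso.trans_hom, Iso.trans_inv,
    PreFunctor.dmapIso_hom, PreFunctor.dmapIso_inv, Iso.symm_hom]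
  simp only [associator_inv_naturality_right_assoc, whisker_exchange_assoc] at h
  rw [h]
  simp only [Category.assoc, Iso.inv_hom_id_assoc, Iso.inv_hom_id, Category.comp_id]
  bicategory

/-- The disks `d` and `e` form a commuting square with the squares `φ` and `ψ`. -/
def DiskNat {A B A' B' : C} {m m' : A ⟶ B} {n n' : A' ⟶ B'} {f : Arr A A'} {g : Arr B B'}
    (φ : Sq m n f g) (ψ : Sq m' n' f g) (d : m ⟶ m') (e : n ⟶ n') : Prop :=
  scomp φ e (acomp_aid f) (acomp_aid g) = scomp d ψ (aid_acomp f) (aid_acomp g)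

namespace DiskNat

variable {A B A' B' : C} {m m' m'' : A ⟶ B} {n n' n'' : A' ⟶ B'} {f : Arr A A'} {g : Arr B B'}
  {φ : Sq m n f g} {ψ : Sq m' n' f g} {χ : Sq m'' n'' f g}

theorem comp {d : m ⟶ m'} {e : n ⟶ n'} {d' : m' ⟶ m''} {e' : n' ⟶ n''} (h : DiskNat φ ψ d e)
    (h' : DiskNat ψ χ d' e') : DiskNat φ χ (d ≫ d') (e ≫ e') := by
  change scomp φ (scomp e e' (aid_acomp _) (aid_acomp _)) _ _ =
    scomp (scomp d d' (aid_acomp _) (aid_acomp _)) χ _ _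
  rw [scomp_scomp d d' χ _ _ _ _ (aid_acomp _) (aid_acomp _) (aid_acomp _) (aid_acomp _), ← h',
    ← scomp_scomp φ e e' (acomp_aid _) (acomp_aid _) (acomp_aid _) (acomp_aid _), h,
    scomp_scomp d ψ e' _ _ _ _ (acomp_aid _) (acomp_aid _) (aid_acomp _) (aid_acomp _)]

theorem inv {d : m ≅ m'} {e : n ≅ n'} (h : DiskNat φ ψ d.hom e.hom) :
    DiskNat ψ φ d.inv e.inv := by
  have hd : scomp d.inv d.hom (aid_acomp _) (aid_acomp _) = sid m' rfl rfl := d.inv_hom_id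
  have he : scomp e.hom e.inv (aid_acomp _) (aid_acomp _) = sid n rfl rfl := e.hom_inv_id
  have h1 : ψ = scomp d.inv (scomp φ e.hom (acomp_aid f) (acomp_aid g))
      (aid_acomp f) (aid_acomp g) := by
    rw [h, ← scomp_scomp d.inv d.hom ψ (aid_acomp _) (aid_acomp _) (aid_acomp _) (aid_acomp _), hd,
      sid_scomp]
  unfold DiskNat
  conv_lhs => rw [h1]
  rw [scomp_scomp d.inv _ e.inv _ _ _ _ (acomp_aid _) (acomp_aid _) (aid_acomp _) (aid_acomp _),
    scomp_scomp φ e.hom e.inv _ _ _ _ (aid_acomp _) (aid_acomp _) (acomp_aid _) (acomp_aid _), he,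
    scomp_sid]

theorem whiskerRight {d : m ⟶ m'} {e : n ⟶ n'} (h : DiskNat φ ψ d e) {E E' : C} {p : B ⟶ E}
    {q : B' ⟶ E'} {k : Arr E E'} (ω : Sq p q g k) :
    DiskNat (pcomp φ ω) (pcomp ψ ω) (d ▷ p) (e ▷ q) := by
  change scomp (pcomp φ ω) (pcomp e (sid q rfl rfl)) _ _ =
    scomp (pcomp d (sid p rfl rfl)) (pcomp ψ ω) _ _
  rw [pcomp_scomp' _ _ _ _ _ (acomp_aid _), pcomp_scomp' _ _ _ _ _ (aid_acomp _), scomp_sid,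
    sid_scomp, h]

theorem dmap (P : DFunctor C D) {d : m ⟶ m'} {e : n ⟶ n'} (h : DiskNat φ ψ d e) :
    DiskNat (P.smap φ) (P.smap ψ) (P.dmap d) (P.dmap e) := by
  unfold DiskNat
  rw [P.smap_dmap, P.dmap_smap, h]

theorem prod {X Y X' Y' : C ×ᵈ D} {m m' : X ⟶ Y} {n n' : X' ⟶ Y'} {f : Arr X X'} {g : Arr Y Y'}
    {φ : Sq m n f g} {ψ : Sq m' n' f g} {d : m ⟶ m'} {e : n ⟶ n'}
    (h₁ : DiskNat φ.1 ψ.1 d.1 e.1) (h₂ : DiskNat φ.2 ψ.2 d.2 e.2) : DiskNat φ ψ d e :=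
  Prod.ext h₁ h₂

end DiskNat

/-- The dinatural transformation given by the identity transformation of a difunctor. Its object
components are unit proarrows, its arrow components are unit squares, and its proarrow components
are identity disks up to the coherence isomorphisms. -/
def diagonalId (P : DFunctor (Co C ×ᵈ C) D) : Dinat P P where
  app A := 𝟙 (P.obj ⟨Co.mk A, A⟩)
  appSq f := unitSq (P.amap (arrLR f f))
  appSq_aid A := by
    have : ∀ {X : D} {f : Arr X X} (h : f = aid X), unitSq f = sid (𝟙 X) h h := by
      rintro X f rfl; exact unitSq_aid X
    exact this (P.amap_aid _)
  appSq_acomp f g := by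
    have : ∀ {X Y Z : D} {f : Arr X Y} {g : Arr Y Z} {k : Arr X Z} (h : acomp f g = k),
      unitSq k = scomp (unitSq f) (unitSq g) h h := by
      rintro X Y Z f g _ rfl; exact unitSq_acomp f g
    exact this (P.amap_acomp (arrLR f f) (arrLR g g)).symm
  disk {A B} m := whiskerRightIso (ρ_ (P.pmap (proR B m))) (P.pmap (proL m B)) ≪≫
    P.mapCompIso (proExchange m m) ≪≫
    whiskerRightIso (ρ_ (P.pmap (proL m A))).symm (P.pmap (proR A m))
  disk_naturality {A B A' B' m n f g} φ := by
    have key : DiskNat (pcomp (sqR g φ) (sqL φ g)) (pcomp (sqL φ f) (sqR f φ))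
        (proExchange m m).hom (proExchange n n).hom := by
      refine DiskNat.prod ?_ ?_
      · refine DiskNat.comp (C := Co C) (ψ := φ) (lhom_naturality (C := Co C) φ) ?_
        exact DiskNat.inv (C := Co C) (d := ρ_ (show Co.mk B ⟶ Co.mk A from m))
          (e := ρ_ (show Co.mk B' ⟶ Co.mk A' from n)) (rhom_naturality (C := Co C) φ)
      · refine DiskNat.comp (ψ := φ) (rhom_naturality φ) ?_
        exact DiskNat.inv (d := λ_ m) (e := λ_ n) (lhom_naturality φ)
    refine DiskNat.comp (DiskNat.whiskerRight (rhom_naturality (P.smap (sqR g φ))) _) ?_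
    refine DiskNat.comp ?_ (DiskNat.whiskerRight (DiskNat.inv (d := ρ_ (P.pmap (proL m A)))
      (e := ρ_ (P.pmap (proL n A'))) (rhom_naturality (P.smap (sqL φ f)))) _)
    refine DiskNat.comp (DiskNat.inv (d := P.mapComp _ _) (e := P.mapComp _ _)
      (P.mapComp_naturality _ _)) ?_
    exact DiskNat.comp (DiskNat.dmap P key) (P.mapComp_naturality _ _)
  disk_id A := by
    have key : (proExchange (𝟙 A) (𝟙 A)).hom = 𝟙 (proR A (𝟙 A) ≫ proL (𝟙 A) A) := by
      have h : (ρ_ (𝟙 A)).hom ≫ (λ_ (𝟙 A)).inv = 𝟙 (𝟙 A ≫ 𝟙 A) := by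
        rw [← Bicategory.unitors_equal]; simp
      have h' : (λ_ (𝟙 (Co.mk A))).hom ≫ (ρ_ (𝟙 (Co.mk A))).inv =
          𝟙 (𝟙 (Co.mk A) ≫ 𝟙 (Co.mk A)) := by
        rw [Bicategory.unitors_equal]; simp
      exact Prod.ext h' h
    have h2 : (P.mapCompIso (proExchange (𝟙 A) (𝟙 A))).hom = 𝟙 _ := by
      have h3 : P.dmap (proExchange (𝟙 A) (𝟙 A)).hom = 𝟙 (P.pmap (proR A (𝟙 A) ≫ proL (𝟙 A) A)) :=
        (congrArg P.dmap key).trans (P.dmap_id _)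
      have h4 := congrArg (fun d => (P.mapComp (proR A (𝟙 A)) (proL (𝟙 A) A)).inv ≫ d ≫
        (P.mapComp (proR A (𝟙 A)) (proL (𝟙 A) A)).hom) h3
      refine h4.trans ?_
      simp
    rw [Iso.trans_hom, Iso.trans_hom, h2]
    exact (congrArg _ (Category.id_comp _)).trans
      (Iso.hom_inv_id (whiskerRightIso (ρ_ (P.pmap (proR A (𝟙 A)))) (P.pmap (proL (𝟙 A) A))))
  disk_comp m n := diagonalId_comp P m n

end Difunctor

/-! ### Companions -/

/-- A companion of an arrow. -/
structure Companion {A B : C} (f : Arr A B) where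
  /-- the companion proarrow -/
  pro : A ⟶ B
  /-- the unit square -/
  unit : Sq (𝟙 A) pro (aid A) f
  /-- the counit square -/
  counit : Sq pro (𝟙 B) f (aid B)
  unit_counit : scomp unit counit (aid_acomp f) (acomp_aid f) = unitSq f
  pcomp_unit_counit :
    (show 𝟙 A ≫ pro ⟶ pro ≫ 𝟙 B from pcomp unit counit) = (λ_ pro).hom ≫ (ρ_ pro).inv

namespace Companion

/-- The square between companions which corresponds to a commuting square of arrows. -/
def sq {A B A' B' : C} {s : Arr A B} {t : Arr A' B'} (hs : Companion s) (ht : Companion t)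
    {f : Arr A A'} {g : Arr B B'} (e : acomp f t = acomp s g) : Sq hs.pro ht.pro f g :=
  scomp (linv hs.pro)
    (scomp
      (pcomp (scomp (unitSq f) ht.unit (acomp_aid f) e) (scomp hs.counit (unitSq g) rfl
        (aid_acomp g)))
      (rhom ht.pro) (acomp_aid f) (acomp_aid g))
    (aid_acomp f) (aid_acomp g)

/-- The disk between companions of the arrow boundaries of a square. -/
def disk {A B A' B' : C} {m : A ⟶ A'} {n : B ⟶ B'} {s : Arr A B} {t : Arr A' B'}
    (hs : Companion s) (ht : Companion t) (φ : Sq m n s t) : m ≫ ht.pro ⟶ hs.pro ≫ n :=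
  (λ_ (m ≫ ht.pro)).inv ≫
    (show 𝟙 A ≫ m ≫ ht.pro ⟶ hs.pro ≫ n ≫ 𝟙 B' from pcomp hs.unit (pcomp φ ht.counit)) ≫
    hs.pro ◁ (ρ_ n).hom

/-- The disk in the direction opposite to `Companion.disk`, for a square whose arrow boundaries are
inverse to the given arrows. -/
def diskInv {A B A' B' : C} {m : A ⟶ A'} {n : B ⟶ B'} {s : Arr A B} {t : Arr A' B'}
    (hs : Companion s) (ht : Companion t) {s' : Arr B A} {t' : Arr B' A'}
    (es : acomp s s' = aid A) (et : acomp t' t = aid B') (φ : Sq n m s' t') :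
    hs.pro ≫ n ⟶ m ≫ ht.pro :=
  hs.pro ◁ (ρ_ n).inv ≫
    (show hs.pro ≫ n ≫ 𝟙 B' ⟶ 𝟙 A ≫ m ≫ ht.pro from
      pcomp (scomp hs.counit (unitSq s') es (aid_acomp s'))
        (pcomp φ (scomp (unitSq t') ht.unit (acomp_aid t') et))) ≫
    (λ_ (m ≫ ht.pro)).hom

end Companion

/-! ### Monoidal double categories -/

/-- The underlying data of a monoidal structure on a double category: a tensor product functor, a
unit object, an associator and unitors. -/
class MonoidalData (C : Type u) [DoubleCategory.{u, v, w, x} C] where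
  /-- tensor product -/
  tensor : DFunctor (C ×ᵈ C) C
  /-- monoidal unit -/
  one : C
  /-- associator -/
  assoc : ArrNatIso ((tensor.prodMap (DFunctor.id C)).comp tensor)
    ((DFunctor.prodAssoc C C C).comp (((DFunctor.id C).prodMap tensor).comp tensor))
  /-- left unitor -/
  left : ArrNatIso ((DFunctor.pair (DFunctor.const C one) (DFunctor.id C)).comp tensor)
    (DFunctor.id C)
  /-- right unitor -/
  right : ArrNatIso ((DFunctor.pair (DFunctor.id C) (DFunctor.const C one)).comp tensor)
    (DFunctor.id C)

namespace MonoidalData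

variable [MonoidalData C]

/-- tensor product of objects -/
def obj (A B : C) : C := (tensor (C := C)).obj ⟨A, B⟩

/-- tensor product of arrows -/
def arr {A B A' B' : C} (f : Arr A A') (g : Arr B B') : Arr (obj A B) (obj A' B') :=
  (tensor (C := C)).amap (A := ⟨A, B⟩) (B := ⟨A', B'⟩) (f, g)

/-- tensor product of proarrows -/
def pro {A B A' B' : C} (m : A ⟶ A') (n : B ⟶ B') : obj A B ⟶ obj A' B' :=
  (tensor (C := C)).pmap (A := ⟨A, B⟩) (B := ⟨A', B'⟩) (m, n)

infixr:70 " ⊗ₒ " => MonoidalData.obj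
infixr:70 " ⊗ₐ " => MonoidalData.arr
infixr:70 " ⊗ₚ " => MonoidalData.pro

/-- tensor product of squares -/
def sq {A₁ B₁ A₁' B₁' A₂ B₂ A₂' B₂' : C} {m₁ : A₁ ⟶ B₁} {n₁ : A₁' ⟶ B₁'} {f₁ : Arr A₁ A₁'}
    {g₁ : Arr B₁ B₁'} {m₂ : A₂ ⟶ B₂} {n₂ : A₂' ⟶ B₂'} {f₂ : Arr A₂ A₂'} {g₂ : Arr B₂ B₂'}
    (φ : Sq m₁ n₁ f₁ g₁) (ψ : Sq m₂ n₂ f₂ g₂) :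
    Sq (m₁ ⊗ₚ m₂) (n₁ ⊗ₚ n₂) (f₁ ⊗ₐ f₂) (g₁ ⊗ₐ g₂) :=
  (tensor (C := C)).smap (A := ⟨A₁, A₂⟩) (B := ⟨B₁, B₂⟩) (A' := ⟨A₁', A₂'⟩) (B' := ⟨B₁', B₂'⟩)
    (m := (m₁, m₂)) (n := (n₁, n₂)) (f := (f₁, f₂)) (g := (g₁, g₂)) (φ, ψ)

infixr:70 " ⊗ₛ " => MonoidalData.sq

/-- tensor product of invertible disks -/
def iso {A B A' B' : C} {m m' : A ⟶ A'} {n n' : B ⟶ B'} (d : m ≅ m') (e : n ≅ n') :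
    m ⊗ₚ n ≅ m' ⊗ₚ n' :=
  (tensor (C := C)).dmapIso (DFunctor.prodIso (X := ⟨A, B⟩) (Y := ⟨A', B'⟩) (m := (m, n))
    (n := (m', n')) d e)

/-- tensor product of disks -/
def disk {A B A' B' : C} {m m' : A ⟶ A'} {n n' : B ⟶ B'} (d : m ⟶ m') (e : n ⟶ n') :
    m ⊗ₚ n ⟶ m' ⊗ₚ n' :=
  (tensor (C := C)).dmap (A := ⟨A, B⟩) (B := ⟨A', B'⟩) (m := (m, n)) (n := (m', n')) (d, e)

/-- The comparison disk for the tensor product of composite proarrows. -/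
def compIso {A B E A' B' E' : C} (m : A ⟶ B) (n : B ⟶ E) (m' : A' ⟶ B') (n' : B' ⟶ E') :
    (m ≫ n) ⊗ₚ (m' ≫ n') ≅ (m ⊗ₚ m') ≫ (n ⊗ₚ n') :=
  (tensor (C := C)).mapComp (A := ⟨A, A'⟩) (B := ⟨B, B'⟩) (E := ⟨E, E'⟩) (m, m') (n, n')

/-- The comparison disk for the tensor product of unit proarrows. -/
def unitIso (A B : C) : 𝟙 A ⊗ₚ 𝟙 B ≅ 𝟙 (A ⊗ₒ B) :=
  (tensor (C := C)).mapId ⟨A, B⟩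

/-- component of the associator at objects -/
def assocArr (A B E : C) : Arr ((A ⊗ₒ B) ⊗ₒ E) (A ⊗ₒ B ⊗ₒ E) :=
  (assoc (C := C)).hom.app ⟨⟨A, B⟩, E⟩

/-- component of the inverse associator at objects -/
def assocInvArr (A B E : C) : Arr (A ⊗ₒ B ⊗ₒ E) ((A ⊗ₒ B) ⊗ₒ E) :=
  (assoc (C := C)).inv.app ⟨⟨A, B⟩, E⟩

/-- component of the left unitor at objects -/
def leftArr (A : C) : Arr (one ⊗ₒ A) A := (left (C := C)).hom.app A

/-- component of the inverse left unitor at objects -/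
def leftInvArr (A : C) : Arr A (one ⊗ₒ A) := (left (C := C)).inv.app A

/-- component of the right unitor at objects -/
def rightArr (A : C) : Arr (A ⊗ₒ one) A := (right (C := C)).hom.app A

/-- component of the inverse right unitor at objects -/
def rightInvArr (A : C) : Arr A (A ⊗ₒ one) := (right (C := C)).inv.app A

/-- component of the associator at proarrows -/
def assocSq {A B E A' B' E' : C} (m : A ⟶ A') (n : B ⟶ B') (p : E ⟶ E') :
    Sq ((m ⊗ₚ n) ⊗ₚ p) (m ⊗ₚ n ⊗ₚ p) (assocArr A B E) (assocArr A' B' E') :=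
  (assoc (C := C)).hom.appSq (A := ⟨⟨A, B⟩, E⟩) (B := ⟨⟨A', B'⟩, E'⟩) ((m, n), p)

/-- component of the inverse associator at proarrows -/
def assocInvSq {A B E A' B' E' : C} (m : A ⟶ A') (n : B ⟶ B') (p : E ⟶ E') :
    Sq (m ⊗ₚ n ⊗ₚ p) ((m ⊗ₚ n) ⊗ₚ p) (assocInvArr A B E) (assocInvArr A' B' E') :=
  (assoc (C := C)).inv.appSq (A := ⟨⟨A, B⟩, E⟩) (B := ⟨⟨A', B'⟩, E'⟩) ((m, n), p)

/-- component of the left unitor at proarrows -/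
def leftSq {A B : C} (m : A ⟶ B) : Sq (𝟙 one ⊗ₚ m) m (leftArr A) (leftArr B) :=
  (left (C := C)).hom.appSq m

/-- component of the inverse left unitor at proarrows -/
def leftInvSq {A B : C} (m : A ⟶ B) : Sq m (𝟙 one ⊗ₚ m) (leftInvArr A) (leftInvArr B) :=
  (left (C := C)).inv.appSq m

/-- component of the right unitor at proarrows -/
def rightSq {A B : C} (m : A ⟶ B) : Sq (m ⊗ₚ 𝟙 one) m (rightArr A) (rightArr B) :=
  (right (C := C)).hom.appSq m

/-- component of the inverse right unitor at proarrows -/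
def rightInvSq {A B : C} (m : A ⟶ B) : Sq m (m ⊗ₚ 𝟙 one) (rightInvArr A) (rightInvArr B) :=
  (right (C := C)).inv.appSq m

end MonoidalData

open MonoidalData in
/-- A monoidal double category: the associator and unitors satisfy the pentagon and triangle
equations, on arrows and on squares. -/
class MonoidalDoubleCategory (C : Type u) [DoubleCategory.{u, v, w, x} C] extends
    MonoidalData C where
  tensor_pentagon (A B E F : C) :
    acomp (assocArr A B E ⊗ₐ aid F)
        (acomp (assocArr A (B ⊗ₒ E) F) (aid A ⊗ₐ assocArr B E F)) =
      acomp (assocArr (A ⊗ₒ B) E F) (assocArr A B (E ⊗ₒ F))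
  tensor_pentagon_sq {A B E F A' B' E' F' : C} (m : A ⟶ A') (n : B ⟶ B') (p : E ⟶ E')
      (q : F ⟶ F') :
    scomp (assocSq m n p ⊗ₛ sid q rfl rfl)
        (scomp (assocSq m (n ⊗ₚ p) q) (sid m rfl rfl ⊗ₛ assocSq n p q) rfl rfl)
        (tensor_pentagon A B E F) (tensor_pentagon A' B' E' F') =
      scomp (assocSq (m ⊗ₚ n) p q) (assocSq m n (p ⊗ₚ q)) rfl rfl
  tensor_triangle (A B : C) :
    acomp (assocArr A one B) (aid A ⊗ₐ leftArr B) = rightArr A ⊗ₐ aid B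
  tensor_triangle_sq {A B A' B' : C} (m : A ⟶ A') (n : B ⟶ B') :
    scomp (assocSq m (𝟙 one) n) (sid m rfl rfl ⊗ₛ leftSq n)
        (tensor_triangle A B) (tensor_triangle A' B') =
      rightSq m ⊗ₛ sid n rfl rfl

open MonoidalData

variable (C) in
/-- A choice of companions for the components of the associator, the unitors and their inverses,
i.e. of proarrows which represent the coherence isomorphisms of the tensor product. (If the tensor
product is strictly associative and unital, the unit proarrows are such companions.) -/
structure CoherenceCompanions [MonoidalData C] where
  /-- companion of the associator -/
  assoc (A B E : C) : Companion (assocArr A B E)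
  /-- companion of the inverse associator -/
  assocInv (A B E : C) : Companion (assocInvArr A B E)
  /-- companion of the left unitor -/
  left (A : C) : Companion (leftArr A)
  /-- companion of the inverse left unitor -/
  leftInv (A : C) : Companion (leftInvArr A)
  /-- companion of the right unitor -/
  right (A : C) : Companion (rightArr A)
  /-- companion of the inverse right unitor -/
  rightInv (A : C) : Companion (rightInvArr A)

/-! ### Duals and strips -/

section Strips

variable (S : DFunctor (Co C) C)

/-- the dual of an object -/
abbrev dobj (A : C) : C := S.obj (Co.mk A)

/-- the dual of an arrow -/
abbrev darr {A B : C} (f : Arr A B) : Arr (dobj S A) (dobj S B) :=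
  S.amap (A := Co.mk A) (B := Co.mk B) f

/-- the dual of a proarrow -/
abbrev dpro {A B : C} (m : A ⟶ B) : dobj S B ⟶ dobj S A :=
  S.pmap (A := Co.mk B) (B := Co.mk A) m

variable (C) in
/-- The strip `ι`: the dinatural transformation given by the identity of `(X, Y) ↦ Y`. -/
def strip : Dinat (DFunctor.snd (Co C) C) (DFunctor.snd (Co C) C) :=
  diagonalId (DFunctor.snd (Co C) C)

theorem strip_app (A : C) : (strip C).app A = 𝟙 A := rfl

theorem strip_appSq {A B : C} (f : Arr A B) : (strip C).appSq f = unitSq f := rfl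

/-- The strip `ι*`: the dinatural transformation given by the identity of `(X, Y) ↦ X*`. -/
def dualStrip : Dinat ((DFunctor.fst (Co C) C).comp S) ((DFunctor.fst (Co C) C).comp S) :=
  diagonalId ((DFunctor.fst (Co C) C).comp S)

theorem dualStrip_app (A : C) : (dualStrip S).app A = 𝟙 (dobj S A) := rfl

theorem dualStrip_appSq {A B : C} (f : Arr A B) : (dualStrip S).appSq f = unitSq (darr S f) := rfl

end Strips

/-! ### Folds -/

section Folds

variable [MonoidalData C] (S : DFunctor (Co C) C)

variable (C) in
/-- The difunctor which is constant at the monoidal unit. -/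
def oneDifunctor : DFunctor (Co C ×ᵈ C) C := DFunctor.const (Co C ×ᵈ C) (one : C)

/-- The difunctor `(X, Y) ↦ X* ⊗ Y`. -/
def leftDifunctor : DFunctor (Co C ×ᵈ C) C := (S.prodMap (DFunctor.id C)).comp tensor

/-- The difunctor `(X, Y) ↦ Y ⊗ X*`. -/
def rightDifunctor : DFunctor (Co C ×ᵈ C) C :=
  ((S.prodMap (DFunctor.id C)).comp (DFunctor.swap C C)).comp tensor

/-- A cap. -/
abbrev Cap := Dinat (oneDifunctor C) (leftDifunctor S)

/-- A cup. -/
abbrev Cup := Dinat (rightDifunctor S) (oneDifunctor C)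

variable {S}

namespace Cap

variable (cap : Cap S)

/-- object-component proarrow of a cap -/
def pro (A : C) : (one : C) ⟶ dobj S A ⊗ₒ A := cap.app A

/-- arrow-component square of a cap -/
def sq {A B : C} (f : Arr A B) : Sq (Cap.pro cap A) (Cap.pro cap B) (aid one) (darr S f ⊗ₐ f) :=
  cap.appSq f

/-- proarrow-component disk of a cap -/
def disk {A B : C} (m : A ⟶ B) :
    Cap.pro cap B ≫ (dpro S m ⊗ₚ 𝟙 B) ⟶ Cap.pro cap A ≫ (𝟙 (dobj S A) ⊗ₚ m) :=
  (λ_ (Cap.pro cap B)).inv ▷ (dpro S m ⊗ₚ 𝟙 B) ≫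
    (show (𝟙 (one : C) ≫ Cap.pro cap B) ≫ (dpro S m ⊗ₚ 𝟙 B) ⟶
      (𝟙 (one : C) ≫ Cap.pro cap A) ≫ (S.pmap (𝟙 (Co.mk A)) ⊗ₚ m) from (Dinat.disk cap m).hom) ≫
    (λ_ (Cap.pro cap A)).hom ▷ _ ≫ Cap.pro cap A ◁ MonoidalData.disk (S.mapId (Co.mk A)).hom (𝟙 m)

end Cap

namespace Cup

variable (cup : Cup S)

/-- object-component proarrow of a cup -/
def pro (A : C) : A ⊗ₒ dobj S A ⟶ (one : C) := cup.app A

/-- arrow-component square of a cup -/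
def sq {A B : C} (f : Arr A B) : Sq (Cup.pro cup A) (Cup.pro cup B) (f ⊗ₐ darr S f) (aid one) :=
  cup.appSq f

/-- proarrow-component disk of a cup -/
def disk {A B : C} (m : A ⟶ B) :
    (m ⊗ₚ 𝟙 (dobj S B)) ≫ Cup.pro cup B ⟶ (𝟙 A ⊗ₚ dpro S m) ≫ Cup.pro cup A :=
  MonoidalData.disk (𝟙 m) (S.mapId (Co.mk B)).inv ▷ Cup.pro cup B ≫
    (ρ_ ((m ⊗ₚ S.pmap (𝟙 (Co.mk B))) ≫ Cup.pro cup B)).inv ≫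
    (show ((m ⊗ₚ S.pmap (𝟙 (Co.mk B))) ≫ Cup.pro cup B) ≫ 𝟙 (one : C) ⟶
      ((𝟙 A ⊗ₚ dpro S m) ≫ Cup.pro cup A) ≫ 𝟙 (one : C) from (Dinat.disk cup m).hom) ≫
    (ρ_ ((𝟙 A ⊗ₚ dpro S m) ≫ Cup.pro cup A)).hom

end Cup

end Folds

open MonoidalData

section Zigzag

variable {C : Type u} [DoubleCategory.{u, v, w, x} C] [MonoidalData C]

/-- The interchanger `(m ⊗ 1) ≫ (1 ⊗ n) ≅ (1 ⊗ n) ≫ (m ⊗ 1)`, both being isomorphic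
to `m ⊗ n`. -/
def interchanger {A B A' B' : C} (m : A ⟶ B) (n : A' ⟶ B') :
    (m ⊗ₚ 𝟙 A') ≫ (𝟙 B ⊗ₚ n) ≅ (𝟙 A ⊗ₚ n) ≫ (m ⊗ₚ 𝟙 B') :=
  (compIso m (𝟙 B) (𝟙 A') n).symm ≪≫ iso (ρ_ m) (λ_ n) ≪≫ iso (λ_ m).symm (ρ_ n).symm ≪≫
    compIso (𝟙 A) m n (𝟙 B')

/-- Tensoring a disk between composite proarrows on the right by an object. -/
def tensorObj {A B B' E : C} {m : A ⟶ B} {n : B ⟶ E} {m' : A ⟶ B'} {n' : B' ⟶ E}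
    (d : m ≫ n ⟶ m' ≫ n') (X : C) :
    (m ⊗ₚ 𝟙 X) ≫ (n ⊗ₚ 𝟙 X) ⟶ (m' ⊗ₚ 𝟙 X) ≫ (n' ⊗ₚ 𝟙 X) :=
  (compIso m n (𝟙 X) (𝟙 X)).inv ≫ disk d (𝟙 (𝟙 X ≫ 𝟙 X)) ≫ (compIso m' n' (𝟙 X) (𝟙 X)).hom

/-- Tensoring a disk between composite proarrows on the left by an object. -/
def objTensor (X : C) {A B B' E : C} {m : A ⟶ B} {n : B ⟶ E} {m' : A ⟶ B'} {n' : B' ⟶ E}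
    (d : m ≫ n ⟶ m' ≫ n') :
    (𝟙 X ⊗ₚ m) ≫ (𝟙 X ⊗ₚ n) ⟶ (𝟙 X ⊗ₚ m') ≫ (𝟙 X ⊗ₚ n') :=
  (compIso (𝟙 X) (𝟙 X) m n).inv ≫ disk (𝟙 (𝟙 X ≫ 𝟙 X)) d ≫ (compIso (𝟙 X) (𝟙 X) m' n').hom

variable (K : CoherenceCompanions C) {S : DFunctor (Co C) C} (cap : Cap S) (cup : Cup S)

/-- The object-component proarrow of the first zigzag:
`A ⟶ A ⊗ 1 ⟶ A ⊗ (A* ⊗ A) ⟶ (A ⊗ A*) ⊗ A ⟶ 1 ⊗ A ⟶ A`.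
The object component of the strip `ι` at `A` is `𝟙 A`. -/
def zigzagSPro (A : C) : A ⟶ A :=
  (K.rightInv A).pro ≫ (𝟙 A ⊗ₚ Cap.pro cap A) ≫ (K.assocInv A (dobj S A) A).pro ≫
    (Cup.pro cup A ⊗ₚ 𝟙 A) ≫ (K.left A).pro

/-- The object-component proarrow of the second zigzag:
`A* ⟶ 1 ⊗ A* ⟶ (A* ⊗ A) ⊗ A* ⟶ A* ⊗ (A ⊗ A*) ⟶ A* ⊗ 1 ⟶ A*`.
The object component of the strip `ι*` at `A` is `𝟙 (dobj S A)`. -/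
def zigzagZPro (A : C) : dobj S A ⟶ dobj S A :=
  (K.leftInv (dobj S A)).pro ≫ (Cap.pro cap A ⊗ₚ 𝟙 (dobj S A)) ≫
    (K.assoc (dobj S A) A (dobj S A)).pro ≫ (𝟙 (dobj S A) ⊗ₚ Cup.pro cup A) ≫
    (K.right (dobj S A)).pro

/-- The arrow-component square of the first zigzag. The arrow component of the strip `ι` at `f` is
`unitSq f`, and similarly for `ι*`. -/
def zigzagSSq {A B : C} (f : Arr A B) :
    Sq (zigzagSPro K cap cup A) (zigzagSPro K cap cup B) f f :=
  pcomp (Companion.sq (K.rightInv A) (K.rightInv B) ((right (C := C)).inv.naturality f))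
    (pcomp (unitSq f ⊗ₛ Cap.sq cap f)
      (pcomp (Companion.sq (K.assocInv A (dobj S A) A) (K.assocInv B (dobj S B) B)
          ((assoc (C := C)).inv.naturality (A := ⟨⟨A, dobj S A⟩, A⟩) (B := ⟨⟨B, dobj S B⟩, B⟩)
            ((f, darr S f), f)))
        (pcomp (Cup.sq cup f ⊗ₛ unitSq f)
          (Companion.sq (K.left A) (K.left B) ((left (C := C)).hom.naturality f)))))

/-- The arrow-component square of the second zigzag. -/
def zigzagZSq {A B : C} (f : Arr A B) :
    Sq (zigzagZPro K cap cup A) (zigzagZPro K cap cup B) (darr S f) (darr S f) :=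
  pcomp (Companion.sq (K.leftInv (dobj S A)) (K.leftInv (dobj S B))
      ((left (C := C)).inv.naturality (darr S f)))
    (pcomp (Cap.sq cap f ⊗ₛ unitSq (darr S f))
      (pcomp (Companion.sq (K.assoc (dobj S A) A (dobj S A)) (K.assoc (dobj S B) B (dobj S B))
          ((assoc (C := C)).hom.naturality (A := ⟨⟨dobj S A, A⟩, dobj S A⟩)
            (B := ⟨⟨dobj S B, B⟩, dobj S B⟩) ((darr S f, f), darr S f)))
        (pcomp (unitSq (darr S f) ⊗ₛ Cup.sq cup f)
          (Companion.sq (K.right (dobj S A)) (K.right (dobj S B))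
            ((right (C := C)).hom.naturality (darr S f))))))

/-- The proarrow-component disk of the first zigzag, composed of the interchanger of `m` and the cap
at `B`, the disk of the cup at `m`, the disk of the cap at `m` and the interchanger of the cup at `A`
and `m`, together with the disks which move these past the coherence proarrows. -/
def zigzagSDisk {A B : C} (m : A ⟶ B) :
    m ≫ zigzagSPro K cap cup B ⟶ zigzagSPro K cap cup A ≫ m :=
  𝟙 (m ≫ (K.rightInv B).pro ≫ (𝟙 B ⊗ₚ Cap.pro cap B) ≫ (K.assocInv B (dobj S B) B).pro ≫
    (Cup.pro cup B ⊗ₚ 𝟙 B) ≫ (K.left B).pro) ⊗≫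
  Companion.disk (K.rightInv A) (K.rightInv B) (rightInvSq m) ▷
    ((𝟙 B ⊗ₚ Cap.pro cap B) ≫ (K.assocInv B (dobj S B) B).pro ≫ (Cup.pro cup B ⊗ₚ 𝟙 B) ≫
      (K.left B).pro) ⊗≫
  (K.rightInv A).pro ◁ (interchanger m (Cap.pro cap B)).hom ▷
    ((K.assocInv B (dobj S B) B).pro ≫ (Cup.pro cup B ⊗ₚ 𝟙 B) ≫ (K.left B).pro) ⊗≫
  ((K.rightInv A).pro ≫ (𝟙 A ⊗ₚ Cap.pro cap B)) ◁
    (disk (𝟙 m) (unitIso (dobj S B) B).inv ▷ (K.assocInv B (dobj S B) B).pro ≫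
      Companion.disk (K.assocInv A (dobj S B) B) (K.assocInv B (dobj S B) B)
        (assocInvSq m (𝟙 (dobj S B)) (𝟙 B))) ▷
    ((Cup.pro cup B ⊗ₚ 𝟙 B) ≫ (K.left B).pro) ⊗≫
  ((K.rightInv A).pro ≫ (𝟙 A ⊗ₚ Cap.pro cap B) ≫ (K.assocInv A (dobj S B) B).pro) ◁
    tensorObj (Cup.disk cup m) B ▷ (K.left B).pro ⊗≫
  ((K.rightInv A).pro ≫ (𝟙 A ⊗ₚ Cap.pro cap B)) ◁
    Companion.diskInv (K.assocInv A (dobj S B) B) (K.assocInv A (dobj S A) B)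
      ((assoc (C := C)).inv_hom ⟨⟨A, dobj S B⟩, B⟩) ((assoc (C := C)).hom_inv ⟨⟨A, dobj S A⟩, B⟩)
      (assocSq (𝟙 A) (dpro S m) (𝟙 B)) ▷
    ((Cup.pro cup A ⊗ₚ 𝟙 B) ≫ (K.left B).pro) ⊗≫
  (K.rightInv A).pro ◁ objTensor A (Cap.disk cap m) ▷
    ((K.assocInv A (dobj S A) B).pro ≫ (Cup.pro cup A ⊗ₚ 𝟙 B) ≫ (K.left B).pro) ⊗≫
  ((K.rightInv A).pro ≫ (𝟙 A ⊗ₚ Cap.pro cap A)) ◁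
    (Companion.disk (K.assocInv A (dobj S A) A) (K.assocInv A (dobj S A) B)
        (assocInvSq (𝟙 A) (𝟙 (dobj S A)) m) ≫
      (K.assocInv A (dobj S A) A).pro ◁ disk (unitIso A (dobj S A)).hom (𝟙 m)) ▷
    ((Cup.pro cup A ⊗ₚ 𝟙 B) ≫ (K.left B).pro) ⊗≫
  ((K.rightInv A).pro ≫ (𝟙 A ⊗ₚ Cap.pro cap A) ≫ (K.assocInv A (dobj S A) A).pro) ◁
    (interchanger (Cup.pro cup A) m).inv ▷ (K.left B).pro ⊗≫
  ((K.rightInv A).pro ≫ (𝟙 A ⊗ₚ Cap.pro cap A) ≫ (K.assocInv A (dobj S A) A).pro ≫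
    (Cup.pro cup A ⊗ₚ 𝟙 A)) ◁ Companion.disk (K.left A) (K.left B) (leftSq m) ⊗≫
  𝟙 (((K.rightInv A).pro ≫ (𝟙 A ⊗ₚ Cap.pro cap A) ≫ (K.assocInv A (dobj S A) A).pro ≫
    (Cup.pro cup A ⊗ₚ 𝟙 A) ≫ (K.left A).pro) ≫ m)

/-- The proarrow-component disk of the second zigzag, composed of the interchanger of `m*` and the
cup at `B`, the disk of the cap at `m`, the disk of the cup at `m` and the interchanger of the cap
at `A` and `m*`, together with the disks which move these past the coherence proarrows. -/
def zigzagZDisk {A B : C} (m : A ⟶ B) :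
    zigzagZPro K cap cup B ≫ dpro S m ⟶ dpro S m ≫ zigzagZPro K cap cup A :=
  𝟙 (((K.leftInv (dobj S B)).pro ≫ (Cap.pro cap B ⊗ₚ 𝟙 (dobj S B)) ≫
    (K.assoc (dobj S B) B (dobj S B)).pro ≫ (𝟙 (dobj S B) ⊗ₚ Cup.pro cup B) ≫
    (K.right (dobj S B)).pro) ≫ dpro S m) ⊗≫
  ((K.leftInv (dobj S B)).pro ≫ (Cap.pro cap B ⊗ₚ 𝟙 (dobj S B)) ≫
      (K.assoc (dobj S B) B (dobj S B)).pro ≫ (𝟙 (dobj S B) ⊗ₚ Cup.pro cup B)) ◁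
    Companion.diskInv (K.right (dobj S B)) (K.right (dobj S A))
      ((right (C := C)).hom_inv (dobj S B)) ((right (C := C)).inv_hom (dobj S A))
      (rightInvSq (dpro S m)) ⊗≫
  ((K.leftInv (dobj S B)).pro ≫ (Cap.pro cap B ⊗ₚ 𝟙 (dobj S B)) ≫
      (K.assoc (dobj S B) B (dobj S B)).pro) ◁
    (interchanger (dpro S m) (Cup.pro cup B)).inv ▷ (K.right (dobj S A)).pro ⊗≫
  ((K.leftInv (dobj S B)).pro ≫ (Cap.pro cap B ⊗ₚ 𝟙 (dobj S B))) ◁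
    ((K.assoc (dobj S B) B (dobj S B)).pro ◁ disk (𝟙 (dpro S m)) (unitIso B (dobj S B)).inv ≫
      Companion.diskInv (K.assoc (dobj S B) B (dobj S B)) (K.assoc (dobj S A) B (dobj S B))
        ((assoc (C := C)).hom_inv ⟨⟨dobj S B, B⟩, dobj S B⟩)
        ((assoc (C := C)).inv_hom ⟨⟨dobj S A, B⟩, dobj S B⟩)
        (assocInvSq (dpro S m) (𝟙 B) (𝟙 (dobj S B)))) ▷
    ((𝟙 (dobj S A) ⊗ₚ Cup.pro cup B) ≫ (K.right (dobj S A)).pro) ⊗≫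
  (K.leftInv (dobj S B)).pro ◁ tensorObj (Cap.disk cap m) (dobj S B) ▷
    ((K.assoc (dobj S A) B (dobj S B)).pro ≫ (𝟙 (dobj S A) ⊗ₚ Cup.pro cup B) ≫
      (K.right (dobj S A)).pro) ⊗≫
  ((K.leftInv (dobj S B)).pro ≫ (Cap.pro cap A ⊗ₚ 𝟙 (dobj S B))) ◁
    Companion.disk (K.assoc (dobj S A) A (dobj S B)) (K.assoc (dobj S A) B (dobj S B))
      (assocSq (𝟙 (dobj S A)) m (𝟙 (dobj S B))) ▷
    ((𝟙 (dobj S A) ⊗ₚ Cup.pro cup B) ≫ (K.right (dobj S A)).pro) ⊗≫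
  ((K.leftInv (dobj S B)).pro ≫ (Cap.pro cap A ⊗ₚ 𝟙 (dobj S B)) ≫
      (K.assoc (dobj S A) A (dobj S B)).pro) ◁
    objTensor (dobj S A) (Cup.disk cup m) ▷ (K.right (dobj S A)).pro ⊗≫
  ((K.leftInv (dobj S B)).pro ≫ (Cap.pro cap A ⊗ₚ 𝟙 (dobj S B))) ◁
    (Companion.diskInv (K.assoc (dobj S A) A (dobj S B)) (K.assoc (dobj S A) A (dobj S A))
        ((assoc (C := C)).hom_inv ⟨⟨dobj S A, A⟩, dobj S B⟩)
        ((assoc (C := C)).inv_hom ⟨⟨dobj S A, A⟩, dobj S A⟩)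
        (assocInvSq (𝟙 (dobj S A)) (𝟙 A) (dpro S m)) ≫
      disk (unitIso (dobj S A) A).hom (𝟙 (dpro S m)) ▷ (K.assoc (dobj S A) A (dobj S A)).pro) ▷
    ((𝟙 (dobj S A) ⊗ₚ Cup.pro cup A) ≫ (K.right (dobj S A)).pro) ⊗≫
  (K.leftInv (dobj S B)).pro ◁ (interchanger (Cap.pro cap A) (dpro S m)).hom ▷
    ((K.assoc (dobj S A) A (dobj S A)).pro ≫ (𝟙 (dobj S A) ⊗ₚ Cup.pro cup A) ≫
      (K.right (dobj S A)).pro) ⊗≫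
  Companion.diskInv (K.leftInv (dobj S B)) (K.leftInv (dobj S A))
      ((left (C := C)).inv_hom (dobj S B)) ((left (C := C)).hom_inv (dobj S A))
      (leftSq (dpro S m)) ▷
    ((Cap.pro cap A ⊗ₚ 𝟙 (dobj S A)) ≫ (K.assoc (dobj S A) A (dobj S A)).pro ≫
      (𝟙 (dobj S A) ⊗ₚ Cup.pro cup A) ≫ (K.right (dobj S A)).pro) ⊗≫
  𝟙 (dpro S m ≫ (K.leftInv (dobj S A)).pro ≫ (Cap.pro cap A ⊗ₚ 𝟙 (dobj S A)) ≫
    (K.assoc (dobj S A) A (dobj S A)).pro ≫ (𝟙 (dobj S A) ⊗ₚ Cup.pro cup A) ≫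
    (K.right (dobj S A)).pro)

/-- The components of the first zigzag. -/
def zigzagS : ProComponents (DFunctor.id C) (DFunctor.id C) where
  app A := zigzagSPro K cap cup A
  appSq f := zigzagSSq K cap cup f

/-- The components of the second zigzag. -/
def zigzagZ : ProComponents S S where
  app A := zigzagZPro K cap cup A.un
  appSq {A B} f := zigzagZSq K cap cup (A := A.un) (B := B.un) f

end Zigzag

end DoubleCategory

open DoubleCategory

/-! Disks make the proarrows of a double category into a bicategory, and the disks of a
proarrow-dimension transformation are sliding cells `p ≫ t' ⟶ t ≫ q`: the strand `p` passes `t` and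
comes out as `q`. A zigzag is a bent strand that a proarrow `m` has to pass, and `m` does so in four
moves. It slides past the cap (`capSlide`) onto the first leg, as `(m ⊗ 1) ⊗ 1`. It turns around the
cup (`cupTurn`) onto the middle leg, as `(1 ⊗ m*) ⊗ 1`. It turns around the cap (`capTurn`) onto the
last leg, as `1 ⊗ m`. Finally it slides past the cup (`cupSlide`) and leaves. `foldIso` pastes the
four moves.

Naturality of the disk for squares is inherited from the pieces: interchanger, unitors, associator,
cap and cup are natural, and `DiskNat` is closed under pasting. Companions transport the
arrow-dimension coherence to proarrows: a square between companions is determined by its composite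
with the unit (`Companion.unit_ext`), and companion disks respect composition
(`Companion.disk_pcomp`).

The substance is compatibility with a composite `m ≫ n`. Sliding splits without trouble, but turning
does not: the composition law of a dinatural transformation interposes an exchange between a strand
that has already turned and one that has not (`cupPaste`, `capPaste`). Splitting the four moves
therefore makes `m` and `n` travel together, whereas a pseudo natural transformation requires `n` to
pass the whole zigzag before `m` starts. By `foldIso_exchange` the two journeys agree as soon as
sliding `m` past the cap commutes with turning `n` around it (`slideNatT_capTurn`) and turning `m`
around the cup commutes with sliding `n` past it (`slideNatT_cupTurn`). Both follow from naturality
of the interchanger and of the associator. `slideNat_zigzagFold` assembles the result. The unit law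
then comes for free, because the disks are invertible (`slide_unit_of_comp`).

The second zigzag is the first one in a reversed setting. The construction is carried out for
functors `U` on `J` and `V` on `Co J` with caps `1 ⟶ V A ⊗ U A` and cups `U A ⊗ V A ⟶ 1` (`CapData`,
`CupData`). The first zigzag has `J = C`, `U` the identity and `V` the dual. For the second, the
tensor product is reversed (`revMonoidalData`), `J = Co C`, `U` is the dual, `V` is `DFunctor.coCo
C`, and the turning disks are inverted. `Cap.disk_comp` and `Cup.disk_comp` extract the turning laws
from dinaturality, and `zigzagCell_hom` and `zigzagCell_inv` identify the resulting disks with the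
prescribed composites. -/

namespace DoubleCategory

/-! ### Sliding cells in a bicategory -/

section Slide

universe u₁ v₁ w₁

variable {B : Type u₁} [Bicategory.{w₁, v₁} B]

/-- Pasting of two sliding cells along the common `1`-cell `t'` which is being slid past. -/
def slideP {a b c a' b' c' : B} {p : a ⟶ b} {p' : b ⟶ c} {t : a ⟶ a'} {t' : b ⟶ b'} {t'' : c ⟶ c'}
    {q : a' ⟶ b'} {q' : b' ⟶ c'} (θ : p ≫ t' ⟶ t ≫ q) (θ' : p' ≫ t'' ⟶ t' ≫ q') :
    (p ≫ p') ≫ t'' ⟶ t ≫ q ≫ q' :=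
  (α_ p p' t'').hom ≫ p ◁ θ' ≫ (α_ p t' q').inv ≫ θ ▷ q' ≫ (α_ t q q').hom

/-- Pasting of two sliding cells along the sliding `1`-cell `q`. -/
def slideT {a b a' b' a'' b'' : B} {p : a ⟶ b} {q : a' ⟶ b'} {r : a'' ⟶ b''} {t : a ⟶ a'}
    {t' : b ⟶ b'} {s : a' ⟶ a''} {s' : b' ⟶ b''} (θ : p ≫ t' ⟶ t ≫ q) (κ : q ≫ s' ⟶ s ≫ r) :
    p ≫ t' ≫ s' ⟶ (t ≫ s) ≫ r :=
  (α_ p t' s').inv ≫ θ ▷ s' ≫ (α_ t q s').hom ≫ t ◁ κ ≫ (α_ t s r).inv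

/-- Pasting of two invertible sliding cells along the sliding `1`-cell `q`. -/
@[simps]
def slideTIso {a b a' b' a'' b'' : B} {p : a ⟶ b} {q : a' ⟶ b'} {r : a'' ⟶ b''} {t : a ⟶ a'}
    {t' : b ⟶ b'} {s : a' ⟶ a''} {s' : b' ⟶ b''} (θ : p ≫ t' ≅ t ≫ q) (κ : q ≫ s' ≅ s ≫ r) :
    p ≫ t' ≫ s' ≅ (t ≫ s) ≫ r where
  hom := slideT θ.hom κ.hom
  inv := (α_ t s r).hom ≫ t ◁ κ.inv ≫ (α_ t q s').inv ≫ θ.inv ▷ s' ≫ (α_ p t' s').hom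
  hom_inv_id := by simp [slideT]
  inv_hom_id := by simp [slideT]

/-- Compatibility of sliding cells with `2`-cells between the sliding `1`-cells. -/
def SlideNat {a b a' b' : B} {p p₂ : a ⟶ b} {q q₂ : a' ⟶ b'} {t : a ⟶ a'} {t' : b ⟶ b'}
    (θ : p ≫ t' ⟶ t ≫ q) (θ₂ : p₂ ≫ t' ⟶ t ≫ q₂) (x : p ⟶ p₂) (y : q ⟶ q₂) : Prop :=
  θ ≫ t ◁ y = x ▷ t' ≫ θ₂

/-- Compatibility of sliding cells with `2`-cells between the `1`-cells which are slid past. -/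
def SlideNatT {a b a' b' : B} {p : a ⟶ b} {q : a' ⟶ b'} {t t₂ : a ⟶ a'} {t' t₂' : b ⟶ b'}
    (θ : p ≫ t' ⟶ t ≫ q) (θ₂ : p ≫ t₂' ⟶ t₂ ≫ q) (x : t ⟶ t₂) (y : t' ⟶ t₂') : Prop :=
  θ ≫ x ▷ q = p ◁ y ≫ θ₂

theorem SlideNat.trans {a b a' b' : B} {p p₂ p₃ : a ⟶ b} {q q₂ q₃ : a' ⟶ b'} {t : a ⟶ a'}
    {t' : b ⟶ b'} {θ : p ≫ t' ⟶ t ≫ q} {θ₂ : p₂ ≫ t' ⟶ t ≫ q₂} {θ₃ : p₃ ≫ t' ⟶ t ≫ q₃}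
    {x : p ⟶ p₂} {y : q ⟶ q₂} {x' : p₂ ⟶ p₃} {y' : q₂ ⟶ q₃} (h : SlideNat θ θ₂ x y)
    (h' : SlideNat θ₂ θ₃ x' y') : SlideNat θ θ₃ (x ≫ x') (y ≫ y') := by
  unfold SlideNat at *
  rw [Bicategory.whiskerLeft_comp, reassoc_of% h, h', comp_whiskerRight, Category.assoc]

theorem SlideNatT.trans {a b a' b' : B} {p : a ⟶ b} {q : a' ⟶ b'} {t t₂ t₃ : a ⟶ a'}
    {t' t₂' t₃' : b ⟶ b'} {θ : p ≫ t' ⟶ t ≫ q} {θ₂ : p ≫ t₂' ⟶ t₂ ≫ q} {θ₃ : p ≫ t₃' ⟶ t₃ ≫ q}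
    {x : t ⟶ t₂} {y : t' ⟶ t₂'} {x' : t₂ ⟶ t₃} {y' : t₂' ⟶ t₃'} (h : SlideNatT θ θ₂ x y)
    (h' : SlideNatT θ₂ θ₃ x' y') : SlideNatT θ θ₃ (x ≫ x') (y ≫ y') := by
  unfold SlideNatT at *
  rw [Bicategory.whiskerLeft_comp, comp_whiskerRight, reassoc_of% h, h', Category.assoc]

/-- Sliding past a composite is assembled in layers: the 2-cell `y` on the intermediate strand
leaves the first cell and enters the second. For a cap the layers are the inverse unitor, the
interchanger and the inverse associator. -/
theorem SlideNat.slideT {a b a' b' a'' b'' : B} {p p₂ : a ⟶ b} {q q₂ : a' ⟶ b'} {r r₂ : a'' ⟶ b''}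
    {t : a ⟶ a'} {t' : b ⟶ b'} {s : a' ⟶ a''} {s' : b' ⟶ b''} {θ : p ≫ t' ⟶ t ≫ q}
    {κ : q ≫ s' ⟶ s ≫ r} {θ₂ : p₂ ≫ t' ⟶ t ≫ q₂} {κ₂ : q₂ ≫ s' ⟶ s ≫ r₂} {x : p ⟶ p₂} {y : q ⟶ q₂}
    {z : r ⟶ r₂} (h : SlideNat θ θ₂ x y) (h' : SlideNat κ κ₂ y z) :
    SlideNat (slideT θ κ) (slideT θ₂ κ₂) x z := by
  unfold SlideNat DoubleCategory.slideT at *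
  have e : t ◁ κ ≫ (α_ t s r).inv ≫ (t ≫ s) ◁ z = t ◁ (κ ≫ s ◁ z) ≫ (α_ t s r₂).inv := by simp
  have e' : x ▷ (t' ≫ s') ≫ (α_ p₂ t' s').inv ≫ θ₂ ▷ s' =
    (α_ p t' s').inv ≫ (x ▷ t' ≫ θ₂) ▷ s' := by simp
  simp only [Category.assoc]
  rw [e, h', reassoc_of% e', ← h]
  simp

/-- A two-by-two grid of sliding cells has only one composite, since only `θ` and `κ'`, which act on
disjoint strands, change order. This turns composition laws for single layers into one for the whole
stack. -/
theorem slideT_slideP {a b c a' b' c' a'' b'' c'' : B} {p : a ⟶ b} {p' : b ⟶ c} {t : a ⟶ a'}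
    {t' : b ⟶ b'} {t'' : c ⟶ c'} {q : a' ⟶ b'} {q' : b' ⟶ c'} {s : a' ⟶ a''} {s' : b' ⟶ b''}
    {s'' : c' ⟶ c''} {r : a'' ⟶ b''} {r' : b'' ⟶ c''} (θ : p ≫ t' ⟶ t ≫ q)
    (θ' : p' ≫ t'' ⟶ t' ≫ q') (κ : q ≫ s' ⟶ s ≫ r) (κ' : q' ≫ s'' ⟶ s' ≫ r') :
    slideT (slideP θ θ') (slideP κ κ') = slideP (slideT θ κ) (slideT θ' κ') := by
  unfold slideT slideP
  calc _ = 𝟙 _ ⊗≫ p ◁ θ' ▷ s'' ⊗≫ (θ ▷ (q' ≫ s'') ≫ (t ≫ q) ◁ κ') ⊗≫ t ◁ κ ▷ r' ⊗≫ 𝟙 _ := by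
        bicategory
    _ = 𝟙 _ ⊗≫ p ◁ θ' ▷ s'' ⊗≫ ((p ≫ t') ◁ κ' ≫ θ ▷ (s' ≫ r')) ⊗≫ t ◁ κ ▷ r' ⊗≫ 𝟙 _ := by
        rw [whisker_exchange]
    _ = _ := by bicategory

/-- The 2-cell `x` and the cell `κ` act on disjoint strands, so the exchange law moves `x` back next
to `θ`. -/
theorem SlideNatT.slideT_left {a b a' b' a'' b'' : B} {p : a ⟶ b} {q : a' ⟶ b'} {r : a'' ⟶ b''}
    {t t₂ : a ⟶ a'} {t' t₂' : b ⟶ b'} {s : a' ⟶ a''} {s' : b' ⟶ b''} {θ : p ≫ t' ⟶ t ≫ q}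
    {θ₂ : p ≫ t₂' ⟶ t₂ ≫ q} {x : t ⟶ t₂} {y : t' ⟶ t₂'} (h : SlideNatT θ θ₂ x y)
    (κ : q ≫ s' ⟶ s ≫ r) : SlideNatT (slideT θ κ) (slideT θ₂ κ) (x ▷ s) (y ▷ s') := by
  unfold SlideNatT slideT at *
  calc _ = 𝟙 _ ⊗≫ θ ▷ s' ⊗≫ (t ◁ κ ≫ x ▷ (s ≫ r)) ⊗≫ 𝟙 _ := by bicategory
    _ = 𝟙 _ ⊗≫ (θ ≫ x ▷ q) ▷ s' ⊗≫ t₂ ◁ κ ⊗≫ 𝟙 _ := by rw [whisker_exchange]; bicategory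
    _ = _ := by rw [h]; bicategory

theorem SlideNatT.slideT_right {a b a' b' a'' b'' : B} {p : a ⟶ b} {q : a' ⟶ b'} {r : a'' ⟶ b''}
    {t : a ⟶ a'} {t' : b ⟶ b'} {s s₂ : a' ⟶ a''} {s' s₂' : b' ⟶ b''} {κ : q ≫ s' ⟶ s ≫ r}
    {κ₂ : q ≫ s₂' ⟶ s₂ ≫ r} {x : s ⟶ s₂} {y : s' ⟶ s₂'} (θ : p ≫ t' ⟶ t ≫ q)
    (h : SlideNatT κ κ₂ x y) : SlideNatT (slideT θ κ) (slideT θ κ₂) (t ◁ x) (t' ◁ y) := by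
  unfold SlideNatT slideT at *
  calc _ = 𝟙 _ ⊗≫ θ ▷ s' ⊗≫ t ◁ (κ ≫ x ▷ r) ⊗≫ 𝟙 _ := by bicategory
    _ = 𝟙 _ ⊗≫ (θ ▷ s' ≫ (t ≫ q) ◁ y) ⊗≫ t ◁ κ₂ ⊗≫ 𝟙 _ := by rw [h]; bicategory
    _ = _ := by rw [← whisker_exchange]; bicategory

theorem SlideNatT.assoc {a b a' b' a'' b'' a₃ b₃ : B} {p : a ⟶ b} {q : a' ⟶ b'} {r : a'' ⟶ b''}
    {o : a₃ ⟶ b₃} {t : a ⟶ a'} {t' : b ⟶ b'} {s : a' ⟶ a''} {s' : b' ⟶ b''} {k : a'' ⟶ a₃}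
    {k' : b'' ⟶ b₃} (θ : p ≫ t' ⟶ t ≫ q) (κ : q ≫ s' ⟶ s ≫ r) (ν : r ≫ k' ⟶ k ≫ o) :
    SlideNatT (slideT (slideT θ κ) ν) (slideT θ (slideT κ ν)) (α_ t s k).hom (α_ t' s' k').hom := by
  unfold SlideNatT slideT
  bicategory

theorem SlideNatT.symm {a b a' b' : B} {p : a ⟶ b} {q : a' ⟶ b'} {t t₂ : a ⟶ a'}
    {t' t₂' : b ⟶ b'} {θ : p ≫ t' ⟶ t ≫ q} {θ₂ : p ≫ t₂' ⟶ t₂ ≫ q}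
    {x : t ≅ t₂} {y : t' ≅ t₂'} (h : SlideNatT θ θ₂ x.hom y.hom) :
    SlideNatT θ₂ θ x.inv y.inv := by
  unfold SlideNatT at *
  rw [← cancel_epi (p ◁ y.hom), ← reassoc_of% h]
  simp

/-- A sliding cell for a composite past which two composites are slid commutes with the exchange of
the two sliding `1`-cells. -/
theorem SlideNatT.of_slideP {a b b₂ c a' b' b₂' c' : B} {p : a ⟶ b} {w : b ⟶ c} {w' : a ⟶ b₂}
    {p' : b₂ ⟶ c} {q : a' ⟶ b'} {y : b' ⟶ c'} {y' : a' ⟶ b₂'} {q' : b₂' ⟶ c'} {t : a ⟶ a'}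
    {t₁ : b ⟶ b'} {t₂ : b₂ ⟶ b₂'} {t₃ : c ⟶ c'} {θ : p ≫ t₁ ⟶ t ≫ q} {ω : w ≫ t₃ ⟶ t₁ ≫ y}
    {ω' : w' ≫ t₂ ⟶ t ≫ y'} {θ' : p' ≫ t₃ ⟶ t₂ ≫ q'} {σ : p ≫ w ⟶ w' ≫ p'}
    {τ : q ≫ y ⟶ y' ≫ q'} (h : SlideNat (slideP θ ω) (slideP ω' θ') σ τ) :
    SlideNatT (slideT σ θ') (slideT θ τ) ω' ω := by
  unfold SlideNatT SlideNat slideT slideP at *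
  -- Hypothesis and goal are the same equation of pastings, read once along the sliding strands and
  -- once along the strands slid past; only associators differ.
  calc _ = 𝟙 _ ⊗≫ (σ ▷ t₃ ≫ (α_ w' p' t₃).hom ≫ w' ◁ θ' ≫ (α_ w' t₂ q').inv ≫ ω' ▷ q' ≫
        (α_ t y' q').hom) ⊗≫ 𝟙 _ := by bicategory
    _ = _ := by rw [← h]; bicategory

end Slide

end DoubleCategory

namespace DoubleCategory

/-! ### Composition of turning cells -/

section Turn

universe u₁ v₁ w₁

variable {B : Type u₁} [Bicategory.{w₁, v₁} B]

/-- Pasting of two cells which turn a `1`-cell around a cup, along an exchange `σ`. -/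
def cupPaste {a b c d f k g : B} {mX : a ⟶ b} {nX : b ⟶ c} {nY : b ⟶ d} {nY' : a ⟶ f} {mX' : f ⟶ d}
    {mY : f ⟶ k} {e'' : c ⟶ g} {e' : d ⟶ g} {e : k ⟶ g} (κm : mX' ≫ e' ⟶ mY ≫ e)
    (κn : nX ≫ e'' ⟶ nY ≫ e') (σ : mX ≫ nY ⟶ nY' ≫ mX') :
    (mX ≫ nX) ≫ e'' ⟶ (nY' ≫ mY) ≫ e :=
  (α_ mX nX e'').hom ≫ mX ◁ κn ≫ (α_ mX nY e').inv ≫ σ ▷ e' ≫ (α_ nY' mX' e').hom ≫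
    nY' ◁ κm ≫ (α_ nY' mY e).inv

/-- Pasting of two cells which turn a `1`-cell around a cap, along an exchange `τ`. -/
def capPaste {a b c d k l o : B} {nY : a ⟶ b} {mY : b ⟶ c} {nZ : d ⟶ b} {mY' : d ⟶ k} {nZ' : k ⟶ c}
    {mZ : l ⟶ k} {h'' : o ⟶ a} {h' : o ⟶ d} {h : o ⟶ l} (κm : h' ≫ mY' ⟶ h ≫ mZ)
    (κn : h'' ≫ nY ⟶ h' ≫ nZ) (τ : nZ ≫ mY ⟶ mY' ≫ nZ') :
    h'' ≫ nY ≫ mY ⟶ h ≫ mZ ≫ nZ' :=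
  (α_ h'' nY mY).inv ≫ κn ▷ mY ≫ (α_ h' nZ mY).hom ≫ h' ◁ τ ≫ (α_ h' mY' nZ').inv ≫ κm ▷ nZ' ≫
    (α_ h mZ nZ').hom

/-- The pasting of the cells which move a `1`-cell through a cap followed by a cup. -/
@[simps]
def foldIso {fA fB gA gB tA tAB tA' tB : B} {F : fA ⟶ fB} {G : gA ⟶ gB} {hB : fB ⟶ tB}
    {hAB : fA ⟶ tAB} {hA : fA ⟶ tA} {mX : tAB ⟶ tB} {mY : tAB ⟶ tA'} {mZ : tA ⟶ tA'}
    {eB : tB ⟶ gB} {eAB : tA' ⟶ gB} {eA : tA ⟶ gA} (hX : F ≫ hB ≅ hAB ≫ mX)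
    (eX : mX ≫ eB ≅ mY ≫ eAB) (hY : hAB ≫ mY ≅ hA ≫ mZ) (eZ : mZ ≫ eAB ≅ eA ≫ G) :
    F ≫ hB ≫ eB ≅ (hA ≫ eA) ≫ G where
  hom := (α_ F hB eB).inv ≫ hX.hom ▷ eB ≫ (α_ hAB mX eB).hom ≫ hAB ◁ eX.hom ≫
    (α_ hAB mY eAB).inv ≫ hY.hom ▷ eAB ≫ (α_ hA mZ eAB).hom ≫ hA ◁ eZ.hom ≫ (α_ hA eA G).inv
  inv := (α_ hA eA G).hom ≫ hA ◁ eZ.inv ≫ (α_ hA mZ eAB).inv ≫ hY.inv ▷ eAB ≫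
    (α_ hAB mY eAB).hom ≫ hAB ◁ eX.inv ≫ (α_ hAB mX eB).inv ≫ hX.inv ▷ eB ≫ (α_ F hB eB).hom
  hom_inv_id := by simp
  inv_hom_id := by simp

/-- The heart of the composition law. On the left both strands travel together: `n` and then `m`
slide in, `n` turns at the cup, `σ` exchanges it with `m`, and `m` turns; at the cap the same
happens with `ν`; then both leave. On the right `n` completes all four moves before `m` begins. `hh`
lets the turn of `n` at the cap overtake the entry of `m`, and `he` lets the exit of `n` overtake
the turn of `m` at the cup. -/
theorem foldIso_exchange {fA fB fE gA gB gE tAA tAB tAE tBB tBE tEE tAB' tAE' tBE' tABE : B}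
    {Fm : fA ⟶ fB} {Fn : fB ⟶ fE} {Gm : gA ⟶ gB} {Gn : gB ⟶ gE}
    {hEE : fE ⟶ tEE} {hBE : fB ⟶ tBE} {hAE : fA ⟶ tAE} {hBB : fB ⟶ tBB} {hAB : fA ⟶ tAB}
    {hAA : fA ⟶ tAA} {eEE : tEE ⟶ gE} {eBE : tBE' ⟶ gE} {eAE : tAE' ⟶ gE} {eBB : tBB ⟶ gB}
    {eAB : tAB' ⟶ gB} {eAA : tAA ⟶ gA}
    {mXE : tAE ⟶ tBE} {nX : tBE ⟶ tEE} {nYB : tBE ⟶ tBE'} {nYA : tAE ⟶ tABE} {mX' : tABE ⟶ tBE'}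
    {mYE : tABE ⟶ tAE'} {nZA : tAB ⟶ tABE} {nZB : tBB ⟶ tBE'} {mXB : tAB ⟶ tBB}
    {mYB : tAB ⟶ tAB'} {nZ : tAB' ⟶ tAE'} {mZ : tAA ⟶ tAB'}
    {hXmE : Fm ≫ hBE ⟶ hAE ≫ mXE} {hXn : Fn ≫ hEE ≅ hBE ≫ nX} {eXn : nX ≫ eEE ≅ nYB ≫ eBE}
    {hYnB : hBE ≫ nYB ≅ hBB ≫ nZB} {eZn : nZB ≫ eBE ≅ eBB ≫ Gn}
    {hXmB : Fm ≫ hBB ≅ hAB ≫ mXB} {eXm : mXB ≫ eBB ≅ mYB ≫ eAB} {hYm : hAB ≫ mYB ≅ hAA ≫ mZ}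
    {eZm : mZ ≫ eAB ≅ eAA ≫ Gm} {σ : mXE ≫ nYB ⟶ nYA ≫ mX'} {hYnA : hAE ≫ nYA ⟶ hAB ≫ nZA}
    {τ : mXB ≫ nZB ≅ nZA ≫ mX'} {eXmE : mX' ≫ eBE ⟶ mYE ≫ eAE} {eZnA : nZ ≫ eAE ⟶ eAB ≫ Gn}
    {ν : nZA ≫ mYE ⟶ mYB ≫ nZ}
    (hh : SlideNatT (slideT hXmE σ) (slideT hXmB.hom τ.hom) hYnA hYnB.hom)
    (he : SlideNatT (slideT τ.inv eZn.hom) (slideT ν eZnA) eXm.hom eXmE) :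
    (α_ _ _ _).inv ≫ slideP hXmE hXn.hom ▷ eEE ≫ (α_ _ _ _).hom ≫
      hAE ◁ cupPaste eXmE eXn.hom σ ≫ (α_ _ _ _).inv ≫ capPaste hYm.hom hYnA ν ▷ eAE ≫
      (α_ _ _ _).hom ≫ hAA ◁ slideP eZm.hom eZnA ≫ (α_ _ _ _).inv =
    slideP (foldIso hXmB eXm hYm eZm).hom (foldIso hXn eXn hYnB eZn).hom := by
  unfold slideP cupPaste capPaste foldIso SlideNatT slideT at *
  calc _ = 𝟙 _ ⊗≫ Fm ◁ hXn.hom ▷ eEE ⊗≫ (hXmE ▷ (nX ≫ eEE) ≫ (hAE ≫ mXE) ◁ eXn.hom) ⊗≫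
        hAE ◁ σ ▷ eBE ⊗≫ ((hAE ≫ nYA) ◁ eXmE ≫ hYnA ▷ (mYE ≫ eAE)) ⊗≫ hAB ◁ ν ▷ eAE ⊗≫
        (hYm.hom ▷ (nZ ≫ eAE) ≫ (hAA ≫ mZ) ◁ eZnA) ⊗≫ hAA ◁ eZm.hom ▷ Gn ⊗≫ 𝟙 _ := by
        bicategory
    -- Three pairs of moves on disjoint strands trade places, so that in each pair the move of `n`
    -- now precedes the move of `m`.
    _ = 𝟙 _ ⊗≫ Fm ◁ hXn.hom ▷ eEE ⊗≫ ((Fm ≫ hBE) ◁ eXn.hom ≫ hXmE ▷ (nYB ≫ eBE)) ⊗≫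
        hAE ◁ σ ▷ eBE ⊗≫ (hYnA ▷ (mX' ≫ eBE) ≫ (hAB ≫ nZA) ◁ eXmE) ⊗≫ hAB ◁ ν ▷ eAE ⊗≫
        ((hAB ≫ mYB) ◁ eZnA ≫ hYm.hom ▷ (eAB ≫ Gn)) ⊗≫ hAA ◁ eZm.hom ▷ Gn ⊗≫ 𝟙 _ := by
        simp only [whisker_exchange]
    _ = 𝟙 _ ⊗≫ Fm ◁ hXn.hom ▷ eEE ⊗≫ (Fm ≫ hBE) ◁ eXn.hom ⊗≫
        (((α_ _ _ _).inv ≫ hXmE ▷ nYB ≫ (α_ _ _ _).hom ≫ hAE ◁ σ ≫ (α_ _ _ _).inv) ≫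
          hYnA ▷ mX') ▷ eBE ⊗≫
        hAB ◁ (nZA ◁ eXmE ≫ (α_ _ _ _).inv ≫ ν ▷ eAE ≫ (α_ _ _ _).hom ≫ mYB ◁ eZnA ≫
          (α_ _ _ _).inv) ⊗≫ hYm.hom ▷ (eAB ≫ Gn) ⊗≫ hAA ◁ eZm.hom ▷ Gn ⊗≫ 𝟙 _ := by
        bicategory
    -- `hh` and the reverse of `he` leave `τ` followed by its inverse: `m` on its first leg is
    -- exchanged with `n` on its last leg, and exchanged back.
    _ = 𝟙 _ ⊗≫ Fm ◁ hXn.hom ▷ eEE ⊗≫ (Fm ≫ hBE) ◁ eXn.hom ⊗≫ Fm ◁ hYnB.hom ▷ eBE ⊗≫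
        hXmB.hom ▷ nZB ▷ eBE ⊗≫ hAB ◁ ((τ.hom ≫ τ.inv) ▷ eBE) ⊗≫ hAB ◁ mXB ◁ eZn.hom ⊗≫
        hAB ◁ eXm.hom ▷ Gn ⊗≫ hYm.hom ▷ (eAB ≫ Gn) ⊗≫ hAA ◁ eZm.hom ▷ Gn ⊗≫ 𝟙 _ := by
        rw [hh, ← he]; bicategory
    _ = 𝟙 _ ⊗≫ Fm ◁ hXn.hom ▷ eEE ⊗≫ (Fm ≫ hBE) ◁ eXn.hom ⊗≫ Fm ◁ hYnB.hom ▷ eBE ⊗≫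
        (hXmB.hom ▷ (nZB ≫ eBE) ≫ (hAB ≫ mXB) ◁ eZn.hom) ⊗≫
        hAB ◁ eXm.hom ▷ Gn ⊗≫ hYm.hom ▷ (eAB ≫ Gn) ⊗≫ hAA ◁ eZm.hom ▷ Gn ⊗≫ 𝟙 _ := by
        rw [τ.hom_inv_id]; bicategory
    _ = _ := by rw [← whisker_exchange]; bicategory

/-- Each of `chX` (entry), `ceX` and `chY` (the two turns) and `ceZ` (exit) splits one stage.
Pushing the splitting 2-cell backwards from `g` to `f` through the four stages reaches the left side
of `foldIso_exchange`. -/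
theorem slideNat_foldIso {fA fB fE gA gB gE tAA tAB tAE tBB tBE tEE tAB' tAE' tBE' tABE : B}
    {F : fA ⟶ fE} {G : gA ⟶ gE} {mnX : tAE ⟶ tEE} {mnY : tAE ⟶ tAE'} {mnZ : tAA ⟶ tAE'}
    {Fm : fA ⟶ fB} {Fn : fB ⟶ fE} {Gm : gA ⟶ gB} {Gn : gB ⟶ gE}
    {hEE : fE ⟶ tEE} {hBE : fB ⟶ tBE} {hAE : fA ⟶ tAE} {hBB : fB ⟶ tBB} {hAB : fA ⟶ tAB}
    {hAA : fA ⟶ tAA} {eEE : tEE ⟶ gE} {eBE : tBE' ⟶ gE} {eAE : tAE' ⟶ gE} {eBB : tBB ⟶ gB}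
    {eAB : tAB' ⟶ gB} {eAA : tAA ⟶ gA}
    {mXE : tAE ⟶ tBE} {nX : tBE ⟶ tEE} {nYB : tBE ⟶ tBE'} {nYA : tAE ⟶ tABE} {mX' : tABE ⟶ tBE'}
    {mYE : tABE ⟶ tAE'} {nZA : tAB ⟶ tABE} {nZB : tBB ⟶ tBE'} {mXB : tAB ⟶ tBB}
    {mYB : tAB ⟶ tAB'} {nZ : tAB' ⟶ tAE'} {mZ : tAA ⟶ tAB'}
    {hX : F ≫ hEE ≅ hAE ≫ mnX} {eX : mnX ≫ eEE ≅ mnY ≫ eAE} {hY : hAE ≫ mnY ≅ hAA ≫ mnZ}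
    {eZ : mnZ ≫ eAE ≅ eAA ≫ G}
    {hXmE : Fm ≫ hBE ⟶ hAE ≫ mXE} {hXn : Fn ≫ hEE ≅ hBE ≫ nX} {eXn : nX ≫ eEE ≅ nYB ≫ eBE}
    {hYnB : hBE ≫ nYB ≅ hBB ≫ nZB} {eZn : nZB ≫ eBE ≅ eBB ≫ Gn}
    {hXmB : Fm ≫ hBB ≅ hAB ≫ mXB} {eXm : mXB ≫ eBB ≅ mYB ≫ eAB} {hYm : hAB ≫ mYB ≅ hAA ≫ mZ}
    {eZm : mZ ≫ eAB ≅ eAA ≫ Gm} {σ : mXE ≫ nYB ⟶ nYA ≫ mX'} {hYnA : hAE ≫ nYA ⟶ hAB ≫ nZA}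
    {τ : mXB ≫ nZB ≅ nZA ≫ mX'} {eXmE : mX' ≫ eBE ⟶ mYE ≫ eAE} {eZnA : nZ ≫ eAE ⟶ eAB ≫ Gn}
    {ν : nZA ≫ mYE ⟶ mYB ≫ nZ}
    {f : F ⟶ Fm ≫ Fn} {g : G ⟶ Gm ≫ Gn} {i : mnX ⟶ mXE ≫ nX} {j : mnY ⟶ nYA ≫ mYE}
    {k : mnZ ⟶ mZ ≫ nZ}
    (chX : SlideNat hX.hom (slideP hXmE hXn.hom) f i)
    (ceX : eX.hom ≫ j ▷ eAE = i ▷ eEE ≫ cupPaste eXmE eXn.hom σ)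
    (chY : hY.hom ≫ hAA ◁ k = hAE ◁ j ≫ capPaste hYm.hom hYnA ν)
    (ceZ : SlideNat eZ.hom (slideP eZm.hom eZnA) k g)
    (hh : SlideNatT (slideT hXmE σ) (slideT hXmB.hom τ.hom) hYnA hYnB.hom)
    (he : SlideNatT (slideT τ.inv eZn.hom) (slideT ν eZnA) eXm.hom eXmE) :
    SlideNat (foldIso hX eX hY eZ).hom
      (slideP (foldIso hXmB eXm hYm eZm).hom (foldIso hXn eXn hYnB eZn).hom) f g := by
  unfold SlideNat at *
  rw [← foldIso_exchange hh he]
  simp only [foldIso_hom]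
  calc _ = 𝟙 _ ⊗≫ hX.hom ▷ eEE ⊗≫ hAE ◁ eX.hom ⊗≫ hY.hom ▷ eAE ⊗≫ hAA ◁ (eZ.hom ≫ eAA ◁ g) ⊗≫
        𝟙 _ := by bicategory
    _ = 𝟙 _ ⊗≫ hX.hom ▷ eEE ⊗≫ hAE ◁ eX.hom ⊗≫ (hY.hom ≫ hAA ◁ k) ▷ eAE ⊗≫
        hAA ◁ slideP eZm.hom eZnA ⊗≫ 𝟙 _ := by rw [ceZ]; bicategory
    _ = 𝟙 _ ⊗≫ hX.hom ▷ eEE ⊗≫ hAE ◁ (eX.hom ≫ j ▷ eAE) ⊗≫ (capPaste hYm.hom hYnA ν) ▷ eAE ⊗≫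
        hAA ◁ slideP eZm.hom eZnA ⊗≫ 𝟙 _ := by rw [chY]; bicategory
    _ = 𝟙 _ ⊗≫ (hX.hom ≫ hAE ◁ i) ▷ eEE ⊗≫ hAE ◁ cupPaste eXmE eXn.hom σ ⊗≫
        (capPaste hYm.hom hYnA ν) ▷ eAE ⊗≫
        hAA ◁ slideP eZm.hom eZnA ⊗≫ 𝟙 _ := by rw [ceX]; bicategory
    _ = _ := by rw [chX]; bicategory

/-- The unit law of a pseudonatural transformation follows from its composition law. -/
theorem slide_unit_of_comp {a b : B} {F₁ : a ⟶ a} {G₁ : b ⟶ b} {t : a ⟶ b} (θ : F₁ ≫ t ≅ t ≫ G₁)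
    (i : F₁ ≅ 𝟙 a) (j : G₁ ≅ 𝟙 b)
    (h : θ.hom ≫ t ◁ ((λ_ G₁).inv ≫ j.inv ▷ G₁) =
      ((λ_ F₁).inv ≫ i.inv ▷ F₁) ▷ t ≫ slideP θ.hom θ.hom) :
    θ.hom = i.hom ▷ t ≫ (λ_ t).hom ≫ (ρ_ t).inv ≫ t ◁ j.inv := by
  have e : ((λ_ F₁).inv ≫ i.inv ▷ F₁) ▷ t ≫ slideP θ.hom θ.hom =
      θ.hom ≫ (λ_ _).inv ≫ i.inv ▷ (t ≫ G₁) ≫ (α_ _ _ _).inv ≫ θ.hom ▷ G₁ ≫ (α_ _ _ _).hom := by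
    unfold slideP
    calc _ = 𝟙 _ ⊗≫ (i.inv ▷ (F₁ ≫ t) ≫ F₁ ◁ θ.hom) ⊗≫ θ.hom ▷ G₁ ⊗≫ 𝟙 _ := by bicategory
      _ = 𝟙 _ ⊗≫ (𝟙 a ◁ θ.hom ≫ i.inv ▷ (t ≫ G₁)) ⊗≫ θ.hom ▷ G₁ ⊗≫ 𝟙 _ := by
        rw [whisker_exchange]
      _ = _ := by bicategory
  -- Invertibility of `θ` enters here: `h` compares `θ` with its own square, so one copy cancels,
  -- just as an invertible idempotent is an identity.
  rw [e, cancel_epi] at h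
  have h₁ : t ◁ ((λ_ G₁).inv ≫ j.inv ▷ G₁) ≫ t ◁ (G₁ ◁ j.hom ≫ (ρ_ G₁).hom) = 𝟙 _ := by
    rw [← Bicategory.whiskerLeft_comp, Category.assoc, ← whisker_exchange_assoc]
    simp
  -- Collapsing `G₁` along `j` turns the cancelled equation into an explicit one-sided inverse of
  -- `θ`, which suffices to compute it.
  have h₂ : (λ_ (t ≫ G₁)).inv ≫ i.inv ▷ (t ≫ G₁) ≫ F₁ ◁ (t ◁ j.hom ≫ (ρ_ t).hom) ≫ θ.hom =
      𝟙 _ := by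
    rw [← h₁, h]
    calc _ = 𝟙 _ ⊗≫ i.inv ▷ (t ≫ G₁) ⊗≫ ((F₁ ≫ t) ◁ j.hom ≫ θ.hom ▷ 𝟙 b) ⊗≫ 𝟙 _ := by bicategory
      _ = 𝟙 _ ⊗≫ i.inv ▷ (t ≫ G₁) ⊗≫ (θ.hom ▷ G₁ ≫ (t ≫ G₁) ◁ j.hom) ⊗≫ 𝟙 _ := by
        rw [whisker_exchange]
      _ = _ := by bicategory
  rw [← whisker_exchange_assoc] at h₂
  rw [← cancel_epi ((λ_ (t ≫ G₁)).inv ≫ 𝟙 a ◁ (t ◁ j.hom ≫ (ρ_ t).hom) ≫ i.inv ▷ t)]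
  simp only [Category.assoc]
  rw [h₂, inv_hom_whiskerRight_assoc]
  calc _ = t ◁ (j.hom ≫ j.inv) := by simp
    _ = _ := by bicategory

end Turn

end DoubleCategory

namespace DoubleCategory

variable {C : Type u} [DoubleCategory.{u, v, w, x} C]

/-! ### The actions of disks on squares -/

section Act

/-- Composition of a disk with a square. -/
def lact {A B A' B' : C} {m m' : A ⟶ B} {n : A' ⟶ B'} {f : Arr A A'} {g : Arr B B'}
    (d : m' ⟶ m) (φ : Sq m n f g) : Sq m' n f g :=
  scomp d φ (aid_acomp f) (aid_acomp g)

/-- Composition of a square with a disk. -/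
def ract {A B A' B' : C} {m : A ⟶ B} {n n' : A' ⟶ B'} {f : Arr A A'} {g : Arr B B'}
    (φ : Sq m n f g) (e : n ⟶ n') : Sq m n' f g :=
  scomp φ e (acomp_aid f) (acomp_aid g)

variable {A B A' B' : C} {m m' m'' : A ⟶ B} {n n' n'' : A' ⟶ B'} {f : Arr A A'} {g : Arr B B'}

theorem diskNat_iff {φ : Sq m n f g} {ψ : Sq m' n' f g} {d : m ⟶ m'} {e : n ⟶ n'} :
    DiskNat φ ψ d e ↔ ract φ e = lact d ψ := Iff.rfl

theorem lact_disk (d : m'' ⟶ m') (e : m' ⟶ m) : lact d e = d ≫ e := rfl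

theorem ract_disk (d : m'' ⟶ m') (e : m' ⟶ m) : ract d e = d ≫ e := rfl

theorem lact_id (φ : Sq m n f g) : lact (𝟙 m) φ = φ := sid_scomp φ

theorem ract_id (φ : Sq m n f g) : ract φ (𝟙 n) = φ := scomp_sid φ

theorem lact_lact (d : m'' ⟶ m') (e : m' ⟶ m) (φ : Sq m n f g) :
    lact d (lact e φ) = lact (d ≫ e) φ :=
  (scomp_scomp _ _ _ _ _ _ _ _ _ _ _).symm

theorem ract_ract (φ : Sq m n f g) (d : n ⟶ n') (e : n' ⟶ n'') :
    ract (ract φ d) e = ract φ (d ≫ e) :=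
  scomp_scomp _ _ _ _ _ _ _ _ _ _ _

theorem ract_lact (d : m' ⟶ m) (φ : Sq m n f g) (e : n ⟶ n') :
    ract (lact d φ) e = lact d (ract φ e) :=
  scomp_scomp _ _ _ _ _ _ _ _ _ _ _

theorem lact_eq_iff (d : m' ≅ m) {φ : Sq m n f g} {ψ : Sq m' n f g} :
    lact d.hom φ = ψ ↔ φ = lact d.inv ψ := by
  constructor
  · rintro rfl
    rw [lact_lact, d.inv_hom_id, lact_id]
  · rintro rfl
    rw [lact_lact, d.hom_inv_id, lact_id]

theorem ract_eq_iff (e : n ≅ n') {φ : Sq m n f g} {ψ : Sq m n' f g} :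
    ract φ e.hom = ψ ↔ φ = ract ψ e.inv := by
  constructor
  · rintro rfl
    rw [ract_ract, e.hom_inv_id, ract_id]
  · rintro rfl
    rw [ract_ract, e.inv_hom_id, ract_id]

variable {E E' : C} {p p' : B ⟶ E} {q q' : B' ⟶ E'} {k : Arr E E'}

theorem pcomp_lact_left (d : m' ⟶ m) (φ : Sq m n f g) (ψ : Sq p q g k) :
    pcomp (lact d φ) ψ = lact (d ▷ p) (pcomp φ ψ) := by
  change _ = scomp (pcomp d (sid p rfl rfl)) _ _ _
  rw [pcomp_scomp' _ _ _ _ _ (aid_acomp _), sid_scomp]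
  rfl

theorem pcomp_lact_right (φ : Sq m n f g) (d : p' ⟶ p) (ψ : Sq p q g k) :
    pcomp φ (lact d ψ) = lact (m ◁ d) (pcomp φ ψ) := by
  change _ = scomp (pcomp (sid m rfl rfl) d) _ _ _
  rw [pcomp_scomp' _ _ _ _ _ (aid_acomp _), sid_scomp]
  rfl

theorem pcomp_ract_left (φ : Sq m n f g) (e : n ⟶ n') (ψ : Sq p q g k) :
    pcomp (ract φ e) ψ = ract (pcomp φ ψ) (e ▷ q) := by
  change _ = scomp _ (pcomp e (sid q rfl rfl)) _ _
  rw [pcomp_scomp' _ _ _ _ _ (acomp_aid _), scomp_sid]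
  rfl

theorem pcomp_ract_right (φ : Sq m n f g) (ψ : Sq p q g k) (e : q ⟶ q') :
    pcomp φ (ract ψ e) = ract (pcomp φ ψ) (n ◁ e) := by
  change _ = scomp _ (pcomp (sid n rfl rfl) e) _ _
  rw [pcomp_scomp' _ _ _ _ _ (acomp_aid _), scomp_sid]
  rfl

theorem pcomp_assoc {F F' : C} {r : E ⟶ F} {s : E' ⟶ F'} {l : Arr F F'} (φ : Sq m n f g)
    (ψ : Sq p q g k) (χ : Sq r s k l) :
    ract (pcomp (pcomp φ ψ) χ) (α_ n q s).hom = lact (α_ m p r).hom (pcomp φ (pcomp ψ χ)) :=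
  ahom_naturality φ ψ χ

theorem pcomp_assoc' {F F' : C} {r : E ⟶ F} {s : E' ⟶ F'} {l : Arr F F'} (φ : Sq m n f g)
    (ψ : Sq p q g k) (χ : Sq r s k l) :
    pcomp φ (pcomp ψ χ) = lact (α_ m p r).inv (ract (pcomp (pcomp φ ψ) χ) (α_ n q s).hom) :=
  (lact_eq_iff (α_ m p r)).1 (pcomp_assoc φ ψ χ).symm

theorem unitSq_pcomp (φ : Sq m n f g) :
    ract (pcomp (unitSq f) φ) (λ_ n).hom = lact (λ_ m).hom φ :=
  lhom_naturality φ

theorem pcomp_unitSq (φ : Sq m n f g) :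
    ract (pcomp φ (unitSq g)) (ρ_ n).hom = lact (ρ_ m).hom φ :=
  rhom_naturality φ

theorem unitSq_scomp_unitSq {a b c : C} {f : Arr a b} {g : Arr b c} {k : Arr a c}
    (h h' : acomp f g = k) : scomp (unitSq f) (unitSq g) h h' = unitSq k := by
  subst h; exact (unitSq_acomp f g).symm

theorem unitSq_eq_sid {a : C} {f : Arr a a} (h : f = aid a) : unitSq f = sid (𝟙 a) h h := by
  subst h; exact unitSq_aid a

theorem sid_scomp' {a : Arr A A} {b : Arr B B} (ha : a = aid A) (hb : b = aid B) (φ : Sq m n f g)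
    (hf : acomp a f = f) (hg : acomp b g = g) : scomp (sid m ha hb) φ hf hg = φ := by
  subst ha hb; exact sid_scomp φ

theorem scomp_sid' {a : Arr A' A'} {b : Arr B' B'} (ha : a = aid A') (hb : b = aid B')
    (φ : Sq m n f g) (hf : acomp f a = f) (hg : acomp g b = g) :
    scomp φ (sid n ha hb) hf hg = φ := by
  subst ha hb; exact scomp_sid φ

end Act

namespace DiskNat

variable {A B A' B' : C} {m m' m'' : A ⟶ B} {n n' n'' : A' ⟶ B'} {f : Arr A A'} {g : Arr B B'}
  {φ : Sq m n f g} {ψ : Sq m' n' f g} {χ : Sq m'' n'' f g}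

theorem id (φ : Sq m n f g) : DiskNat φ φ (𝟙 m) (𝟙 n) :=
  (ract_id φ).trans (lact_id φ).symm

theorem whiskerLeft {d : m ⟶ m'} {e : n ⟶ n'} (h : DiskNat φ ψ d e) {E E' : C} {p : E ⟶ A}
    {q : E' ⟶ A'} {k : Arr E E'} (ω : Sq p q k f) :
    DiskNat (pcomp ω φ) (pcomp ω ψ) (p ◁ d) (q ◁ e) := by
  rw [diskNat_iff] at *
  rw [← pcomp_ract_right, ← pcomp_lact_right, h]

theorem associator {E E' F F' : C} {p : B ⟶ E} {q : B' ⟶ E'} {k : Arr E E'} {r : E ⟶ F}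
    {s : E' ⟶ F'} {l : Arr F F'} (φ : Sq m n f g) (ψ : Sq p q g k) (χ : Sq r s k l) :
    DiskNat (pcomp (pcomp φ ψ) χ) (pcomp φ (pcomp ψ χ)) (α_ m p r).hom (α_ n q s).hom :=
  pcomp_assoc φ ψ χ

theorem associator_inv {E E' F F' : C} {p : B ⟶ E} {q : B' ⟶ E'} {k : Arr E E'} {r : E ⟶ F}
    {s : E' ⟶ F'} {l : Arr F F'} (φ : Sq m n f g) (ψ : Sq p q g k) (χ : Sq r s k l) :
    DiskNat (pcomp φ (pcomp ψ χ)) (pcomp (pcomp φ ψ) χ) (α_ m p r).inv (α_ n q s).inv :=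
  DiskNat.inv (pcomp_assoc φ ψ χ)

/-- Each of the five factors of a stacked sliding cell is natural for squares, so later only single
layers need to be checked. -/
theorem slideT {a b a' b' a'' b'' c d c' d' c'' d'' : C} {p : a ⟶ b} {q : a' ⟶ b'} {r : a'' ⟶ b''}
    {t : a ⟶ a'} {t' : b ⟶ b'} {s : a' ⟶ a''} {s' : b' ⟶ b''}
    {p₂ : c ⟶ d} {q₂ : c' ⟶ d'} {r₂ : c'' ⟶ d''} {t₂ : c ⟶ c'} {t₂' : d ⟶ d'} {s₂ : c' ⟶ c''}
    {s₂' : d' ⟶ d''} {θ : p ≫ t' ⟶ t ≫ q} {κ : q ≫ s' ⟶ s ≫ r}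
    {θ₂ : p₂ ≫ t₂' ⟶ t₂ ≫ q₂} {κ₂ : q₂ ≫ s₂' ⟶ s₂ ≫ r₂}
    {fa : Arr a c} {fb : Arr b d} {fa' : Arr a' c'} {fb' : Arr b' d'} {fa'' : Arr a'' c''}
    {fb'' : Arr b'' d''} {P : Sq p p₂ fa fb} {Q : Sq q q₂ fa' fb'} {R : Sq r r₂ fa'' fb''}
    {T : Sq t t₂ fa fa'} {T' : Sq t' t₂' fb fb'} {U : Sq s s₂ fa' fa''} {U' : Sq s' s₂' fb' fb''}
    (h : DiskNat (pcomp P T') (pcomp T Q) θ θ₂) (h' : DiskNat (pcomp Q U') (pcomp U R) κ κ₂) :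
    DiskNat (pcomp P (pcomp T' U')) (pcomp (pcomp T U) R) (slideT θ κ)
      (DoubleCategory.slideT θ₂ κ₂) :=
  (associator_inv P T' U').comp ((h.whiskerRight U').comp ((associator T Q U').comp
    ((h'.whiskerLeft T).comp (associator_inv T U R))))

end DiskNat

/-! ### Companions -/

namespace Companion

section

variable {A B A' B' : C} {s : Arr A B} {t : Arr A' B'} (hs : Companion s) (ht : Companion t)

/-- A disk absorbed into a square can be pulled out of the companion disk again. In this way the
unit comparison hidden in `assocInvX` reappears as the explicit disk in `zigzagSDisk`. -/
theorem disk_lact {m m' : A ⟶ A'} {n : B ⟶ B'} (d : m' ⟶ m) (φ : Sq m n s t) :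
    disk hs ht (lact d φ) = d ▷ ht.pro ≫ disk hs ht φ := by
  unfold disk
  rw [pcomp_lact_left, pcomp_lact_right]
  simp only [lact_disk]
  simp

theorem disk_ract {m : A ⟶ A'} {n n' : B ⟶ B'} (φ : Sq m n s t) (e : n ⟶ n') :
    disk hs ht (ract φ e) = disk hs ht φ ≫ hs.pro ◁ e := by
  unfold disk
  rw [pcomp_ract_left, pcomp_ract_right]
  simp only [ract_disk]
  simp

/-- Where the two disks are pasted along `ht.pro`, the unit of `ht` meets its counit; the two
compose to the unit square of `t`, and a unitor absorbs that. This is the source of every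
composition law for coherence disks. -/
theorem disk_pcomp {A'' B'' : C} {r : Arr A'' B''} (hr : Companion r) {m : A ⟶ A'} {n : B ⟶ B'}
    {p : A' ⟶ A''} {q : B' ⟶ B''} (φ : Sq m n s t) (ψ : Sq p q t r) :
    disk hs hr (pcomp φ ψ) = slideP (disk hs ht φ) (disk ht hr ψ) := by
  have e : (𝟙 A ◁ m ◁ (show 𝟙 A' ≫ p ≫ hr.pro ⟶ ht.pro ≫ q ≫ 𝟙 B'' from
        pcomp ht.unit (pcomp ψ hr.counit))) ≫
      (show 𝟙 A ≫ m ≫ ht.pro ≫ q ≫ 𝟙 B'' ⟶ hs.pro ≫ n ≫ 𝟙 B' ≫ q ≫ 𝟙 B'' from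
        pcomp hs.unit (pcomp φ (pcomp ht.counit (𝟙 (q ≫ 𝟙 B''))))) =
      (show 𝟙 A ≫ m ≫ 𝟙 A' ≫ p ≫ hr.pro ⟶ hs.pro ≫ n ≫ 𝟙 B' ≫ q ≫ 𝟙 B'' from
        pcomp hs.unit (pcomp φ (pcomp (unitSq t) (pcomp ψ hr.counit)))) := by
    change scomp (pcomp (sid _ rfl rfl) (pcomp (sid _ rfl rfl) (pcomp ht.unit _)))
      (pcomp hs.unit (pcomp φ (pcomp ht.counit (sid _ rfl rfl)))) _ _ = _
    rw [pcomp_scomp' _ _ _ _ _ (aid_acomp _), pcomp_scomp' _ _ _ _ _ (aid_acomp _),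
      pcomp_scomp' _ _ _ _ _ (acomp_aid _), sid_scomp, sid_scomp, scomp_sid, ht.unit_counit]
  have e₁ : (show 𝟙 A ≫ m ≫ 𝟙 A' ≫ p ≫ hr.pro ⟶ hs.pro ≫ n ≫ 𝟙 B' ≫ q ≫ 𝟙 B'' from
        pcomp hs.unit (pcomp φ (pcomp (unitSq t) (pcomp ψ hr.counit)))) =
      𝟙 A ◁ m ◁ (λ_ _).hom ≫ (show 𝟙 A ≫ m ≫ p ≫ hr.pro ⟶ hs.pro ≫ n ≫ q ≫ 𝟙 B'' from
        pcomp hs.unit (pcomp φ (pcomp ψ hr.counit))) ≫ hs.pro ◁ n ◁ (λ_ _).inv := by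
    have h : pcomp (unitSq t) (pcomp ψ hr.counit) =
        ract (lact (λ_ _).hom (pcomp ψ hr.counit)) (λ_ (q ≫ 𝟙 B'')).inv :=
      (ract_eq_iff (λ_ (q ≫ 𝟙 B''))).1 (unitSq_pcomp _)
    rw [h, pcomp_ract_right, pcomp_lact_right, pcomp_ract_right, pcomp_lact_right]
    simp only [lact_disk, ract_disk, Category.assoc]
  have e₂ : (show 𝟙 A ≫ m ≫ p ≫ hr.pro ⟶ hs.pro ≫ n ≫ q ≫ 𝟙 B'' from
        pcomp hs.unit (pcomp φ (pcomp ψ hr.counit))) =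
      𝟙 A ◁ (α_ _ _ _).inv ≫ (show 𝟙 A ≫ (m ≫ p) ≫ hr.pro ⟶ hs.pro ≫ (n ≫ q) ≫ 𝟙 B'' from
        pcomp hs.unit (pcomp (pcomp φ ψ) hr.counit)) ≫ hs.pro ◁ (α_ _ _ _).hom := by
    rw [pcomp_assoc' φ, pcomp_lact_right, pcomp_ract_right]
    simp only [lact_disk, ract_disk]
  have e₃ : (show 𝟙 A ≫ m ≫ ht.pro ≫ q ≫ 𝟙 B'' ⟶ hs.pro ≫ n ≫ 𝟙 B' ≫ q ≫ 𝟙 B'' from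
        pcomp hs.unit (pcomp φ (pcomp ht.counit (𝟙 (q ≫ 𝟙 B''))))) =
      𝟙 A ◁ (α_ _ _ _).inv ≫ (α_ _ _ _).inv ≫
        (show 𝟙 A ≫ m ≫ ht.pro ⟶ hs.pro ≫ n ≫ 𝟙 B' from
          pcomp hs.unit (pcomp φ ht.counit)) ▷ (q ≫ 𝟙 B'') ≫
        (α_ _ _ _).hom ≫ hs.pro ◁ (α_ _ _ _).hom := by
    rw [pcomp_assoc' φ, pcomp_lact_right, pcomp_ract_right, pcomp_assoc' hs.unit]
    simp only [lact_disk, ract_disk, Category.assoc]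
    rfl
  have e₄ := e₁.symm.trans (e.symm.trans (congrArg _ e₃))
  rw [e₂] at e₄
  unfold disk slideP
  generalize (show 𝟙 A ≫ (m ≫ p) ≫ hr.pro ⟶ hs.pro ≫ (n ≫ q) ≫ 𝟙 B'' from
        pcomp hs.unit (pcomp (pcomp φ ψ) hr.counit)) = X at *
  generalize (show 𝟙 A' ≫ p ≫ hr.pro ⟶ ht.pro ≫ q ≫ 𝟙 B'' from
        pcomp ht.unit (pcomp ψ hr.counit)) = Y at *
  generalize (show 𝟙 A ≫ m ≫ ht.pro ⟶ hs.pro ≫ n ≫ 𝟙 B' from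
          pcomp hs.unit (pcomp φ ht.counit)) = Z at *
  -- `e₄` determines only a conjugate of `X` by associators and unitors, so `X` is padded with their
  -- inverses before rewriting.
  have e₅ : X = 𝟙 A ◁ (α_ _ _ _).hom ≫ 𝟙 A ◁ m ◁ (λ_ _).inv ≫ (𝟙 A ◁ m ◁ (λ_ _).hom ≫
    (𝟙 A ◁ (α_ m p hr.pro).inv ≫ X ≫ hs.pro ◁ (α_ n q (𝟙 B'')).hom) ≫ hs.pro ◁ n ◁ (λ_ _).inv) ≫
      hs.pro ◁ n ◁ (λ_ _).hom ≫ hs.pro ◁ (α_ _ _ _).inv := by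
    simp
  rw [e₅, e₄]
  bicategory

end

end Companion

end DoubleCategory

/-! ### Squares and disks between companions, and the universal property of the unit -/

namespace DoubleCategory

variable {C : Type u} [DoubleCategory.{u, v, w, x} C]

namespace Companion

section

variable {A B A' B' : C} {s : Arr A B} {t : Arr A' B'} (hs : Companion s) (ht : Companion t)

/-- The unit of `hs` meets the counit inside `sq`; `unit_counit` leaves unit squares, which the
unitors absorb. By `unit_ext` this equation characterises `sq`. -/
theorem unit_sq {f : Arr A A'} {g : Arr B B'} (e : acomp f t = acomp s g) {b : Arr A B'}
    (hb : acomp s g = b) :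
    scomp hs.unit (sq hs ht e) (aid_acomp f) hb =
      scomp (unitSq f) ht.unit (acomp_aid f) (e.trans hb) := by
  subst hb
  have h : lact (λ_ (𝟙 A)).inv (pcomp (unitSq (aid A)) hs.unit) = ract hs.unit (λ_ hs.pro).inv := by
    rw [(ract_eq_iff (λ_ hs.pro)).1 (unitSq_pcomp hs.unit), ← ract_lact, lact_lact,
      Iso.inv_hom_id, lact_id]
  have h₁ : scomp hs.unit (sq hs ht e) (aid_acomp f) rfl =
      scomp (ract hs.unit (λ_ hs.pro).inv)
        (ract (pcomp (scomp (unitSq f) ht.unit (acomp_aid f) e)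
          (scomp hs.counit (unitSq g) rfl (aid_acomp g))) (ρ_ ht.pro).hom)
        (aid_acomp f) rfl :=
    (scomp_scomp _ _ _ _ _ _ _ _ _ _ _).symm
  have h₂ : scomp hs.unit (scomp hs.counit (unitSq g) rfl (aid_acomp g)) (aid_acomp _) rfl =
      unitSq (acomp s g) := by
    rw [← scomp_scomp _ _ _ (aid_acomp s) (acomp_aid s) rfl rfl, hs.unit_counit,
      unitSq_scomp_unitSq]
  have h₃ := pcomp_scomp' (unitSq (aid A)) hs.unit (scomp (unitSq f) ht.unit (acomp_aid f) e)
    (scomp hs.counit (unitSq g) rfl (aid_acomp g)) (aid_acomp f) (aid_acomp _) rfl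
  rw [h₂, unitSq_aid, sid_scomp] at h₃
  have h₄ : scomp (ract hs.unit (λ_ hs.pro).inv)
        (ract (pcomp (scomp (unitSq f) ht.unit (acomp_aid f) e)
          (scomp hs.counit (unitSq g) rfl (aid_acomp g))) (ρ_ ht.pro).hom)
        (aid_acomp f) rfl = lact (λ_ (𝟙 A)).inv (ract (scomp (pcomp (sid (𝟙 A) rfl rfl) hs.unit)
          (pcomp (scomp (unitSq f) ht.unit (acomp_aid f) e)
          (scomp hs.counit (unitSq g) rfl (aid_acomp g))) (aid_acomp f) rfl) (ρ_ ht.pro).hom) := by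
    rw [← h, unitSq_aid]
    unfold lact ract
    rw [scomp_scomp _ _ _ _ _ _ _ (aid_acomp f) rfl (aid_acomp f) (aid_acomp _),
      scomp_scomp _ _ _ (aid_acomp f) rfl]
  rw [h₁, h₄, h₃, pcomp_unitSq, lact_lact, ← unitors_equal, Iso.inv_hom_id, lact_id]

theorem sq_counit {f : Arr A A'} {g : Arr B B'} (e : acomp f t = acomp s g) {b : Arr A B'}
    (hb : acomp f t = b) :
    scomp (sq hs ht e) ht.counit hb (acomp_aid g) =
      scomp hs.counit (unitSq g) (e.symm.trans hb) (aid_acomp g) := by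
  subst hb
  have h : ract (pcomp ht.counit (unitSq (aid B'))) (λ_ (𝟙 B')).hom =
      lact (ρ_ ht.pro).hom ht.counit := by
    rw [unitors_equal, pcomp_unitSq]
  have h₁ : scomp (sq hs ht e) ht.counit rfl (acomp_aid g) =
      scomp (lact (λ_ hs.pro).inv (pcomp (scomp (unitSq f) ht.unit (acomp_aid f) rfl)
          (scomp hs.counit (unitSq g) e.symm (aid_acomp g))))
        (lact (ρ_ ht.pro).hom ht.counit) rfl (acomp_aid g) := by
    have h₀ : ∀ {b c : Arr A B'} (e₁ : acomp f t = b) (e₂ : acomp s g = b) (h : b = c),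
        pcomp (scomp (unitSq f) ht.unit (acomp_aid f) e₁)
          (scomp hs.counit (unitSq g) e₂ (aid_acomp g)) =
        pcomp (scomp (unitSq f) ht.unit (acomp_aid f) (e₁.trans h))
          (scomp hs.counit (unitSq g) (e₂.trans h) (aid_acomp g)) := by
      rintro b _ e₁ e₂ rfl; rfl
    rw [← h₀ e rfl e.symm]
    unfold sq
    rw [← ract, ← lact, ← ract_lact]
    exact scomp_scomp _ _ _ _ _ _ _ _ _ _ _
  have h₂ : scomp (scomp (unitSq f) ht.unit (acomp_aid f) rfl) ht.counit rfl (acomp_aid _) =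
      unitSq (acomp f t) := by
    rw [scomp_scomp _ _ _ _ _ _ _ (aid_acomp t) (acomp_aid t) rfl rfl, ht.unit_counit,
      unitSq_scomp_unitSq]
  have h₃ := pcomp_scomp' (scomp (unitSq f) ht.unit (acomp_aid f) rfl)
    (scomp hs.counit (unitSq g) e.symm (aid_acomp g)) ht.counit (unitSq (aid B')) rfl
    (acomp_aid _) (acomp_aid g)
  rw [h₂, unitSq_aid, scomp_sid] at h₃
  have h₄ : scomp (lact (λ_ hs.pro).inv (pcomp (scomp (unitSq f) ht.unit (acomp_aid f) rfl)
          (scomp hs.counit (unitSq g) e.symm (aid_acomp g))))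
        (lact (ρ_ ht.pro).hom ht.counit) rfl (acomp_aid g) = lact (λ_ hs.pro).inv (ract (scomp
          (pcomp (scomp (unitSq f) ht.unit (acomp_aid f) rfl)
          (scomp hs.counit (unitSq g) e.symm (aid_acomp g)))
          (pcomp ht.counit (sid (𝟙 B') rfl rfl)) rfl (acomp_aid g)) (λ_ (𝟙 B')).hom) := by
    rw [← h, unitSq_aid]
    unfold lact ract
    rw [scomp_scomp _ _ _ _ _ _ _ rfl (acomp_aid g) (aid_acomp _) (aid_acomp g)]
    congr 1
    exact (scomp_scomp _ _ _ _ _ _ _ _ _ _ _).symm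
  rw [h₁, h₄, h₃, unitSq_pcomp, lact_lact, Iso.inv_hom_id, lact_id]

/-- The second companion law writes the identity of `hs.pro`, up to unitors, as the unit beside the
counit, so a square out of `hs.pro` is recovered from its composite with the unit. -/
theorem eq_of_unit {f : Arr A A'} {g : Arr B B'} (τ : Sq hs.pro ht.pro f g)
    {k : Arr A B'} (hk : acomp s g = k) :
    τ = lact (λ_ hs.pro).inv (ract (pcomp (scomp hs.unit τ (aid_acomp f) hk)
      (scomp hs.counit (unitSq g) hk (aid_acomp g))) (ρ_ ht.pro).hom) := by
  have h := pcomp_scomp' hs.unit hs.counit τ (unitSq g) (aid_acomp f) hk (aid_acomp g)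
  rw [← h]
  change _ = lact _ (ract (lact (show 𝟙 A ≫ hs.pro ⟶ hs.pro ≫ 𝟙 B from _) _) _)
  rw [hs.pcomp_unit_counit, ract_lact, lact_lact, pcomp_unitSq, lact_lact]
  simp [lact_id]

theorem unit_ext {f : Arr A A'} {g : Arr B B'} {τ τ' : Sq hs.pro ht.pro f g}
    {b : Arr A B'} (hb : acomp s g = b)
    (h : scomp hs.unit τ (aid_acomp f) hb = scomp hs.unit τ' (aid_acomp f) hb) : τ = τ' := by
  rw [eq_of_unit hs ht τ hb, eq_of_unit hs ht τ' hb, h]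

theorem sq_aid {f : Arr A A} {g : Arr B B} (e : acomp f s = acomp s g) (hf : f = aid A)
    (hg : g = aid B) : sq hs hs e = sid hs.pro hf hg := by
  subst hf hg
  refine unit_ext hs hs (acomp_aid s) ?_
  rw [scomp_sid' rfl rfl hs.unit, unit_sq, unitSq_aid, sid_scomp' rfl rfl hs.unit]

/-- By `unit_ext` it is enough to compose with the unit of `hs`, and `unit_sq` then moves a unit
through one square after the other. -/
theorem sq_acomp {A'' B'' : C} {r : Arr A'' B''} (hr : Companion r) {f : Arr A A'} {g : Arr B B'}
    {f' : Arr A' A''} {g' : Arr B' B''} {k : Arr A A''} {l : Arr B B''} (e : acomp f t = acomp s g)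
    (e' : acomp f' r = acomp t g') (e'' : acomp k r = acomp s l) (hk : acomp f f' = k)
    (hl : acomp g g' = l) : sq hs hr e'' = scomp (sq hs ht e) (sq ht hr e') hk hl := by
  subst hk hl
  refine unit_ext hs hr rfl ?_
  rw [unit_sq, ← scomp_scomp hs.unit _ _ (aid_acomp f) rfl rfl (acomp_assoc _ _ _), unit_sq,
    scomp_scomp _ _ _ _ _ _ _ (aid_acomp f') rfl rfl
      (by rw [← acomp_assoc, e, acomp_assoc]), unit_sq,
    ← scomp_scomp _ _ _ rfl rfl (acomp_aid _) (e''.trans rfl), unitSq_scomp_unitSq]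

/-- An inverse of `s` makes the counit cancellable in the arrow dimension, with a cancelling square
built from the inverse arrow and the unit. Together with `unit_counit_inv` this inverts the
companion disks. -/
theorem counit_inv_unit {s' : Arr B A} (es : acomp s s' = aid A) (es' : acomp s' s = aid B) :
    scomp hs.counit (scomp (unitSq s') hs.unit (acomp_aid s') es') es (aid_acomp _) =
      sid hs.pro rfl rfl := by
  refine unit_ext hs hs (acomp_aid s) ?_
  rw [scomp_sid' rfl rfl hs.unit, ← scomp_scomp hs.unit _ _ (aid_acomp s) (acomp_aid s) es (acomp_aid s),
    hs.unit_counit,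
    ← scomp_scomp (unitSq s) _ _ es es (acomp_aid _) (aid_acomp _), unitSq_scomp_unitSq,
    unitSq_aid, sid_scomp' rfl rfl hs.unit]

theorem unit_counit_inv {s' : Arr B A} (es : acomp s s' = aid A) :
    scomp hs.unit (scomp hs.counit (unitSq s') es (aid_acomp s')) (aid_acomp _) es =
      sid (𝟙 A) rfl rfl := by
  rw [← scomp_scomp hs.unit _ _ (aid_acomp s) (acomp_aid s) es es, hs.unit_counit,
    unitSq_scomp_unitSq, unitSq_aid]

/-- The invertible disk between companions of invertible arrows given by an invertible square. -/
@[simps]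
def diskIso {m : A ⟶ A'} {n : B ⟶ B'} {s' : Arr B A} {t' : Arr B' A'} (es : acomp s s' = aid A)
    (es' : acomp s' s = aid B) (et : acomp t t' = aid A') (et' : acomp t' t = aid B')
    (φ : Sq m n s t) (φ' : Sq n m s' t') (h : scomp φ φ' es et = sid m rfl rfl)
    (h' : scomp φ' φ es' et' = sid n rfl rfl) : m ≫ ht.pro ≅ hs.pro ≫ n where
  hom := disk hs ht φ
  inv := diskInv hs ht es et' φ'
  hom_inv_id := by
    have e : (show 𝟙 A ≫ m ≫ ht.pro ⟶ hs.pro ≫ n ≫ 𝟙 B' from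
        pcomp hs.unit (pcomp φ ht.counit)) ≫ (show hs.pro ≫ n ≫ 𝟙 B' ⟶ 𝟙 A ≫ m ≫ ht.pro from
      pcomp (scomp hs.counit (unitSq s') es (aid_acomp s'))
        (pcomp φ' (scomp (unitSq t') ht.unit (acomp_aid t') et'))) = 𝟙 _ := by
      refine (pcomp_scomp' _ _ _ _ _ es (aid_acomp _)).trans ?_
      rw [pcomp_scomp' _ _ _ _ _ et (aid_acomp _), h, unit_counit_inv, counit_inv_unit ht et et',
        pcomp_sid, pcomp_sid]
      rfl
    unfold disk diskInv
    simp only [Category.assoc, whiskerLeft_hom_inv_assoc]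
    rw [reassoc_of% e, Iso.inv_hom_id]
  inv_hom_id := by
    have e : (show hs.pro ≫ n ≫ 𝟙 B' ⟶ 𝟙 A ≫ m ≫ ht.pro from
      pcomp (scomp hs.counit (unitSq s') es (aid_acomp s'))
        (pcomp φ' (scomp (unitSq t') ht.unit (acomp_aid t') et'))) ≫
        (show 𝟙 A ≫ m ≫ ht.pro ⟶ hs.pro ≫ n ≫ 𝟙 B' from
        pcomp hs.unit (pcomp φ ht.counit)) = 𝟙 _ := by
      refine (pcomp_scomp' _ _ _ _ _ es' (aid_acomp _)).trans ?_
      rw [pcomp_scomp' _ _ _ _ _ et' (aid_acomp _), h',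
        scomp_scomp _ _ _ _ _ _ _ (acomp_aid s') es' es (aid_acomp _), counit_inv_unit hs es es',
        scomp_scomp _ _ _ _ _ _ _ (aid_acomp t) (acomp_aid t) et' et', ht.unit_counit,
        unitSq_scomp_unitSq, unitSq_aid, pcomp_sid, pcomp_sid]
      rfl
    unfold disk diskInv
    simp only [Category.assoc, Iso.hom_inv_id_assoc]
    rw [reassoc_of% e, ← Bicategory.whiskerLeft_comp, Iso.inv_hom_id, Bicategory.whiskerLeft_id]

/-- A companion disk is a unit, a square and a counit side by side, and each factor is natural: by
`unit_sq`, by `hφ` and by `sq_counit`. Naturality of the coherence disks for squares reduces to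
this. -/
theorem diskNat_disk {A₂ B₂ A₂' B₂' : C} {s₂ : Arr A₂ B₂} {t₂ : Arr A₂' B₂'} (hs₂ : Companion s₂)
    (ht₂ : Companion t₂) {m : A ⟶ A'} {n : B ⟶ B'} {m₂ : A₂ ⟶ A₂'} {n₂ : B₂ ⟶ B₂'}
    {f : Arr A A₂} {g : Arr A' A₂'} {h : Arr B B₂} {k : Arr B' B₂'} {μ : Sq m m₂ f g}
    {ν : Sq n n₂ h k} {φ : Sq m n s t} {φ₂ : Sq m₂ n₂ s₂ t₂} (e : acomp f s₂ = acomp s h)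
    (e' : acomp g t₂ = acomp t k) (hφ : scomp μ φ₂ e e' = scomp φ ν rfl rfl) :
    DiskNat (pcomp μ (sq ht ht₂ e')) (pcomp (sq hs hs₂ e) ν) (disk hs ht φ) (disk hs₂ ht₂ φ₂) := by
  refine DiskNat.comp (ψ := pcomp (unitSq f) (pcomp μ (sq ht ht₂ e')))
    (DiskNat.inv (d := λ_ (m ≫ ht.pro)) (e := λ_ (m₂ ≫ ht₂.pro))
      (unitSq_pcomp (pcomp μ (sq ht ht₂ e')))) ?_
  refine DiskNat.comp (ψ := pcomp (sq hs hs₂ e) (pcomp ν (unitSq k))) ?_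
    (DiskNat.whiskerLeft (pcomp_unitSq ν) _)
  unfold DiskNat
  rw [pcomp_scomp' _ _ _ _ _ e (acomp_aid _), pcomp_scomp' _ _ _ _ _ e' (acomp_aid _),
    pcomp_scomp' _ _ _ _ _ rfl (aid_acomp _), pcomp_scomp' _ _ _ _ _ rfl (aid_acomp _),
    unit_sq, sq_counit, hφ]

end

end Companion

end DoubleCategory

namespace DoubleCategory

/-! ### Functors and sliding cells -/

section Bicat

universe u₁ v₁ w₁

variable {B : Type u₁} [Bicategory.{w₁, v₁} B]

/-- The cell which slides `p` past a unit. -/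
def slideRight {a b : B} (p : a ⟶ b) : p ≫ 𝟙 b ⟶ 𝟙 a ≫ p := (ρ_ p).hom ≫ (λ_ p).inv

/-- The cell which slides a unit past `t`. -/
def slideLeft {a b : B} (t : a ⟶ b) : 𝟙 a ≫ t ⟶ t ≫ 𝟙 b := (λ_ t).hom ≫ (ρ_ t).inv

theorem slideRight_comp {a b c : B} (p : a ⟶ b) (p' : b ⟶ c) :
    slideRight (p ≫ p') = slideP (slideRight p) (slideRight p') := by
  unfold slideRight slideP; bicategory

theorem slideLeft_comp {a b c : B} (t : a ⟶ b) (s : b ⟶ c) :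
    slideLeft (t ≫ s) = slideT (slideLeft t) (slideLeft s) := by
  unfold slideLeft slideT; bicategory

theorem slideNat_slideLeft_unit {a b : B} (t : a ⟶ b) :
    SlideNat (slideLeft t) (slideP (slideLeft t) (slideLeft t)) (λ_ (𝟙 a)).inv (λ_ (𝟙 b)).inv := by
  unfold SlideNat slideLeft slideP; bicategory

theorem slideNatT_slideRight_unit {a b : B} (p : a ⟶ b) :
    SlideNatT (slideRight p) (slideT (slideRight p) (slideRight p)) (λ_ (𝟙 a)).inv
      (λ_ (𝟙 b)).inv := by
  unfold SlideNatT slideRight slideT; bicategory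

theorem slideRight_natural {a b : B} {p q : a ⟶ b} (x : p ⟶ q) :
    SlideNat (slideRight p) (slideRight q) x x := by
  unfold SlideNat slideRight; simp

theorem slideLeft_natural {a b : B} {p q : a ⟶ b} (x : p ⟶ q) :
    SlideNatT (slideLeft p) (slideLeft q) x x := by
  unfold SlideNatT slideLeft; simp

theorem SlideNat.refl {a b a' b' : B} {p : a ⟶ b} {q : a' ⟶ b'} {t : a ⟶ a'} {t' : b ⟶ b'}
    (θ : p ≫ t' ⟶ t ≫ q) : SlideNat θ θ (𝟙 p) (𝟙 q) := by
  unfold SlideNat; simp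

theorem SlideNatT.refl {a b a' b' : B} {p : a ⟶ b} {q : a' ⟶ b'} {t : a ⟶ a'} {t' : b ⟶ b'}
    (θ : p ≫ t' ⟶ t ≫ q) : SlideNatT θ θ (𝟙 t) (𝟙 t') := by
  unfold SlideNatT; simp

end Bicat

universe u' v' w' x' u'' v'' w'' x''

variable {C : Type u} [DoubleCategory.{u, v, w, x} C]
  {D : Type u'} [DoubleCategory.{u', v', w', x'} D]
  {E : Type u''} [DoubleCategory.{u'', v'', w'', x''} E]

namespace DFunctor

/-- The action of a functor on a disk between composites. -/
def slide (P : DFunctor C D) {a b c d : C} {p : a ⟶ b} {t' : b ⟶ d} {t : a ⟶ c} {q : c ⟶ d}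
    (θ : p ≫ t' ⟶ t ≫ q) : P.pmap p ≫ P.pmap t' ⟶ P.pmap t ≫ P.pmap q :=
  (P.mapComp p t').inv ≫ P.dmap θ ≫ (P.mapComp t q).hom

theorem slide_comp (P : DFunctor C D) {a b c d e : C} {p : a ⟶ b} {t' : b ⟶ d} {t : a ⟶ c}
    {q : c ⟶ d} {s : a ⟶ e} {r : e ⟶ d} (θ : p ≫ t' ⟶ t ≫ q) (κ : t ≫ q ⟶ s ≫ r) :
    P.slide (θ ≫ κ) = P.slide θ ≫ P.slide κ := by
  unfold slide
  simp [PreFunctor.dmap_comp]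

theorem slide_id (P : DFunctor C D) {a b d : C} (p : a ⟶ b) (t' : b ⟶ d) :
    P.slide (𝟙 (p ≫ t')) = 𝟙 _ := by
  unfold slide
  simp [PreFunctor.dmap_id]

/-- The action of a functor on an invertible disk between composites. -/
@[simps]
def slideIso (P : DFunctor C D) {a b c d : C} {p : a ⟶ b} {t' : b ⟶ d} {t : a ⟶ c} {q : c ⟶ d}
    (θ : p ≫ t' ≅ t ≫ q) : P.pmap p ≫ P.pmap t' ≅ P.pmap t ≫ P.pmap q where
  hom := P.slide θ.hom
  inv := P.slide θ.inv
  hom_inv_id := by rw [← slide_comp, θ.hom_inv_id, slide_id]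
  inv_hom_id := by rw [← slide_comp, θ.inv_hom_id, slide_id]

variable (P : DFunctor C D)

theorem slideNat_slide {a b a' b' : C} {p p₂ : a ⟶ b} {q q₂ : a' ⟶ b'} {t : a ⟶ a'} {t' : b ⟶ b'}
    {θ : p ≫ t' ⟶ t ≫ q} {θ₂ : p₂ ≫ t' ⟶ t ≫ q₂} {x : p ⟶ p₂} {y : q ⟶ q₂}
    (h : SlideNat θ θ₂ x y) : SlideNat (P.slide θ) (P.slide θ₂) (P.dmap x) (P.dmap y) := by
  have h' := congrArg P.dmap h
  unfold SlideNat slide at *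
  rw [PreFunctor.dmap_comp, PreFunctor.dmap_comp, dmap_whiskerLeft, dmap_whiskerRight] at h'
  rw [← cancel_epi (P.mapComp p t').hom, ← cancel_mono (P.mapComp t q₂).inv]
  simpa using h'

theorem slideNatT_slide {a b a' b' : C} {p : a ⟶ b} {q : a' ⟶ b'} {t t₂ : a ⟶ a'}
    {t' t₂' : b ⟶ b'} {θ : p ≫ t' ⟶ t ≫ q} {θ₂ : p ≫ t₂' ⟶ t₂ ≫ q} {x : t ⟶ t₂} {y : t' ⟶ t₂'}
    (h : SlideNatT θ θ₂ x y) : SlideNatT (P.slide θ) (P.slide θ₂) (P.dmap x) (P.dmap y) := by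
  have h' := congrArg P.dmap h
  unfold SlideNatT slide at *
  rw [PreFunctor.dmap_comp, PreFunctor.dmap_comp, dmap_whiskerLeft, dmap_whiskerRight] at h'
  rw [← cancel_epi (P.mapComp p t').hom, ← cancel_mono (P.mapComp t₂ q).inv]
  simpa using h'

/-- This is the associativity law of the comparison disks: after unfolding, the inner comparisons
cancel in pairs. A functor therefore carries pasted sliding cells to pasted sliding cells, up to
`mapComp`. -/
theorem slideNat_slide_slideP {a b c a' b' c' : C} {p : a ⟶ b} {p' : b ⟶ c} {t : a ⟶ a'}
    {t' : b ⟶ b'} {t'' : c ⟶ c'} {q : a' ⟶ b'} {q' : b' ⟶ c'} (θ : p ≫ t' ⟶ t ≫ q)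
    (θ' : p' ≫ t'' ⟶ t' ≫ q') :
    SlideNat (P.slide (slideP θ θ')) (slideP (P.slide θ) (P.slide θ')) (P.mapComp p p').hom
      (P.mapComp q q').hom := by
  unfold SlideNat slide slideP
  simp only [PreFunctor.dmap_comp, dmap_whiskerLeft, dmap_whiskerRight, dmap_associator_inv,
    DFunctor.dmap_associator, Bicategory.whiskerLeft_comp, comp_whiskerRight, Category.assoc,
    Iso.inv_hom_id_assoc, Iso.inv_hom_id, whiskerLeft_inv_hom, Category.comp_id]

theorem slideNatT_slide_slideT {a b a' b' a'' b'' : C} {p : a ⟶ b} {q : a' ⟶ b'} {r : a'' ⟶ b''}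
    {t : a ⟶ a'} {t' : b ⟶ b'} {s : a' ⟶ a''} {s' : b' ⟶ b''} (θ : p ≫ t' ⟶ t ≫ q)
    (κ : q ≫ s' ⟶ s ≫ r) :
    SlideNatT (P.slide (slideT θ κ)) (slideT (P.slide θ) (P.slide κ)) (P.mapComp t s).hom
      (P.mapComp t' s').hom := by
  unfold SlideNatT slide slideT
  simp only [PreFunctor.dmap_comp, dmap_whiskerLeft, dmap_whiskerRight, dmap_associator_inv,
    DFunctor.dmap_associator, Bicategory.whiskerLeft_comp, comp_whiskerRight, Category.assoc,
    Iso.inv_hom_id_assoc, Iso.inv_hom_id, inv_hom_whiskerRight, Category.comp_id]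

/-- The same cancellation of inner comparisons; it is what allows the turning laws to be tensored
with an object. -/
theorem slide_cupPaste {a b c d f k g : C} {mX : a ⟶ b} {nX : b ⟶ c} {nY : b ⟶ d} {nY' : a ⟶ f}
    {mX' : f ⟶ d} {mY : f ⟶ k} {e'' : c ⟶ g} {e' : d ⟶ g} {e : k ⟶ g} (κm : mX' ≫ e' ⟶ mY ≫ e)
    (κn : nX ≫ e'' ⟶ nY ≫ e') (σ : mX ≫ nY ⟶ nY' ≫ mX') :
    P.slide (cupPaste κm κn σ) ≫ (P.mapComp nY' mY).hom ▷ P.pmap e =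
      (P.mapComp mX nX).hom ▷ P.pmap e'' ≫ cupPaste (P.slide κm) (P.slide κn) (P.slide σ) := by
  unfold slide cupPaste
  simp only [PreFunctor.dmap_comp, dmap_whiskerLeft, dmap_whiskerRight, dmap_associator_inv,
    DFunctor.dmap_associator, Bicategory.whiskerLeft_comp, comp_whiskerRight, Category.assoc,
    Iso.inv_hom_id_assoc, Iso.inv_hom_id, inv_hom_whiskerRight, Category.comp_id]

theorem slide_capPaste {a b c d k l o : C} {nY : a ⟶ b} {mY : b ⟶ c} {nZ : d ⟶ b} {mY' : d ⟶ k}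
    {nZ' : k ⟶ c} {mZ : l ⟶ k} {h'' : o ⟶ a} {h' : o ⟶ d} {h : o ⟶ l} (κm : h' ≫ mY' ⟶ h ≫ mZ)
    (κn : h'' ≫ nY ⟶ h' ≫ nZ) (τ : nZ ≫ mY ⟶ mY' ≫ nZ') :
    P.slide (capPaste κm κn τ) ≫ P.pmap h ◁ (P.mapComp mZ nZ').hom =
      P.pmap h'' ◁ (P.mapComp nY mY).hom ≫ capPaste (P.slide κm) (P.slide κn) (P.slide τ) := by
  unfold slide capPaste
  simp only [PreFunctor.dmap_comp, dmap_whiskerLeft, dmap_whiskerRight, dmap_associator_inv,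
    DFunctor.dmap_associator, Bicategory.whiskerLeft_comp, comp_whiskerRight, Category.assoc,
    Iso.inv_hom_id_assoc, Iso.inv_hom_id, whiskerLeft_inv_hom, Category.comp_id]

theorem dmap_rightUnitor_inv {a b : C} (p : a ⟶ b) :
    P.dmap (ρ_ p).inv = (ρ_ (P.pmap p)).inv ≫ P.pmap p ◁ (P.mapId b).inv ≫
      (P.mapComp p (𝟙 b)).inv := by
  have h : P.dmapIso (ρ_ p) = P.mapComp p (𝟙 b) ≪≫ whiskerLeftIso (P.pmap p) (P.mapId b) ≪≫
    ρ_ (P.pmap p) := Iso.ext (P.dmap_rightUnitor p)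
  simpa using congrArg Iso.inv h

theorem dmap_leftUnitor_inv {a b : C} (p : a ⟶ b) :
    P.dmap (λ_ p).inv = (λ_ (P.pmap p)).inv ≫ (P.mapId a).inv ▷ P.pmap p ≫
      (P.mapComp (𝟙 a) p).inv := by
  have h : P.dmapIso (λ_ p) = P.mapComp (𝟙 a) p ≪≫ whiskerRightIso (P.mapId a) (P.pmap p) ≪≫
    λ_ (P.pmap p) := Iso.ext (P.dmap_leftUnitor p)
  simpa using congrArg Iso.inv h

theorem slideNatT_slide_slideRight {a b : C} (p : a ⟶ b) :
    SlideNatT (P.slide (slideRight p)) (slideRight (P.pmap p)) (P.mapId a).hom (P.mapId b).hom := by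
  unfold SlideNatT slide slideRight
  rw [PreFunctor.dmap_comp, dmap_leftUnitor_inv, DFunctor.dmap_rightUnitor]
  simp

theorem slideNat_slide_slideLeft {a b : C} (t : a ⟶ b) :
    SlideNat (P.slide (slideLeft t)) (slideLeft (P.pmap t)) (P.mapId a).hom (P.mapId b).hom := by
  unfold SlideNat slide slideLeft
  rw [PreFunctor.dmap_comp, dmap_rightUnitor_inv, DFunctor.dmap_leftUnitor]
  simp

theorem mapId_comp_mapId (a : C) :
    (λ_ (𝟙 (P.obj a))).inv ≫ (P.mapId a).inv ▷ 𝟙 (P.obj a) ≫ P.pmap (𝟙 a) ◁ (P.mapId a).inv =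
      (P.mapId a).inv ≫ P.dmap (λ_ (𝟙 a)).inv ≫ (P.mapComp (𝟙 a) (𝟙 a)).hom := by
  rw [dmap_leftUnitor_inv, ← whisker_exchange]
  simp

theorem comp_slide (P : DFunctor C D) (Q : DFunctor D E) {a b c d : C} {p : a ⟶ b} {t' : b ⟶ d}
    {t : a ⟶ c} {q : c ⟶ d} (θ : p ≫ t' ⟶ t ≫ q) : (P.comp Q).slide θ = Q.slide (P.slide θ) := by
  have h₁ : ((P.comp Q).mapComp p t').inv = (Q.mapComp _ _).inv ≫ Q.dmap (P.mapComp p t').inv := rfl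
  have h₂ : ((P.comp Q).mapComp t q).hom = Q.dmap (P.mapComp t q).hom ≫ (Q.mapComp _ _).hom := rfl
  have h₃ : (P.comp Q).dmap θ = Q.dmap (P.dmap θ) := PreFunctor.comp_dmap _ _ θ
  unfold slide
  rw [h₁, h₂, h₃, PreFunctor.dmap_comp, PreFunctor.dmap_comp]
  simp only [Category.assoc]
  exact Category.assoc _ _ _

theorem diskNat_slide {a b a' b' c d c' d' : C} {p : a ⟶ b} {q : a' ⟶ b'} {t : a ⟶ a'}
    {t' : b ⟶ b'} {p₂ : c ⟶ d} {q₂ : c' ⟶ d'} {t₂ : c ⟶ c'} {t₂' : d ⟶ d'} {θ : p ≫ t' ⟶ t ≫ q}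
    {θ₂ : p₂ ≫ t₂' ⟶ t₂ ≫ q₂} {f : Arr a c} {g : Arr b d} {f' : Arr a' c'} {g' : Arr b' d'}
    {φ : Sq p p₂ f g} {ψ : Sq q q₂ f' g'} {τ : Sq t t₂ f f'} {τ' : Sq t' t₂' g g'}
    (h : DiskNat (pcomp φ τ') (pcomp τ ψ) θ θ₂) :
    DiskNat (pcomp (P.smap φ) (P.smap τ')) (pcomp (P.smap τ) (P.smap ψ)) (P.slide θ) (P.slide θ₂) :=
  (DiskNat.inv (P.mapComp_naturality φ τ')).comp ((h.dmap P).comp (P.mapComp_naturality τ ψ))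

end DFunctor

theorem ArrNat.diskNat_dmap {P Q : DFunctor C D} (t : ArrNat P Q) {a b : C} {p r : a ⟶ b}
    (θ : p ⟶ r) : DiskNat (t.appSq p) (t.appSq r) (P.dmap θ) (Q.dmap θ) := by
  -- A functor sends identity arrows to identities only up to an equation, so the naturality law is
  -- transported before it can be read as one about disks.
  have h := congrArg (scast (show _ = t.app a by rw [Q.amap_aid, acomp_aid])
    (show _ = t.app b by rw [Q.amap_aid, acomp_aid]))
    (t.sq_naturality θ).symm
  rw [scast_of_scomp, scast_of_scomp] at h
  unfold DiskNat PreFunctor.dmap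
  rwa [scomp_scast, scast_scomp]

theorem ArrNat.diskNat_slide {P Q : DFunctor C D} (t : ArrNat P Q) {a b c d : C} {p : a ⟶ b}
    {r : b ⟶ d} {s : a ⟶ c} {q : c ⟶ d} (θ : p ≫ r ⟶ s ≫ q) :
    DiskNat (pcomp (t.appSq p) (t.appSq r)) (pcomp (t.appSq s) (t.appSq q)) (P.slide θ)
      (Q.slide θ) :=
  (DiskNat.inv (d := P.mapComp p r) (e := Q.mapComp p r) (t.appSq_comp p r)).comp
    ((t.diskNat_dmap θ).comp (t.appSq_comp s q))

theorem ArrNat.diskNat_comp {P Q : DFunctor C D} (t : ArrNat P Q) {a b c : C} {p : a ⟶ b}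
    {r : b ⟶ c} {s : a ⟶ c} (θ : s ⟶ p ≫ r) :
    DiskNat (t.appSq s) (pcomp (t.appSq p) (t.appSq r)) (P.dmap θ ≫ (P.mapComp p r).hom)
      (Q.dmap θ ≫ (Q.mapComp p r).hom) :=
  (t.diskNat_dmap θ).comp (t.appSq_comp p r)

end DoubleCategory

namespace DoubleCategory

open MonoidalData

/-! ### The tensor product of disks -/

section Tensor

universe u' v' w' x' u'' v'' w'' x''

variable {C : Type u} [DoubleCategory.{u, v, w, x} C] {D : Type u'} [DoubleCategory.{u', v', w', x'} D]
  {E : Type u''} [DoubleCategory.{u'', v'', w'', x''} E]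

theorem DFunctor.pair_dmap (P : DFunctor C D) (Q : DFunctor C E) {a b : C} {m n : a ⟶ b}
    (d : m ⟶ n) : (P.pair Q).dmap d = (P.dmap d, Q.dmap d) := by
  rw [PreFunctor.dmap, scast_prod]
  rfl

theorem SlideNat.symm {a b a' b' : C} {p p₂ : a ⟶ b} {q q₂ : a' ⟶ b'} {t : a ⟶ a'}
    {t' : b ⟶ b'} {θ : p ≫ t' ⟶ t ≫ q} {θ₂ : p₂ ≫ t' ⟶ t ≫ q₂}
    {x : p ≅ p₂} {y : q ≅ q₂} (h : SlideNat θ θ₂ x.hom y.hom) :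
    SlideNat θ₂ θ x.inv y.inv := by
  unfold SlideNat at *
  rw [← cancel_epi (x.hom ▷ t'), ← reassoc_of% h]
  simp

theorem diskNat_slideRight {a b a' b' : C} {p : a ⟶ b} {q : a' ⟶ b'} {f : Arr a a'} {g : Arr b b'}
    (φ : Sq p q f g) : DiskNat (pcomp φ (unitSq g)) (pcomp (unitSq f) φ) (slideRight p)
      (slideRight q) :=
  DiskNat.comp (pcomp_unitSq φ) (DiskNat.inv (d := λ_ p) (e := λ_ q) (unitSq_pcomp φ))

theorem diskNat_slideLeft {a b a' b' : C} {p : a ⟶ b} {q : a' ⟶ b'} {f : Arr a a'} {g : Arr b b'}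
    (φ : Sq p q f g) : DiskNat (pcomp (unitSq f) φ) (pcomp φ (unitSq g)) (slideLeft p)
      (slideLeft q) :=
  DiskNat.comp (unitSq_pcomp φ) (DiskNat.inv (d := ρ_ p) (e := ρ_ q) (pcomp_unitSq φ))

variable [MonoidalData C]

variable (C) in
/-- The functor tensoring with an object on the right. -/
def tensorRight (X : C) : DFunctor C C :=
  ((DFunctor.id C).pair (DFunctor.const C X)).comp tensor

variable (C) in
/-- The functor tensoring with an object on the left. -/
def tensorLeft (X : C) : DFunctor C C :=
  ((DFunctor.const C X).pair (DFunctor.id C)).comp tensor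

theorem disk_comp {A B A' B' : C} {m m' m'' : A ⟶ A'} {n n' n'' : B ⟶ B'} (d : m ⟶ m')
    (e : n ⟶ n') (d' : m' ⟶ m'') (e' : n' ⟶ n'') :
    disk d e ≫ disk d' e' = disk (d ≫ d') (e ≫ e') :=
  ((tensor (C := C)).dmap_comp (A := ⟨A, B⟩) (B := ⟨A', B'⟩) (m := (m, n)) (n := (m', n'))
    (p := (m'', n'')) (d, e) (d', e')).symm

theorem disk_comp_assoc {A B A' B' : C} {m m' m'' : A ⟶ A'} {n n' n'' : B ⟶ B'} (d : m ⟶ m')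
    (e : n ⟶ n') (d' : m' ⟶ m'') (e' : n' ⟶ n'') {p : A ⊗ₒ B ⟶ A' ⊗ₒ B'} (h : m'' ⊗ₚ n'' ⟶ p) :
    disk d e ≫ disk d' e' ≫ h = disk (d ≫ d') (e ≫ e') ≫ h := by
  rw [← Category.assoc, disk_comp]

theorem disk_id {A B A' B' : C} (m : A ⟶ A') (n : B ⟶ B') : disk (𝟙 m) (𝟙 n) = 𝟙 (m ⊗ₚ n) :=
  (tensor (C := C)).dmap_id (A := ⟨A, B⟩) (B := ⟨A', B'⟩) (m, n)

theorem tensorRight_dmap (X : C) {a b : C} {m n : a ⟶ b} (d : m ⟶ n) :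
    (tensorRight C X).dmap d = disk d (𝟙 (𝟙 X)) := by
  refine (PreFunctor.comp_dmap _ _ d).trans ?_
  rw [DFunctor.pair_dmap]
  rfl

theorem tensorLeft_dmap (X : C) {a b : C} {m n : a ⟶ b} (d : m ⟶ n) :
    (tensorLeft C X).dmap d = disk (𝟙 (𝟙 X)) d := by
  refine (PreFunctor.comp_dmap _ _ d).trans ?_
  rw [DFunctor.pair_dmap]
  rfl

/-- The comparison disk for the tensor product of a composite with an object on the right. -/
def rightComp {a b c : C} (m : a ⟶ b) (n : b ⟶ c) (X : C) :
    (m ≫ n) ⊗ₚ 𝟙 X ≅ (m ⊗ₚ 𝟙 X) ≫ (n ⊗ₚ 𝟙 X) :=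
  (tensorRight C X).mapComp m n

/-- The comparison disk for the tensor product of a composite with an object on the left. -/
def leftComp (X : C) {a b c : C} (m : a ⟶ b) (n : b ⟶ c) :
    𝟙 X ⊗ₚ (m ≫ n) ≅ (𝟙 X ⊗ₚ m) ≫ (𝟙 X ⊗ₚ n) :=
  (tensorLeft C X).mapComp m n

/-- The tensor product of disks between composites. -/
def diskSlide {a b c d a' b' c' d' : C} {p : a ⟶ b} {t' : b ⟶ d} {t : a ⟶ c} {q : c ⟶ d}
    {p₂ : a' ⟶ b'} {t₂' : b' ⟶ d'} {t₂ : a' ⟶ c'} {q₂ : c' ⟶ d'} (θ : p ≫ t' ⟶ t ≫ q)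
    (κ : p₂ ≫ t₂' ⟶ t₂ ≫ q₂) : (p ⊗ₚ p₂) ≫ (t' ⊗ₚ t₂') ⟶ (t ⊗ₚ t₂) ≫ (q ⊗ₚ q₂) :=
  (tensor (C := C)).slide (a := ⟨a, a'⟩) (b := ⟨b, b'⟩) (c := ⟨c, c'⟩) (d := ⟨d, d'⟩)
    (p := (p, p₂)) (t' := (t', t₂')) (t := (t, t₂)) (q := (q, q₂)) (θ, κ)

theorem diskSlide_eq {a b c d a' b' c' d' : C} {p : a ⟶ b} {t' : b ⟶ d} {t : a ⟶ c} {q : c ⟶ d}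
    {p₂ : a' ⟶ b'} {t₂' : b' ⟶ d'} {t₂ : a' ⟶ c'} {q₂ : c' ⟶ d'} (θ : p ≫ t' ⟶ t ≫ q)
    (κ : p₂ ≫ t₂' ⟶ t₂ ≫ q₂) :
    diskSlide θ κ = (compIso p t' p₂ t₂').inv ≫ disk θ κ ≫ (compIso t q t₂ q₂).hom := rfl

theorem slideNat_diskSlide {a b c d a' b' c' d' : C} {p r : a ⟶ b} {t' : b ⟶ d} {t : a ⟶ c}
    {q s : c ⟶ d} {p₂ r₂ : a' ⟶ b'} {t₂' : b' ⟶ d'} {t₂ : a' ⟶ c'} {q₂ s₂ : c' ⟶ d'}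
    {θ : p ≫ t' ⟶ t ≫ q} {θ₂ : r ≫ t' ⟶ t ≫ s} {κ : p₂ ≫ t₂' ⟶ t₂ ≫ q₂}
    {κ₂ : r₂ ≫ t₂' ⟶ t₂ ≫ s₂} {x : p ⟶ r} {y : q ⟶ s} {x₂ : p₂ ⟶ r₂} {y₂ : q₂ ⟶ s₂}
    (h : SlideNat θ θ₂ x y) (h₂ : SlideNat κ κ₂ x₂ y₂) :
    SlideNat (diskSlide θ κ) (diskSlide θ₂ κ₂) (disk x x₂) (disk y y₂) :=
  (tensor (C := C)).slideNat_slide (a := ⟨a, a'⟩) (b := ⟨b, b'⟩) (a' := ⟨c, c'⟩) (b' := ⟨d, d'⟩)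
    (p := (p, p₂)) (p₂ := (r, r₂)) (q := (q, q₂)) (q₂ := (s, s₂)) (t := (t, t₂)) (t' := (t', t₂'))
    (θ := (θ, κ)) (θ₂ := (θ₂, κ₂)) (x := (x, x₂)) (y := (y, y₂)) (Prod.ext h h₂)

theorem slideNatT_diskSlide {a b c d a' b' c' d' : C} {p : a ⟶ b} {t' s' : b ⟶ d} {t s : a ⟶ c}
    {q : c ⟶ d} {p₂ : a' ⟶ b'} {t₂' s₂' : b' ⟶ d'} {t₂ s₂ : a' ⟶ c'} {q₂ : c' ⟶ d'}
    {θ : p ≫ t' ⟶ t ≫ q} {θ₂ : p ≫ s' ⟶ s ≫ q} {κ : p₂ ≫ t₂' ⟶ t₂ ≫ q₂}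
    {κ₂ : p₂ ≫ s₂' ⟶ s₂ ≫ q₂} {x : t ⟶ s} {y : t' ⟶ s'} {x₂ : t₂ ⟶ s₂} {y₂ : t₂' ⟶ s₂'}
    (h : SlideNatT θ θ₂ x y) (h₂ : SlideNatT κ κ₂ x₂ y₂) :
    SlideNatT (diskSlide θ κ) (diskSlide θ₂ κ₂) (disk x x₂) (disk y y₂) :=
  (tensor (C := C)).slideNatT_slide (a := ⟨a, a'⟩) (b := ⟨b, b'⟩) (a' := ⟨c, c'⟩) (b' := ⟨d, d'⟩)
    (p := (p, p₂)) (q := (q, q₂)) (t := (t, t₂)) (t₂ := (s, s₂)) (t' := (t', t₂'))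
    (t₂' := (s', s₂')) (θ := (θ, κ)) (θ₂ := (θ₂, κ₂)) (x := (x, x₂)) (y := (y, y₂)) (Prod.ext h h₂)

theorem slideNat_diskSlide_slideP {a b c a' b' c' d e f d' e' f' : C} {p : a ⟶ b} {p' : b ⟶ c}
    {t : a ⟶ a'} {t' : b ⟶ b'} {t'' : c ⟶ c'} {q : a' ⟶ b'} {q' : b' ⟶ c'}
    (θ : p ≫ t' ⟶ t ≫ q) (θ' : p' ≫ t'' ⟶ t' ≫ q') {r : d ⟶ e} {r' : e ⟶ f} {s : d ⟶ d'}
    {s' : e ⟶ e'} {s'' : f ⟶ f'} {o : d' ⟶ e'} {o' : e' ⟶ f'} (κ : r ≫ s' ⟶ s ≫ o)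
    (κ' : r' ≫ s'' ⟶ s' ≫ o') :
    SlideNat (diskSlide (slideP θ θ') (slideP κ κ')) (slideP (diskSlide θ κ) (diskSlide θ' κ'))
      (compIso p p' r r').hom (compIso q q' o o').hom :=
  (tensor (C := C)).slideNat_slide_slideP
    (a := ⟨a, d⟩) (b := ⟨b, e⟩) (c := ⟨c, f⟩) (a' := ⟨a', d'⟩) (b' := ⟨b', e'⟩) (c' := ⟨c', f'⟩)
    (p := (p, r)) (p' := (p', r')) (q := (q, o)) (q' := (q', o')) (t := (t, s))
    (t' := (t', s')) (t'' := (t'', s'')) (θ, κ) (θ', κ')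

theorem slideNatT_diskSlide_slideT {a b a' b' a'' b'' c d c' d' c'' d'' : C} {p : a ⟶ b}
    {q : a' ⟶ b'} {r : a'' ⟶ b''} {t : a ⟶ a'} {t' : b ⟶ b'} {s : a' ⟶ a''} {s' : b' ⟶ b''}
    (θ : p ≫ t' ⟶ t ≫ q) (κ : q ≫ s' ⟶ s ≫ r) {p₂ : c ⟶ d}
    {q₂ : c' ⟶ d'} {r₂ : c'' ⟶ d''} {t₂ : c ⟶ c'} {t₂' : d ⟶ d'} {s₂ : c' ⟶ c''} {s₂' : d' ⟶ d''}
    (θ₂ : p₂ ≫ t₂' ⟶ t₂ ≫ q₂) (κ₂ : q₂ ≫ s₂' ⟶ s₂ ≫ r₂) :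
    SlideNatT (diskSlide (slideT θ κ) (slideT θ₂ κ₂)) (slideT (diskSlide θ θ₂) (diskSlide κ κ₂))
      (compIso t s t₂ s₂).hom (compIso t' s' t₂' s₂').hom :=
  (tensor (C := C)).slideNatT_slide_slideT
    (a := ⟨a, c⟩) (b := ⟨b, d⟩) (a' := ⟨a', c'⟩) (b' := ⟨b', d'⟩) (a'' := ⟨a'', c''⟩)
    (b'' := ⟨b'', d''⟩) (p := (p, p₂)) (q := (q, q₂)) (r := (r, r₂)) (t := (t, t₂))
    (t' := (t', t₂')) (s := (s, s₂)) (s' := (s', s₂')) (θ, θ₂) (κ, κ₂)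

/-- Seeing the interchanger as the tensor product of two unit slides, of `m` past a unit and of a
unit past `n`, reduces its laws to those of unit slides and to functoriality of the tensor product.
-/
theorem interchanger_hom {A B A' B' : C} (m : A ⟶ B) (n : A' ⟶ B') :
    (interchanger m n).hom = diskSlide (slideRight m) (slideLeft n) := by
  rw [diskSlide_eq, slideRight, slideLeft, ← disk_comp, Category.assoc]
  rfl

theorem tensorObj_eq_diskSlide {A B B' E : C} {m : A ⟶ B} {n : B ⟶ E} {m' : A ⟶ B'} {n' : B' ⟶ E}
    (d : m ≫ n ⟶ m' ≫ n') (X : C) : tensorObj d X = diskSlide d (𝟙 (𝟙 X ≫ 𝟙 X)) := rfl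

theorem objTensor_eq_diskSlide (X : C) {A B B' E : C} {m : A ⟶ B} {n : B ⟶ E} {m' : A ⟶ B'}
    {n' : B' ⟶ E} (d : m ≫ n ⟶ m' ≫ n') : objTensor X d = diskSlide (𝟙 (𝟙 X ≫ 𝟙 X)) d := rfl

theorem tensorRight_slide (X : C) {A B B' E : C} {m : A ⟶ B} {n : B ⟶ E} {m' : A ⟶ B'}
    {n' : B' ⟶ E} (d : m ≫ n ⟶ m' ≫ n') : (tensorRight C X).slide d = tensorObj d X := by
  refine (congrArg (fun k => ((tensorRight C X).mapComp m n).inv ≫ k ≫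
    ((tensorRight C X).mapComp m' n').hom) (tensorRight_dmap X d)).trans ?_
  -- The constant factor of `tensorRight` contributes a unitor of `𝟙 X` before `d` and its inverse
  -- after `d`; they cancel.
  change ((compIso m n (𝟙 X) (𝟙 X)).inv ≫ disk (𝟙 (m ≫ n)) (λ_ (𝟙 X)).hom) ≫
    disk d (𝟙 (𝟙 X)) ≫ disk (𝟙 (m' ≫ n')) (λ_ (𝟙 X)).inv ≫
      (compIso m' n' (𝟙 X) (𝟙 X)).hom = _
  rw [Category.assoc, disk_comp_assoc, disk_comp_assoc]
  simp [tensorObj]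

theorem tensorLeft_slide (X : C) {A B B' E : C} {m : A ⟶ B} {n : B ⟶ E} {m' : A ⟶ B'}
    {n' : B' ⟶ E} (d : m ≫ n ⟶ m' ≫ n') : (tensorLeft C X).slide d = objTensor X d := by
  refine (congrArg (fun k => ((tensorLeft C X).mapComp m n).inv ≫ k ≫
    ((tensorLeft C X).mapComp m' n').hom) (tensorLeft_dmap X d)).trans ?_
  change ((compIso (𝟙 X) (𝟙 X) m n).inv ≫ disk (λ_ (𝟙 X)).hom (𝟙 (m ≫ n))) ≫
    disk (𝟙 (𝟙 X)) d ≫ disk (λ_ (𝟙 X)).inv (𝟙 (m' ≫ n')) ≫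
      (compIso (𝟙 X) (𝟙 X) m' n').hom = _
  rw [Category.assoc, disk_comp_assoc, disk_comp_assoc]
  simp [objTensor]

/-- Splitting `p ≫ p'` requires two slides past `t`; `slideNat_slideLeft_unit` supplies the second
by duplicating the unit strand that accompanies `p`. -/
theorem slideNat_interchanger_comp {a b c a' b' : C} (p : a ⟶ b) (p' : b ⟶ c) (t : a' ⟶ b') :
    SlideNat (interchanger (p ≫ p') t).hom
      (slideP (interchanger p t).hom (interchanger p' t).hom)
      (rightComp p p' a').hom (rightComp p p' b').hom := by
  simp only [interchanger_hom]
  rw [slideRight_comp]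
  exact (slideNat_diskSlide (SlideNat.refl (slideP (slideRight p) (slideRight p')))
    (slideNat_slideLeft_unit t)).trans (slideNat_diskSlide_slideP _ _ _ _)

theorem slideNatT_interchanger_comp {a b a' b' c' : C} (p : a ⟶ b) (t : a' ⟶ b') (s : b' ⟶ c') :
    SlideNatT (interchanger p (t ≫ s)).hom
      (slideT (interchanger p t).hom (interchanger p s).hom)
      (leftComp a t s).hom (leftComp b t s).hom := by
  simp only [interchanger_hom]
  rw [slideLeft_comp]
  exact (slideNatT_diskSlide (slideNatT_slideRight_unit p)
    (SlideNatT.refl (slideT (slideLeft t) (slideLeft s)))).trans (slideNatT_diskSlide_slideT _ _ _ _)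

theorem interchanger_natural_left {a b a' b' : C} {p q : a ⟶ b} (x : p ⟶ q) (t : a' ⟶ b') :
    SlideNat (interchanger p t).hom (interchanger q t).hom (disk x (𝟙 (𝟙 a')))
      (disk x (𝟙 (𝟙 b'))) := by
  simp only [interchanger_hom]
  exact slideNat_diskSlide (slideRight_natural x) (SlideNat.refl _)

theorem interchanger_natural_right {a b a' b' : C} (p : a ⟶ b) {t s : a' ⟶ b'} (y : t ⟶ s) :
    SlideNatT (interchanger p t).hom (interchanger p s).hom (disk (𝟙 (𝟙 a)) y)
      (disk (𝟙 (𝟙 b)) y) := by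
  simp only [interchanger_hom]
  exact slideNatT_diskSlide (SlideNatT.refl _) (slideLeft_natural y)

/-- The interchanger commutes with disks between composites on the right. -/
theorem slideNatT_interchanger_slide {a b a' b' c' d' : C} (p : a ⟶ b) {t : a' ⟶ b'} {s : b' ⟶ d'}
    {t₂ : a' ⟶ c'} {s₂ : c' ⟶ d'} (k : t ≫ s ⟶ t₂ ≫ s₂) :
    SlideNatT (slideT (interchanger p t).hom (interchanger p s).hom)
      (slideT (interchanger p t₂).hom (interchanger p s₂).hom) (objTensor a k) (objTensor b k) := by
  -- Recombine the composite, move `k` across it as a single cell, and split again.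
  have h := (slideNatT_interchanger_comp p t s).symm.trans ((interchanger_natural_right p k).trans
    (slideNatT_interchanger_comp p t₂ s₂))
  rw [← tensorLeft_dmap, ← tensorLeft_dmap] at h
  rw [← tensorLeft_slide, ← tensorLeft_slide]
  exact h

/-- The interchanger commutes with disks between composites on the left. -/
theorem slideNat_interchanger_slide {a b c d a' b' : C} {p : a ⟶ b} {q : b ⟶ d} {p₂ : a ⟶ c}
    {q₂ : c ⟶ d} (k : p ≫ q ⟶ p₂ ≫ q₂) (t : a' ⟶ b') :
    SlideNat (slideP (interchanger p t).hom (interchanger q t).hom)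
      (slideP (interchanger p₂ t).hom (interchanger q₂ t).hom) (tensorObj k a')
      (tensorObj k b') := by
  have h := (slideNat_interchanger_comp p q t).symm.trans ((interchanger_natural_left k t).trans
    (slideNat_interchanger_comp p₂ q₂ t))
  rw [← tensorRight_dmap, ← tensorRight_dmap] at h
  rw [← tensorRight_slide, ← tensorRight_slide]
  exact h

theorem diskNat_diskSlide {a b c d a' b' c' d' : C} {p : a ⟶ b} {t' : b ⟶ d} {t : a ⟶ c} {q : c ⟶ d}
    {p₂ : a' ⟶ b'} {t₂' : b' ⟶ d'} {t₂ : a' ⟶ c'} {q₂ : c' ⟶ d'} {θ : p ≫ t' ⟶ t ≫ q}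
    {θ₂ : p₂ ≫ t₂' ⟶ t₂ ≫ q₂} {f : Arr a a'} {g : Arr b b'} {h : Arr c c'} {k : Arr d d'}
    {P : Sq p p₂ f g} {T' : Sq t' t₂' g k} {T : Sq t t₂ f h} {Q : Sq q q₂ h k}
    (H : DiskNat (pcomp P T') (pcomp T Q) θ θ₂)
    {e i j l e' i' j' l' : C} {r : e ⟶ i} {s' : i ⟶ l} {s : e ⟶ j} {o : j ⟶ l}
    {r₂ : e' ⟶ i'} {s₂' : i' ⟶ l'} {s₂ : e' ⟶ j'} {o₂ : j' ⟶ l'} {κ : r ≫ s' ⟶ s ≫ o}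
    {κ₂ : r₂ ≫ s₂' ⟶ s₂ ≫ o₂} {f' : Arr e e'} {g' : Arr i i'} {h' : Arr j j'} {k' : Arr l l'}
    {R : Sq r r₂ f' g'} {S' : Sq s' s₂' g' k'} {S : Sq s s₂ f' h'} {O : Sq o o₂ h' k'}
    (H' : DiskNat (pcomp R S') (pcomp S O) κ κ₂) :
    DiskNat (pcomp (P ⊗ₛ R) (T' ⊗ₛ S')) (pcomp (T ⊗ₛ S) (Q ⊗ₛ O)) (diskSlide θ κ)
      (diskSlide θ₂ κ₂) :=
  (tensor (C := C)).diskNat_slide (a := ⟨a, e⟩) (b := ⟨b, i⟩) (a' := ⟨c, j⟩) (b' := ⟨d, l⟩)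
    (c := ⟨a', e'⟩) (d := ⟨b', i'⟩) (c' := ⟨c', j'⟩) (d' := ⟨d', l'⟩)
    (p := (p, r)) (q := (q, o)) (t := (t, s)) (t' := (t', s')) (p₂ := (p₂, r₂)) (q₂ := (q₂, o₂))
    (t₂ := (t₂, s₂)) (t₂' := (t₂', s₂')) (θ := (θ, κ)) (θ₂ := (θ₂, κ₂)) (f := (f, f'))
    (g := (g, g')) (f' := (h, h')) (g' := (k, k')) (φ := (P, R)) (ψ := (Q, O)) (τ := (T, S))
    (τ' := (T', S')) (DiskNat.prod H H')

theorem diskNat_interchanger {a b a' b' c d c' d' : C} {p : a ⟶ b} {q : a' ⟶ b'} {f : Arr a a'}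
    {g : Arr b b'} {r : c ⟶ d} {s : c' ⟶ d'} {h : Arr c c'} {k : Arr d d'} (φ : Sq p q f g)
    (ψ : Sq r s h k) : DiskNat (pcomp (φ ⊗ₛ unitSq h) (unitSq g ⊗ₛ ψ))
      (pcomp (unitSq f ⊗ₛ ψ) (φ ⊗ₛ unitSq k)) (interchanger p r).hom (interchanger q s).hom := by
  simp only [interchanger_hom]
  exact diskNat_diskSlide (diskNat_slideRight φ) (diskNat_slideLeft ψ)

end Tensor

end DoubleCategory

/-! ### Functors on disks into a composite, computed componentwise -/

namespace DoubleCategory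

open MonoidalData

section Split

universe u' v' w' x' u'' v'' w'' x'' u₃ v₃ w₃ x₃

variable {C : Type u} [DoubleCategory.{u, v, w, x} C] {D : Type u'} [DoubleCategory.{u', v', w', x'} D]
  {E : Type u''} [DoubleCategory.{u'', v'', w'', x''} E]

namespace DFunctor

/-- The action of a functor on a disk into a composite. -/
def split (P : DFunctor C D) {a b c : C} {s : a ⟶ c} {p : a ⟶ b} {r : b ⟶ c} (θ : s ⟶ p ≫ r) :
    P.pmap s ⟶ P.pmap p ≫ P.pmap r :=
  P.dmap θ ≫ (P.mapComp p r).hom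

theorem comp_split (P : DFunctor C D) (Q : DFunctor D E) {a b c : C} {s : a ⟶ c} {p : a ⟶ b}
    {r : b ⟶ c} (θ : s ⟶ p ≫ r) : (P.comp Q).split θ = Q.split (P.split θ) := by
  have h₂ : ((P.comp Q).mapComp p r).hom = Q.dmap (P.mapComp p r).hom ≫ (Q.mapComp _ _).hom := rfl
  have h₃ : (P.comp Q).dmap θ = Q.dmap (P.dmap θ) := PreFunctor.comp_dmap _ _ θ
  unfold split
  rw [h₂, h₃, PreFunctor.dmap_comp]
  exact (Category.assoc _ _ _).symm

theorem pair_split (P : DFunctor C D) (Q : DFunctor C E) {a b c : C} {s : a ⟶ c} {p : a ⟶ b}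
    {r : b ⟶ c} (θ : s ⟶ p ≫ r) : (P.pair Q).split θ = (P.split θ, Q.split θ) := by
  unfold split
  rw [pair_dmap]
  rfl

theorem pair_slide (P : DFunctor C D) (Q : DFunctor C E) {a b c d : C} {p : a ⟶ b} {t' : b ⟶ d}
    {t : a ⟶ c} {q : c ⟶ d} (θ : p ≫ t' ⟶ t ≫ q) :
    (P.pair Q).slide θ = (P.slide θ, Q.slide θ) := by
  unfold slide
  rw [pair_dmap]
  rfl

theorem id_split {a b c : C} {s : a ⟶ c} {p : a ⟶ b} {r : b ⟶ c} (θ : s ⟶ p ≫ r) :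
    (DFunctor.id C).split θ = θ := Category.comp_id θ

theorem id_slide {a b c d : C} {p : a ⟶ b} {t' : b ⟶ d} {t : a ⟶ c} {q : c ⟶ d}
    (θ : p ≫ t' ⟶ t ≫ q) : (DFunctor.id C).slide θ = θ :=
  (Category.id_comp _).trans (Category.comp_id θ)

theorem fst_split {a b c : C ×ᵈ D} {s : a ⟶ c} {p : a ⟶ b} {r : b ⟶ c} (θ : s ⟶ p ≫ r) :
    (fst C D).split θ = θ.1 :=
  Category.comp_id (show s.1 ⟶ p.1 ≫ r.1 from θ.1)

theorem snd_split {a b c : C ×ᵈ D} {s : a ⟶ c} {p : a ⟶ b} {r : b ⟶ c} (θ : s ⟶ p ≫ r) :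
    (snd C D).split θ = θ.2 :=
  Category.comp_id (show s.2 ⟶ p.2 ≫ r.2 from θ.2)

theorem fst_slide {a b c d : C ×ᵈ D} {p : a ⟶ b} {t' : b ⟶ d} {t : a ⟶ c} {q : c ⟶ d}
    (θ : p ≫ t' ⟶ t ≫ q) : (fst C D).slide θ = θ.1 :=
  (Category.id_comp _).trans (Category.comp_id (show p.1 ≫ t'.1 ⟶ t.1 ≫ q.1 from θ.1))

theorem snd_slide {a b c d : C ×ᵈ D} {p : a ⟶ b} {t' : b ⟶ d} {t : a ⟶ c} {q : c ⟶ d}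
    (θ : p ≫ t' ⟶ t ≫ q) : (snd C D).slide θ = θ.2 :=
  (Category.id_comp _).trans (Category.comp_id (show p.2 ≫ t'.2 ⟶ t.2 ≫ q.2 from θ.2))

theorem prodMap_split {F : Type u₃} [DoubleCategory.{u₃, v₃, w₃, x₃} F] (P : DFunctor C D)
    (Q : DFunctor E F) {a b c : C ×ᵈ E} {s : a ⟶ c} {p : a ⟶ b} {r : b ⟶ c} (θ : s ⟶ p ≫ r) :
    (P.prodMap Q).split θ = (P.split θ.1, Q.split θ.2) :=
  (pair_split _ _ θ).trans (Prod.ext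
    ((comp_split _ _ θ).trans (congrArg P.split (fst_split θ)))
    ((comp_split _ _ θ).trans (congrArg Q.split (snd_split θ))))

theorem prodMap_slide {F : Type u₃} [DoubleCategory.{u₃, v₃, w₃, x₃} F] (P : DFunctor C D)
    (Q : DFunctor E F) {a b c d : C ×ᵈ E} {p : a ⟶ b} {t' : b ⟶ d} {t : a ⟶ c} {q : c ⟶ d}
    (θ : p ≫ t' ⟶ t ≫ q) : (P.prodMap Q).slide θ = (P.slide θ.1, Q.slide θ.2) :=
  (pair_slide _ _ θ).trans (Prod.ext
    ((comp_slide _ _ θ).trans (congrArg P.slide (fst_slide θ)))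
    ((comp_slide _ _ θ).trans (congrArg Q.slide (snd_slide θ))))

theorem prodAssoc_split {a b c : (C ×ᵈ D) ×ᵈ E} {s : a ⟶ c} {p : a ⟶ b} {r : b ⟶ c}
    (θ : s ⟶ p ≫ r) : (prodAssoc C D E).split θ = (θ.1.1, (θ.1.2, θ.2)) :=
  (pair_split _ _ θ).trans (Prod.ext
    ((comp_split _ _ θ).trans ((congrArg (fst C D).split (fst_split θ)).trans (fst_split _)))
    ((pair_split _ _ θ).trans (Prod.ext
      ((comp_split _ _ θ).trans ((congrArg (snd C D).split (fst_split θ)).trans (snd_split _)))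
      (snd_split θ))))

theorem prodAssoc_slide {a b c d : (C ×ᵈ D) ×ᵈ E} {p : a ⟶ b} {t' : b ⟶ d} {t : a ⟶ c} {q : c ⟶ d}
    (θ : p ≫ t' ⟶ t ≫ q) : (prodAssoc C D E).slide θ = (θ.1.1, (θ.1.2, θ.2)) :=
  (pair_slide _ _ θ).trans (Prod.ext
    ((comp_slide _ _ θ).trans ((congrArg (fst C D).slide (fst_slide θ)).trans (fst_slide _)))
    ((pair_slide _ _ θ).trans (Prod.ext
      ((comp_slide _ _ θ).trans ((congrArg (snd C D).slide (fst_slide θ)).trans (snd_slide _)))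
      (snd_slide θ))))

end DFunctor

end Split

/-! ### The associator squares -/

section Associator

variable {C : Type u} [DoubleCategory.{u, v, w, x} C]

/-- Meant for unit comparisons: they may be absorbed into the squares of a composition law provided
that they commute with the splitting. -/
theorem DiskNat.lact_lact_pcomp {a b c a' b' c' : C} {s : a ⟶ c} {p : a ⟶ b} {r : b ⟶ c}
    {s' : a' ⟶ c'} {p' : a' ⟶ b'} {r' : b' ⟶ c'} {f : Arr a a'} {g : Arr b b'} {h : Arr c c'}
    {φ : Sq s s' f h} {χ : Sq p p' f g} {ψ : Sq r r' g h} {d : s ⟶ p ≫ r} {e : s' ⟶ p' ≫ r'}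
    (H : DiskNat φ (pcomp χ ψ) d e) {s₂ : a ⟶ c} {p₂ : a ⟶ b} {r₂ : b ⟶ c} {x : s₂ ⟶ s}
    {y : p₂ ⟶ p} {z : r₂ ⟶ r} {d₂ : s₂ ⟶ p₂ ≫ r₂} (hd : x ≫ d = d₂ ≫ y ▷ r₂ ≫ p ◁ z) :
    DiskNat (lact x φ) (pcomp (lact y χ) (lact z ψ)) d₂ e := by
  rw [diskNat_iff] at *
  rw [pcomp_lact_left, pcomp_lact_right, ract_lact, H, lact_lact, lact_lact, lact_lact, hd,
    Category.assoc]

theorem DiskNat.ract_ract_pcomp {a b c a' b' c' : C} {s : a ⟶ c} {p : a ⟶ b} {r : b ⟶ c}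
    {s' : a' ⟶ c'} {p' : a' ⟶ b'} {r' : b' ⟶ c'} {f : Arr a a'} {g : Arr b b'} {h : Arr c c'}
    {φ : Sq s s' f h} {χ : Sq p p' f g} {ψ : Sq r r' g h} {d : s ⟶ p ≫ r} {e : s' ⟶ p' ≫ r'}
    (H : DiskNat φ (pcomp χ ψ) d e) {s₂ : a' ⟶ c'} {p₂ : a' ⟶ b'} {r₂ : b' ⟶ c'} {x : s' ⟶ s₂}
    {y : p' ⟶ p₂} {z : r' ⟶ r₂} {e₂ : s₂ ⟶ p₂ ≫ r₂} (he : x ≫ e₂ = e ≫ y ▷ r' ≫ p₂ ◁ z) :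
    DiskNat (ract φ x) (pcomp (ract χ y) (ract ψ z)) d e₂ := by
  rw [diskNat_iff] at *
  rw [ract_ract, he, ← ract_ract, H, pcomp_ract_right, pcomp_ract_left, ract_lact, ract_ract]

theorem DiskNat.lact_of_slideNat {a b c d a' b' c' d' : C} {p : a ⟶ b} {t' : b ⟶ d} {t : a ⟶ c}
    {q : c ⟶ d} {p₂ : a' ⟶ b'} {t₂' : b' ⟶ d'} {t₂ : a' ⟶ c'} {q₂ : c' ⟶ d'} {θ : p ≫ t' ⟶ t ≫ q}
    {κ : p₂ ≫ t₂' ⟶ t₂ ≫ q₂} {f : Arr a a'} {g : Arr b b'} {h : Arr c c'} {k : Arr d d'}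
    {P : Sq p p₂ f g} {T' : Sq t' t₂' g k} {T : Sq t t₂ f h} {Q : Sq q q₂ h k}
    (H : DiskNat (pcomp P T') (pcomp T Q) θ κ) {r : a ⟶ b} {s : c ⟶ d} {x : r ⟶ p} {y : s ⟶ q}
    {θ' : r ≫ t' ⟶ t ≫ s} (hθ : SlideNat θ' θ x y) :
    DiskNat (pcomp (lact x P) T') (pcomp T (lact y Q)) θ' κ := by
  rw [diskNat_iff] at *
  rw [pcomp_lact_left, pcomp_lact_right, ract_lact, H, lact_lact, lact_lact, hθ]

theorem DiskNat.ract_of_slideNatT {a b c d a' b' c' d' : C} {p : a ⟶ b} {t' : b ⟶ d} {t : a ⟶ c}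
    {q : c ⟶ d} {p₂ : a' ⟶ b'} {t₂' : b' ⟶ d'} {t₂ : a' ⟶ c'} {q₂ : c' ⟶ d'} {θ : p ≫ t' ⟶ t ≫ q}
    {κ : p₂ ≫ t₂' ⟶ t₂ ≫ q₂} {f : Arr a a'} {g : Arr b b'} {h : Arr c c'} {k : Arr d d'}
    {P : Sq p p₂ f g} {T' : Sq t' t₂' g k} {T : Sq t t₂ f h} {Q : Sq q q₂ h k}
    (H : DiskNat (pcomp P T') (pcomp T Q) θ κ) {r : a' ⟶ c'} {s : b' ⟶ d'} {x : t₂ ⟶ r}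
    {y : t₂' ⟶ s} {κ' : p₂ ≫ s ⟶ r ≫ q₂} (hκ : SlideNatT κ κ' x y) :
    DiskNat (pcomp P (ract T' y)) (pcomp (ract T x) Q) θ κ' := by
  rw [diskNat_iff] at *
  rw [pcomp_ract_left, pcomp_ract_right, ract_ract, ← hκ, ← ract_ract, H, ract_lact]

/-- It allows an identity leg to count as a unit slide, so that a slide tensored with an identity
becomes a tensor product of two slides. -/
theorem slideLeft_unit (a : C) : slideLeft (𝟙 a) = 𝟙 (𝟙 a ≫ 𝟙 a) := by
  unfold slideLeft; rw [unitors_equal, Iso.hom_inv_id]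

theorem slideRight_unit (a : C) : slideRight (𝟙 a) = 𝟙 (𝟙 a ≫ 𝟙 a) := by
  unfold slideRight; rw [← unitors_equal, Iso.hom_inv_id]

variable [MonoidalData C]

/-- The tensor product of disks into composites. -/
def diskSplit {a b c a' b' c' : C} {s : a ⟶ c} {p : a ⟶ b} {r : b ⟶ c} {s' : a' ⟶ c'} {p' : a' ⟶ b'}
    {r' : b' ⟶ c'} (θ : s ⟶ p ≫ r) (κ : s' ⟶ p' ≫ r') : s ⊗ₚ s' ⟶ (p ⊗ₚ p') ≫ (r ⊗ₚ r') :=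
  disk θ κ ≫ (compIso p r p' r').hom

theorem disk_comp_diskSplit {a b c a' b' c' : C} {t s : a ⟶ c} {p : a ⟶ b} {r : b ⟶ c}
    {t' s' : a' ⟶ c'} {p' : a' ⟶ b'} {r' : b' ⟶ c'} (d : t ⟶ s) (d' : t' ⟶ s') (θ : s ⟶ p ≫ r)
    (κ : s' ⟶ p' ≫ r') : disk d d' ≫ diskSplit θ κ = diskSplit (d ≫ θ) (d' ≫ κ) := by
  unfold diskSplit
  rw [disk_comp_assoc]

theorem diskSplit_whisker {a b c a' b' c' : C} {s : a ⟶ c} {p q : a ⟶ b} {r o : b ⟶ c}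
    {s' : a' ⟶ c'} {p' q' : a' ⟶ b'} {r' o' : b' ⟶ c'} (θ : s ⟶ p ≫ r) (κ : s' ⟶ p' ≫ r')
    (d : p ⟶ q) (e : r ⟶ o) (d' : p' ⟶ q') (e' : r' ⟶ o') :
    diskSplit θ κ ≫ disk d d' ▷ (r ⊗ₚ r') ≫ (q ⊗ₚ q') ◁ disk e e' =
      diskSplit (θ ≫ d ▷ r ≫ q ◁ e) (κ ≫ d' ▷ r' ≫ q' ◁ e') := by
  have h₁ : disk (d ▷ r) (d' ▷ r') =
      (compIso p r p' r').hom ≫ disk d d' ▷ (r ⊗ₚ r') ≫ (compIso q r q' r').inv :=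
    dmap_whiskerRight (tensor (C := C)) (A := ⟨a, a'⟩) (B := ⟨b, b'⟩) (E := ⟨c, c'⟩) (m := (p, p'))
      (m' := (q, q')) (d, d') (r, r')
  have h₂ : disk (q ◁ e) (q' ◁ e') =
      (compIso q r q' r').hom ≫ (q ⊗ₚ q') ◁ disk e e' ≫ (compIso q o q' o').inv :=
    dmap_whiskerLeft (tensor (C := C)) (A := ⟨a, a'⟩) (B := ⟨b, b'⟩) (E := ⟨c, c'⟩) (q, q')
      (n := (r, r')) (n' := (o, o')) (e, e')
  unfold diskSplit
  rw [← disk_comp, ← disk_comp, h₁, h₂]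
  simp

theorem rightComp_hom_eq_diskSplit {a b c : C} (m : a ⟶ b) (n : b ⟶ c) (X : C) :
    (rightComp m n X).hom = diskSplit (𝟙 (m ≫ n)) (λ_ (𝟙 X)).inv := rfl

theorem leftComp_hom_eq_diskSplit (X : C) {a b c : C} (m : a ⟶ b) (n : b ⟶ c) :
    (leftComp X m n).hom = diskSplit (λ_ (𝟙 X)).inv (𝟙 (m ≫ n)) := rfl

theorem unitIso_inv_comp_diskSplit (W Z : C) :
    (unitIso W Z).inv ≫ diskSplit (λ_ (𝟙 W)).inv (λ_ (𝟙 Z)).inv =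
      (λ_ (𝟙 (W ⊗ₒ Z))).inv ≫ (unitIso W Z).inv ▷ 𝟙 (W ⊗ₒ Z) ≫
        (𝟙 W ⊗ₚ 𝟙 Z) ◁ (unitIso W Z).inv :=
  ((tensor (C := C)).mapId_comp_mapId ⟨W, Z⟩).symm

theorem unitIso_hom_comp (W Z : C) :
    (unitIso W Z).hom ≫ (λ_ (𝟙 (W ⊗ₒ Z))).inv =
      diskSplit (λ_ (𝟙 W)).inv (λ_ (𝟙 Z)).inv ≫ (unitIso W Z).hom ▷ (𝟙 W ⊗ₚ 𝟙 Z) ≫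
        𝟙 (W ⊗ₒ Z) ◁ (unitIso W Z).hom := by
  rw [← cancel_epi (unitIso W Z).inv, Iso.inv_hom_id_assoc,
    reassoc_of% unitIso_inv_comp_diskSplit, whisker_exchange_assoc, inv_hom_whiskerRight_assoc,
    ← Bicategory.whiskerLeft_comp, Iso.inv_hom_id, Bicategory.whiskerLeft_id, Category.comp_id]

/-- Evaluates one of the composite functors between which the associator runs, so that its abstract
naturality becomes a statement about tensor products of disks. -/
theorem assoc_target_split {A B E A' B' E' A'' B'' E'' : C} {s : A ⟶ A''} {p : A ⟶ A'} {r : A' ⟶ A''}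
    {s' : B ⟶ B''} {p' : B ⟶ B'} {r' : B' ⟶ B''} {s'' : E ⟶ E''} {p'' : E ⟶ E'} {r'' : E' ⟶ E''}
    (θ : s ⟶ p ≫ r) (κ : s' ⟶ p' ≫ r') (ν : s'' ⟶ p'' ≫ r'') :
    ((DFunctor.prodAssoc C C C).comp (((DFunctor.id C).prodMap tensor).comp tensor)).split
      (a := ⟨⟨A, B⟩, E⟩) (b := ⟨⟨A', B'⟩, E'⟩) (c := ⟨⟨A'', B''⟩, E''⟩) (s := ((s, s'), s''))
      (p := ((p, p'), p'')) (r := ((r, r'), r'')) ((θ, κ), ν) = diskSplit θ (diskSplit κ ν) := by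
  rw [DFunctor.comp_split, DFunctor.comp_split, DFunctor.prodAssoc_split]
  have h := DFunctor.prodMap_split (DFunctor.id C) (tensor (C := C)) (a := ⟨A, ⟨B, E⟩⟩)
    (b := ⟨A', ⟨B', E'⟩⟩) (c := ⟨A'', ⟨B'', E''⟩⟩) (s := (s, (s', s''))) (p := (p, (p', p'')))
    (r := (r, (r', r''))) (θ, (κ, ν))
  rw [DFunctor.id_split] at h
  exact congrArg (tensor (C := C)).split h

theorem assoc_source_split {A B E A' B' E' A'' B'' E'' : C} {s : A ⟶ A''} {p : A ⟶ A'} {r : A' ⟶ A''}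
    {s' : B ⟶ B''} {p' : B ⟶ B'} {r' : B' ⟶ B''} {s'' : E ⟶ E''} {p'' : E ⟶ E'} {r'' : E' ⟶ E''}
    (θ : s ⟶ p ≫ r) (κ : s' ⟶ p' ≫ r') (ν : s'' ⟶ p'' ≫ r'') :
    ((tensor.prodMap (DFunctor.id C)).comp tensor).split
      (a := ⟨⟨A, B⟩, E⟩) (b := ⟨⟨A', B'⟩, E'⟩) (c := ⟨⟨A'', B''⟩, E''⟩) (s := ((s, s'), s''))
      (p := ((p, p'), p'')) (r := ((r, r'), r'')) ((θ, κ), ν) = diskSplit (diskSplit θ κ) ν := by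
  rw [DFunctor.comp_split, DFunctor.prodMap_split, DFunctor.id_split]
  rfl

theorem assoc_target_slide {a b c d a' b' c' d' a'' b'' c'' d'' : C} {p : a ⟶ b} {t' : b ⟶ d}
    {t : a ⟶ c} {q : c ⟶ d} {p₂ : a' ⟶ b'} {t₂' : b' ⟶ d'} {t₂ : a' ⟶ c'} {q₂ : c' ⟶ d'}
    {p₃ : a'' ⟶ b''} {t₃' : b'' ⟶ d''} {t₃ : a'' ⟶ c''} {q₃ : c'' ⟶ d''}
    (θ : p ≫ t' ⟶ t ≫ q) (κ : p₂ ≫ t₂' ⟶ t₂ ≫ q₂) (ν : p₃ ≫ t₃' ⟶ t₃ ≫ q₃) :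
    ((DFunctor.prodAssoc C C C).comp (((DFunctor.id C).prodMap tensor).comp tensor)).slide
      (a := ⟨⟨a, a'⟩, a''⟩) (b := ⟨⟨b, b'⟩, b''⟩) (c := ⟨⟨c, c'⟩, c''⟩) (d := ⟨⟨d, d'⟩, d''⟩)
      (p := ((p, p₂), p₃)) (t' := ((t', t₂'), t₃')) (t := ((t, t₂), t₃)) (q := ((q, q₂), q₃))
      ((θ, κ), ν) = diskSlide θ (diskSlide κ ν) := by
  rw [DFunctor.comp_slide, DFunctor.comp_slide, DFunctor.prodAssoc_slide]
  have h := DFunctor.prodMap_slide (DFunctor.id C) (tensor (C := C)) (a := ⟨a, ⟨a', a''⟩⟩)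
    (b := ⟨b, ⟨b', b''⟩⟩) (c := ⟨c, ⟨c', c''⟩⟩) (d := ⟨d, ⟨d', d''⟩⟩) (p := (p, (p₂, p₃)))
    (t' := (t', (t₂', t₃'))) (t := (t, (t₂, t₃))) (q := (q, (q₂, q₃))) (θ, (κ, ν))
  rw [DFunctor.id_slide] at h
  exact congrArg (tensor (C := C)).slide h

theorem assoc_source_slide {a b c d a' b' c' d' a'' b'' c'' d'' : C} {p : a ⟶ b} {t' : b ⟶ d}
    {t : a ⟶ c} {q : c ⟶ d} {p₂ : a' ⟶ b'} {t₂' : b' ⟶ d'} {t₂ : a' ⟶ c'} {q₂ : c' ⟶ d'}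
    {p₃ : a'' ⟶ b''} {t₃' : b'' ⟶ d''} {t₃ : a'' ⟶ c''} {q₃ : c'' ⟶ d''}
    (θ : p ≫ t' ⟶ t ≫ q) (κ : p₂ ≫ t₂' ⟶ t₂ ≫ q₂) (ν : p₃ ≫ t₃' ⟶ t₃ ≫ q₃) :
    ((tensor.prodMap (DFunctor.id C)).comp tensor).slide
      (a := ⟨⟨a, a'⟩, a''⟩) (b := ⟨⟨b, b'⟩, b''⟩) (c := ⟨⟨c, c'⟩, c''⟩) (d := ⟨⟨d, d'⟩, d''⟩)
      (p := ((p, p₂), p₃)) (t' := ((t', t₂'), t₃')) (t := ((t, t₂), t₃)) (q := ((q, q₂), q₃))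
      ((θ, κ), ν) = diskSlide (diskSlide θ κ) ν := by
  rw [DFunctor.comp_slide, DFunctor.prodMap_slide, DFunctor.id_slide]
  rfl

theorem diskNat_assocInvSq_split {A B E A' B' E' A'' B'' E'' : C} {s : A ⟶ A''} {p : A ⟶ A'}
    {r : A' ⟶ A''} {s' : B ⟶ B''} {p' : B ⟶ B'} {r' : B' ⟶ B''} {s'' : E ⟶ E''} {p'' : E ⟶ E'}
    {r'' : E' ⟶ E''} (θ : s ⟶ p ≫ r) (κ : s' ⟶ p' ≫ r') (ν : s'' ⟶ p'' ≫ r'') :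
    DiskNat (assocInvSq s s' s'') (pcomp (assocInvSq p p' p'') (assocInvSq r r' r''))
      (diskSplit θ (diskSplit κ ν)) (diskSplit (diskSplit θ κ) ν) := by
  rw [← assoc_target_split, ← assoc_source_split]
  exact (assoc (C := C)).inv.diskNat_comp
      (a := ⟨⟨A, B⟩, E⟩) (b := ⟨⟨A', B'⟩, E'⟩) (c := ⟨⟨A'', B''⟩, E''⟩) (s := ((s, s'), s''))
      (p := ((p, p'), p'')) (r := ((r, r'), r'')) ((θ, κ), ν)

theorem diskNat_assocInvSq_slide {a b c d a' b' c' d' a'' b'' c'' d'' : C} {p : a ⟶ b} {t' : b ⟶ d}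
    {t : a ⟶ c} {q : c ⟶ d} {p₂ : a' ⟶ b'} {t₂' : b' ⟶ d'} {t₂ : a' ⟶ c'} {q₂ : c' ⟶ d'}
    {p₃ : a'' ⟶ b''} {t₃' : b'' ⟶ d''} {t₃ : a'' ⟶ c''} {q₃ : c'' ⟶ d''}
    (θ : p ≫ t' ⟶ t ≫ q) (κ : p₂ ≫ t₂' ⟶ t₂ ≫ q₂) (ν : p₃ ≫ t₃' ⟶ t₃ ≫ q₃) :
    DiskNat (pcomp (assocInvSq p p₂ p₃) (assocInvSq t' t₂' t₃'))
      (pcomp (assocInvSq t t₂ t₃) (assocInvSq q q₂ q₃))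
      (diskSlide θ (diskSlide κ ν)) (diskSlide (diskSlide θ κ) ν) := by
  rw [← assoc_target_slide, ← assoc_source_slide]
  exact (assoc (C := C)).inv.diskNat_slide
      (a := ⟨⟨a, a'⟩, a''⟩) (b := ⟨⟨b, b'⟩, b''⟩) (c := ⟨⟨c, c'⟩, c''⟩) (d := ⟨⟨d, d'⟩, d''⟩)
      (p := ((p, p₂), p₃)) (r := ((t', t₂'), t₃')) (s := ((t, t₂), t₃)) (q := ((q, q₂), q₃))
      ((θ, κ), ν)

/-- The inverse associator at a proarrow and two objects. -/
def assocInvX {a b : C} (p : a ⟶ b) (W Z : C) :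
    Sq (p ⊗ₚ 𝟙 (W ⊗ₒ Z)) ((p ⊗ₚ 𝟙 W) ⊗ₚ 𝟙 Z) (assocInvArr a W Z) (assocInvArr b W Z) :=
  lact (disk (𝟙 p) (unitIso W Z).inv) (assocInvSq p (𝟙 W) (𝟙 Z))

/-- The inverse associator at two objects and a proarrow. -/
def assocInvZ (a W : C) {Z Z' : C} (z : Z ⟶ Z') :
    Sq (𝟙 a ⊗ₚ 𝟙 W ⊗ₚ z) (𝟙 (a ⊗ₒ W) ⊗ₚ z) (assocInvArr a W Z) (assocInvArr a W Z') :=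
  ract (assocInvSq (𝟙 a) (𝟙 W) z) (disk (unitIso a W).hom (𝟙 z))

/-- Naturality of the inverse associator along a splitting in which both unit legs are duplicated.
The unit comparison inside `assocInvX` commutes with this duplication by the unit law of the tensor
functor. -/
theorem diskNat_assocInvX_comp {a b c : C} (p : a ⟶ b) (p' : b ⟶ c) (W Z : C) :
    DiskNat (assocInvX (p ≫ p') W Z) (pcomp (assocInvX p W Z) (assocInvX p' W Z))
      (rightComp p p' (W ⊗ₒ Z)).hom
      (disk (rightComp p p' W).hom (𝟙 (𝟙 Z)) ≫ (rightComp (p ⊗ₚ 𝟙 W) (p' ⊗ₚ 𝟙 W) Z).hom) := by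
  rw [rightComp_hom_eq_diskSplit (p ⊗ₚ 𝟙 W), disk_comp_diskSplit, Category.comp_id,
    Category.id_comp]
  refine (diskNat_assocInvSq_split (𝟙 (p ≫ p')) (λ_ (𝟙 W)).inv (λ_ (𝟙 Z)).inv).lact_lact_pcomp ?_
  rw [disk_comp_diskSplit, rightComp_hom_eq_diskSplit, diskSplit_whisker,
    unitIso_inv_comp_diskSplit]
  simp

theorem diskNat_assocInvY_comp (a : C) {b c d : C} (p : b ⟶ c) (p' : c ⟶ d) (Z : C) :
    DiskNat (assocInvSq (𝟙 a) (p ≫ p') (𝟙 Z))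
      (pcomp (assocInvSq (𝟙 a) p (𝟙 Z)) (assocInvSq (𝟙 a) p' (𝟙 Z)))
      (disk (𝟙 (𝟙 a)) (rightComp p p' Z).hom ≫ (leftComp a (p ⊗ₚ 𝟙 Z) (p' ⊗ₚ 𝟙 Z)).hom)
      (disk (leftComp a p p').hom (𝟙 (𝟙 Z)) ≫ (rightComp (𝟙 a ⊗ₚ p) (𝟙 a ⊗ₚ p') Z).hom) := by
  rw [rightComp_hom_eq_diskSplit (𝟙 a ⊗ₚ p), disk_comp_diskSplit, Category.comp_id,
    Category.id_comp, leftComp_hom_eq_diskSplit a (p ⊗ₚ 𝟙 Z), disk_comp_diskSplit,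
    Category.comp_id, Category.id_comp]
  exact diskNat_assocInvSq_split _ _ _

theorem diskNat_assocInvZ_comp (a W : C) {b c d : C} (p : b ⟶ c) (p' : c ⟶ d) :
    DiskNat (assocInvZ a W (p ≫ p')) (pcomp (assocInvZ a W p) (assocInvZ a W p'))
      (disk (𝟙 (𝟙 a)) (leftComp W p p').hom ≫ (leftComp a (𝟙 W ⊗ₚ p) (𝟙 W ⊗ₚ p')).hom)
      (leftComp (a ⊗ₒ W) p p').hom := by
  rw [leftComp_hom_eq_diskSplit a (𝟙 W ⊗ₚ p), disk_comp_diskSplit, Category.comp_id,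
    Category.id_comp]
  refine (diskNat_assocInvSq_split (λ_ (𝟙 a)).inv (λ_ (𝟙 W)).inv (𝟙 (p ≫ p'))).ract_ract_pcomp ?_
  rw [leftComp_hom_eq_diskSplit (a ⊗ₒ W), disk_comp_diskSplit, diskSplit_whisker,
    unitIso_hom_comp]
  simp

/-- Once the identity leg is rewritten as a unit slide, this is preservation of unit slides by the
tensor functor, read backwards. -/
theorem slideNat_slideLeft_diskSlide {W W' : C} (p : W ⟶ W') (Z : C) :
    SlideNat (slideLeft (p ⊗ₚ 𝟙 Z)) (diskSlide (slideLeft p) (𝟙 (𝟙 Z ≫ 𝟙 Z))) (unitIso W Z).inv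
      (unitIso W' Z).inv := by
  rw [← slideLeft_unit]
  exact SlideNat.symm ((tensor (C := C)).slideNat_slide_slideLeft (a := ⟨W, Z⟩) (b := ⟨W', Z⟩)
    (p, 𝟙 Z))

theorem slideNat_slideLeft_diskSlide' (W : C) {Z Z' : C} (z : Z ⟶ Z') :
    SlideNat (slideLeft (𝟙 W ⊗ₚ z)) (diskSlide (𝟙 (𝟙 W ≫ 𝟙 W)) (slideLeft z)) (unitIso W Z).inv
      (unitIso W Z').inv := by
  rw [← slideLeft_unit]
  exact SlideNat.symm ((tensor (C := C)).slideNat_slide_slideLeft (a := ⟨W, Z⟩) (b := ⟨W, Z'⟩)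
    (𝟙 W, z))

theorem slideNatT_diskSlide_slideRight {a b : C} (p : a ⟶ b) (W : C) :
    SlideNatT (diskSlide (slideRight p) (𝟙 (𝟙 W ≫ 𝟙 W))) (slideRight (p ⊗ₚ 𝟙 W)) (unitIso a W).hom
      (unitIso b W).hom := by
  rw [← slideRight_unit]
  exact (tensor (C := C)).slideNatT_slide_slideRight (a := ⟨a, W⟩) (b := ⟨b, W⟩) (p, 𝟙 W)

theorem slideNatT_diskSlide_slideRight' (a : C) {W W' : C} (p : W ⟶ W') :
    SlideNatT (diskSlide (𝟙 (𝟙 a ≫ 𝟙 a)) (slideRight p)) (slideRight (𝟙 a ⊗ₚ p)) (unitIso a W).hom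
      (unitIso a W').hom := by
  rw [← slideRight_unit]
  exact (tensor (C := C)).slideNatT_slide_slideRight (a := ⟨a, W⟩) (b := ⟨a, W'⟩) (𝟙 a, p)

/-- The exchange of `p` and `q` is the tensor product of `slideRight p`, `slideLeft q` and an
identity, and the inverse associator is natural for such triples. The two other pairs of positions
differ only in where a unit comparison has to be absorbed. -/
theorem diskNat_assocInvX_assocInvY {a b W W' : C} (p : a ⟶ b) (q : W ⟶ W') (Z : C) :
    DiskNat (pcomp (assocInvX p W Z) (assocInvSq (𝟙 b) q (𝟙 Z)))
      (pcomp (assocInvSq (𝟙 a) q (𝟙 Z)) (assocInvX p W' Z))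
      (interchanger p (q ⊗ₚ 𝟙 Z)).hom (tensorObj (interchanger p q).hom Z) := by
  rw [interchanger_hom, interchanger_hom, tensorObj_eq_diskSlide]
  exact (diskNat_assocInvSq_slide (slideRight p) (slideLeft q) (𝟙 (𝟙 Z ≫ 𝟙 Z))).lact_of_slideNat
    (slideNat_diskSlide (SlideNat.refl _) (slideNat_slideLeft_diskSlide q Z))

theorem diskNat_assocInvX_assocInvZ {a b Z Z' : C} (p : a ⟶ b) (W : C) (z : Z ⟶ Z') :
    DiskNat (pcomp (assocInvX p W Z) (assocInvZ b W z))
      (pcomp (assocInvZ a W z) (assocInvX p W Z'))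
      (interchanger p (𝟙 W ⊗ₚ z)).hom (interchanger (p ⊗ₚ 𝟙 W) z).hom := by
  rw [interchanger_hom, interchanger_hom]
  exact ((diskNat_assocInvSq_slide (slideRight p) (𝟙 (𝟙 W ≫ 𝟙 W)) (slideLeft z)).lact_of_slideNat
    (slideNat_diskSlide (SlideNat.refl _) (slideNat_slideLeft_diskSlide' W z))).ract_of_slideNatT
    (slideNatT_diskSlide (slideNatT_diskSlide_slideRight p W) (SlideNatT.refl _))

theorem diskNat_assocInvY_assocInvZ (a : C) {W W' Z Z' : C} (q : W ⟶ W') (z : Z ⟶ Z') :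
    DiskNat (pcomp (assocInvSq (𝟙 a) q (𝟙 Z)) (assocInvZ a W' z))
      (pcomp (assocInvZ a W z) (assocInvSq (𝟙 a) q (𝟙 Z')))
      (objTensor a (interchanger q z).hom) (interchanger (𝟙 a ⊗ₚ q) z).hom := by
  rw [interchanger_hom, interchanger_hom, objTensor_eq_diskSlide]
  exact (diskNat_assocInvSq_slide (𝟙 (𝟙 a ≫ 𝟙 a)) (slideRight q) (slideLeft z)).ract_of_slideNatT
    (slideNatT_diskSlide (slideNatT_diskSlide_slideRight' a q) (SlideNatT.refl _))

end Associator

end DoubleCategory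

/-! ### Turning cells whiskered and conjugated by coherence strands -/

namespace DoubleCategory

section Turn

universe u₁ v₁ w₁

variable {B : Type u₁} [Bicategory.{w₁, v₁} B]

theorem SlideNatT.inv {a b a' b' : B} {p : a ⟶ b} {q : a' ⟶ b'} {t t₂ : a ⟶ a'} {t' t₂' : b ⟶ b'}
    {θ : p ≫ t' ≅ t ≫ q} {θ₂ : p ≫ t₂' ≅ t₂ ≫ q} {x : t ⟶ t₂} {y : t' ⟶ t₂'}
    (h : SlideNatT θ.hom θ₂.hom x y) : SlideNat θ.inv θ₂.inv x y := by
  unfold SlideNatT SlideNat at *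
  rw [Iso.inv_comp_eq, ← Category.assoc, Iso.eq_comp_inv, h]

theorem SlideNat.inv {a b a' b' : B} {p p₂ : a ⟶ b} {q q₂ : a' ⟶ b'} {t : a ⟶ a'} {t' : b ⟶ b'}
    {θ : p ≫ t' ≅ t ≫ q} {θ₂ : p₂ ≫ t' ≅ t ≫ q₂} {x : p ⟶ p₂} {y : q ⟶ q₂}
    (h : SlideNat θ.hom θ₂.hom x y) : SlideNatT θ.inv θ₂.inv x y := by
  unfold SlideNatT SlideNat at *
  rw [Iso.inv_comp_eq, ← Category.assoc, Iso.eq_comp_inv, h]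

/-- Pasting of two invertible sliding cells along the `1`-cell which is being slid past. -/
@[simps]
def slidePIso {a b c a' b' c' : B} {p : a ⟶ b} {p' : b ⟶ c} {t : a ⟶ a'} {t' : b ⟶ b'}
    {t'' : c ⟶ c'} {q : a' ⟶ b'} {q' : b' ⟶ c'} (θ : p ≫ t' ≅ t ≫ q) (θ' : p' ≫ t'' ≅ t' ≫ q') :
    (p ≫ p') ≫ t'' ≅ t ≫ q ≫ q' where
  hom := slideP θ.hom θ'.hom
  inv := slideT θ.inv θ'.inv
  hom_inv_id := by simp [slideT, slideP]
  inv_hom_id := by simp [slideT, slideP]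

/-- Inversion swaps the roles of the sliding strand and the strand slid past, so the inverse of a
`slideP` is a `slideT`. -/
theorem SlideNat.inv_slideP {a b b₂ c a' b' b₂' c' : B} {p : a ⟶ b} {p' : b ⟶ c} {r : a ⟶ b₂}
    {r' : b₂ ⟶ c} {t : a ⟶ a'} {t' : b ⟶ b'} {s' : b₂ ⟶ b₂'} {t'' : c ⟶ c'} {q : a' ⟶ b'}
    {q' : b' ⟶ c'} {o : a' ⟶ b₂'} {o' : b₂' ⟶ c'} {θ : p ≫ t' ≅ t ≫ q} {θ' : p' ≫ t'' ≅ t' ≫ q'}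
    {κ : r ≫ s' ≅ t ≫ o} {κ' : r' ≫ t'' ≅ s' ≫ o'} {x : p ≫ p' ⟶ r ≫ r'} {y : q ≫ q' ⟶ o ≫ o'}
    (h : SlideNat (slideP θ.hom θ'.hom) (slideP κ.hom κ'.hom) x y) :
    SlideNatT (DoubleCategory.slideT θ.inv θ'.inv) (DoubleCategory.slideT κ.inv κ'.inv) x y :=
  SlideNat.inv (θ := slidePIso θ θ') (θ₂ := slidePIso κ κ') h

theorem SlideNatT.inv_slideT {a b a' b' a'' b'' : B} {p : a ⟶ b} {q : a' ⟶ b'} {r : a'' ⟶ b''}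
    {t : a ⟶ a'} {t' : b ⟶ b'} {s : a' ⟶ a''} {s' : b' ⟶ b''} {o : a ⟶ a''} {o' : b ⟶ b''}
    {ν : p ≫ o' ≅ o ≫ r} {θ : p ≫ t' ≅ t ≫ q} {κ : q ≫ s' ≅ s ≫ r} {x : o ⟶ t ≫ s}
    {y : o' ⟶ t' ≫ s'} (h : SlideNatT ν.hom (slideT θ.hom κ.hom) x y) :
    SlideNat ν.inv (slideP θ.inv κ.inv) x y :=
  SlideNatT.inv (θ₂ := slideTIso θ κ) h

/-- A cell which turns a `1`-cell around a cup, followed by a further `1`-cell. -/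
@[simps]
def turnCup {a b c d k : B} {mX : a ⟶ b} {e : b ⟶ d} {mY : a ⟶ c} {e' : c ⟶ d}
    (κ : mX ≫ e ≅ mY ≫ e') (l : d ⟶ k) : mX ≫ e ≫ l ≅ mY ≫ e' ≫ l where
  hom := (α_ mX e l).inv ≫ κ.hom ▷ l ≫ (α_ mY e' l).hom
  inv := (α_ mY e' l).inv ≫ κ.inv ▷ l ≫ (α_ mX e l).hom

/-- The strand `l` after the cup takes no part in the turn, so the law is merely whiskered by it. -/
theorem turnCup_cupPaste {a b c d f k g g' : B} {mnX : a ⟶ c} {mnY : a ⟶ k} {mX : a ⟶ b} {nX : b ⟶ c}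
    {nY : b ⟶ d} {nY' : a ⟶ f} {mX' : f ⟶ d} {mY : f ⟶ k} {e'' : c ⟶ g} {e' : d ⟶ g} {e : k ⟶ g}
    {κ : mnX ≫ e'' ≅ mnY ≫ e} {κm : mX' ≫ e' ≅ mY ≫ e} {κn : nX ≫ e'' ≅ nY ≫ e'}
    {σ : mX ≫ nY ⟶ nY' ≫ mX'} {i : mnX ⟶ mX ≫ nX} {j : mnY ⟶ nY' ≫ mY} (l : g ⟶ g')
    (h : κ.hom ≫ j ▷ e = i ▷ e'' ≫ cupPaste κm.hom κn.hom σ) :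
    (turnCup κ l).hom ≫ j ▷ (e ≫ l) =
      i ▷ (e'' ≫ l) ≫ cupPaste (turnCup κm l).hom (turnCup κn l).hom σ := by
  calc _ = (α_ _ _ _).inv ≫ (κ.hom ≫ j ▷ e) ▷ l ≫ (α_ _ _ _).hom := by simp
    _ = _ := by
      rw [h]
      unfold cupPaste
      simp only [turnCup_hom]
      bicategory

theorem slideNatT_turnCup {a b c d k a' b' c' d' k' : B} {mX : a ⟶ b} {e : b ⟶ d} {mY : a ⟶ c}
    {e' : c ⟶ d} {κ : mX ≫ e ≅ mY ≫ e'} {l : d ⟶ k} {mX₂ : a' ⟶ b'} {e₂ : b' ⟶ d'} {mY₂ : a' ⟶ c'}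
    {e₂' : c' ⟶ d'} {κ₂ : mX₂ ≫ e₂ ≅ mY₂ ≫ e₂'} {l₂ : d' ⟶ k'} {p : a ⟶ a'} {q : b ⟶ b'}
    {q' : c ⟶ c'} {r : d ⟶ d'} {s : k ⟶ k'} {θ : p ≫ mX₂ ⟶ mX ≫ q} {θ' : q ≫ e₂ ⟶ e ≫ r}
    {ω : p ≫ mY₂ ⟶ mY ≫ q'} {ω' : q' ≫ e₂' ⟶ e' ≫ r}
    (h : SlideNatT (slideT θ θ') (slideT ω ω') κ.hom κ₂.hom) (ν : r ≫ l₂ ⟶ l ≫ s) :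
    SlideNatT (slideT θ (slideT θ' ν)) (slideT ω (slideT ω' ν)) (turnCup κ l).hom
      (turnCup κ₂ l₂).hom :=
  (SlideNatT.symm (x := α_ _ _ _) (y := α_ _ _ _) (SlideNatT.assoc θ θ' ν)).trans
    ((h.slideT_left ν).trans (SlideNatT.assoc ω ω' ν))

/-- A cell which turns a `1`-cell around a cap, conjugated by sliding cells. -/
@[simps]
def turnCapCore {o x x' x'' t t' t'' : B} {h : o ⟶ x} {yv : x ⟶ x'} {h' : o ⟶ x''}
    {zv : x'' ⟶ x'} {a : x ⟶ t} {a' : x' ⟶ t'} {a'' : x'' ⟶ t''} {mY : t ⟶ t'} {mZ : t'' ⟶ t'}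
    (y : yv ≫ a' ≅ a ≫ mY) (k : h ≫ yv ≅ h' ≫ zv) (z : zv ≫ a' ≅ a'' ≫ mZ) :
    (h ≫ a) ≫ mY ≅ (h' ≫ a'') ≫ mZ where
  hom := (α_ _ _ _).hom ≫ h ◁ y.inv ≫ (α_ _ _ _).inv ≫ k.hom ▷ a' ≫
    (α_ _ _ _).hom ≫ h' ◁ z.hom ≫ (α_ _ _ _).inv
  inv := (α_ _ _ _).hom ≫ h' ◁ z.inv ≫ (α_ _ _ _).inv ≫ k.inv ▷ a' ≫
    (α_ _ _ _).hom ≫ h ◁ y.hom ≫ (α_ _ _ _).inv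
  hom_inv_id := by simp
  inv_hom_id := by simp

/-- A cell which turns a `1`-cell around a cap, conjugated by sliding cells, after a further
`1`-cell. -/
@[simps!]
def turnCap {s o x x' x'' t t' t'' : B} (r : s ⟶ o) {h : o ⟶ x} {yv : x ⟶ x'} {h' : o ⟶ x''}
    {zv : x'' ⟶ x'} {a : x ⟶ t} {a' : x' ⟶ t'} {a'' : x'' ⟶ t''} {mY : t ⟶ t'} {mZ : t'' ⟶ t'}
    (y : yv ≫ a' ≅ a ≫ mY) (k : h ≫ yv ≅ h' ≫ zv) (z : zv ≫ a' ≅ a'' ≫ mZ) :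
    (r ≫ h ≫ a) ≫ mY ≅ (r ≫ h' ≫ a'') ≫ mZ :=
  α_ _ _ _ ≪≫ whiskerLeftIso r (turnCapCore y k z) ≪≫ (α_ _ _ _).symm

/-- The conjugated turn is `y` reversed, then `k`, then `z`. A strand passing by replaces `σ` by
`σ'`, then by `τ'`, then by `τ`, so the three hypotheses chain together with associators in between.
-/
theorem slideNatT_turnCap {s o x x' x'' t t' t'' s₂ o₂ x₂ x₂' x₂'' t₂ t₂' t₂'' : B}
    {r : s ⟶ o} {h : o ⟶ x} {yv : x ⟶ x'} {h' : o ⟶ x''}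
    {zv : x'' ⟶ x'} {a : x ⟶ t} {a' : x' ⟶ t'} {a'' : x'' ⟶ t''} {mY : t ⟶ t'} {mZ : t'' ⟶ t'}
    {y : yv ≫ a' ≅ a ≫ mY} {k : h ≫ yv ≅ h' ≫ zv} {z : zv ≫ a' ≅ a'' ≫ mZ}
    {r₂ : s₂ ⟶ o₂} {h₂ : o₂ ⟶ x₂} {yv₂ : x₂ ⟶ x₂'} {h₂' : o₂ ⟶ x₂''}
    {zv₂ : x₂'' ⟶ x₂'} {a₂ : x₂ ⟶ t₂} {a₂' : x₂' ⟶ t₂'} {a₂'' : x₂'' ⟶ t₂''} {mY₂ : t₂ ⟶ t₂'}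
    {mZ₂ : t₂'' ⟶ t₂'} {y₂ : yv₂ ≫ a₂' ≅ a₂ ≫ mY₂} {k₂ : h₂ ≫ yv₂ ≅ h₂' ≫ zv₂}
    {z₂ : zv₂ ≫ a₂' ≅ a₂'' ≫ mZ₂}
    {p : s ⟶ s₂} {p₁ : o ⟶ o₂} {px : x ⟶ x₂} {px' : x' ⟶ x₂'} {px'' : x'' ⟶ x₂''} {pt : t ⟶ t₂}
    {pt' : t' ⟶ t₂'} {pt'' : t'' ⟶ t₂''} (θ : p ≫ r₂ ⟶ r ≫ p₁) {i : p₁ ≫ h₂ ⟶ h ≫ px}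
    {i' : p₁ ≫ h₂' ⟶ h' ≫ px''} {X : px ≫ a₂ ⟶ a ≫ pt} {X' : px' ≫ a₂' ⟶ a' ≫ pt'}
    {X'' : px'' ≫ a₂'' ⟶ a'' ≫ pt''} {σ : pt ≫ mY₂ ⟶ mY ≫ pt'} {σ' : px ≫ yv₂ ⟶ yv ≫ px'}
    {τ' : px'' ≫ zv₂ ⟶ zv ≫ px'} {τ : pt'' ≫ mZ₂ ⟶ mZ ≫ pt'}
    (hy : SlideNatT (slideT σ' X') (slideT X σ) y.hom y₂.hom)
    (hk : SlideNatT (slideT i σ') (slideT i' τ') k.hom k₂.hom)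
    (hz : SlideNatT (slideT τ' X') (slideT X'' τ) z.hom z₂.hom) :
    SlideNatT (slideT (slideT θ (slideT i X)) σ) (slideT (slideT θ (slideT i' X'')) τ)
      (turnCap r y k z).hom (turnCap r₂ y₂ k₂ z₂).hom :=
  (SlideNatT.assoc θ (slideT i X) σ).trans ((SlideNatT.slideT_right θ
    ((SlideNatT.assoc i X σ).trans ((SlideNatT.slideT_right i hy.symm).trans
      ((SlideNatT.symm (x := α_ _ _ _) (y := α_ _ _ _) (SlideNatT.assoc i σ' X')).trans
        ((hk.slideT_left X').trans ((SlideNatT.assoc i' τ' X').trans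
          ((SlideNatT.slideT_right i' hz).trans
            (SlideNatT.symm (x := α_ _ _ _) (y := α_ _ _ _) (SlideNatT.assoc i' X'' τ))))))))).trans
    (SlideNatT.symm (x := α_ _ _ _) (y := α_ _ _ _) (SlideNatT.assoc θ (slideT i' X'') τ)))

/-- Conjugation preserves the composition law of turning. Between the two turns, the cell
conjugating `n` after its turn is followed by the exchange and by the inverse of the cell
conjugating `m` before its turn; `hν` trades the outer exchange `ν` for the inner one `τ`. The
outermost conjugating cells split by `hj` and `hk`. -/
theorem turnCap_capPaste {s o : B} {ax ay az axy ayz azz tx ty tz txy tyz tzz : B} (r : s ⟶ o)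
    {hE : o ⟶ ax} {hB : o ⟶ ay} {hA : o ⟶ az}
    {yn : ax ⟶ axy} {zn : ay ⟶ axy} {ym : axy ⟶ azz} {ym' : ay ⟶ ayz} {zn' : ayz ⟶ azz}
    {zm : az ⟶ ayz} {ymn : ax ⟶ azz} {zmn : az ⟶ azz}
    {αx : ax ⟶ tx} {αy : ay ⟶ ty} {αz : az ⟶ tz} {αxy : axy ⟶ txy} {αyz : ayz ⟶ tyz}
    {αzz : azz ⟶ tzz}
    {Yn : tx ⟶ txy} {Zn : ty ⟶ txy} {Ym : txy ⟶ tzz} {Ym' : ty ⟶ tyz} {Zn' : tyz ⟶ tzz}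
    {Zm : tz ⟶ tyz} {Ymn : tx ⟶ tzz} {Zmn : tz ⟶ tzz}
    {yn_ : yn ≫ αxy ≅ αx ≫ Yn} {zn_ : zn ≫ αxy ≅ αy ≫ Zn} {ym_ : ym ≫ αzz ⟶ αxy ≫ Ym}
    {ym_' : ym' ≫ αyz ≅ αy ≫ Ym'} {zn_' : zn' ≫ αzz ⟶ αyz ≫ Zn'} {zm_ : zm ≫ αyz ≅ αz ≫ Zm}
    {ymn_ : ymn ≫ αzz ≅ αx ≫ Ymn} {zmn_ : zmn ≫ αzz ≅ αz ≫ Zmn}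
    {κ : hE ≫ ymn ≅ hA ≫ zmn} {κm : hB ≫ ym' ≅ hA ≫ zm} {κn : hE ≫ yn ≅ hB ≫ zn}
    {τ : zn ≫ ym ⟶ ym' ≫ zn'} {ν : Zn ≫ Ym ⟶ Ym' ≫ Zn'} {j₀ : ymn ⟶ yn ≫ ym}
    {k₀ : zmn ⟶ zm ≫ zn'} {j : Ymn ⟶ Yn ≫ Ym} {k : Zmn ⟶ Zm ≫ Zn'}
    (hj : SlideNat ymn_.hom (slideP yn_.hom ym_) j₀ j)
    (hk : SlideNat zmn_.hom (slideP zm_.hom zn_') k₀ k)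
    (hν : SlideNat (slideP zn_.hom ym_) (slideP ym_'.hom zn_') τ ν)
    (h : κ.hom ≫ hA ◁ k₀ = hE ◁ j₀ ≫ capPaste κm.hom κn.hom τ) :
    (turnCap r ymn_ κ zmn_).hom ≫ (r ≫ hA ≫ αz) ◁ k =
      (r ≫ hE ≫ αx) ◁ j ≫ capPaste (turnCap r ym_' κm zm_).hom (turnCap r yn_ κn zn_).hom ν := by
  -- `ym_` is not assumed invertible, so only `yn_` and `ymn_` are inverted in `hj`.
  have hj' : αx ◁ j ≫ (α_ _ _ _).inv ≫ yn_.inv ▷ Ym =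
      ymn_.inv ≫ j₀ ▷ αzz ≫ (α_ _ _ _).hom ≫ yn ◁ ym_ ≫ (α_ _ _ _).inv := by
    rw [← cancel_epi ymn_.hom, ← Category.assoc, hj]
    unfold slideP
    simp
  unfold SlideNat at hk hν
  calc _ = 𝟙 _ ⊗≫ r ◁ hE ◁ ymn_.inv ⊗≫ r ◁ κ.hom ▷ αzz ⊗≫ r ◁ hA ◁ (zmn_.hom ≫ αz ◁ k) ⊗≫ 𝟙 _ := by
        simp only [turnCap_hom]; bicategory
    _ = 𝟙 _ ⊗≫ r ◁ hE ◁ ymn_.inv ⊗≫ r ◁ (κ.hom ≫ hA ◁ k₀) ▷ αzz ⊗≫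
        r ◁ hA ◁ slideP zm_.hom zn_' ⊗≫ 𝟙 _ := by
        rw [hk]; bicategory
    _ = 𝟙 _ ⊗≫ r ◁ hE ◁ (ymn_.inv ≫ j₀ ▷ αzz ≫ (α_ _ _ _).hom) ⊗≫ r ◁ κn.hom ▷ (ym ≫ αzz) ⊗≫
        r ◁ hB ◁ τ ▷ αzz ⊗≫ r ◁ (κm.hom ▷ (zn' ≫ αzz) ≫ (hA ≫ zm) ◁ zn_') ⊗≫
        r ◁ hA ◁ zm_.hom ▷ Zn' ⊗≫ 𝟙 _ := by
        rw [h]; unfold capPaste slideP; bicategory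
    _ = 𝟙 _ ⊗≫ r ◁ hE ◁ (ymn_.inv ≫ j₀ ▷ αzz ≫ (α_ _ _ _).hom) ⊗≫ r ◁ κn.hom ▷ (ym ≫ αzz) ⊗≫
        r ◁ hB ◁ τ ▷ αzz ⊗≫ r ◁ ((hB ≫ ym') ◁ zn_' ≫ κm.hom ▷ (αyz ≫ Zn')) ⊗≫
        r ◁ hA ◁ zm_.hom ▷ Zn' ⊗≫ 𝟙 _ := by
        rw [whisker_exchange]
    _ = 𝟙 _ ⊗≫ r ◁ hE ◁ (ymn_.inv ≫ j₀ ▷ αzz ≫ (α_ _ _ _).hom) ⊗≫ r ◁ κn.hom ▷ (ym ≫ αzz) ⊗≫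
        r ◁ hB ◁ (τ ▷ αzz ≫ slideP ym_'.hom zn_') ⊗≫ r ◁ hB ◁ ym_'.inv ▷ Zn' ⊗≫
        r ◁ κm.hom ▷ (αyz ≫ Zn') ⊗≫ r ◁ hA ◁ zm_.hom ▷ Zn' ⊗≫ 𝟙 _ := by
        -- Inserting `ym_'` followed by its inverse makes the right side of `hν` appear.
        have : slideP ym_'.hom zn_' ≫ (α_ _ _ _).inv ≫ ym_'.inv ▷ Zn' =
          (α_ _ _ _).hom ≫ ym' ◁ zn_' ≫ (α_ _ _ _).inv := by unfold slideP; simp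
        have h2 : r ◁ hB ◁ (τ ▷ αzz ≫ slideP ym_'.hom zn_' ≫ (α_ _ _ _).inv ≫ ym_'.inv ▷ Zn') =
          r ◁ hB ◁ (τ ▷ αzz ≫ (α_ _ _ _).hom ≫ ym' ◁ zn_' ≫ (α_ _ _ _).inv) := by rw [this]
        calc _ = 𝟙 _ ⊗≫ r ◁ hE ◁ (ymn_.inv ≫ j₀ ▷ αzz ≫ (α_ _ _ _).hom) ⊗≫
              r ◁ κn.hom ▷ (ym ≫ αzz) ⊗≫
              r ◁ hB ◁ (τ ▷ αzz ≫ (α_ _ _ _).hom ≫ ym' ◁ zn_' ≫ (α_ _ _ _).inv) ⊗≫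
              r ◁ κm.hom ▷ (αyz ≫ Zn') ⊗≫ r ◁ hA ◁ zm_.hom ▷ Zn' ⊗≫ 𝟙 _ := by bicategory
          _ = _ := by rw [← h2]; bicategory
    _ = 𝟙 _ ⊗≫ r ◁ hE ◁ (ymn_.inv ≫ j₀ ▷ αzz ≫ (α_ _ _ _).hom) ⊗≫
        r ◁ (κn.hom ▷ (ym ≫ αzz) ≫ (hB ≫ zn) ◁ ym_) ⊗≫ r ◁ hB ◁ zn_.hom ▷ Ym ⊗≫
        r ◁ hB ◁ αy ◁ ν ⊗≫ r ◁ hB ◁ ym_'.inv ▷ Zn' ⊗≫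
        r ◁ κm.hom ▷ (αyz ≫ Zn') ⊗≫ r ◁ hA ◁ zm_.hom ▷ Zn' ⊗≫ 𝟙 _ := by
        rw [← hν]; unfold slideP; bicategory
    _ = 𝟙 _ ⊗≫ r ◁ hE ◁ (ymn_.inv ≫ j₀ ▷ αzz ≫ (α_ _ _ _).hom ≫ yn ◁ ym_ ≫ (α_ _ _ _).inv) ⊗≫
        r ◁ κn.hom ▷ (αxy ≫ Ym) ⊗≫ r ◁ hB ◁ zn_.hom ▷ Ym ⊗≫
        r ◁ hB ◁ αy ◁ ν ⊗≫ r ◁ hB ◁ ym_'.inv ▷ Zn' ⊗≫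
        r ◁ κm.hom ▷ (αyz ≫ Zn') ⊗≫ r ◁ hA ◁ zm_.hom ▷ Zn' ⊗≫ 𝟙 _ := by
        rw [← whisker_exchange]; bicategory
    _ = _ := by
        rw [← hj']; simp only [turnCap_hom]; unfold capPaste; bicategory

end Turn

end DoubleCategory

/-! ### Invertibility and disk naturality of companion disks -/

namespace DoubleCategory

open MonoidalData

variable {C : Type u} [DoubleCategory.{u, v, w, x} C]

/-- Correcting a square and its inverse by a disk and the inverse disk keeps them inverse. With the
companion lemma below, this keeps `assocInvX` and `assocInvZ` invertible. -/
theorem scomp_lact_ract {A B A' B' : C} {m m' : A ⟶ B} {n : A' ⟶ B'} {f : Arr A A'} {g : Arr B B'}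
    {f' : Arr A' A} {g' : Arr B' B} {φ : Sq m n f g} {φ' : Sq n m f' g'} {hf : acomp f f' = aid A}
    {hg : acomp g g' = aid B} (h : scomp φ φ' hf hg = sid m rfl rfl) (d : m' ≅ m) :
    scomp (lact d.hom φ) (ract φ' d.inv) hf hg = sid m' rfl rfl := by
  unfold lact ract
  rw [scomp_scomp _ _ _ _ _ _ _ hf hg (aid_acomp _) (aid_acomp _),
    ← scomp_scomp φ _ _ hf hg (acomp_aid _) (acomp_aid _), h, sid_scomp]
  exact d.hom_inv_id

theorem scomp_ract_lact {A B A' B' : C} {m m' : A ⟶ B} {n : A' ⟶ B'} {f : Arr A A'} {g : Arr B B'}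
    {f' : Arr A' A} {g' : Arr B' B} {φ : Sq m n f g} {φ' : Sq n m f' g'} {hf : acomp f' f = aid A'}
    {hg : acomp g' g = aid B'} (h : scomp φ' φ hf hg = sid n rfl rfl) (d : m ≅ m') :
    scomp (ract φ' d.hom) (lact d.inv φ) hf hg = sid n rfl rfl := by
  unfold lact ract
  have e : scomp d.hom d.inv (aid_acomp _) (aid_acomp _) = sid m rfl rfl := d.hom_inv_id
  rw [scomp_scomp φ' d.hom (scomp d.inv φ (aid_acomp f) (aid_acomp g)) (acomp_aid f')
      (acomp_aid g') hf hg (aid_acomp f) (aid_acomp g) hf hg,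
    ← scomp_scomp d.hom d.inv φ (aid_acomp _) (aid_acomp _) (aid_acomp f) (aid_acomp g)
      (aid_acomp f) (aid_acomp g) (aid_acomp f) (aid_acomp g), e, sid_scomp, h]

theorem Companion.slideNat_disk {A B A' B' : C} {s : Arr A B} {t : Arr A' B'} (hs : Companion s)
    (ht : Companion t) {m m' : A ⟶ A'} {n n' : B ⟶ B'} {φ : Sq m n s t} {ψ : Sq m' n' s t}
    {x : m ⟶ m'} {y : n ⟶ n'} (h : DiskNat φ ψ x y) :
    SlideNat (Companion.disk hs ht φ) (Companion.disk hs ht ψ) x y := by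
  unfold SlideNat
  rw [← Companion.disk_ract, ← Companion.disk_lact, diskNat_iff.1 h]

variable [MonoidalData C]

/-- Tensoring an invertible disk between composite proarrows on the right by an object. -/
def tensorObjIso {A B B' E : C} {m : A ⟶ B} {n : B ⟶ E} {m' : A ⟶ B'} {n' : B' ⟶ E}
    (d : m ≫ n ≅ m' ≫ n') (X : C) : (m ⊗ₚ 𝟙 X) ≫ (n ⊗ₚ 𝟙 X) ≅ (m' ⊗ₚ 𝟙 X) ≫ (n' ⊗ₚ 𝟙 X) :=
  (tensorRight C X).slideIso d

theorem tensorObjIso_hom {A B B' E : C} {m : A ⟶ B} {n : B ⟶ E} {m' : A ⟶ B'} {n' : B' ⟶ E}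
    (d : m ≫ n ≅ m' ≫ n') (X : C) : (tensorObjIso d X).hom = tensorObj d.hom X :=
  tensorRight_slide X d.hom

theorem tensorObjIso_inv {A B B' E : C} {m : A ⟶ B} {n : B ⟶ E} {m' : A ⟶ B'} {n' : B' ⟶ E}
    (d : m ≫ n ≅ m' ≫ n') (X : C) : (tensorObjIso d X).inv = tensorObj d.inv X :=
  tensorRight_slide X d.inv

/-- Tensoring an invertible disk between composite proarrows on the left by an object. -/
def objTensorIso (X : C) {A B B' E : C} {m : A ⟶ B} {n : B ⟶ E} {m' : A ⟶ B'} {n' : B' ⟶ E}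
    (d : m ≫ n ≅ m' ≫ n') : (𝟙 X ⊗ₚ m) ≫ (𝟙 X ⊗ₚ n) ≅ (𝟙 X ⊗ₚ m') ≫ (𝟙 X ⊗ₚ n') :=
  (tensorLeft C X).slideIso d

theorem objTensorIso_hom (X : C) {A B B' E : C} {m : A ⟶ B} {n : B ⟶ E} {m' : A ⟶ B'} {n' : B' ⟶ E}
    (d : m ≫ n ≅ m' ≫ n') : (objTensorIso X d).hom = objTensor X d.hom :=
  tensorLeft_slide X d.hom

theorem objTensorIso_inv (X : C) {A B B' E : C} {m : A ⟶ B} {n : B ⟶ E} {m' : A ⟶ B'} {n' : B' ⟶ E}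
    (d : m ≫ n ≅ m' ≫ n') : (objTensorIso X d).inv = objTensor X d.inv :=
  tensorLeft_slide X d.inv

variable (K : CoherenceCompanions C)

/-! ### The pieces of a zigzag -/

namespace CoherenceCompanions

/-- The disk between companions of the inverse right unitor. -/
def rightInvIso {a b : C} (p : a ⟶ b) :
    p ≫ (K.rightInv b).pro ≅ (K.rightInv a).pro ≫ (p ⊗ₚ 𝟙 one) :=
  Companion.diskIso (K.rightInv a) (K.rightInv b) ((MonoidalData.right (C := C)).inv_hom a)
    ((MonoidalData.right (C := C)).hom_inv a) ((MonoidalData.right (C := C)).inv_hom b) ((MonoidalData.right (C := C)).hom_inv b)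
    (rightInvSq p) (rightSq p) ((MonoidalData.right (C := C)).inv_hom_sq p) ((MonoidalData.right (C := C)).hom_inv_sq p)

/-- The disk between companions of the left unitor. -/
def leftIso {a b : C} (p : a ⟶ b) : (𝟙 one ⊗ₚ p) ≫ (K.left b).pro ≅ (K.left a).pro ≫ p :=
  Companion.diskIso (K.left a) (K.left b) ((MonoidalData.left (C := C)).hom_inv a)
    ((MonoidalData.left (C := C)).inv_hom a) ((MonoidalData.left (C := C)).hom_inv b) ((MonoidalData.left (C := C)).inv_hom b)
    (leftSq p) (leftInvSq p) ((MonoidalData.left (C := C)).hom_inv_sq p) ((MonoidalData.left (C := C)).inv_hom_sq p)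

/-- The disk between companions of the inverse associator, at a proarrow and two objects. -/
def assocIsoX {a b : C} (p : a ⟶ b) (W Z : C) :
    (p ⊗ₚ 𝟙 (W ⊗ₒ Z)) ≫ (K.assocInv b W Z).pro ≅
      (K.assocInv a W Z).pro ≫ ((p ⊗ₚ 𝟙 W) ⊗ₚ 𝟙 Z) :=
  Companion.diskIso (K.assocInv a W Z) (K.assocInv b W Z)
    ((MonoidalData.assoc (C := C)).inv_hom ⟨⟨a, W⟩, Z⟩) ((MonoidalData.assoc (C := C)).hom_inv ⟨⟨a, W⟩, Z⟩)
    ((MonoidalData.assoc (C := C)).inv_hom ⟨⟨b, W⟩, Z⟩) ((MonoidalData.assoc (C := C)).hom_inv ⟨⟨b, W⟩, Z⟩)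
    (assocInvX p W Z) (ract (assocSq p (𝟙 W) (𝟙 Z)) (disk (𝟙 p) (unitIso W Z).hom))
    (scomp_lact_ract ((MonoidalData.assoc (C := C)).inv_hom_sq (A := ⟨⟨a, W⟩, Z⟩) (B := ⟨⟨b, W⟩, Z⟩)
      ((p, 𝟙 W), 𝟙 Z)) (iso (Iso.refl p) (unitIso W Z).symm))
    (scomp_ract_lact ((MonoidalData.assoc (C := C)).hom_inv_sq (A := ⟨⟨a, W⟩, Z⟩) (B := ⟨⟨b, W⟩, Z⟩)
      ((p, 𝟙 W), 𝟙 Z)) (iso (Iso.refl p) (unitIso W Z)))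

/-- The disk between companions of the inverse associator, at two objects around a proarrow. -/
def assocIsoY (a : C) {W W' : C} (q : W ⟶ W') (Z : C) :
    (𝟙 a ⊗ₚ q ⊗ₚ 𝟙 Z) ≫ (K.assocInv a W' Z).pro ≅
      (K.assocInv a W Z).pro ≫ ((𝟙 a ⊗ₚ q) ⊗ₚ 𝟙 Z) :=
  Companion.diskIso (K.assocInv a W Z) (K.assocInv a W' Z)
    ((MonoidalData.assoc (C := C)).inv_hom ⟨⟨a, W⟩, Z⟩) ((MonoidalData.assoc (C := C)).hom_inv ⟨⟨a, W⟩, Z⟩)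
    ((MonoidalData.assoc (C := C)).inv_hom ⟨⟨a, W'⟩, Z⟩) ((MonoidalData.assoc (C := C)).hom_inv ⟨⟨a, W'⟩, Z⟩)
    (assocInvSq (𝟙 a) q (𝟙 Z)) (assocSq (𝟙 a) q (𝟙 Z))
    ((MonoidalData.assoc (C := C)).inv_hom_sq (A := ⟨⟨a, W⟩, Z⟩) (B := ⟨⟨a, W'⟩, Z⟩) ((𝟙 a, q), 𝟙 Z))
    ((MonoidalData.assoc (C := C)).hom_inv_sq (A := ⟨⟨a, W⟩, Z⟩) (B := ⟨⟨a, W'⟩, Z⟩) ((𝟙 a, q), 𝟙 Z))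

/-- The disk between companions of the inverse associator, at two objects and a proarrow. -/
def assocIsoZ (a W : C) {Z Z' : C} (z : Z ⟶ Z') :
    (𝟙 a ⊗ₚ 𝟙 W ⊗ₚ z) ≫ (K.assocInv a W Z').pro ≅
      (K.assocInv a W Z).pro ≫ (𝟙 (a ⊗ₒ W) ⊗ₚ z) :=
  Companion.diskIso (K.assocInv a W Z) (K.assocInv a W Z')
    ((MonoidalData.assoc (C := C)).inv_hom ⟨⟨a, W⟩, Z⟩) ((MonoidalData.assoc (C := C)).hom_inv ⟨⟨a, W⟩, Z⟩)
    ((MonoidalData.assoc (C := C)).inv_hom ⟨⟨a, W⟩, Z'⟩) ((MonoidalData.assoc (C := C)).hom_inv ⟨⟨a, W⟩, Z'⟩)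
    (assocInvZ a W z) (lact (disk (unitIso a W).inv (𝟙 z)) (assocSq (𝟙 a) (𝟙 W) z))
    (scomp_ract_lact ((MonoidalData.assoc (C := C)).inv_hom_sq (A := ⟨⟨a, W⟩, Z⟩) (B := ⟨⟨a, W⟩, Z'⟩)
      ((𝟙 a, 𝟙 W), z)) (iso (unitIso a W) (Iso.refl z)))
    (scomp_lact_ract ((MonoidalData.assoc (C := C)).hom_inv_sq (A := ⟨⟨a, W⟩, Z⟩) (B := ⟨⟨a, W⟩, Z'⟩)
      ((𝟙 a, 𝟙 W), z)) (iso (unitIso a W).symm (Iso.refl z)))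

/-- A cap, tensored on the left. -/
def capPro (a : C) {W Z : C} (h : one ⟶ W ⊗ₒ Z) : a ⟶ (a ⊗ₒ W) ⊗ₒ Z :=
  (K.rightInv a).pro ≫ (𝟙 a ⊗ₚ h) ≫ (K.assocInv a W Z).pro

/-- A cup, tensored on the right. -/
def cupPro {T : C} (e : T ⟶ one) (Z : C) : T ⊗ₒ Z ⟶ Z := (e ⊗ₚ 𝟙 Z) ≫ (K.left Z).pro

/-- A proarrow slides past a cap. -/
def capSlide {a b W Z : C} (p : a ⟶ b) (h : one ⟶ W ⊗ₒ Z) :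
    p ≫ K.capPro b h ≅ K.capPro a h ≫ ((p ⊗ₚ 𝟙 W) ⊗ₚ 𝟙 Z) :=
  slideTIso (K.rightInvIso p) (slideTIso (interchanger p h) (K.assocIsoX p W Z))

/-- A proarrow slides past a cup. -/
def cupSlide {T Z Z' : C} (e : T ⟶ one) (z : Z ⟶ Z') :
    (𝟙 T ⊗ₚ z) ≫ K.cupPro e Z' ≅ K.cupPro e Z ≫ z :=
  slideTIso (interchanger e z).symm (K.leftIso z)

/-- A proarrow turns around a cup, tensored on the right. -/
def cupTurn {T T₁ T₂ : C} {y : T ⟶ T₁} {e : T₁ ⟶ one} {y' : T ⟶ T₂} {e' : T₂ ⟶ one}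
    (κ : y ≫ e ≅ y' ≫ e') (Z : C) : (y ⊗ₚ 𝟙 Z) ≫ K.cupPro e Z ≅ (y' ⊗ₚ 𝟙 Z) ≫ K.cupPro e' Z :=
  turnCup (tensorObjIso κ Z) (K.left Z).pro

/-- A proarrow turns around a cap, tensored on the left. -/
def capTurn (a : C) {W W' Z Z' : C} {q : W ⟶ W'} {z : Z' ⟶ Z} {h : one ⟶ W ⊗ₒ Z}
    {h' : one ⟶ W' ⊗ₒ Z'} (κ : h ≫ (q ⊗ₚ 𝟙 Z) ≅ h' ≫ (𝟙 W' ⊗ₚ z)) :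
    K.capPro a h ≫ ((𝟙 a ⊗ₚ q) ⊗ₚ 𝟙 Z) ≅ K.capPro a h' ≫ (𝟙 (a ⊗ₒ W') ⊗ₚ z) :=
  turnCap (K.rightInv a).pro (K.assocIsoY a q Z) (objTensorIso a κ) (K.assocIsoZ a W' z)

/-! #### Compatibility with composition -/

/-- Each of the three layers splits along `p ≫ p'`. Their stack is then regrouped by `slideT_slideP`
into two complete slides, one for `p` and one for `p'`. -/
theorem slideNat_capSlide_comp {a b c W Z : C} (p : a ⟶ b) (p' : b ⟶ c) (h : one ⟶ W ⊗ₒ Z) :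
    SlideNat (K.capSlide (p ≫ p') h).hom (slideP (K.capSlide p h).hom (K.capSlide p' h).hom)
      (𝟙 (p ≫ p'))
      (disk (rightComp p p' W).hom (𝟙 (𝟙 Z)) ≫ (rightComp (p ⊗ₚ 𝟙 W) (p' ⊗ₚ 𝟙 W) Z).hom) := by
  have h₁ : SlideNat (K.rightInvIso (p ≫ p')).hom
      (slideP (K.rightInvIso p).hom (K.rightInvIso p').hom) (𝟙 (p ≫ p'))
      (rightComp p p' one).hom := by
    have := Companion.slideNat_disk (K.rightInv a) (K.rightInv c)
      (show DiskNat (rightInvSq (p ≫ p')) (pcomp (rightInvSq p) (rightInvSq p')) (𝟙 (p ≫ p'))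
        (rightComp p p' one).hom from (MonoidalData.right (C := C)).inv.appSq_comp p p')
    rwa [Companion.disk_pcomp (K.rightInv a) (K.rightInv b)] at this
  have h₂ : SlideNat (K.assocIsoX (p ≫ p') W Z).hom
      (slideP (K.assocIsoX p W Z).hom (K.assocIsoX p' W Z).hom) (rightComp p p' (W ⊗ₒ Z)).hom
      (disk (rightComp p p' W).hom (𝟙 (𝟙 Z)) ≫ (rightComp (p ⊗ₚ 𝟙 W) (p' ⊗ₚ 𝟙 W) Z).hom) := by
    have := Companion.slideNat_disk (K.assocInv a W Z) (K.assocInv c W Z)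
      (diskNat_assocInvX_comp p p' W Z)
    rwa [Companion.disk_pcomp (K.assocInv a W Z) (K.assocInv b W Z)] at this
  have := h₁.slideT ((slideNat_interchanger_comp p p' h).slideT h₂)
  rwa [slideT_slideP, slideT_slideP] at this

/-- Here the interchanger occurs inverted, since `z` is the strand slid past in the interchanger but
the sliding strand at the cup; its composition law is inverted with `inv_slideT`. -/
theorem slideNat_cupSlide_comp {T Z Z' Z'' : C} (e : T ⟶ one) (z : Z ⟶ Z') (z' : Z' ⟶ Z'') :
    SlideNat (K.cupSlide e (z ≫ z')).hom (slideP (K.cupSlide e z).hom (K.cupSlide e z').hom)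
      (leftComp T z z').hom (𝟙 (z ≫ z')) := by
  have h₁ : SlideNat (K.leftIso (z ≫ z')).hom
      (slideP (K.leftIso z).hom (K.leftIso z').hom) (leftComp one z z').hom (𝟙 (z ≫ z')) := by
    have := Companion.slideNat_disk (K.left Z) (K.left Z'')
      (show DiskNat (leftSq (z ≫ z')) (pcomp (leftSq z) (leftSq z'))
        (leftComp one z z').hom (𝟙 (z ≫ z')) from (MonoidalData.left (C := C)).hom.appSq_comp z z')
    rwa [Companion.disk_pcomp (K.left Z) (K.left Z')] at this
  have := (slideNatT_interchanger_comp e z z').inv_slideT.slideT h₁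
  rwa [slideT_slideP] at this

theorem slideNat_assocIsoY_comp (a : C) {b c d : C} (p : b ⟶ c) (p' : c ⟶ d) (Z : C) :
    SlideNat (K.assocIsoY a (p ≫ p') Z).hom
      (slideP (K.assocIsoY a p Z).hom (K.assocIsoY a p' Z).hom)
      (disk (𝟙 (𝟙 a)) (rightComp p p' Z).hom ≫ (leftComp a (p ⊗ₚ 𝟙 Z) (p' ⊗ₚ 𝟙 Z)).hom)
      (disk (leftComp a p p').hom (𝟙 (𝟙 Z)) ≫ (rightComp (𝟙 a ⊗ₚ p) (𝟙 a ⊗ₚ p') Z).hom) := by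
  have := Companion.slideNat_disk (K.assocInv a b Z) (K.assocInv a d Z)
    (diskNat_assocInvY_comp a p p' Z)
  rwa [Companion.disk_pcomp (K.assocInv a b Z) (K.assocInv a c Z)] at this

theorem slideNat_assocIsoZ_comp (a W : C) {b c d : C} (p : b ⟶ c) (p' : c ⟶ d) :
    SlideNat (K.assocIsoZ a W (p ≫ p')).hom
      (slideP (K.assocIsoZ a W p).hom (K.assocIsoZ a W p').hom)
      (disk (𝟙 (𝟙 a)) (leftComp W p p').hom ≫ (leftComp a (𝟙 W ⊗ₚ p) (𝟙 W ⊗ₚ p')).hom)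
      (leftComp (a ⊗ₒ W) p p').hom := by
  have := Companion.slideNat_disk (K.assocInv a W b) (K.assocInv a W d)
    (diskNat_assocInvZ_comp a W p p')
  rwa [Companion.disk_pcomp (K.assocInv a W b) (K.assocInv a W c)] at this

/-! #### Exchange -/

theorem slideNat_assocIsoX_assocIsoY {a b W W' : C} (p : a ⟶ b) (q : W ⟶ W') (Z : C) :
    SlideNat (slideP (K.assocIsoX p W Z).hom (K.assocIsoY b q Z).hom)
      (slideP (K.assocIsoY a q Z).hom (K.assocIsoX p W' Z).hom)
      (interchanger p (q ⊗ₚ 𝟙 Z)).hom (tensorObj (interchanger p q).hom Z) := by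
  have := Companion.slideNat_disk (K.assocInv a W Z) (K.assocInv b W' Z)
    (diskNat_assocInvX_assocInvY p q Z)
  rwa [Companion.disk_pcomp (K.assocInv a W Z) (K.assocInv b W Z),
    Companion.disk_pcomp (K.assocInv a W Z) (K.assocInv a W' Z)] at this

theorem slideNat_assocIsoX_assocIsoZ {a b Z Z' : C} (p : a ⟶ b) (W : C) (z : Z ⟶ Z') :
    SlideNat (slideP (K.assocIsoX p W Z).hom (K.assocIsoZ b W z).hom)
      (slideP (K.assocIsoZ a W z).hom (K.assocIsoX p W Z').hom)
      (interchanger p (𝟙 W ⊗ₚ z)).hom (interchanger (p ⊗ₚ 𝟙 W) z).hom := by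
  have := Companion.slideNat_disk (K.assocInv a W Z) (K.assocInv b W Z')
    (diskNat_assocInvX_assocInvZ p W z)
  rwa [Companion.disk_pcomp (K.assocInv a W Z) (K.assocInv b W Z),
    Companion.disk_pcomp (K.assocInv a W Z) (K.assocInv a W Z')] at this

/-- At the cap the strand that has turned comes before the one that has not, so the exchange needed
is the inverse interchanger; the naturality statement is inverted accordingly. -/
theorem slideNat_assocIsoZ_assocIsoY (a : C) {W W' Z Z' : C} (q : W ⟶ W') (z : Z ⟶ Z') :
    SlideNat (slideP (K.assocIsoZ a W z).hom (K.assocIsoY a q Z').hom)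
      (slideP (K.assocIsoY a q Z).hom (K.assocIsoZ a W' z).hom)
      (objTensor a (interchanger q z).inv) (interchanger (𝟙 a ⊗ₚ q) z).inv := by
  have h := diskNat_assocInvY_assocInvZ a q z
  rw [← objTensorIso_hom] at h
  have := Companion.slideNat_disk (K.assocInv a W Z) (K.assocInv a W' Z') h.inv
  rwa [Companion.disk_pcomp (K.assocInv a W Z) (K.assocInv a W' Z),
    Companion.disk_pcomp (K.assocInv a W Z) (K.assocInv a W Z'), objTensorIso_inv] at this

/-- This supplies `hh` in `foldIso_exchange`. Layer by layer it is the exchange of `p` with the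
middle leg, naturality of the interchanger in the disk of the cap, and the exchange of `p` with the
last leg. -/
theorem slideNatT_capTurn {a b W W' Z Z' : C} (p : a ⟶ b) {q : W ⟶ W'} {z : Z' ⟶ Z}
    {h : one ⟶ W ⊗ₒ Z} {h' : one ⟶ W' ⊗ₒ Z'} (κ : h ≫ (q ⊗ₚ 𝟙 Z) ≅ h' ≫ (𝟙 W' ⊗ₚ z)) :
    SlideNatT (slideT (K.capSlide p h).hom (tensorObj (interchanger p q).hom Z))
      (slideT (K.capSlide p h').hom (interchanger (p ⊗ₚ 𝟙 W') z).hom)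
      (K.capTurn a κ).hom (K.capTurn b κ).hom := by
  refine slideNatT_turnCap (K.rightInvIso p).hom
    (SlideNatT.of_slideP (K.slideNat_assocIsoX_assocIsoY p q Z)) ?_
    (SlideNatT.of_slideP (K.slideNat_assocIsoX_assocIsoZ p W' z))
  rw [objTensorIso_hom, objTensorIso_hom]
  exact slideNatT_interchanger_slide p κ.hom

/-- This supplies `he` in `foldIso_exchange`: the interchanger is natural in the disk `κ`, and the
unitor after the cup is not affected by the turn. -/
theorem slideNatT_cupTurn {T T₁ T₂ Z Z' : C} {y : T ⟶ T₁} {e : T₁ ⟶ one} {y' : T ⟶ T₂}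
    {e' : T₂ ⟶ one} (κ : y ≫ e ≅ y' ≫ e') (z : Z ⟶ Z') :
    SlideNatT (slideT (interchanger y z).inv (K.cupSlide e z).hom)
      (slideT (interchanger y' z).inv (K.cupSlide e' z).hom) (K.cupTurn κ Z).hom
      (K.cupTurn κ Z').hom := by
  have h := slideNat_interchanger_slide κ.hom z
  rw [← tensorObjIso_hom, ← tensorObjIso_hom] at h
  exact slideNatT_turnCup h.inv_slideP (K.leftIso z).hom

end CoherenceCompanions

end DoubleCategory

/-! ### Functors applied to turning laws -/

namespace DoubleCategory

open MonoidalData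

section

universe u' v' w' x'

variable {C : Type u} [DoubleCategory.{u, v, w, x} C] {D : Type u'} [DoubleCategory.{u', v', w', x'} D]

namespace DFunctor

variable (P : DFunctor C D)

theorem slide_whiskerRight {a b c : C} {p q : a ⟶ b} (d : p ⟶ q) (r : b ⟶ c) :
    P.slide (d ▷ r) = P.dmap d ▷ P.pmap r := by
  unfold slide
  rw [dmap_whiskerRight]
  simp

theorem slide_whiskerLeft {a b c : C} (r : a ⟶ b) {p q : b ⟶ c} (d : p ⟶ q) :
    P.slide (r ◁ d) = P.pmap r ◁ P.dmap d := by
  unfold slide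
  rw [dmap_whiskerLeft]
  simp

theorem slide_comp_cupPaste {a b c d f k g : C} {mnX : a ⟶ c} {mnY : a ⟶ k} {mX : a ⟶ b}
    {nX : b ⟶ c} {nY : b ⟶ d} {nY' : a ⟶ f} {mX' : f ⟶ d} {mY : f ⟶ k} {e'' : c ⟶ g} {e' : d ⟶ g}
    {e : k ⟶ g} {κ : mnX ≫ e'' ⟶ mnY ≫ e} {κm : mX' ≫ e' ⟶ mY ≫ e} {κn : nX ≫ e'' ⟶ nY ≫ e'}
    {σ : mX ≫ nY ⟶ nY' ≫ mX'} {i : mnX ⟶ mX ≫ nX} {j : mnY ⟶ nY' ≫ mY}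
    (h : κ ≫ j ▷ e = i ▷ e'' ≫ cupPaste κm κn σ) :
    P.slide κ ≫ (P.dmap j ≫ (P.mapComp nY' mY).hom) ▷ P.pmap e =
      (P.dmap i ≫ (P.mapComp mX nX).hom) ▷ P.pmap e'' ≫
        cupPaste (P.slide κm) (P.slide κn) (P.slide σ) := by
  have h' := congrArg P.slide h
  rw [slide_comp, slide_comp, slide_whiskerRight, slide_whiskerRight] at h'
  rw [comp_whiskerRight, reassoc_of% h', slide_cupPaste, comp_whiskerRight, Category.assoc]

theorem slide_comp_capPaste {a b c d k l o : C} {mnY : a ⟶ c} {mnZ : l ⟶ c} {nY : a ⟶ b}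
    {mY : b ⟶ c} {nZ : d ⟶ b} {mY' : d ⟶ k} {nZ' : k ⟶ c} {mZ : l ⟶ k} {h'' : o ⟶ a} {h' : o ⟶ d}
    {h : o ⟶ l} {κ : h'' ≫ mnY ⟶ h ≫ mnZ} {κm : h' ≫ mY' ⟶ h ≫ mZ} {κn : h'' ≫ nY ⟶ h' ≫ nZ}
    {τ : nZ ≫ mY ⟶ mY' ≫ nZ'} {j : mnY ⟶ nY ≫ mY} {i : mnZ ⟶ mZ ≫ nZ'}
    (H : κ ≫ h ◁ i = h'' ◁ j ≫ capPaste κm κn τ) :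
    P.slide κ ≫ P.pmap h ◁ (P.dmap i ≫ (P.mapComp mZ nZ').hom) =
      P.pmap h'' ◁ (P.dmap j ≫ (P.mapComp nY mY).hom) ≫
        capPaste (P.slide κm) (P.slide κn) (P.slide τ) := by
  have h' := congrArg P.slide H
  rw [slide_comp, slide_comp, slide_whiskerLeft, slide_whiskerLeft] at h'
  rw [Bicategory.whiskerLeft_comp, reassoc_of% h', slide_capPaste, Bicategory.whiskerLeft_comp,
    Category.assoc]

end DFunctor

/-! ### The unit law of a transformation -/

namespace ProComponents

variable {P Q : DFunctor C D} (t : ProComponents P Q)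

/-- A disk is a square with identity boundaries, so naturality for squares specialises to it; the
arrow components at identities become identity squares after transport of the boundaries. -/
theorem slideNat_of_naturality (appSq_aid : ∀ A : C,
      t.appSq (aid A) = sid (t.app A) (P.amap_aid A) (Q.amap_aid A))
    {A B : C} {m n : A ⟶ B} (d : m ⟶ n) {θ : P.pmap m ≫ t.app B ⟶ t.app A ≫ Q.pmap m}
    {θ' : P.pmap n ≫ t.app B ⟶ t.app A ≫ Q.pmap n}
    (h : scomp (pcomp (P.smap d) (t.appSq (aid B))) θ' (acomp_aid _) (acomp_aid _) =
      scomp θ (pcomp (t.appSq (aid A)) (Q.smap d)) (aid_acomp _) (aid_acomp _)) :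
    SlideNat θ θ' (P.dmap d) (Q.dmap d) := by
  have h' := congrArg (scast (P.amap_aid A) (Q.amap_aid B)) h
  rw [appSq_aid, appSq_aid, scast_of_scomp, scast_of_scomp] at h'
  change scomp θ (pcomp (sid _ rfl rfl) (scast _ _ _)) _ _ =
    scomp (pcomp (scast _ _ _) (sid _ rfl rfl)) θ' _ _
  have e₁ : sid (t.app B) rfl rfl = scast (P.amap_aid B) (Q.amap_aid B)
    (sid (t.app B) (P.amap_aid B) (Q.amap_aid B)) := (scast_sid _ _ _ _ _).symm
  have e₂ : sid (t.app A) rfl rfl = scast (P.amap_aid A) (Q.amap_aid A)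
    (sid (t.app A) (P.amap_aid A) (Q.amap_aid A)) := (scast_sid _ _ _ _ _).symm
  rw [e₁, e₂, scast_pcomp, scast_pcomp, scast_scomp, scomp_scast]
  exact h'.symm

/-- A transformation from data which satisfies all laws except for the unit law of its disks. -/
def pseudoNat (appSq_aid : ∀ A : C,
      t.appSq (aid A) = sid (t.app A) (P.amap_aid A) (Q.amap_aid A))
    (appSq_acomp : ∀ {A B E : C} (f : Arr A B) (g : Arr B E), t.appSq (acomp f g) =
      scomp (t.appSq f) (t.appSq g) (P.amap_acomp f g).symm (Q.amap_acomp f g).symm)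
    (disk : ∀ {A B : C} (m : A ⟶ B), P.pmap m ≫ t.app B ≅ t.app A ≫ Q.pmap m)
    (disk_naturality : ∀ {A B A' B' : C} {m : A ⟶ B} {n : A' ⟶ B'} {f : Arr A A'} {g : Arr B B'}
      (φ : Sq m n f g), DiskNat (pcomp (P.smap φ) (t.appSq g)) (pcomp (t.appSq f) (Q.smap φ))
        (disk m).hom (disk n).hom)
    (disk_comp : ∀ {A B E : C} (m : A ⟶ B) (n : B ⟶ E), SlideNat (disk (m ≫ n)).hom
      (slideP (disk m).hom (disk n).hom) (P.mapComp m n).hom (Q.mapComp m n).hom) : PseudoNat t where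
  appSq_aid := appSq_aid
  appSq_acomp := appSq_acomp
  disk := disk
  disk_naturality φ := disk_naturality φ
  disk_id A := by
    -- Naturality at the inverse unitor `𝟙 A ⟶ 𝟙 A ≫ 𝟙 A`, followed by the composition law, compares
    -- the disk at a unit with its own square; this is what `slide_unit_of_comp` needs.
    have h := (t.slideNat_of_naturality appSq_aid _
      (disk_naturality (λ_ (𝟙 A)).inv)).trans (disk_comp (𝟙 A) (𝟙 A))
    rw [P.dmap_leftUnitor_inv, Q.dmap_leftUnitor_inv] at h
    simp only [Category.assoc, Iso.inv_hom_id, Category.comp_id] at h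
    exact slide_unit_of_comp _ (P.mapId A) (Q.mapId A) h
  disk_comp m n := by
    have h := disk_comp m n
    unfold SlideNat at h
    rw [← cancel_mono (t.app _ ◁ (Q.mapComp m n).hom), h]
    simp [slideP]

end ProComponents

end

end DoubleCategory

/-! ### Naturality of the pieces of a zigzag -/

namespace DoubleCategory

open MonoidalData

variable {C : Type u} [DoubleCategory.{u, v, w, x} C]

section

variable {A B A' B' : C} {m m' : A ⟶ B} {n n' : A' ⟶ B'} {f : Arr A A'} {g : Arr B B'}

theorem DiskNat.lact_lact {φ : Sq m n f g} {l l' : A ⟶ B} {ψ : Sq m' n' f g} {x : m ⟶ m'}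
    {y : n ⟶ n'} (h : DiskNat φ ψ x y) (d : l ⟶ m) (d' : l' ⟶ m') {x' : l ⟶ l'}
    (e : x' ≫ d' = d ≫ x) : DiskNat (lact d φ) (lact d' ψ) x' y := by
  rw [diskNat_iff] at *
  rw [ract_lact, h, DoubleCategory.lact_lact, DoubleCategory.lact_lact, e]

theorem DiskNat.ract_ract {φ : Sq m n f g} {l l' : A' ⟶ B'} {ψ : Sq m' n' f g} {x : m ⟶ m'}
    {y : n ⟶ n'} (h : DiskNat φ ψ x y) (d : n ⟶ l) (d' : n' ⟶ l') {y' : l ⟶ l'}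
    (e : d ≫ y' = y ≫ d') : DiskNat (ract φ d) (ract ψ d') x y' := by
  rw [diskNat_iff] at *
  rw [← ract_lact, ← h, DoubleCategory.ract_ract, DoubleCategory.ract_ract, e]

end

section

variable {A B A₂ B₂ A' B' A₂' B₂' : C} {m m' : A ⟶ A'} {n n' : B ⟶ B'} {m₂ m₂' : A₂ ⟶ A₂'}
  {n₂ n₂' : B₂ ⟶ B₂'} {f : Arr A A₂} {g : Arr A' A₂'} {s : Arr A B} {t : Arr A' B'} {h : Arr B B₂}
  {k : Arr B' B₂'} {s₂ : Arr A₂ B₂} {t₂ : Arr A₂' B₂'}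

/-- A correction that is itself natural does not disturb a naturality equation. The correction in
view is the unit comparison in `assocInvX`. -/
theorem scomp_lact_of_diskNat {μ : Sq m m₂ f g} {μ' : Sq m' m₂' f g} {d : m ⟶ m'} {e : m₂ ⟶ m₂'}
    {φ : Sq m' n s t} {φ₂ : Sq m₂' n₂ s₂ t₂} {ν : Sq n n₂ h k} (H : DiskNat μ μ' d e)
    {l : Arr A B₂} {l' : Arr A' B₂'} (ha : acomp f s₂ = l) (hb : acomp g t₂ = l')
    (hc : acomp s h = l) (hd : acomp t k = l') (H' : scomp μ' φ₂ ha hb = scomp φ ν hc hd) :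
    scomp μ (lact e φ₂) ha hb = scomp (lact d φ) ν hc hd := by
  unfold lact
  rw [← scomp_scomp μ e φ₂ (acomp_aid _) (acomp_aid _) ha hb _ _ ha hb,
    scomp_scomp d φ ν _ _ hc hd hc hd (aid_acomp _) (aid_acomp _), ← H', H,
    scomp_scomp d μ' φ₂ _ _ ha hb ha hb (aid_acomp _) (aid_acomp _)]

theorem scomp_ract_of_diskNat {μ : Sq m m₂ f g} {d : n ⟶ n'} {e : n₂ ⟶ n₂'}
    {φ : Sq m n s t} {φ₂ : Sq m₂ n₂ s₂ t₂} {ν : Sq n n₂ h k} {ν' : Sq n' n₂' h k}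
    (H : DiskNat ν ν' d e)
    {l : Arr A B₂} {l' : Arr A' B₂'} (ha : acomp f s₂ = l) (hb : acomp g t₂ = l')
    (hc : acomp s h = l) (hd : acomp t k = l') (H' : scomp μ φ₂ ha hb = scomp φ ν hc hd) :
    scomp μ (ract φ₂ e) ha hb = scomp (ract φ d) ν' hc hd := by
  unfold ract
  rw [← scomp_scomp μ φ₂ e ha hb (acomp_aid _) (acomp_aid _) _ _ ha hb, H',
    scomp_scomp φ d ν' _ _ hc hd (aid_acomp _) (aid_acomp _) hc hd, ← H,
    ← scomp_scomp φ ν e hc hd (acomp_aid _) (acomp_aid _) (acomp_aid _) (acomp_aid _) hc hd]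

end

variable [MonoidalData C]

theorem unitSq_tensor {a b a' b' : C} (f : Arr a b) (g : Arr a' b') :
    DiskNat (unitSq f ⊗ₛ unitSq g) (unitSq (f ⊗ₐ g)) (unitIso a a').hom (unitIso b b').hom :=
  (tensor (C := C)).mapId_naturality (A := ⟨a, a'⟩) (B := ⟨b, b'⟩) (f, g)

theorem DiskNat.tensor {A B A' B' : C} {m m' : A ⟶ B} {n n' : A' ⟶ B'} {f : Arr A A'} {g : Arr B B'}
    {φ : Sq m n f g} {ψ : Sq m' n' f g} {d : m ⟶ m'} {e : n ⟶ n'} (h : DiskNat φ ψ d e)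
    {A₂ B₂ A₂' B₂' : C} {m₂ m₂' : A₂ ⟶ B₂} {n₂ n₂' : A₂' ⟶ B₂'} {f₂ : Arr A₂ A₂'} {g₂ : Arr B₂ B₂'}
    {φ₂ : Sq m₂ n₂ f₂ g₂} {ψ₂ : Sq m₂' n₂' f₂ g₂} {d₂ : m₂ ⟶ m₂'} {e₂ : n₂ ⟶ n₂'}
    (h₂ : DiskNat φ₂ ψ₂ d₂ e₂) :
    DiskNat (φ ⊗ₛ φ₂) (ψ ⊗ₛ ψ₂) (MonoidalData.disk d d₂) (MonoidalData.disk e e₂) := by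
  have H : DiskNat (C := C ×ᵈ C) (A := ⟨A, A₂⟩) (B := ⟨B, B₂⟩) (A' := ⟨A', A₂'⟩) (B' := ⟨B', B₂'⟩)
    (m := (m, m₂)) (m' := (m', m₂')) (n := (n, n₂)) (n' := (n', n₂')) (f := (f, f₂)) (g := (g, g₂))
    (φ, φ₂) (ψ, ψ₂) (d, d₂) (e, e₂) := DiskNat.prod h h₂
  exact H.dmap MonoidalData.tensor

theorem diskNat_assocInvSq_disk {A B E A' B' E' : C} {m m' : A ⟶ A'} {n n' : B ⟶ B'}
    {p p' : E ⟶ E'} (d : m ⟶ m') (e : n ⟶ n') (k : p ⟶ p') :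
    DiskNat (assocInvSq m n p) (assocInvSq m' n' p') (disk d (disk e k)) (disk (disk d e) k) := by
  have h := (assoc (C := C)).inv.diskNat_dmap (a := ⟨⟨A, B⟩, E⟩) (b := ⟨⟨A', B'⟩, E'⟩)
    (p := ((m, n), p)) (r := ((m', n'), p')) ((d, e), k)
  have h₁ : ((DFunctor.prodAssoc C C C).comp (((DFunctor.id C).prodMap tensor).comp tensor)).dmap
      (A := ⟨⟨A, B⟩, E⟩) (B := ⟨⟨A', B'⟩, E'⟩) (m := ((m, n), p)) (n := ((m', n'), p'))
      ((d, e), k) = disk d (disk e k) := by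
    refine (PreFunctor.comp_dmap _ _ _).trans ((PreFunctor.comp_dmap _ _ _).trans ?_)
    unfold DFunctor.prodAssoc DFunctor.prodMap
    rw [DFunctor.pair_dmap, DFunctor.pair_dmap, DFunctor.pair_dmap]
    -- The inner component is the value of another composite functor, whose action on disks has to
    -- be unfolded separately.
    have : ∀ {X X' : C} {o o' : X ⟶ X'} {Y Y' : C ×ᵈ C} {r r' : Y ⟶ Y'} (d : o ⟶ o') (e : r ⟶ r'),
        ((DFunctor.snd C (C ×ᵈ C)).comp tensor).dmap (A := ⟨X, Y⟩) (B := ⟨X', Y'⟩) (m := (o, r))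
          (n := (o', r')) (d, e) = (tensor (C := C)).dmap e := fun d e =>
      PreFunctor.comp_dmap _ _ _
    exact congrArg (fun z => disk d z) (this d _)
  have h₂ : ((tensor.prodMap (DFunctor.id C)).comp tensor).dmap
      (A := ⟨⟨A, B⟩, E⟩) (B := ⟨⟨A', B'⟩, E'⟩) (m := ((m, n), p)) (n := ((m', n'), p'))
      ((d, e), k) = disk (disk d e) k := by
    refine (PreFunctor.comp_dmap _ _ _).trans ?_
    unfold DFunctor.prodMap
    rw [DFunctor.pair_dmap]
    have : ((DFunctor.fst (C ×ᵈ C) C).comp tensor).dmap (A := ⟨⟨A, B⟩, E⟩) (B := ⟨⟨A', B'⟩, E'⟩)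
        (m := ((m, n), p)) (n := ((m', n'), p')) ((d, e), k) = disk d e :=
      PreFunctor.comp_dmap _ _ _
    exact congrArg (fun z => disk z k) this
  rw [h₁, h₂] at h
  exact h

theorem diskNat_assocInvX_disk {a b : C} {p q : a ⟶ b} (x : p ⟶ q) (W Z : C) :
    DiskNat (assocInvX p W Z) (assocInvX q W Z) (disk x (𝟙 (𝟙 (W ⊗ₒ Z))))
      (disk (disk x (𝟙 (𝟙 W))) (𝟙 (𝟙 Z))) := by
  refine (diskNat_assocInvSq_disk x (𝟙 (𝟙 W)) (𝟙 (𝟙 Z))).lact_lact _ _ ?_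
  rw [disk_id, disk_comp, disk_comp, Category.id_comp, Category.id_comp, Category.comp_id,
    Category.comp_id]

theorem diskNat_assocInvZ_disk (a W : C) {Z Z' : C} {z z' : Z ⟶ Z'} (x : z ⟶ z') :
    DiskNat (assocInvZ a W z) (assocInvZ a W z') (disk (𝟙 (𝟙 a)) (disk (𝟙 (𝟙 W)) x))
      (disk (𝟙 (𝟙 (a ⊗ₒ W))) x) := by
  refine (diskNat_assocInvSq_disk (𝟙 (𝟙 a)) (𝟙 (𝟙 W)) x).ract_ract _ _ ?_
  rw [disk_id, disk_comp, disk_comp, Category.id_comp, Category.id_comp, Category.comp_id,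
    Category.comp_id]

variable (K : CoherenceCompanions C)

namespace CoherenceCompanions

/-! #### Naturality with respect to disks -/

theorem slideNat_capSlide {a b W Z : C} {p q : a ⟶ b} (x : p ⟶ q) (h : one ⟶ W ⊗ₒ Z) :
    SlideNat (K.capSlide p h).hom (K.capSlide q h).hom x
      (disk (disk x (𝟙 (𝟙 W))) (𝟙 (𝟙 Z))) := by
  have h₁ : SlideNat (K.rightInvIso p).hom (K.rightInvIso q).hom x (disk x (𝟙 (𝟙 one))) := by
    have := (MonoidalData.right (C := C)).inv.diskNat_dmap x
    have e : ((DFunctor.pair (DFunctor.id C) (DFunctor.const C one)).comp tensor).dmap x =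
      disk x (𝟙 (𝟙 one)) := tensorRight_dmap one x
    rw [e] at this
    exact Companion.slideNat_disk (K.rightInv a) (K.rightInv b) this
  exact h₁.slideT ((interchanger_natural_left x h).slideT
    (Companion.slideNat_disk (K.assocInv a W Z) (K.assocInv b W Z) (diskNat_assocInvX_disk x W Z)))

theorem slideNat_cupSlide {T Z Z' : C} (e : T ⟶ one) {z z' : Z ⟶ Z'} (x : z ⟶ z') :
    SlideNat (K.cupSlide e z).hom (K.cupSlide e z').hom (disk (𝟙 (𝟙 T)) x) x := by
  have h₁ : SlideNat (K.leftIso z).hom (K.leftIso z').hom (disk (𝟙 (𝟙 one)) x) x := by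
    have := (MonoidalData.left (C := C)).hom.diskNat_dmap x
    have e : ((DFunctor.pair (DFunctor.const C one) (DFunctor.id C)).comp tensor).dmap x =
      disk (𝟙 (𝟙 one)) x := tensorLeft_dmap one x
    rw [e] at this
    exact Companion.slideNat_disk (K.left Z) (K.left Z') this
  exact (SlideNatT.inv (interchanger_natural_right e x)).slideT h₁

theorem slideNat_assocIsoY (a : C) {W W' : C} {q q' : W ⟶ W'} (x : q ⟶ q') (Z : C) :
    SlideNat (K.assocIsoY a q Z).hom (K.assocIsoY a q' Z).hom
      (disk (𝟙 (𝟙 a)) (disk x (𝟙 (𝟙 Z)))) (disk (disk (𝟙 (𝟙 a)) x) (𝟙 (𝟙 Z))) :=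
  Companion.slideNat_disk (K.assocInv a W Z) (K.assocInv a W' Z) (diskNat_assocInvSq_disk _ _ _)

theorem slideNat_assocIsoZ (a W : C) {Z Z' : C} {z z' : Z ⟶ Z'} (x : z ⟶ z') :
    SlideNat (K.assocIsoZ a W z).hom (K.assocIsoZ a W z').hom
      (disk (𝟙 (𝟙 a)) (disk (𝟙 (𝟙 W)) x)) (disk (𝟙 (𝟙 (a ⊗ₒ W))) x) :=
  Companion.slideNat_disk (K.assocInv a W Z) (K.assocInv a W Z') (diskNat_assocInvZ_disk a W x)

/-! #### Naturality with respect to squares -/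

/-- The square between tensored caps. -/
def capSq {a a' W W' Z Z' : C} (f : Arr a a') {k : Arr W W'} {l : Arr Z Z'} {h : one ⟶ W ⊗ₒ Z}
    {h' : one ⟶ W' ⊗ₒ Z'} (ψ : Sq h h' (aid one) (k ⊗ₐ l)) :
    Sq (K.capPro a h) (K.capPro a' h') f ((f ⊗ₐ k) ⊗ₐ l) :=
  pcomp (Companion.sq (K.rightInv a) (K.rightInv a')
      ((MonoidalData.right (C := C)).inv.naturality f))
    (pcomp (unitSq f ⊗ₛ ψ) (Companion.sq (K.assocInv a W Z) (K.assocInv a' W' Z')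
      ((MonoidalData.assoc (C := C)).inv.naturality (A := ⟨⟨a, W⟩, Z⟩) (B := ⟨⟨a', W'⟩, Z'⟩)
        ((f, k), l))))

/-- The square between tensored cups. -/
def cupSq {T T' Z Z' : C} {t : Arr T T'} {e : T ⟶ one} {e' : T' ⟶ one} (ψ : Sq e e' t (aid one))
    (l : Arr Z Z') : Sq (K.cupPro e Z) (K.cupPro e' Z') (t ⊗ₐ l) l :=
  pcomp (ψ ⊗ₛ unitSq l) (Companion.sq (K.left Z) (K.left Z')
    ((MonoidalData.left (C := C)).hom.naturality l))

/-- Naturality of the inverse associator at the triple of `φ` and two unit squares; `unitSq_tensor`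
carries the unit comparison across the square. -/
theorem diskNat_assocIsoX {a b W Z a' b' W' Z' : C} {p : a ⟶ b} {p' : a' ⟶ b'} {f : Arr a a'}
    {g : Arr b b'} (φ : Sq p p' f g) (k : Arr W W') (l : Arr Z Z') :
    DiskNat (pcomp (φ ⊗ₛ unitSq (k ⊗ₐ l)) (Companion.sq (K.assocInv b W Z) (K.assocInv b' W' Z')
        ((MonoidalData.assoc (C := C)).inv.naturality (A := ⟨⟨b, W⟩, Z⟩) (B := ⟨⟨b', W'⟩, Z'⟩)
          ((g, k), l))))
      (pcomp (Companion.sq (K.assocInv a W Z) (K.assocInv a' W' Z')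
        ((MonoidalData.assoc (C := C)).inv.naturality (A := ⟨⟨a, W⟩, Z⟩) (B := ⟨⟨a', W'⟩, Z'⟩)
          ((f, k), l))) ((φ ⊗ₛ unitSq k) ⊗ₛ unitSq l))
      (K.assocIsoX p W Z).hom (K.assocIsoX p' W' Z').hom :=
  Companion.diskNat_disk _ _ _ _ _ _ (scomp_lact_of_diskNat
    ((DiskNat.id φ).tensor (DiskNat.inv (unitSq_tensor k l))) _ _ _ _
    ((MonoidalData.assoc (C := C)).inv.sq_naturality (A := ⟨⟨a, W⟩, Z⟩) (B := ⟨⟨b, W⟩, Z⟩)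
      (A' := ⟨⟨a', W'⟩, Z'⟩) (B' := ⟨⟨b', W'⟩, Z'⟩) (m := ((p, 𝟙 W), 𝟙 Z)) (n := ((p', 𝟙 W'), 𝟙 Z'))
      (f := ((f, k), l)) (g := ((g, k), l)) ((φ, unitSq k), unitSq l)))

theorem diskNat_assocIsoY {a a' W W' Z V V' Z' : C} {q : W ⟶ W'} {q' : V ⟶ V'} (f : Arr a a')
    {k : Arr W V} {k' : Arr W' V'} (φ : Sq q q' k k') (l : Arr Z Z') :
    DiskNat (pcomp (unitSq f ⊗ₛ φ ⊗ₛ unitSq l)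
        (Companion.sq (K.assocInv a W' Z) (K.assocInv a' V' Z')
          ((MonoidalData.assoc (C := C)).inv.naturality (A := ⟨⟨a, W'⟩, Z⟩) (B := ⟨⟨a', V'⟩, Z'⟩)
            ((f, k'), l))))
      (pcomp (Companion.sq (K.assocInv a W Z) (K.assocInv a' V Z')
        ((MonoidalData.assoc (C := C)).inv.naturality (A := ⟨⟨a, W⟩, Z⟩) (B := ⟨⟨a', V⟩, Z'⟩)
          ((f, k), l))) ((unitSq f ⊗ₛ φ) ⊗ₛ unitSq l))
      (K.assocIsoY a q Z).hom (K.assocIsoY a' q' Z').hom :=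
  Companion.diskNat_disk _ _ _ _ _ _
    ((MonoidalData.assoc (C := C)).inv.sq_naturality (A := ⟨⟨a, W⟩, Z⟩) (B := ⟨⟨a, W'⟩, Z⟩)
      (A' := ⟨⟨a', V⟩, Z'⟩) (B' := ⟨⟨a', V'⟩, Z'⟩) (m := ((𝟙 a, q), 𝟙 Z)) (n := ((𝟙 a', q'), 𝟙 Z'))
      (f := ((f, k), l)) (g := ((f, k'), l)) ((unitSq f, φ), unitSq l))

theorem diskNat_assocIsoZ {a a' W W' Z V V' Z' : C} {z : Z ⟶ Z'} {z' : V ⟶ V'} (f : Arr a a')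
    (k : Arr W W') {l : Arr Z V} {l' : Arr Z' V'} (φ : Sq z z' l l') :
    DiskNat (pcomp (unitSq f ⊗ₛ unitSq k ⊗ₛ φ)
        (Companion.sq (K.assocInv a W Z') (K.assocInv a' W' V')
          ((MonoidalData.assoc (C := C)).inv.naturality (A := ⟨⟨a, W⟩, Z'⟩) (B := ⟨⟨a', W'⟩, V'⟩)
            ((f, k), l'))))
      (pcomp (Companion.sq (K.assocInv a W Z) (K.assocInv a' W' V)
        ((MonoidalData.assoc (C := C)).inv.naturality (A := ⟨⟨a, W⟩, Z⟩) (B := ⟨⟨a', W'⟩, V⟩)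
          ((f, k), l))) (unitSq (f ⊗ₐ k) ⊗ₛ φ))
      (K.assocIsoZ a W z).hom (K.assocIsoZ a' W' z').hom :=
  Companion.diskNat_disk _ _ _ _ _ _ (scomp_ract_of_diskNat
    ((unitSq_tensor f k).tensor (DiskNat.id φ)) _ _ _ _
    ((MonoidalData.assoc (C := C)).inv.sq_naturality (A := ⟨⟨a, W⟩, Z⟩) (B := ⟨⟨a, W⟩, Z'⟩)
      (A' := ⟨⟨a', W'⟩, V⟩) (B' := ⟨⟨a', W'⟩, V'⟩) (m := ((𝟙 a, 𝟙 W), z)) (n := ((𝟙 a', 𝟙 W'), z'))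
      (f := ((f, k), l)) (g := ((f, k), l')) ((unitSq f, unitSq k), φ)))

theorem diskNat_capSlide {a b W Z a' b' W' Z' : C} {p : a ⟶ b} {p' : a' ⟶ b'} {f : Arr a a'}
    {g : Arr b b'} (φ : Sq p p' f g) {k : Arr W W'} {l : Arr Z Z'} {h : one ⟶ W ⊗ₒ Z}
    {h' : one ⟶ W' ⊗ₒ Z'} (ψ : Sq h h' (aid one) (k ⊗ₐ l)) :
    DiskNat (pcomp φ (K.capSq g ψ)) (pcomp (K.capSq f ψ) ((φ ⊗ₛ unitSq k) ⊗ₛ unitSq l))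
      (K.capSlide p h).hom (K.capSlide p' h').hom := by
  have h₁ : DiskNat (pcomp φ (Companion.sq (K.rightInv b) (K.rightInv b')
        ((MonoidalData.right (C := C)).inv.naturality g)))
      (pcomp (Companion.sq (K.rightInv a) (K.rightInv a')
        ((MonoidalData.right (C := C)).inv.naturality f)) (φ ⊗ₛ unitSq (aid one)))
      (K.rightInvIso p).hom (K.rightInvIso p').hom := by
    -- The constant functor sends squares to `sid`, while the interchanger leaves `unitSq (aid one)`
    -- behind.
    rw [unitSq_aid]
    exact Companion.diskNat_disk _ _ _ _ _ _ ((MonoidalData.right (C := C)).inv.sq_naturality φ)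
  exact h₁.slideT ((diskNat_interchanger φ ψ).slideT (K.diskNat_assocIsoX φ k l))

theorem diskNat_cupSlide {T T' Z Z' V V' : C} {t : Arr T T'} {e : T ⟶ one} {e' : T' ⟶ one}
    (ψ : Sq e e' t (aid one)) {z : Z ⟶ Z'} {z' : V ⟶ V'} {l : Arr Z V} {l' : Arr Z' V'}
    (φ : Sq z z' l l') :
    DiskNat (pcomp (unitSq t ⊗ₛ φ) (K.cupSq ψ l')) (pcomp (K.cupSq ψ l) φ)
      (K.cupSlide e z).hom (K.cupSlide e' z').hom := by
  have h₁ : DiskNat (pcomp (unitSq (aid one) ⊗ₛ φ) (Companion.sq (K.left Z') (K.left V')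
        ((MonoidalData.left (C := C)).hom.naturality l')))
      (pcomp (Companion.sq (K.left Z) (K.left V)
        ((MonoidalData.left (C := C)).hom.naturality l)) φ)
      (K.leftIso z).hom (K.leftIso z').hom := by
    rw [unitSq_aid]
    exact Companion.diskNat_disk _ _ _ _ _ _ ((MonoidalData.left (C := C)).hom.sq_naturality φ)
  exact (DiskNat.inv (diskNat_interchanger ψ φ)).slideT h₁

theorem diskNat_cupTurn {T T₁ T₂ T' T₁' T₂' Z Z' : C} {y : T ⟶ T₁} {e : T₁ ⟶ one} {y₂ : T ⟶ T₂}
    {e₂ : T₂ ⟶ one} {κ : y ≫ e ≅ y₂ ≫ e₂} {y' : T' ⟶ T₁'} {e' : T₁' ⟶ one} {y₂' : T' ⟶ T₂'}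
    {e₂' : T₂' ⟶ one} {κ' : y' ≫ e' ≅ y₂' ≫ e₂'} {t : Arr T T'} {t₁ : Arr T₁ T₁'} {t₂ : Arr T₂ T₂'}
    {Y : Sq y y' t t₁} {E : Sq e e' t₁ (aid one)} {Y₂ : Sq y₂ y₂' t t₂} {E₂ : Sq e₂ e₂' t₂ (aid one)}
    (h : DiskNat (pcomp Y E) (pcomp Y₂ E₂) κ.hom κ'.hom) (l : Arr Z Z') :
    DiskNat (pcomp (Y ⊗ₛ unitSq l) (K.cupSq E l)) (pcomp (Y₂ ⊗ₛ unitSq l) (K.cupSq E₂ l))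
      (K.cupTurn κ Z).hom (K.cupTurn κ' Z').hom := by
  have h' := diskNat_diskSlide h (DiskNat.id (pcomp (unitSq l) (unitSq l)))
  rw [← tensorObj_eq_diskSlide, ← tensorObj_eq_diskSlide, ← tensorObjIso_hom,
    ← tensorObjIso_hom] at h'
  exact (DiskNat.associator_inv _ _ _).comp ((h'.whiskerRight _).comp (DiskNat.associator _ _ _))

/-- Each factor of the conjugated turn is natural: the inverse of the disk on the middle leg, the
disk of the cap tensored with an object, and the disk on the last leg. Associators bring the squares
into position for each of them. -/
theorem diskNat_capTurn {a a' W V Z U W' V' Z' U' : C} (f : Arr a a') {q : W ⟶ V} {z : U ⟶ Z}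
    {h : one ⟶ W ⊗ₒ Z} {h₂ : one ⟶ V ⊗ₒ U} {κ : h ≫ (q ⊗ₚ 𝟙 Z) ≅ h₂ ≫ (𝟙 V ⊗ₚ z)}
    {q' : W' ⟶ V'} {z' : U' ⟶ Z'} {h' : one ⟶ W' ⊗ₒ Z'} {h₂' : one ⟶ V' ⊗ₒ U'}
    {κ' : h' ≫ (q' ⊗ₚ 𝟙 Z') ≅ h₂' ≫ (𝟙 V' ⊗ₚ z')} {k : Arr W W'} {l : Arr Z Z'} {k₂ : Arr V V'}
    {l₂ : Arr U U'} {H : Sq h h' (aid one) (k ⊗ₐ l)} {H₂ : Sq h₂ h₂' (aid one) (k₂ ⊗ₐ l₂)}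
    {Q : Sq q q' k k₂} {O : Sq z z' l₂ l}
    (hκ : DiskNat (pcomp H (Q ⊗ₛ unitSq l)) (pcomp H₂ (unitSq k₂ ⊗ₛ O)) κ.hom κ'.hom) :
    DiskNat (pcomp (K.capSq f H) ((unitSq f ⊗ₛ Q) ⊗ₛ unitSq l))
      (pcomp (K.capSq f H₂) (unitSq (f ⊗ₐ k₂) ⊗ₛ O)) (K.capTurn a κ).hom (K.capTurn a' κ').hom := by
  have h' := diskNat_diskSlide (DiskNat.id (pcomp (unitSq f) (unitSq f))) hκ
  rw [← objTensor_eq_diskSlide, ← objTensor_eq_diskSlide, ← objTensorIso_hom,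
    ← objTensorIso_hom] at h'
  change DiskNat _ _
    ((α_ _ _ _).hom ≫ (K.rightInv a).pro ◁ (turnCapCore (K.assocIsoY a q Z) (objTensorIso a κ)
      (K.assocIsoZ a V z)).hom ≫ (α_ _ _ _).inv)
    ((α_ _ _ _).hom ≫ (K.rightInv a').pro ◁ (turnCapCore (K.assocIsoY a' q' Z')
      (objTensorIso a' κ') (K.assocIsoZ a' V' z')).hom ≫ (α_ _ _ _).inv)
  refine (DiskNat.associator _ _ _).comp ?_
  refine DiskNat.comp (DiskNat.whiskerLeft ?_ _) (DiskNat.associator_inv _ _ _)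
  refine (DiskNat.associator _ _ _).comp ?_
  refine (DiskNat.whiskerLeft (DiskNat.inv (K.diskNat_assocIsoY f Q l)) _).comp ?_
  refine (DiskNat.associator_inv _ _ _).comp ((h'.whiskerRight _).comp ?_)
  refine (DiskNat.associator _ _ _).comp ?_
  exact (DiskNat.whiskerLeft (K.diskNat_assocIsoZ f k₂ O) _).comp (DiskNat.associator_inv _ _ _)

end CoherenceCompanions

end DoubleCategory

/-! ### Regrouping, and caps and cups for a pair of functors -/

namespace DoubleCategory

open MonoidalData

section Regroup

universe u₁ v₁ w₁

variable {B : Type u₁} [Bicategory.{w₁, v₁} B]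

/-- Conjugation of a sliding cell by isomorphisms of the `1`-cells which are slid past. -/
@[simps!]
def slideConj {a b a' b' : B} {p : a ⟶ b} {q : a' ⟶ b'} {t s : a ⟶ a'} {t' s' : b ⟶ b'}
    (i : t ≅ s) (i' : t' ≅ s') (θ : p ≫ t' ≅ t ≫ q) : p ≫ s' ≅ s ≫ q :=
  whiskerLeftIso p i'.symm ≪≫ θ ≪≫ whiskerRightIso i q

theorem SlideNat.slideConj {a b c a' b' c' : B} {o : a ⟶ c} {p : a ⟶ b} {p' : b ⟶ c} {r : a' ⟶ c'}
    {q : a' ⟶ b'} {q' : b' ⟶ c'} {t s : a ⟶ a'} {t' s' : b ⟶ b'} {t'' s'' : c ⟶ c'}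
    (i : t ≅ s) (i' : t' ≅ s') (i'' : t'' ≅ s'') {θ : o ≫ t'' ≅ t ≫ r} {κ : p ≫ t' ≅ t ≫ q}
    {κ' : p' ≫ t'' ≅ t' ≫ q'} {x : o ⟶ p ≫ p'} {y : r ⟶ q ≫ q'}
    (h : SlideNat θ.hom (slideP κ.hom κ'.hom) x y) :
    SlideNat (slideConj i i'' θ).hom (slideP (DoubleCategory.slideConj i i' κ).hom
      (DoubleCategory.slideConj i' i'' κ').hom) x y := by
  unfold SlideNat at *
  have e : slideP (DoubleCategory.slideConj i i' κ).hom (DoubleCategory.slideConj i' i'' κ').hom =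
      (p ≫ p') ◁ i''.inv ≫ slideP κ.hom κ'.hom ≫ i.hom ▷ (q ≫ q') := by
    unfold slideP
    simp
  rw [e, ← whisker_exchange_assoc, ← reassoc_of% h, slideConj_hom, Category.assoc, Category.assoc,
    whisker_exchange]

/-- Reassociation of a composite of four `1`-cells. -/
@[simps!]
def regroup {a b c d e : B} (r : a ⟶ b) (h : b ⟶ c) (k : c ⟶ d) (l : d ⟶ e) :
    (r ≫ h ≫ k) ≫ l ≅ r ≫ h ≫ k ≫ l :=
  α_ r (h ≫ k) l ≪≫ whiskerLeftIso r (α_ h k l)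

end Regroup

universe u' v' w' x'

variable {C : Type u} [DoubleCategory.{u, v, w, x} C] [MonoidalData C]

section

variable {J : Type u'} [DoubleCategory.{u', v', w', x'} J] (V : DFunctor (Co J) C)

/-- The value of a functor on an object with reversed proarrows. -/
abbrev cobj (A : J) : C := V.obj (Co.mk A)

/-- The value of a functor on an arrow with reversed proarrows. -/
abbrev carr {A B : J} (f : Arr A B) : Arr (cobj V A) (cobj V B) :=
  V.amap (A := Co.mk A) (B := Co.mk B) f

/-- The value of a functor on a reversed proarrow. -/
abbrev cpro {A B : J} (m : A ⟶ B) : cobj V B ⟶ cobj V A :=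
  V.pmap (A := Co.mk B) (B := Co.mk A) m

/-- The value of a functor on a reversed square. -/
abbrev csq {A B A' B' : J} {m : A ⟶ B} {n : A' ⟶ B'} {f : Arr A A'} {g : Arr B B'}
    (φ : Sq m n f g) : Sq (cpro V m) (cpro V n) (carr V g) (carr V f) :=
  V.smap (A := Co.mk B) (B := Co.mk A) (A' := Co.mk B') (B' := Co.mk A') (m := m) (n := n) (f := g)
    (g := f) φ

/-- The comparison disk of a functor for composites of reversed proarrows. -/
abbrev cmapComp {A B E : J} (m : A ⟶ B) (n : B ⟶ E) : cpro V (m ≫ n) ≅ cpro V n ≫ cpro V m :=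
  V.mapComp (A := Co.mk E) (B := Co.mk B) (E := Co.mk A) n m

variable (U : DFunctor J C)

/-- Caps `1 ⟶ V A ⊗ U A` around which proarrows can be turned. -/
structure CapData where
  /-- object-component proarrow -/
  pro (A : J) : (one : C) ⟶ cobj V A ⊗ₒ U.obj A
  /-- arrow-component square -/
  sq {A B : J} (f : Arr A B) : Sq (pro A) (pro B) (aid one) (carr V f ⊗ₐ U.amap f)
  sq_aid (A : J) (h : carr V (aid A) ⊗ₐ U.amap (aid A) = aid _) : sq (aid A) = sid (pro A) rfl h
  sq_acomp {A B E : J} (f : Arr A B) (g : Arr B E)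
    (h : acomp (carr V f ⊗ₐ U.amap f) (carr V g ⊗ₐ U.amap g) =
      carr V (acomp f g) ⊗ₐ U.amap (acomp f g)) :
    sq (acomp f g) = scomp (sq f) (sq g) (aid_acomp _) h
  /-- proarrow-component disk -/
  turn {A B : J} (m : A ⟶ B) :
    pro B ≫ (cpro V m ⊗ₚ 𝟙 (U.obj B)) ≅ pro A ≫ (𝟙 (cobj V A) ⊗ₚ U.pmap m)
  turn_naturality {A B A' B' : J} {m : A ⟶ B} {n : A' ⟶ B'} {f : Arr A A'} {g : Arr B B'}
    (φ : Sq m n f g) : DiskNat (pcomp (sq g) (csq V φ ⊗ₛ unitSq (U.amap g)))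
      (pcomp (sq f) (unitSq (carr V f) ⊗ₛ U.smap φ)) (turn m).hom (turn n).hom
  turn_comp {A B E : J} (m : A ⟶ B) (n : B ⟶ E) :
    (turn (m ≫ n)).hom ≫ pro A ◁ (disk (𝟙 (𝟙 (cobj V A))) (U.mapComp m n).hom ≫
      (leftComp (cobj V A) (U.pmap m) (U.pmap n)).hom) =
    pro E ◁ (disk (cmapComp V m n).hom (𝟙 (𝟙 (U.obj E))) ≫
      (rightComp (cpro V n) (cpro V m) (U.obj E)).hom) ≫
      capPaste (turn m).hom (turn n).hom (interchanger (cpro V m) (U.pmap n)).inv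

/-- Cups `U A ⊗ V A ⟶ 1` around which proarrows can be turned. -/
structure CupData where
  /-- object-component proarrow -/
  pro (A : J) : U.obj A ⊗ₒ cobj V A ⟶ (one : C)
  /-- arrow-component square -/
  sq {A B : J} (f : Arr A B) : Sq (pro A) (pro B) (U.amap f ⊗ₐ carr V f) (aid one)
  sq_aid (A : J) (h : U.amap (aid A) ⊗ₐ carr V (aid A) = aid _) : sq (aid A) = sid (pro A) h rfl
  sq_acomp {A B E : J} (f : Arr A B) (g : Arr B E)
    (h : acomp (U.amap f ⊗ₐ carr V f) (U.amap g ⊗ₐ carr V g) =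
      U.amap (acomp f g) ⊗ₐ carr V (acomp f g)) :
    sq (acomp f g) = scomp (sq f) (sq g) h (aid_acomp _)
  /-- proarrow-component disk -/
  turn {A B : J} (m : A ⟶ B) :
    (U.pmap m ⊗ₚ 𝟙 (cobj V B)) ≫ pro B ≅ (𝟙 (U.obj A) ⊗ₚ cpro V m) ≫ pro A
  turn_naturality {A B A' B' : J} {m : A ⟶ B} {n : A' ⟶ B'} {f : Arr A A'} {g : Arr B B'}
    (φ : Sq m n f g) : DiskNat (pcomp (U.smap φ ⊗ₛ unitSq (carr V g)) (sq g))
      (pcomp (unitSq (U.amap f) ⊗ₛ csq V φ) (sq f)) (turn m).hom (turn n).hom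
  turn_comp {A B E : J} (m : A ⟶ B) (n : B ⟶ E) :
    (turn (m ≫ n)).hom ≫ (disk (𝟙 (𝟙 (U.obj A))) (cmapComp V m n).hom ≫
      (leftComp (U.obj A) (cpro V n) (cpro V m)).hom) ▷ pro A =
    (disk (U.mapComp m n).hom (𝟙 (𝟙 (cobj V E))) ≫
      (rightComp (U.pmap m) (U.pmap n) (cobj V E)).hom) ▷ pro E ≫
      cupPaste (turn m).hom (turn n).hom (interchanger (U.pmap m) (cpro V n)).hom

end

section

variable (C)

theorem arr_aid (A B : C) : aid A ⊗ₐ aid B = aid (A ⊗ₒ B) :=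
  (tensor (C := C)).amap_aid ⟨A, B⟩

variable {C}

theorem acomp_arr {A B E A' B' E' : C} (f : Arr A B) (g : Arr B E) (f' : Arr A' B') (g' : Arr B' E') :
    acomp (f ⊗ₐ f') (g ⊗ₐ g') = acomp f g ⊗ₐ acomp f' g' :=
  ((tensor (C := C)).amap_acomp (A := ⟨A, A'⟩) (B := ⟨B, B'⟩) (E := ⟨E, E'⟩) (f, f') (g, g')).symm

theorem sid_sq_sid {A B A' B' : C} (m : A ⟶ B) (n : A' ⟶ B') {f : Arr A A} {g : Arr B B}
    {f' : Arr A' A'} {g' : Arr B' B'} (hf : f = aid A) (hg : g = aid B) (hf' : f' = aid A')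
    (hg' : g' = aid B') (h : f ⊗ₐ f' = aid _) (k : g ⊗ₐ g' = aid _) :
    sid m hf hg ⊗ₛ sid n hf' hg' = sid (m ⊗ₚ n) h k := by
  subst hf hg hf' hg'
  exact (tensor (C := C)).smap_sid (A := ⟨A, A'⟩) (B := ⟨B, B'⟩) (m, n)

theorem scomp_sq_scomp {A B A' B' A'' B'' : C} {m : A ⟶ B} {n : A' ⟶ B'} {p : A'' ⟶ B''}
    {f : Arr A A'} {g : Arr B B'} {f' : Arr A' A''} {g' : Arr B' B''} (φ : Sq m n f g)
    (ψ : Sq n p f' g') {A₂ B₂ A₂' B₂' A₂'' B₂'' : C} {m₂ : A₂ ⟶ B₂} {n₂ : A₂' ⟶ B₂'}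
    {p₂ : A₂'' ⟶ B₂''} {f₂ : Arr A₂ A₂'} {g₂ : Arr B₂ B₂'} {f₂' : Arr A₂' A₂''}
    {g₂' : Arr B₂' B₂''} (φ₂ : Sq m₂ n₂ f₂ g₂) (ψ₂ : Sq n₂ p₂ f₂' g₂') {h : Arr A A''}
    {k : Arr B B''} {h₂ : Arr A₂ A₂''} {k₂ : Arr B₂ B₂''} (e : acomp f f' = h) (e' : acomp g g' = k)
    (e₂ : acomp f₂ f₂' = h₂) (e₂' : acomp g₂ g₂' = k₂)
    (H : acomp (f ⊗ₐ f₂) (f' ⊗ₐ f₂') = h ⊗ₐ h₂) (H' : acomp (g ⊗ₐ g₂) (g' ⊗ₐ g₂') = k ⊗ₐ k₂) :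
    scomp φ ψ e e' ⊗ₛ scomp φ₂ ψ₂ e₂ e₂' = scomp (φ ⊗ₛ φ₂) (ψ ⊗ₛ ψ₂) H H' := by
  subst e e' e₂ e₂'
  exact (tensor (C := C)).smap_scomp (A := ⟨A, A₂⟩) (B := ⟨B, B₂⟩) (A' := ⟨A', A₂'⟩)
    (B' := ⟨B', B₂'⟩) (A'' := ⟨A'', A₂''⟩) (B'' := ⟨B'', B₂''⟩) (m := (m, m₂)) (n := (n, n₂))
    (p := (p, p₂)) (f := (f, f₂)) (g := (g, g₂)) (f' := (f', f₂')) (g' := (g', g₂')) (φ, φ₂) (ψ, ψ₂)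

/-- The turning law is pushed through the functor `tensorRight C X`, whose comparison disk is
`rightComp`. -/
theorem tensorObj_comp_cupPaste {a b c d f k g : C} {mnX : a ⟶ c} {mnY : a ⟶ k} {mX : a ⟶ b}
    {nX : b ⟶ c} {nY : b ⟶ d} {nY' : a ⟶ f} {mX' : f ⟶ d} {mY : f ⟶ k} {e'' : c ⟶ g} {e' : d ⟶ g}
    {e : k ⟶ g} {κ : mnX ≫ e'' ⟶ mnY ≫ e} {κm : mX' ≫ e' ⟶ mY ≫ e} {κn : nX ≫ e'' ⟶ nY ≫ e'}
    {σ : mX ≫ nY ⟶ nY' ≫ mX'} {i : mnX ⟶ mX ≫ nX} {j : mnY ⟶ nY' ≫ mY}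
    (h : κ ≫ j ▷ e = i ▷ e'' ≫ cupPaste κm κn σ) (X : C) :
    tensorObj κ X ≫ (disk j (𝟙 (𝟙 X)) ≫ (rightComp nY' mY X).hom) ▷ (e ⊗ₚ 𝟙 X) =
      (disk i (𝟙 (𝟙 X)) ≫ (rightComp mX nX X).hom) ▷ (e'' ⊗ₚ 𝟙 X) ≫
        cupPaste (tensorObj κm X) (tensorObj κn X) (tensorObj σ X) := by
  simp only [← tensorRight_slide, ← tensorRight_dmap]
  exact (tensorRight C X).slide_comp_cupPaste h

theorem objTensor_comp_capPaste (X : C) {a b c d k l o : C} {mnY : a ⟶ c} {mnZ : l ⟶ c} {nY : a ⟶ b}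
    {mY : b ⟶ c} {nZ : d ⟶ b} {mY' : d ⟶ k} {nZ' : k ⟶ c} {mZ : l ⟶ k} {h'' : o ⟶ a} {h' : o ⟶ d}
    {h : o ⟶ l} {κ : h'' ≫ mnY ⟶ h ≫ mnZ} {κm : h' ≫ mY' ⟶ h ≫ mZ} {κn : h'' ≫ nY ⟶ h' ≫ nZ}
    {τ : nZ ≫ mY ⟶ mY' ≫ nZ'} {j : mnY ⟶ nY ≫ mY} {i : mnZ ⟶ mZ ≫ nZ'}
    (H : κ ≫ h ◁ i = h'' ◁ j ≫ capPaste κm κn τ) :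
    objTensor X κ ≫ (𝟙 X ⊗ₚ h) ◁ (disk (𝟙 (𝟙 X)) i ≫ (leftComp X mZ nZ').hom) =
      (𝟙 X ⊗ₚ h'') ◁ (disk (𝟙 (𝟙 X)) j ≫ (leftComp X nY mY).hom) ≫
        capPaste (objTensor X κm) (objTensor X κn) (objTensor X τ) := by
  simp only [← tensorLeft_slide, ← tensorLeft_dmap]
  exact (tensorLeft C X).slide_comp_capPaste H

/-! ### The zigzag of a cap and a cup -/

end

section

variable (K : CoherenceCompanions C)

namespace CoherenceCompanions

/-- The square between companions of the inverse right unitor. -/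
def rightInvNat {a b : C} (f : Arr a b) : Sq (K.rightInv a).pro (K.rightInv b).pro f (f ⊗ₐ aid one) :=
  Companion.sq _ _ ((MonoidalData.right (C := C)).inv.naturality f)

/-- The square between companions of the left unitor. -/
def leftNat {a b : C} (f : Arr a b) : Sq (K.left a).pro (K.left b).pro (aid one ⊗ₐ f) f :=
  Companion.sq _ _ ((MonoidalData.left (C := C)).hom.naturality f)

/-- The square between companions of the inverse associator. -/
def assocInvNat {a b a' b' a'' b'' : C} (f : Arr a b) (g : Arr a' b') (h : Arr a'' b'') :
    Sq (K.assocInv a a' a'').pro (K.assocInv b b' b'').pro (f ⊗ₐ g ⊗ₐ h) ((f ⊗ₐ g) ⊗ₐ h) :=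
  Companion.sq _ _ ((MonoidalData.assoc (C := C)).inv.naturality (A := ⟨⟨a, a'⟩, a''⟩)
    (B := ⟨⟨b, b'⟩, b''⟩) ((f, g), h))

theorem rightInvNat_aid {a : C} {f : Arr a a} (e : f = aid a) (h : f ⊗ₐ aid one = aid _) :
    K.rightInvNat f = sid (K.rightInv a).pro e h :=
  Companion.sq_aid (K.rightInv a) _ e h

theorem leftNat_aid {a : C} {f : Arr a a} (e : f = aid a) (h : aid one ⊗ₐ f = aid _) :
    K.leftNat f = sid (K.left a).pro h e :=
  Companion.sq_aid (K.left a) _ h e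

theorem assocInvNat_aid {a a' a'' : C} {f : Arr a a} {g : Arr a' a'} {k : Arr a'' a''}
    (h : f ⊗ₐ g ⊗ₐ k = aid _) (h' : (f ⊗ₐ g) ⊗ₐ k = aid _) :
    K.assocInvNat f g k = sid (K.assocInv a a' a'').pro h h' :=
  Companion.sq_aid (K.assocInv a a' a'') _ h h'

theorem rightInvNat_acomp {a b c : C} {f : Arr a b} {g : Arr b c} {l : Arr a c}
    (e : acomp f g = l) (h : acomp (f ⊗ₐ aid one) (g ⊗ₐ aid one) = l ⊗ₐ aid one) :
    K.rightInvNat l = scomp (K.rightInvNat f) (K.rightInvNat g) e h :=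
  Companion.sq_acomp (K.rightInv a) (K.rightInv b) (K.rightInv c) _ _ _ e h

theorem leftNat_acomp {a b c : C} {f : Arr a b} {g : Arr b c} {l : Arr a c}
    (e : acomp f g = l) (h : acomp (aid one ⊗ₐ f) (aid one ⊗ₐ g) = aid one ⊗ₐ l) :
    K.leftNat l = scomp (K.leftNat f) (K.leftNat g) h e :=
  Companion.sq_acomp (K.left a) (K.left b) (K.left c) _ _ _ h e

theorem assocInvNat_acomp {a b c a' b' c' a'' b'' c'' : C} {f : Arr a b} {g : Arr b c} {l : Arr a c}
    {f' : Arr a' b'} {g' : Arr b' c'} {l' : Arr a' c'} {f'' : Arr a'' b''} {g'' : Arr b'' c''}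
    {l'' : Arr a'' c''}
    (h : acomp (f ⊗ₐ f' ⊗ₐ f'') (g ⊗ₐ g' ⊗ₐ g'') = l ⊗ₐ l' ⊗ₐ l'')
    (h' : acomp ((f ⊗ₐ f') ⊗ₐ f'') ((g ⊗ₐ g') ⊗ₐ g'') = (l ⊗ₐ l') ⊗ₐ l'') :
    K.assocInvNat l l' l'' = scomp (K.assocInvNat f f' f'') (K.assocInvNat g g' g'') h h' :=
  Companion.sq_acomp (K.assocInv _ _ _) (K.assocInv _ _ _) (K.assocInv _ _ _) _ _ _ h h'

end CoherenceCompanions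

end

/-! ### The zigzag of a cap and a cup -/

section

variable (K : CoherenceCompanions C) {J : Type u'} [DoubleCategory.{u', v', w', x'} J]
  {V : DFunctor (Co J) C} {U : DFunctor J C} (cap : CapData V U) (cup : CupData V U)

/-- The zigzag of a cap and a cup. -/
def zigzag : ProComponents U U where
  app A := (K.rightInv (U.obj A)).pro ≫ (𝟙 (U.obj A) ⊗ₚ cap.pro A) ≫
    (K.assocInv (U.obj A) (cobj V A) (U.obj A)).pro ≫ (cup.pro A ⊗ₚ 𝟙 (U.obj A)) ≫
      (K.left (U.obj A)).pro
  appSq f := pcomp (K.rightInvNat (U.amap f)) (pcomp (unitSq (U.amap f) ⊗ₛ cap.sq f)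
    (pcomp (K.assocInvNat (U.amap f) (carr V f) (U.amap f))
      (pcomp (cup.sq f ⊗ₛ unitSq (U.amap f)) (K.leftNat (U.amap f)))))

theorem zigzag_appSq_aid (A : J) : (zigzag K cap cup).appSq (aid A) =
    sid ((zigzag K cap cup).app A) (U.amap_aid A) (U.amap_aid A) := by
  -- Functors preserve identity arrows by equations that need not be definitional, so the boundary
  -- of each tensored square is first shown to be an identity.
  have e : carr V (aid A) = aid (cobj V A) := V.amap_aid (Co.mk A)
  have e' : U.amap (aid A) = aid (U.obj A) := U.amap_aid A
  have h₁ : carr V (aid A) ⊗ₐ U.amap (aid A) = aid (cobj V A ⊗ₒ U.obj A) := by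
    rw [e, e', arr_aid]
  have h₂ : U.amap (aid A) ⊗ₐ carr V (aid A) = aid (U.obj A ⊗ₒ cobj V A) := by
    rw [e, e', arr_aid]
  have h₃ : U.amap (aid A) ⊗ₐ aid one = aid (U.obj A ⊗ₒ one) := by
    rw [e', arr_aid]
  have h₄ : aid one ⊗ₐ U.amap (aid A) = aid (one ⊗ₒ U.obj A) := by
    rw [e', arr_aid]
  have h₅ : U.amap (aid A) ⊗ₐ carr V (aid A) ⊗ₐ U.amap (aid A) = aid _ := by
    rw [h₁, e', arr_aid]
  have h₆ : (U.amap (aid A) ⊗ₐ carr V (aid A)) ⊗ₐ U.amap (aid A) = aid _ := by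
    rw [h₂, e', arr_aid]
  have key : ∀ {A B E : C} (m : A ⟶ B) (p : B ⟶ E) {f : Arr A A} {g : Arr B B} {h : Arr E E}
    (hf : f = aid A) (hg : g = aid B) (hh : h = aid E),
    pcomp (sid m hf hg) (sid p hg hh) = sid (m ≫ p) hf hh := by
    rintro _ _ _ m p _ _ _ rfl rfl rfl
    exact pcomp_sid m p
  unfold zigzag
  dsimp only
  rw [cap.sq_aid A h₁, cup.sq_aid A h₂, unitSq_eq_sid e', sid_sq_sid _ _ _ _ _ _ h₃ h₅,
    sid_sq_sid _ _ _ _ _ _ h₆ h₄, K.rightInvNat_aid e' h₃,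
    K.assocInvNat_aid h₅ h₆, K.leftNat_aid e' h₄,
    key, key, key, key]

theorem zigzag_appSq_acomp {A B E : J} (f : Arr A B) (g : Arr B E) :
    (zigzag K cap cup).appSq (acomp f g) = scomp ((zigzag K cap cup).appSq f)
      ((zigzag K cap cup).appSq g) (U.amap_acomp f g).symm (U.amap_acomp f g).symm := by
  have e : acomp (carr V f) (carr V g) = carr V (acomp f g) :=
    (V.amap_acomp (A := Co.mk A) (B := Co.mk B) (E := Co.mk E) f g).symm
  have e' : acomp (U.amap f) (U.amap g) = U.amap (acomp f g) := (U.amap_acomp f g).symm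
  have h₁ : acomp (carr V f ⊗ₐ U.amap f) (carr V g ⊗ₐ U.amap g) =
      carr V (acomp f g) ⊗ₐ U.amap (acomp f g) := by rw [acomp_arr, e, e']
  have h₂ : acomp (U.amap f ⊗ₐ carr V f) (U.amap g ⊗ₐ carr V g) =
      U.amap (acomp f g) ⊗ₐ carr V (acomp f g) := by rw [acomp_arr, e, e']
  have h₃ : acomp (U.amap f ⊗ₐ aid one) (U.amap g ⊗ₐ aid one) =
      U.amap (acomp f g) ⊗ₐ aid (one : C) := by rw [acomp_arr, e', aid_acomp]
  have h₄ : acomp (aid one ⊗ₐ U.amap f) (aid one ⊗ₐ U.amap g) =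
      aid (one : C) ⊗ₐ U.amap (acomp f g) := by rw [acomp_arr, e', aid_acomp]
  have h₅ : acomp (U.amap f ⊗ₐ carr V f ⊗ₐ U.amap f) (U.amap g ⊗ₐ carr V g ⊗ₐ U.amap g) =
      U.amap (acomp f g) ⊗ₐ carr V (acomp f g) ⊗ₐ U.amap (acomp f g) := by rw [acomp_arr, h₁, e']
  have h₆ : acomp ((U.amap f ⊗ₐ carr V f) ⊗ₐ U.amap f) ((U.amap g ⊗ₐ carr V g) ⊗ₐ U.amap g) =
      (U.amap (acomp f g) ⊗ₐ carr V (acomp f g)) ⊗ₐ U.amap (acomp f g) := by rw [acomp_arr, h₂, e']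
  have hu : unitSq (U.amap (acomp f g)) = scomp (unitSq (U.amap f)) (unitSq (U.amap g)) e' e' :=
    (unitSq_scomp_unitSq e' e').symm
  unfold zigzag
  dsimp only
  rw [cap.sq_acomp f g h₁, cup.sq_acomp f g h₂, hu, scomp_sq_scomp _ _ _ _ _ _ _ _ h₃ h₅,
    scomp_sq_scomp _ _ _ _ _ _ _ _ h₆ h₄,
    K.rightInvNat_acomp e' h₃, K.assocInvNat_acomp h₅ h₆, K.leftNat_acomp e' h₄,
    pcomp_scomp' _ _ _ _ _ h₃, pcomp_scomp' _ _ _ _ _ h₅, pcomp_scomp' _ _ _ _ _ h₆,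
    pcomp_scomp' _ _ _ _ _ h₄]

/-- The disk of a zigzag, up to reassociation. -/
def zigzagFold {A B : J} (m : A ⟶ B) :
    U.pmap m ≫ K.capPro (U.obj B) (cap.pro B) ≫ K.cupPro (cup.pro B) (U.obj B) ≅
      (K.capPro (U.obj A) (cap.pro A) ≫ K.cupPro (cup.pro A) (U.obj A)) ≫ U.pmap m :=
  foldIso (K.capSlide (U.pmap m) (cap.pro B)) (K.cupTurn (cup.turn m) (U.obj B))
    (K.capTurn (U.obj A) (cap.turn m)) (K.cupSlide (cup.pro A) (U.pmap m))

/-- Verifies the hypotheses of `slideNat_foldIso`. Each splitting has two parts: the image of `m ≫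
n` under a functor is compared with a composite, and then the tensored composite is split. The
commutations of sliding with turning come from `slideNatT_capTurn` and `slideNatT_cupTurn`. -/
theorem slideNat_zigzagFold {A B E : J} (m : A ⟶ B) (n : B ⟶ E) :
    SlideNat (zigzagFold K cap cup (m ≫ n)).hom
      (slideP (zigzagFold K cap cup m).hom (zigzagFold K cap cup n).hom) (U.mapComp m n).hom
      (U.mapComp m n).hom := by
  have chX := (K.slideNat_capSlide (U.mapComp m n).hom (cap.pro E)).trans
    (K.slideNat_capSlide_comp (U.pmap m) (U.pmap n) (cap.pro E))
  rw [disk_comp_assoc, Category.comp_id, Category.comp_id] at chX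
  have ceZ := (K.slideNat_cupSlide (cup.pro A) (U.mapComp m n).hom).trans
    (K.slideNat_cupSlide_comp (cup.pro A) (U.pmap m) (U.pmap n))
  rw [Category.comp_id] at ceZ
  have ceX := tensorObj_comp_cupPaste (cup.turn_comp m n) (U.obj E)
  have chY := objTensor_comp_capPaste (U.obj A) (cap.turn_comp m n)
  rw [← tensorObjIso_hom, ← tensorObjIso_hom, ← tensorObjIso_hom] at ceX
  rw [← objTensorIso_hom, ← objTensorIso_hom, ← objTensorIso_hom] at chY
  have hj := (K.slideNat_assocIsoY (U.obj A) (cmapComp V m n).hom (U.obj E)).trans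
    (K.slideNat_assocIsoY_comp (U.obj A) (cpro V n) (cpro V m) (U.obj E))
  rw [disk_comp_assoc, disk_comp_assoc, Category.comp_id, Category.comp_id] at hj
  have hk := (K.slideNat_assocIsoZ (U.obj A) (cobj V A) (U.mapComp m n).hom).trans
    (K.slideNat_assocIsoZ_comp (U.obj A) (cobj V A) (U.pmap m) (U.pmap n))
  rw [disk_comp_assoc, Category.comp_id] at hk
  exact slideNat_foldIso chX (turnCup_cupPaste (K.left (U.obj E)).pro ceX)
    (turnCap_capPaste (K.rightInv (U.obj A)).pro hj hk
      (K.slideNat_assocIsoZ_assocIsoY (U.obj A) (cpro V m) (U.pmap n)) chY) ceZ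
    (K.slideNatT_capTurn (U.pmap m) (cap.turn n)) (K.slideNatT_cupTurn (cup.turn m) (U.pmap n))

end

end DoubleCategory

/-! ### Naturality of the zigzag, and the zigzag as a pseudo natural transformation -/

namespace DoubleCategory

open MonoidalData

universe u' v' w' x'

variable {C : Type u} [DoubleCategory.{u, v, w, x} C]

theorem diskNat_regroup {a b c d e a' b' c' d' e' : C} {r : a ⟶ b} {h : b ⟶ c} {k : c ⟶ d}
    {l : d ⟶ e} {r' : a' ⟶ b'} {h' : b' ⟶ c'} {k' : c' ⟶ d'} {l' : d' ⟶ e'} {f : Arr a a'}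
    {g : Arr b b'} {i : Arr c c'} {j : Arr d d'} {o : Arr e e'} (R : Sq r r' f g) (H : Sq h h' g i)
    (K : Sq k k' i j) (L : Sq l l' j o) :
    DiskNat (pcomp (pcomp R (pcomp H K)) L) (pcomp R (pcomp H (pcomp K L)))
      (regroup r h k l).hom (regroup r' h' k' l').hom := by
  rw [regroup_hom, regroup_hom]
  exact (DiskNat.associator R (pcomp H K) L).comp ((DiskNat.associator H K L).whiskerLeft R)

theorem DiskNat.slideConj {a b a' b' c d c' d' : C} {p : a ⟶ b} {q : a' ⟶ b'} {t s : a ⟶ a'}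
    {t' s' : b ⟶ b'} {p₂ : c ⟶ d} {q₂ : c' ⟶ d'} {t₂ s₂ : c ⟶ c'} {t₂' s₂' : d ⟶ d'} {i : t ≅ s}
    {i' : t' ≅ s'} {i₂ : t₂ ≅ s₂} {i₂' : t₂' ≅ s₂'} {θ : p ≫ t' ≅ t ≫ q} {θ₂ : p₂ ≫ t₂' ≅ t₂ ≫ q₂}
    {f : Arr a c} {g : Arr b d} {f' : Arr a' c'} {g' : Arr b' d'} {P : Sq p p₂ f g}
    {Q : Sq q q₂ f' g'} {T : Sq t t₂ f f'} {S : Sq s s₂ f f'} {T' : Sq t' t₂' g g'}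
    {S' : Sq s' s₂' g g'} (h : DiskNat (pcomp P T') (pcomp T Q) θ.hom θ₂.hom)
    (hi : DiskNat T S i.hom i₂.hom) (hi' : DiskNat T' S' i'.hom i₂'.hom) :
    DiskNat (pcomp P S') (pcomp S Q) (DoubleCategory.slideConj i i' θ).hom
      (DoubleCategory.slideConj i₂ i₂' θ₂).hom := by
  rw [slideConj_hom, slideConj_hom]
  exact (DiskNat.whiskerLeft hi'.inv P).comp (h.comp (hi.whiskerRight Q))

variable [MonoidalData C] (K : CoherenceCompanions C) {J : Type u'}
  [DoubleCategory.{u', v', w', x'} J]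
  {V : DFunctor (Co J) C} {U : DFunctor J C} (cap : CapData V U) (cup : CupData V U)

/-- All four moves and the associators between them are natural; with each move the square `φ`, or
its dual, passes to the next leg. -/
theorem diskNat_zigzagFold {A B A' B' : J} {m : A ⟶ B} {n : A' ⟶ B'} {f : Arr A A'} {g : Arr B B'}
    (φ : Sq m n f g) :
    DiskNat (pcomp (U.smap φ) (pcomp (K.capSq (U.amap g) (cap.sq g))
        (K.cupSq (cup.sq g) (U.amap g))))
      (pcomp (pcomp (K.capSq (U.amap f) (cap.sq f)) (K.cupSq (cup.sq f) (U.amap f))) (U.smap φ))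
      (zigzagFold K cap cup m).hom (zigzagFold K cap cup n).hom := by
  have h₁ := K.diskNat_capSlide (U.smap φ) (cap.sq g)
  have h₂ := K.diskNat_cupTurn (cup.turn_naturality φ) (U.amap g)
  have h₃ := K.diskNat_capTurn (U.amap f) (cap.turn_naturality φ)
  have h₄ := K.diskNat_cupSlide (cup.sq f) (U.smap φ)
  unfold zigzagFold
  rw [foldIso_hom, foldIso_hom]
  exact (DiskNat.associator_inv _ _ _).comp ((h₁.whiskerRight _).comp
    ((DiskNat.associator _ _ _).comp ((h₂.whiskerLeft _).comp ((DiskNat.associator_inv _ _ _).comp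
      ((h₃.whiskerRight _).comp ((DiskNat.associator _ _ _).comp ((h₄.whiskerLeft _).comp
        (DiskNat.associator_inv _ _ _))))))))

/-- The proarrow-component disk of a zigzag. -/
def zigzagDisk {A B : J} (m : A ⟶ B) : U.pmap m ≫ (zigzag K cap cup).app B ≅
    (zigzag K cap cup).app A ≫ U.pmap m :=
  slideConj (regroup _ _ _ _) (regroup _ _ _ _) (zigzagFold K cap cup m)

/-- The zigzag of a cap and a cup is a pseudo natural transformation. -/
def zigzagPseudoNat : PseudoNat (zigzag K cap cup) :=
  ProComponents.pseudoNat _ (zigzag_appSq_aid K cap cup) (zigzag_appSq_acomp K cap cup)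
    (zigzagDisk K cap cup)
    (fun φ => (diskNat_zigzagFold K cap cup φ).slideConj (diskNat_regroup _ _ _ _)
      (diskNat_regroup _ _ _ _))
    (fun m n => (slideNat_zigzagFold K cap cup m n).slideConj (regroup _ _ _ _) (regroup _ _ _ _)
      (regroup _ _ _ _))

end DoubleCategory

/-! ### From the composition law of dinaturality to the turning laws -/

namespace DoubleCategory

open MonoidalData

section Turn

universe u₁ v₁ w₁

variable {B : Type u₁} [Bicategory.{w₁, v₁} B]

/-- The composition law of the disks of a cap, from that of a dinatural transformation whose source
is constant. -/
theorem comp_capPaste_of_dinat {o yEE yAE yBE yBB yAB yAA : B}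
    {pRmn pRm pRn pRm' pLn pLn' pLm pLmn : o ⟶ o} (h₁ : pRmn = 𝟙 o) (h₂ : pRm = 𝟙 o)
    (h₃ : pRn = 𝟙 o) (h₄ : pRm' = 𝟙 o) (h₅ : pLn = 𝟙 o) (h₆ : pLn' = 𝟙 o) (h₇ : pLm = 𝟙 o)
    (h₈ : pLmn = 𝟙 o) {aE : o ⟶ yEE} {aB : o ⟶ yBB} {aA : o ⟶ yAA} {qLmn : yEE ⟶ yAE}
    {qLn : yEE ⟶ yBE} {qLm : yBE ⟶ yAE} {qRn : yBB ⟶ yBE} {qLm' : yBB ⟶ yAB} {qRn' : yAB ⟶ yAE}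
    {qRm : yAA ⟶ yAB} {qRmn : yAA ⟶ yAE} {c₁ : pRmn ⟶ pRm ≫ pRn} (hc₁ : HEq c₁ (λ_ (𝟙 o)).inv)
    {c₂ : pRm ≫ pLn ⟶ pLn' ≫ pRm'} (hc₂ : HEq c₂ (𝟙 (𝟙 o ≫ 𝟙 o))) {c₄ : pLn' ≫ pLm ⟶ pLmn}
    (hc₄ : HEq c₄ (λ_ (𝟙 o)).hom) {cL : qLmn ⟶ qLn ≫ qLm} {τ' : qRn ≫ qLm ⟶ qLm' ≫ qRn'}
    {cR : qRmn ≅ qRm ≫ qRn'} {d : (pRmn ≫ aE) ≫ qLmn ⟶ (pLmn ≫ aA) ≫ qRmn}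
    {dn : (pRn ≫ aE) ≫ qLn ⟶ (pLn ≫ aB) ≫ qRn} {dm : (pRm' ≫ aB) ≫ qLm' ⟶ (pLm ≫ aA) ≫ qRm}
    (H : d = 𝟙 ((pRmn ≫ aE) ≫ qLmn) ⊗≫ c₁ ▷ (aE ≫ qLmn) ⊗≫ (pRm ≫ pRn ≫ aE) ◁ cL ⊗≫
      pRm ◁ dn ▷ qLm ⊗≫ c₂ ▷ (aB ≫ qRn ≫ qLm) ⊗≫ (pLn' ≫ pRm' ≫ aB) ◁ τ' ⊗≫ pLn' ◁ dm ▷ qRn' ⊗≫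
      c₄ ▷ (aA ≫ qRm ≫ qRn') ⊗≫ (pLmn ≫ aA) ◁ cR.inv ⊗≫ 𝟙 ((pLmn ≫ aA) ≫ qRmn))
    {k : (𝟙 o ≫ aE) ≫ qLmn ⟶ (𝟙 o ≫ aA) ≫ qRmn} (hd : HEq d k)
    {kn : (𝟙 o ≫ aE) ≫ qLn ⟶ (𝟙 o ≫ aB) ≫ qRn} (hdn : HEq dn kn)
    {km : (𝟙 o ≫ aB) ≫ qLm' ⟶ (𝟙 o ≫ aA) ≫ qRm} (hdm : HEq dm km)
    {zn : yBB ⟶ yBE} {zn' : yAB ⟶ yAE} {zm : yAA ⟶ yAB} {zmn : yAA ⟶ yAE} {iₙ : qRn ⟶ zn}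
    {iₙ' : qRn' ⟶ zn'} {iₘ : qRm ⟶ zm} {i : qRmn ⟶ zmn} {τ : zn ≫ qLm ⟶ qLm' ≫ zn'}
    {c : zmn ⟶ zm ≫ zn'} (hτ : SlideNat τ' τ iₙ iₙ') (hc : cR.hom ≫ iₘ ▷ qRn' ≫ zm ◁ iₙ' = i ≫ c) :
    ((λ_ aE).inv ▷ qLmn ≫ k ≫ (λ_ aA).hom ▷ qRmn ≫ aA ◁ i) ≫ aA ◁ c =
      aE ◁ cL ≫ capPaste ((λ_ aB).inv ▷ qLm' ≫ km ≫ (λ_ aA).hom ▷ qRm ≫ aA ◁ iₘ)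
        ((λ_ aE).inv ▷ qLn ≫ kn ≫ (λ_ aB).hom ▷ qRn ≫ aB ◁ iₙ) τ := by
  -- The values of the constant functor are units only after unfolding, and the types of the disks
  -- depend on them. The heterogeneous equations allow the dinatural law to be supplied in its
  -- general form and specialised here.
  subst h₁ h₂ h₃ h₄ h₅ h₆ h₇ h₈ hc₁ hc₂ hc₄ hd hdn hdm
  have e : i ≫ c = cR.hom ≫ iₘ ▷ qRn' ≫ zm ◁ iₙ' := hc.symm
  unfold SlideNat at hτ
  rw [H]
  calc _ = 𝟙 _ ⊗≫ aE ◁ cL ⊗≫ (λ_ aE).inv ▷ qLn ▷ qLm ⊗≫ dn ▷ qLm ⊗≫ (λ_ aB).hom ▷ (qRn ≫ qLm) ⊗≫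
        aB ◁ τ' ⊗≫ (λ_ aB).inv ▷ (qLm' ≫ qRn') ⊗≫ dm ▷ qRn' ⊗≫ (λ_ aA).hom ▷ (qRm ≫ qRn') ⊗≫
        aA ◁ (cR.inv ≫ i ≫ c) := by bicategory
    -- `hc` trades the normalisation of the composite leg for separate ones of `m` and `n`. The one
    -- for `n` then moves in front of the turn of `m`, and `hτ` carries it through the exchange.
    _ = 𝟙 _ ⊗≫ aE ◁ cL ⊗≫ (λ_ aE).inv ▷ qLn ▷ qLm ⊗≫ dn ▷ qLm ⊗≫ (λ_ aB).hom ▷ (qRn ≫ qLm) ⊗≫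
        aB ◁ τ' ⊗≫ (λ_ aB).inv ▷ (qLm' ≫ qRn') ⊗≫ dm ▷ qRn' ⊗≫ (λ_ aA).hom ▷ (qRm ≫ qRn') ⊗≫
        aA ◁ (iₘ ▷ qRn' ≫ zm ◁ iₙ') := by rw [e, Iso.inv_hom_id_assoc]
    _ = 𝟙 _ ⊗≫ aE ◁ cL ⊗≫ (λ_ aE).inv ▷ qLn ▷ qLm ⊗≫ dn ▷ qLm ⊗≫ (λ_ aB).hom ▷ (qRn ≫ qLm) ⊗≫
        aB ◁ τ' ⊗≫ (((λ_ aB).inv ▷ qLm' ≫ dm ≫ (λ_ aA).hom ▷ qRm ≫ aA ◁ iₘ) ▷ qRn' ≫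
          (aA ≫ zm) ◁ iₙ') ⊗≫ 𝟙 _ := by bicategory
    _ = 𝟙 _ ⊗≫ aE ◁ cL ⊗≫ (λ_ aE).inv ▷ qLn ▷ qLm ⊗≫ dn ▷ qLm ⊗≫ (λ_ aB).hom ▷ (qRn ≫ qLm) ⊗≫
        aB ◁ (τ' ≫ qLm' ◁ iₙ') ⊗≫ ((λ_ aB).inv ▷ qLm' ≫ dm ≫ (λ_ aA).hom ▷ qRm ≫
          aA ◁ iₘ) ▷ zn' ⊗≫ 𝟙 _ := by rw [← whisker_exchange]; bicategory
    _ = _ := by rw [hτ]; unfold capPaste; bicategory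

/-- The composition law of the disks of a cup, from that of a dinatural transformation whose target
is constant. -/
theorem comp_cupPaste_of_dinat {o xAE xEE xBE xBB xAB xAA : B}
    {qLmn qLn qLm qRn qLm' qRn' qRm qRmn : o ⟶ o} (h₁ : qLmn = 𝟙 o) (h₂ : qLn = 𝟙 o)
    (h₃ : qLm = 𝟙 o) (h₄ : qRn = 𝟙 o) (h₅ : qLm' = 𝟙 o) (h₆ : qRn' = 𝟙 o) (h₇ : qRm = 𝟙 o)
    (h₈ : qRmn = 𝟙 o) {aE : xEE ⟶ o} {aB : xBB ⟶ o} {aA : xAA ⟶ o} {pRmn : xAE ⟶ xEE}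
    {pRm : xAE ⟶ xBE} {pRn : xBE ⟶ xEE} {pLn : xBE ⟶ xBB} {pLn' : xAE ⟶ xAB} {pRm' : xAB ⟶ xBB}
    {pLm : xAB ⟶ xAA} {pLmn : xAE ⟶ xAA} {c₁ : pRmn ≅ pRm ≫ pRn}
    {c₂ : pRm ≫ pLn ⟶ pLn' ≫ pRm'} {c₃ : qLmn ⟶ qLn ≫ qLm} (hc₃ : HEq c₃ (λ_ (𝟙 o)).inv)
    {c₄ : pLmn ≅ pLn' ≫ pLm} {c₅ : qRn ≫ qLm ⟶ qLm' ≫ qRn'} (hc₅ : HEq c₅ (𝟙 (𝟙 o ≫ 𝟙 o)))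
    {c₆ : qRm ≫ qRn' ⟶ qRmn} (hc₆ : HEq c₆ (λ_ (𝟙 o)).hom)
    {d : (pRmn ≫ aE) ≫ qLmn ⟶ (pLmn ≫ aA) ≫ qRmn}
    {dn : (pRn ≫ aE) ≫ qLn ⟶ (pLn ≫ aB) ≫ qRn} {dm : (pRm' ≫ aB) ≫ qLm' ⟶ (pLm ≫ aA) ≫ qRm}
    (H : d = 𝟙 ((pRmn ≫ aE) ≫ qLmn) ⊗≫ c₁.hom ▷ (aE ≫ qLmn) ⊗≫ (pRm ≫ pRn ≫ aE) ◁ c₃ ⊗≫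
      pRm ◁ dn ▷ qLm ⊗≫ c₂ ▷ (aB ≫ qRn ≫ qLm) ⊗≫ (pLn' ≫ pRm' ≫ aB) ◁ c₅ ⊗≫ pLn' ◁ dm ▷ qRn' ⊗≫
      c₄.inv ▷ (aA ≫ qRm ≫ qRn') ⊗≫ (pLmn ≫ aA) ◁ c₆ ⊗≫ 𝟙 ((pLmn ≫ aA) ≫ qRmn))
    {k : (pRmn ≫ aE) ≫ 𝟙 o ⟶ (pLmn ≫ aA) ≫ 𝟙 o} (hd : HEq d k)
    {kn : (pRn ≫ aE) ≫ 𝟙 o ⟶ (pLn ≫ aB) ≫ 𝟙 o} (hdn : HEq dn kn)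
    {km : (pRm' ≫ aB) ≫ 𝟙 o ⟶ (pLm ≫ aA) ≫ 𝟙 o} (hdm : HEq dm km)
    {zmn : xAE ⟶ xEE} {zm : xAE ⟶ xBE} {zn : xBE ⟶ xEE} {zm' : xAB ⟶ xBB} {i : zmn ⟶ pRmn}
    {iₘ : zm ⟶ pRm} {iₘ' : zm' ⟶ pRm'} {iₙ : zn ⟶ pRn} {σ : zm ≫ pLn ⟶ pLn' ≫ zm'}
    {c : zmn ⟶ zm ≫ zn} (hσ : SlideNat σ c₂ iₘ iₘ') (hc : i ≫ c₁.hom = c ≫ iₘ ▷ zn ≫ pRm ◁ iₙ) :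
    (i ▷ aE ≫ (ρ_ (pRmn ≫ aE)).inv ≫ k ≫ (ρ_ (pLmn ≫ aA)).hom) ≫ c₄.hom ▷ aA =
      c ▷ aE ≫ cupPaste (iₘ' ▷ aB ≫ (ρ_ (pRm' ≫ aB)).inv ≫ km ≫ (ρ_ (pLm ≫ aA)).hom)
        (iₙ ▷ aE ≫ (ρ_ (pRn ≫ aE)).inv ≫ kn ≫ (ρ_ (pLn ≫ aB)).hom) σ := by
  subst h₁ h₂ h₃ h₄ h₅ h₆ h₇ h₈ hc₃ hc₅ hc₆ hd hdn hdm
  unfold SlideNat at hσ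
  rw [H]
  calc _ = (i ≫ c₁.hom) ▷ aE ⊗≫ pRm ◁ ((ρ_ (pRn ≫ aE)).inv ≫ dn ≫ (ρ_ (pLn ≫ aB)).hom) ⊗≫
        c₂ ▷ aB ⊗≫ pLn' ◁ ((ρ_ (pRm' ≫ aB)).inv ≫ dm ≫ (ρ_ (pLm ≫ aA)).hom) ⊗≫
        (c₄.inv ≫ c₄.hom) ▷ aA := by bicategory
    _ = c ▷ aE ⊗≫ (iₘ ▷ (zn ≫ aE) ≫ pRm ◁ (iₙ ▷ aE ≫ (ρ_ (pRn ≫ aE)).inv ≫ dn ≫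
        (ρ_ (pLn ≫ aB)).hom)) ⊗≫
        c₂ ▷ aB ⊗≫ pLn' ◁ ((ρ_ (pRm' ≫ aB)).inv ≫ dm ≫ (ρ_ (pLm ≫ aA)).hom) ⊗≫ 𝟙 _ := by
        rw [hc, Iso.inv_hom_id]; bicategory
    _ = c ▷ aE ⊗≫ zm ◁ (iₙ ▷ aE ≫ (ρ_ (pRn ≫ aE)).inv ≫ dn ≫ (ρ_ (pLn ≫ aB)).hom) ⊗≫
        (iₘ ▷ pLn ≫ c₂) ▷ aB ⊗≫ pLn' ◁ ((ρ_ (pRm' ≫ aB)).inv ≫ dm ≫ (ρ_ (pLm ≫ aA)).hom) ⊗≫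
        𝟙 _ := by rw [← whisker_exchange]; bicategory
    _ = _ := by rw [← hσ]; unfold cupPaste; bicategory

end Turn

end DoubleCategory

/-! ### The turning laws of caps and cups -/

namespace DoubleCategory

open MonoidalData

variable {C : Type u} [DoubleCategory.{u, v, w, x} C]

theorem DFunctor.split_id {J : Type*} [DoubleCategory J] (P : DFunctor J C) {a b c : J} (p : a ⟶ b)
    (r : b ⟶ c) : P.split (𝟙 (p ≫ r)) = (P.mapComp p r).hom := by
  unfold DFunctor.split
  rw [PreFunctor.dmap_id, Category.id_comp]

theorem DFunctor.split_unit {J : Type*} [DoubleCategory J] (P : DFunctor J C) (a : J) :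
    P.split (λ_ (𝟙 a)).inv ≫ (P.mapId a).hom ▷ P.pmap (𝟙 a) ≫ 𝟙 (P.obj a) ◁ (P.mapId a).hom =
      (P.mapId a).hom ≫ (λ_ (𝟙 (P.obj a))).inv := by
  rw [← cancel_epi (P.mapId a).inv, Iso.inv_hom_id_assoc]
  have h := P.mapId_comp_mapId a
  have h' : (P.mapId a).inv ≫ P.split (λ_ (𝟙 a)).inv = _ := h.symm
  rw [reassoc_of% h', whisker_exchange_assoc, inv_hom_whiskerRight_assoc,
    ← Bicategory.whiskerLeft_comp, Iso.inv_hom_id, Bicategory.whiskerLeft_id, Category.comp_id]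

theorem DFunctor.swap_split {D E : Type*} [DoubleCategory D] [DoubleCategory E] {a b c : D ×ᵈ E}
    {s : a ⟶ c} {p : a ⟶ b} {r : b ⟶ c} (θ : s ⟶ p ≫ r) :
    (DFunctor.swap D E).split θ = (θ.2, θ.1) :=
  (DFunctor.pair_split _ _ θ).trans (Prod.ext (DFunctor.snd_split θ) (DFunctor.fst_split θ))

theorem DFunctor.swap_slide {D E : Type*} [DoubleCategory D] [DoubleCategory E] {a b c d : D ×ᵈ E}
    {p : a ⟶ b} {t' : b ⟶ d} {t : a ⟶ c} {q : c ⟶ d} (θ : p ≫ t' ⟶ t ≫ q) :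
    (DFunctor.swap D E).slide θ = (θ.2, θ.1) :=
  (DFunctor.pair_slide _ _ θ).trans (Prod.ext (DFunctor.snd_slide θ) (DFunctor.fst_slide θ))

theorem const_slide {J : Type*} [DoubleCategory J] (X : C) {a b c d : J} {p : a ⟶ b} {t' : b ⟶ d}
    {t : a ⟶ c} {q : c ⟶ d} (θ : p ≫ t' ⟶ t ≫ q) : (DFunctor.const J X).slide θ = 𝟙 (𝟙 X ≫ 𝟙 X) := by
  change (λ_ (𝟙 X)).hom ≫ 𝟙 (𝟙 X) ≫ (λ_ (𝟙 X)).inv = _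
  simp

variable [MonoidalData C]

/-- The inverse of `slideRight m` is `slideLeft m`, so inversion exchanges the two kinds of unit
slide. This is why reversing the tensor product inverts the interchanger. -/
theorem interchanger_inv {A B A' B' : C} (m : A ⟶ B) (n : A' ⟶ B') :
    (interchanger m n).inv = diskSlide (slideLeft m) (slideRight n) := by
  change (((_ ≫ _) ≫ _) ≫ _) = _
  rw [diskSlide_eq, slideRight, slideLeft, ← disk_comp]
  simp only [Category.assoc]
  rfl

theorem leftDifunctor_split (S : DFunctor (Co C) C) {a b c : Co C ×ᵈ C} {s : a ⟶ c} {p : a ⟶ b}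
    {r : b ⟶ c} (θ : s ⟶ p ≫ r) : (leftDifunctor S).split θ = diskSplit (S.split θ.1) θ.2 := by
  unfold leftDifunctor
  rw [DFunctor.comp_split, DFunctor.prodMap_split, DFunctor.id_split]
  rfl

theorem leftDifunctor_slide (S : DFunctor (Co C) C) {a b c d : Co C ×ᵈ C} {p : a ⟶ b} {t' : b ⟶ d}
    {t : a ⟶ c} {q : c ⟶ d} (θ : p ≫ t' ⟶ t ≫ q) :
    (leftDifunctor S).slide θ = diskSlide (S.slide θ.1) θ.2 := by
  unfold leftDifunctor
  rw [DFunctor.comp_slide, DFunctor.prodMap_slide, DFunctor.id_slide]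
  rfl

theorem rightDifunctor_split (S : DFunctor (Co C) C) {a b c : Co C ×ᵈ C} {s : a ⟶ c} {p : a ⟶ b}
    {r : b ⟶ c} (θ : s ⟶ p ≫ r) : (rightDifunctor S).split θ = diskSplit θ.2 (S.split θ.1) := by
  unfold rightDifunctor
  rw [DFunctor.comp_split, DFunctor.comp_split, DFunctor.prodMap_split, DFunctor.id_split]
  exact congrArg (tensor (C := C)).split
    (DFunctor.swap_split (a := (S.prodMap (DFunctor.id C)).obj a)
      (b := (S.prodMap (DFunctor.id C)).obj b) (c := (S.prodMap (DFunctor.id C)).obj c)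
      (s := (S.prodMap (DFunctor.id C)).pmap s) (p := (S.prodMap (DFunctor.id C)).pmap p)
      (r := (S.prodMap (DFunctor.id C)).pmap r) (S.split θ.1, θ.2))

theorem rightDifunctor_slide (S : DFunctor (Co C) C) {a b c d : Co C ×ᵈ C} {p : a ⟶ b}
    {t' : b ⟶ d} {t : a ⟶ c} {q : c ⟶ d} (θ : p ≫ t' ⟶ t ≫ q) :
    (rightDifunctor S).slide θ = diskSlide θ.2 (S.slide θ.1) := by
  unfold rightDifunctor
  rw [DFunctor.comp_slide, DFunctor.comp_slide, DFunctor.prodMap_slide, DFunctor.id_slide]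
  exact congrArg (tensor (C := C)).slide
    (DFunctor.swap_slide (a := (S.prodMap (DFunctor.id C)).obj a)
      (b := (S.prodMap (DFunctor.id C)).obj b) (c := (S.prodMap (DFunctor.id C)).obj c)
      (d := (S.prodMap (DFunctor.id C)).obj d) (p := (S.prodMap (DFunctor.id C)).pmap p)
      (t' := (S.prodMap (DFunctor.id C)).pmap t') (t := (S.prodMap (DFunctor.id C)).pmap t)
      (q := (S.prodMap (DFunctor.id C)).pmap q) (S.slide θ.1, θ.2))

variable {S : DFunctor (Co C) C}

namespace Cap

/-- The proarrow-component disk of a cap is invertible. -/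
def diskIso (cap : Cap S) {A B : C} (m : A ⟶ B) :
    Cap.pro cap B ≫ (dpro S m ⊗ₚ 𝟙 B) ≅ Cap.pro cap A ≫ (𝟙 (dobj S A) ⊗ₚ m) :=
  whiskerRightIso (λ_ (Cap.pro cap B)).symm (dpro S m ⊗ₚ 𝟙 B) ≪≫
    (show (𝟙 (one : C) ≫ Cap.pro cap B) ≫ (dpro S m ⊗ₚ 𝟙 B) ≅
      (𝟙 (one : C) ≫ Cap.pro cap A) ≫ (S.pmap (𝟙 (Co.mk A)) ⊗ₚ m) from Dinat.disk cap m) ≪≫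
    whiskerRightIso (λ_ (Cap.pro cap A)) _ ≪≫
      whiskerLeftIso (Cap.pro cap A) (iso (S.mapId (Co.mk A)) (Iso.refl m))

/-- Dinatural naturality with two natural normalisations around it: removal of the constant source
by a unitor, and replacement of the image of a unit under `S` by a unit. -/
theorem disk_naturality (cap : Cap S) {A B A' B' : C} {m : A ⟶ B} {n : A' ⟶ B'} {f : Arr A A'}
    {g : Arr B B'} (φ : Sq m n f g) :
    DiskNat (pcomp (Cap.sq cap g) (csq S φ ⊗ₛ unitSq g))
      (pcomp (Cap.sq cap f) (unitSq (darr S f) ⊗ₛ φ)) (Cap.disk cap m) (Cap.disk cap n) := by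
  have h : DiskNat (pcomp (pcomp (unitSq (aid one)) (Cap.sq cap g)) (csq S φ ⊗ₛ unitSq g))
      (pcomp (pcomp (unitSq (aid one)) (Cap.sq cap f))
        (S.smap (unitSq (C := Co C) (A := Co.mk A) (B := Co.mk A') f) ⊗ₛ φ))
      (show (𝟙 (one : C) ≫ Cap.pro cap B) ≫ (dpro S m ⊗ₚ 𝟙 B) ⟶
        (𝟙 (one : C) ≫ Cap.pro cap A) ≫ (S.pmap (𝟙 (Co.mk A)) ⊗ₚ m) from (Dinat.disk cap m).hom)
      (show (𝟙 (one : C) ≫ Cap.pro cap B') ≫ (dpro S n ⊗ₚ 𝟙 B') ⟶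
        (𝟙 (one : C) ≫ Cap.pro cap A') ≫ (S.pmap (𝟙 (Co.mk A')) ⊗ₚ n) from
          (Dinat.disk cap n).hom) := by
    rw [unitSq_aid]
    exact Dinat.disk_naturality cap φ
  have hu : ∀ {A A' : C} (f : Arr A A'), DiskNat (pcomp (unitSq (aid one)) (Cap.sq cap f))
      (Cap.sq cap f) (λ_ (Cap.pro cap A)).hom (λ_ (Cap.pro cap A')).hom :=
    fun f => unitSq_pcomp (Cap.sq cap f)
  refine DiskNat.comp ((DiskNat.inv (hu g)).whiskerRight _) (h.comp ?_)
  refine DiskNat.comp ((hu f).whiskerRight _) (DiskNat.whiskerLeft ?_ _)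
  exact DiskNat.tensor (S.mapId_naturality (A := Co.mk A) (B := Co.mk A') f) (DiskNat.id φ)

/-- Specialises the dinatural composition law. The exchange on the constant side is an identity, and
the one on the other side becomes the inverse interchanger once images of units under `S` are
replaced by units. -/
theorem disk_comp (cap : Cap S) {A B E : C} (m : A ⟶ B) (n : B ⟶ E) :
    Cap.disk cap (m ≫ n) ≫ Cap.pro cap A ◁ (leftComp (dobj S A) m n).hom =
      Cap.pro cap E ◁ (MonoidalData.disk (cmapComp S m n).hom (𝟙 (𝟙 E)) ≫
        (rightComp (cpro S n) (cpro S m) E).hom) ≫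
      capPaste (Cap.disk cap m) (Cap.disk cap n) (interchanger (cpro S m) n).inv := by
  have hL : ((leftDifunctor S).mapIsoComp (proLComp m n E)).hom =
      MonoidalData.disk (cmapComp S m n).hom (𝟙 (𝟙 E)) ≫
        (rightComp (cpro S n) (cpro S m) E).hom := by
    refine (leftDifunctor_split S (proLComp m n E).hom).trans ?_
    rw [rightComp_hom_eq_diskSplit, disk_comp_diskSplit, Category.comp_id, Category.id_comp]
    exact congrArg (fun k => diskSplit k (λ_ (𝟙 E)).inv)
      (S.split_id (a := Co.mk E) (b := Co.mk B) (c := Co.mk A) n m)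
  rw [← hL]
  refine comp_capPaste_of_dinat rfl rfl rfl rfl rfl rfl rfl rfl
    (iₙ' := MonoidalData.disk (S.mapId (Co.mk A)).hom (𝟙 n))
    (heq_of_eq (Category.id_comp _)) (heq_of_eq ?_) (heq_of_eq ?_) (Dinat.disk_comp cap m n)
    HEq.rfl HEq.rfl HEq.rfl ?_ ?_
  · exact const_slide (J := Co C ×ᵈ C) (one : C) (proExchange n m).hom
  · exact Category.comp_id _
  -- The dinatural exchange involves the image of a unit under `S`, the interchanger a genuine unit;
  -- `S` preserves slides past a unit up to `mapId`.
  · rw [interchanger_inv]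
    have h : ((leftDifunctor S).mapCompIso (proExchange n m)).hom = diskSlide
        (S.slide (slideLeft (show Co.mk B ⟶ Co.mk A from m))) (slideRight n) :=
      leftDifunctor_slide S (proExchange n m).hom
    rw [h]
    exact slideNat_diskSlide (S.slideNat_slide_slideLeft (show Co.mk B ⟶ Co.mk A from m))
      (slideRight_natural (𝟙 n))
  -- Duplicating a unit before applying `S` and duplicating the genuine unit afterwards agree up to
  -- `mapId`.
  · have h : ((leftDifunctor S).mapIsoComp (proRComp A m n)).hom = diskSplit
        (S.split (λ_ (𝟙 (Co.mk A))).inv) (𝟙 (m ≫ n)) :=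
      leftDifunctor_split S (proRComp A m n).hom
    rw [h]
    rw [leftComp_hom_eq_diskSplit]
    refine (diskSplit_whisker _ _ _ _ (𝟙 m) (𝟙 n)).trans (Eq.trans ?_
      (disk_comp_diskSplit (S.mapId (Co.mk A)).hom (𝟙 (m ≫ n)) (λ_ (𝟙 (dobj S A))).inv
        (𝟙 (m ≫ n))).symm)
    refine congrArg₂ diskSplit (S.split_unit (Co.mk A)) ?_
    simp

end Cap

namespace Cup

/-- The proarrow-component disk of a cup is invertible. -/
def diskIso (cup : Cup S) {A B : C} (m : A ⟶ B) :
    (m ⊗ₚ 𝟙 (dobj S B)) ≫ Cup.pro cup B ≅ (𝟙 A ⊗ₚ dpro S m) ≫ Cup.pro cup A :=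
  whiskerRightIso (iso (Iso.refl m) (S.mapId (Co.mk B)).symm) (Cup.pro cup B) ≪≫
    (ρ_ ((m ⊗ₚ S.pmap (𝟙 (Co.mk B))) ≫ Cup.pro cup B)).symm ≪≫
    (show ((m ⊗ₚ S.pmap (𝟙 (Co.mk B))) ≫ Cup.pro cup B) ≫ 𝟙 (one : C) ≅
      ((𝟙 A ⊗ₚ dpro S m) ≫ Cup.pro cup A) ≫ 𝟙 (one : C) from Dinat.disk cup m) ≪≫
    ρ_ ((𝟙 A ⊗ₚ dpro S m) ≫ Cup.pro cup A)

theorem disk_naturality (cup : Cup S) {A B A' B' : C} {m : A ⟶ B} {n : A' ⟶ B'} {f : Arr A A'}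
    {g : Arr B B'} (φ : Sq m n f g) :
    DiskNat (pcomp (φ ⊗ₛ unitSq (darr S g)) (Cup.sq cup g))
      (pcomp (unitSq f ⊗ₛ csq S φ) (Cup.sq cup f)) (Cup.disk cup m) (Cup.disk cup n) := by
  have h : DiskNat (pcomp (pcomp
        (φ ⊗ₛ S.smap (unitSq (C := Co C) (A := Co.mk B) (B := Co.mk B') g))
        (Cup.sq cup g)) (unitSq (aid one)))
      (pcomp (pcomp (unitSq f ⊗ₛ csq S φ) (Cup.sq cup f)) (unitSq (aid one)))
      (show ((m ⊗ₚ S.pmap (𝟙 (Co.mk B))) ≫ Cup.pro cup B) ≫ 𝟙 (one : C) ⟶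
        ((𝟙 A ⊗ₚ dpro S m) ≫ Cup.pro cup A) ≫ 𝟙 (one : C) from (Dinat.disk cup m).hom)
      (show ((n ⊗ₚ S.pmap (𝟙 (Co.mk B'))) ≫ Cup.pro cup B') ≫ 𝟙 (one : C) ⟶
        ((𝟙 A' ⊗ₚ dpro S n) ≫ Cup.pro cup A') ≫ 𝟙 (one : C) from (Dinat.disk cup n).hom) := by
    rw [unitSq_aid]
    exact Dinat.disk_naturality cup φ
  have hu : ∀ {X X' : C} {p : X ⟶ one} {q : X' ⟶ one} {k : Arr X X'} (ψ : Sq p q k (aid one)),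
      DiskNat (pcomp ψ (unitSq (aid one))) ψ (ρ_ p).hom (ρ_ q).hom := fun ψ => pcomp_unitSq ψ
  refine DiskNat.comp (DiskNat.whiskerRight ?_ _) (DiskNat.comp (DiskNat.inv (hu _))
    (h.comp (hu _)))
  exact DiskNat.tensor (DiskNat.id φ) (DiskNat.inv (d := S.mapId (Co.mk B))
    (e := S.mapId (Co.mk B')) (S.mapId_naturality (A := Co.mk B) (B := Co.mk B') g))

/-- As for a cap, except that the unit comparisons precede the turn and therefore occur inverted. -/
theorem disk_comp (cup : Cup S) {A B E : C} (m : A ⟶ B) (n : B ⟶ E) :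
    Cup.disk cup (m ≫ n) ≫ (MonoidalData.disk (𝟙 (𝟙 A)) (cmapComp S m n).hom ≫
        (leftComp A (cpro S n) (cpro S m)).hom) ▷ Cup.pro cup A =
      (rightComp m n (dobj S E)).hom ▷ Cup.pro cup E ≫
      cupPaste (Cup.disk cup m) (Cup.disk cup n) (interchanger m (cpro S n)).hom := by
  have hL : ((rightDifunctor S).mapIsoComp (proLComp m n A)).hom =
      MonoidalData.disk (𝟙 (𝟙 A)) (cmapComp S m n).hom ≫
        (leftComp A (cpro S n) (cpro S m)).hom := by
    refine (rightDifunctor_split S (proLComp m n A).hom).trans ?_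
    rw [leftComp_hom_eq_diskSplit, disk_comp_diskSplit, Category.comp_id, Category.id_comp]
    exact congrArg (fun k => diskSplit (λ_ (𝟙 A)).inv k)
      (S.split_id (a := Co.mk E) (b := Co.mk B) (c := Co.mk A) n m)
  rw [← hL]
  refine comp_cupPaste_of_dinat rfl rfl rfl rfl rfl rfl rfl rfl
    (iₘ' := MonoidalData.disk (𝟙 m) (S.mapId (Co.mk B)).inv)
    (iₘ := MonoidalData.disk (𝟙 m) (S.mapId (Co.mk E)).inv)
    (heq_of_eq (Category.id_comp _)) (heq_of_eq ?_) (heq_of_eq ?_) (Dinat.disk_comp cup m n)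
    HEq.rfl HEq.rfl HEq.rfl ?_ ?_
  · exact const_slide (J := Co C ×ᵈ C) (one : C) (proExchange n m).hom
  · exact Category.comp_id _
  · have h : ((rightDifunctor S).mapCompIso (proExchange m n)).hom = diskSlide (slideRight m)
        (S.slide (slideLeft (show Co.mk E ⟶ Co.mk B from n))) :=
      rightDifunctor_slide S (proExchange m n).hom
    rw [interchanger_hom, h]
    exact slideNat_diskSlide (slideRight_natural (𝟙 m))
      (S.slideNat_slide_slideLeft (show Co.mk E ⟶ Co.mk B from n)).symm
  · have h : ((rightDifunctor S).mapIsoComp (proRComp E m n)).hom = diskSplit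
        (𝟙 (m ≫ n)) (S.split (λ_ (𝟙 (Co.mk E))).inv) :=
      rightDifunctor_split S (proRComp E m n).hom
    rw [h, rightComp_hom_eq_diskSplit]
    refine (disk_comp_diskSplit (𝟙 (m ≫ n)) (S.mapId (Co.mk E)).inv (𝟙 (m ≫ n))
      (S.split (λ_ (𝟙 (Co.mk E))).inv)).trans (Eq.trans ?_
      (diskSplit_whisker _ _ (𝟙 m) (𝟙 n) (S.mapId (Co.mk E)).inv (S.mapId (Co.mk E)).inv).symm)
    refine congrArg₂ diskSplit ?_ (S.mapId_comp_mapId (Co.mk E)).symm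
    simp

end Cup

end DoubleCategory

/-! ### The first zigzag: identification of its disk -/

namespace DoubleCategory

open MonoidalData

variable {C : Type u} [DoubleCategory.{u, v, w, x} C] [MonoidalData C] {S : DFunctor (Co C) C}

namespace Cap

/-- A cap, with its disks as proarrows turning around it. -/
def capData (cap : Cap S) : CapData S (DFunctor.id C) where
  pro A := Cap.pro cap A
  sq f := Cap.sq cap f
  sq_aid A _ := Dinat.appSq_aid cap A
  sq_acomp f g _ := Dinat.appSq_acomp cap f g
  turn m := diskIso cap m
  turn_naturality φ := disk_naturality cap φ
  turn_comp {A B E} m n := by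
    -- `CapData` records a comparison disk of `U`, which is an identity for the identity functor.
    have h : MonoidalData.disk (𝟙 (𝟙 (dobj S A))) ((DFunctor.id C).mapComp m n).hom ≫
        (leftComp (dobj S A) m n).hom = (leftComp (dobj S A) m n).hom :=
      (congrArg (· ≫ (leftComp (dobj S A) m n).hom) (disk_id (𝟙 (dobj S A)) (m ≫ n))).trans
        (Category.id_comp _)
    exact (congrArg (fun k => Cap.disk cap (m ≫ n) ≫ Cap.pro cap A ◁ k) h).trans
      (disk_comp cap m n)

end Cap

namespace Cup

/-- A cup, with its disks as proarrows turning around it. -/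
def cupData (cup : Cup S) : CupData S (DFunctor.id C) where
  pro A := Cup.pro cup A
  sq f := Cup.sq cup f
  sq_aid A _ := Dinat.appSq_aid cup A
  sq_acomp f g _ := Dinat.appSq_acomp cup f g
  turn m := diskIso cup m
  turn_naturality φ := disk_naturality cup φ
  turn_comp {A B E} m n := by
    have h : MonoidalData.disk ((DFunctor.id C).mapComp m n).hom (𝟙 (𝟙 (dobj S E))) ≫
        (rightComp m n (dobj S E)).hom = (rightComp m n (dobj S E)).hom :=
      (congrArg (· ≫ (rightComp m n (dobj S E)).hom) (disk_id (m ≫ n) (𝟙 (dobj S E)))).trans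
        (Category.id_comp _)
    exact (disk_comp cup m n).trans (congrArg (fun k => k ▷ Cup.pro cup E ≫
      cupPaste (Cup.disk cup m) (Cup.disk cup n) (interchanger m (cpro S n)).hom) h.symm)

end Cup

section

universe u₁ v₁ w₁

variable {B : Type u₁} [Bicategory.{w₁, v₁} B]

/-- The cell which moves a `1`-cell through a zigzag. -/
def zigzagCell {a b a₁ b₁ a₂ q r b₂ a₃ q₃ r₃ b₃ a₄ b₄ : B} {p : a ⟶ b} {rA : a ⟶ a₁} {rB : b ⟶ b₁}
    {p₁ : a₁ ⟶ b₁} {hB : b₁ ⟶ b₂} {hQ : a₁ ⟶ q} {p₂ : q ⟶ b₂} {kB : b₂ ⟶ b₃} {kQ : q ⟶ q₃}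
    {p₃ : q₃ ⟶ b₃} {eB : b₃ ⟶ b₄} {y₃ : q₃ ⟶ r₃} {eR : r₃ ⟶ b₄} {lB : b₄ ⟶ b} {y : q ⟶ r}
    {kR : r ⟶ r₃} {hA : a₁ ⟶ a₂} {z : a₂ ⟶ r} {kA : a₂ ⟶ a₃} {z₃ : a₃ ⟶ r₃} {eA : a₃ ⟶ a₄}
    {z₄ : a₄ ⟶ b₄} {lA : a₄ ⟶ a} (θr : p ≫ rB ≅ rA ≫ p₁) (θh : p₁ ≫ hB ≅ hQ ≫ p₂)
    (θk : p₂ ≫ kB ≅ kQ ≫ p₃) (κe : p₃ ≫ eB ≅ y₃ ≫ eR) (θy : y ≫ kR ≅ kQ ≫ y₃)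
    (κh : hQ ≫ y ≅ hA ≫ z) (θz : z ≫ kR ≅ kA ≫ z₃) (θe : z₃ ≫ eR ≅ eA ≫ z₄)
    (θl : z₄ ≫ lB ≅ lA ≫ p) :
    p ≫ rB ≫ hB ≫ kB ≫ eB ≫ lB ≅ (rA ≫ hA ≫ kA ≫ eA ≫ lA) ≫ p :=
  slideConj (regroup _ _ _ _) (regroup _ _ _ _)
    (foldIso (slideTIso θr (slideTIso θh θk)) (turnCup κe lB) (turnCap rA θy κh θz)
      (slideTIso θe θl))

section

variable {a b a₁ b₁ a₂ q r b₂ a₃ q₃ r₃ b₃ a₄ b₄ : B} {p : a ⟶ b} {rA : a ⟶ a₁} {rB : b ⟶ b₁}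
  {p₁ : a₁ ⟶ b₁} {hB : b₁ ⟶ b₂} {hQ : a₁ ⟶ q} {p₂ : q ⟶ b₂} {kB : b₂ ⟶ b₃} {kQ : q ⟶ q₃}
  {p₃ : q₃ ⟶ b₃} {eB : b₃ ⟶ b₄} {y₃ : q₃ ⟶ r₃} {eR : r₃ ⟶ b₄} {lB : b₄ ⟶ b} {y : q ⟶ r}
  {kR : r ⟶ r₃} {hA : a₁ ⟶ a₂} {z : a₂ ⟶ r} {kA : a₂ ⟶ a₃} {z₃ : a₃ ⟶ r₃} {eA : a₃ ⟶ a₄}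
  {z₄ : a₄ ⟶ b₄} {lA : a₄ ⟶ a} (θr : p ≫ rB ≅ rA ≫ p₁) (θh : p₁ ≫ hB ≅ hQ ≫ p₂)
  (θk : p₂ ≫ kB ≅ kQ ≫ p₃) (κe : p₃ ≫ eB ≅ y₃ ≫ eR) (θy : y ≫ kR ≅ kQ ≫ y₃)
  (κh : hQ ≫ y ≅ hA ≫ z) (θz : z ≫ kR ≅ kA ≫ z₃) (θe : z₃ ≫ eR ≅ eA ≫ z₄)
  (θl : z₄ ≫ lB ≅ lA ≫ p)

/-- Both sides consist of the same nine cells in the same order, so only coherence is left. Keeping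
the cells arbitrary separates this coherence argument from the tensor product. -/
theorem zigzagCell_hom : (zigzagCell θr θh θk κe θy κh θz θe θl).hom =
    𝟙 (p ≫ rB ≫ hB ≫ kB ≫ eB ≫ lB) ⊗≫ θr.hom ▷ (hB ≫ kB ≫ eB ≫ lB) ⊗≫
      rA ◁ θh.hom ▷ (kB ≫ eB ≫ lB) ⊗≫ (rA ≫ hQ) ◁ θk.hom ▷ (eB ≫ lB) ⊗≫
      (rA ≫ hQ ≫ kQ) ◁ κe.hom ▷ lB ⊗≫ (rA ≫ hQ) ◁ θy.inv ▷ (eR ≫ lB) ⊗≫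
      rA ◁ κh.hom ▷ (kR ≫ eR ≫ lB) ⊗≫ (rA ≫ hA) ◁ θz.hom ▷ (eR ≫ lB) ⊗≫
      (rA ≫ hA ≫ kA) ◁ θe.hom ▷ lB ⊗≫ (rA ≫ hA ≫ kA ≫ eA) ◁ θl.hom ⊗≫
      𝟙 ((rA ≫ hA ≫ kA ≫ eA ≫ lA) ≫ p) := by
  unfold zigzagCell
  simp only [slideConj_hom, foldIso_hom, turnCup_hom, turnCap_hom, regroup_hom, regroup_inv,
    slideTIso_hom, slideT]
  bicategory

/-- The inverse cells are variables tied by equations, so that they can be supplied in the form in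
which the second zigzag states them; the inverse interchanger of the reversed tensor product, for
example, is an ordinary interchanger. -/
theorem zigzagCell_inv {dh : hQ ≫ p₂ ⟶ p₁ ≫ hB} {dk : kQ ≫ p₃ ⟶ p₂ ≫ kB}
    {de : y₃ ≫ eR ⟶ p₃ ≫ eB} {d : hA ≫ z ⟶ hQ ≫ y} {dz : kA ≫ z₃ ⟶ z ≫ kR}
    {de' : eA ≫ z₄ ⟶ z₃ ≫ eR} (e₁ : θh.inv = dh) (e₂ : θk.inv = dk) (e₃ : κe.inv = de)
    (e₄ : κh.inv = d) (e₅ : θz.inv = dz) (e₆ : θe.inv = de') :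
    (zigzagCell θr θh θk κe θy κh θz θe θl).inv =
    𝟙 ((rA ≫ hA ≫ kA ≫ eA ≫ lA) ≫ p) ⊗≫ (rA ≫ hA ≫ kA ≫ eA) ◁ θl.inv ⊗≫
      (rA ≫ hA ≫ kA) ◁ de' ▷ lB ⊗≫ (rA ≫ hA) ◁ dz ▷ (eR ≫ lB) ⊗≫
      rA ◁ d ▷ (kR ≫ eR ≫ lB) ⊗≫ (rA ≫ hQ) ◁ θy.hom ▷ (eR ≫ lB) ⊗≫
      (rA ≫ hQ ≫ kQ) ◁ de ▷ lB ⊗≫ (rA ≫ hQ) ◁ dk ▷ (eB ≫ lB) ⊗≫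
      rA ◁ dh ▷ (kB ≫ eB ≫ lB) ⊗≫ θr.inv ▷ (hB ≫ kB ≫ eB ≫ lB) ⊗≫
      𝟙 (p ≫ rB ≫ hB ≫ kB ≫ eB ≫ lB) := by
  subst e₁ e₂ e₃ e₄ e₅ e₆
  unfold zigzagCell
  simp only [slideConj_inv, foldIso_inv, turnCup_inv, turnCap_inv, regroup_hom, regroup_inv,
    slideTIso_inv]
  bicategory

end

end

theorem zigzagDisk_capData_cupData (K : CoherenceCompanions C) (cap : Cap S) (cup : Cup S) {A B : C}
    (m : A ⟶ B) :
    (zigzagDisk K (Cap.capData cap) (Cup.cupData cup) m).hom = zigzagSDisk K cap cup m := by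
  refine (zigzagCell_hom (K.rightInvIso m) (interchanger m (Cap.pro cap B))
    (K.assocIsoX m (dobj S B) B) (tensorObjIso (Cup.diskIso cup m) B) (K.assocIsoY A (dpro S m) B)
    (objTensorIso A (Cap.diskIso cap m)) (K.assocIsoZ A (dobj S A) m)
    (interchanger (Cup.pro cup A) m).symm (K.leftIso m)).trans ?_
  -- The unit comparisons absorbed into the associator squares come out as the explicit disks of
  -- `zigzagSDisk`.
  have hX : (K.assocIsoX m (dobj S B) B).hom =
      disk (𝟙 m) (unitIso (dobj S B) B).inv ▷ (K.assocInv B (dobj S B) B).pro ≫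
      Companion.disk (K.assocInv A (dobj S B) B) (K.assocInv B (dobj S B) B)
        (assocInvSq m (𝟙 (dobj S B)) (𝟙 B)) := Companion.disk_lact _ _ _ _
  have hZ : (K.assocIsoZ A (dobj S A) m).hom =
      Companion.disk (K.assocInv A (dobj S A) A) (K.assocInv A (dobj S A) B)
        (assocInvSq (𝟙 A) (𝟙 (dobj S A)) m) ≫
      (K.assocInv A (dobj S A) A).pro ◁ disk (unitIso A (dobj S A)).hom (𝟙 m) :=
    Companion.disk_ract _ _ _ _
  rw [hX, hZ, tensorObjIso_hom, objTensorIso_hom]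
  rfl

end DoubleCategory

/-! ### Inverted turning laws, and functors with exchanged arguments -/

namespace DoubleCategory

open MonoidalData

section

universe u₁ v₁ w₁

variable {B : Type u₁} [Bicategory.{w₁, v₁} B]

theorem capPaste_comp_capPaste {o a b c d k l : B} {nY : a ⟶ b}
    {mY : b ⟶ c} {nZ : d ⟶ b} {mY' : d ⟶ k} {nZ' : k ⟶ c} {mZ : l ⟶ k} {h'' : o ⟶ a} {h' : o ⟶ d}
    {h : o ⟶ l} (κm : h' ≫ mY' ≅ h ≫ mZ) (κn : h'' ≫ nY ≅ h' ≫ nZ)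
    (τ : nZ ≫ mY ≅ mY' ≫ nZ') :
    capPaste κm.hom κn.hom τ.hom ≫ capPaste κn.inv κm.inv τ.inv = 𝟙 _ := by
  simp [capPaste]

theorem cupPaste_comp_cupPaste {a b c d f k g : B} {mX : a ⟶ b}
    {nX : b ⟶ c} {nY : b ⟶ d} {nY' : a ⟶ f} {mX' : f ⟶ d} {mY : f ⟶ k} {e'' : c ⟶ g} {e' : d ⟶ g}
    {e : k ⟶ g} (κm : mX' ≫ e' ≅ mY ≫ e) (κn : nX ≫ e'' ≅ nY ≫ e')
    (σ : mX ≫ nY ≅ nY' ≫ mX') :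
    cupPaste κm.hom κn.hom σ.hom ≫ cupPaste κn.inv κm.inv σ.inv = 𝟙 _ := by
  simp [cupPaste]

/-- Proarrows of `Co C` compose backwards, so the turning law required there has `m` and `n`
interchanged. Inverse turns satisfy precisely such a law. -/
theorem capPaste_inv {o a b c d k l : B} {mnY : a ⟶ c} {mnZ : l ⟶ c} {nY : a ⟶ b}
    {mY : b ⟶ c} {nZ : d ⟶ b} {mY' : d ⟶ k} {nZ' : k ⟶ c} {mZ : l ⟶ k} {h'' : o ⟶ a} {h' : o ⟶ d}
    {h : o ⟶ l} {κ : h'' ≫ mnY ≅ h ≫ mnZ} {κm : h' ≫ mY' ≅ h ≫ mZ} {κn : h'' ≫ nY ≅ h' ≫ nZ}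
    {τ : nZ ≫ mY ≅ mY' ≫ nZ'} {j : mnY ⟶ nY ≫ mY} {i : mnZ ⟶ mZ ≫ nZ'}
    (H : κ.hom ≫ h ◁ i = h'' ◁ j ≫ capPaste κm.hom κn.hom τ.hom) :
    κ.inv ≫ h'' ◁ j = h ◁ i ≫ capPaste κn.inv κm.inv τ.inv := by
  rw [Iso.inv_comp_eq, reassoc_of% H, capPaste_comp_capPaste]
  exact (Category.comp_id _).symm

theorem cupPaste_inv {a b c d f k g : B} {mnX : a ⟶ c} {mnY : a ⟶ k} {mX : a ⟶ b}
    {nX : b ⟶ c} {nY : b ⟶ d} {nY' : a ⟶ f} {mX' : f ⟶ d} {mY : f ⟶ k} {e'' : c ⟶ g} {e' : d ⟶ g}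
    {e : k ⟶ g} {κ : mnX ≫ e'' ≅ mnY ≫ e} {κm : mX' ≫ e' ≅ mY ≫ e} {κn : nX ≫ e'' ≅ nY ≫ e'}
    {σ : mX ≫ nY ≅ nY' ≫ mX'} {i : mnX ⟶ mX ≫ nX} {j : mnY ⟶ nY' ≫ mY}
    (H : κ.hom ≫ j ▷ e = i ▷ e'' ≫ cupPaste κm.hom κn.hom σ.hom) :
    κ.inv ≫ i ▷ e'' = j ▷ e ≫ cupPaste κn.inv κm.inv σ.inv := by
  rw [Iso.inv_comp_eq, reassoc_of% H, cupPaste_comp_cupPaste]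
  exact (Category.comp_id _).symm

end

namespace DFunctor

universe u' v' w' x' u'' v'' w'' x'' u₃ v₃ w₃ x₃

variable {C : Type u} [DoubleCategory.{u, v, w, x} C] {D : Type u'} [DoubleCategory.{u', v', w', x'} D]
  {E : Type u''} [DoubleCategory.{u'', v'', w'', x''} E] {F : Type u₃} [DoubleCategory.{u₃, v₃, w₃, x₃} F]

theorem comp_mapId_hom (P : DFunctor C D) (Q : DFunctor D E) (A : C) :
    ((P.comp Q).mapId A).hom = Q.dmap (P.mapId A).hom ≫ (Q.mapId (P.obj A)).hom := rfl

theorem prodMap_mapId_hom (P : DFunctor C D) (Q : DFunctor E F) (A : C ×ᵈ E) :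
    ((P.prodMap Q).mapId A).hom = ((P.mapId A.1).hom, (Q.mapId A.2).hom) :=
  Prod.ext ((congrArg (· ≫ (P.mapId A.1).hom) (P.dmap_id _)).trans (Category.id_comp _))
    ((congrArg (· ≫ (Q.mapId A.2).hom) (Q.dmap_id _)).trans (Category.id_comp _))

theorem prodAssoc_mapId_hom (A : (C ×ᵈ D) ×ᵈ E) :
    ((prodAssoc C D E).mapId A).hom = 𝟙 ((prodAssoc C D E).pmap (𝟙 A)) := by
  have h₁ : (fst C D).dmap (𝟙 (𝟙 A.1)) ≫ 𝟙 (𝟙 A.1.1) = 𝟙 (𝟙 A.1.1) :=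
    (congrArg (· ≫ 𝟙 (𝟙 A.1.1)) ((fst C D).dmap_id (𝟙 A.1))).trans (Category.id_comp _)
  have h₂ : (snd C D).dmap (𝟙 (𝟙 A.1)) ≫ 𝟙 (𝟙 A.1.2) = 𝟙 (𝟙 A.1.2) :=
    (congrArg (· ≫ 𝟙 (𝟙 A.1.2)) ((snd C D).dmap_id (𝟙 A.1))).trans (Category.id_comp _)
  exact Prod.ext h₁ (Prod.ext h₂ rfl)

/-- The functor `C ×ᵈ C ⥤ C` with exchanged arguments. -/
def flip (T : DFunctor (C ×ᵈ C) C) : DFunctor (C ×ᵈ C) C where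
  obj X := T.obj ⟨X.2, X.1⟩
  amap {A B} f := T.amap (A := ⟨A.2, A.1⟩) (B := ⟨B.2, B.1⟩) (f.2, f.1)
  pmap {A B} m := T.pmap (A := ⟨A.2, A.1⟩) (B := ⟨B.2, B.1⟩) (m.2, m.1)
  smap {A B A' B' m n f g} φ := T.smap (A := ⟨A.2, A.1⟩) (B := ⟨B.2, B.1⟩) (A' := ⟨A'.2, A'.1⟩)
    (B' := ⟨B'.2, B'.1⟩) (m := (m.2, m.1)) (n := (n.2, n.1)) (f := (f.2, f.1)) (g := (g.2, g.1))
    (φ.2, φ.1)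
  amap_aid A := T.amap_aid ⟨A.2, A.1⟩
  amap_acomp {A B E} f g := T.amap_acomp (A := ⟨A.2, A.1⟩) (B := ⟨B.2, B.1⟩) (E := ⟨E.2, E.1⟩)
    (f.2, f.1) (g.2, g.1)
  smap_sid {A B} m := T.smap_sid (A := ⟨A.2, A.1⟩) (B := ⟨B.2, B.1⟩) (m.2, m.1)
  smap_scomp {A B A' B' A'' B'' m n p f g f' g'} φ ψ := T.smap_scomp (A := ⟨A.2, A.1⟩)
    (B := ⟨B.2, B.1⟩) (A' := ⟨A'.2, A'.1⟩) (B' := ⟨B'.2, B'.1⟩) (A'' := ⟨A''.2, A''.1⟩)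
    (B'' := ⟨B''.2, B''.1⟩) (m := (m.2, m.1)) (n := (n.2, n.1)) (p := (p.2, p.1))
    (f := (f.2, f.1)) (g := (g.2, g.1)) (f' := (f'.2, f'.1)) (g' := (g'.2, g'.1)) (φ.2, φ.1)
    (ψ.2, ψ.1)
  mapComp {A B E} m n := T.mapComp (A := ⟨A.2, A.1⟩) (B := ⟨B.2, B.1⟩) (E := ⟨E.2, E.1⟩)
    (m.2, m.1) (n.2, n.1)
  mapId A := T.mapId ⟨A.2, A.1⟩
  mapComp_naturality {A B E A' B' E' m p n q f g h} φ ψ := T.mapComp_naturality (A := ⟨A.2, A.1⟩)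
    (B := ⟨B.2, B.1⟩) (E := ⟨E.2, E.1⟩) (A' := ⟨A'.2, A'.1⟩) (B' := ⟨B'.2, B'.1⟩)
    (E' := ⟨E'.2, E'.1⟩) (m := (m.2, m.1)) (n := (n.2, n.1)) (p := (p.2, p.1)) (q := (q.2, q.1))
    (f := (f.2, f.1)) (g := (g.2, g.1)) (h := (h.2, h.1)) (φ.2, φ.1) (ψ.2, ψ.1)
  mapId_naturality {A B} f := T.mapId_naturality (A := ⟨A.2, A.1⟩) (B := ⟨B.2, B.1⟩) (f.2, f.1)
  dmap_associator {A B E G} m n p := T.dmap_associator (A := ⟨A.2, A.1⟩) (B := ⟨B.2, B.1⟩)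
    (E := ⟨E.2, E.1⟩) (F := ⟨G.2, G.1⟩) (m.2, m.1) (n.2, n.1) (p.2, p.1)
  dmap_leftUnitor {A B} m := T.dmap_leftUnitor (A := ⟨A.2, A.1⟩) (B := ⟨B.2, B.1⟩) (m.2, m.1)
  dmap_rightUnitor {A B} m := T.dmap_rightUnitor (A := ⟨A.2, A.1⟩) (B := ⟨B.2, B.1⟩) (m.2, m.1)

variable (C) in
/-- The functor which restores twice reversed proarrows. -/
def coCo : DFunctor (Co (Co C)) C where
  obj A := A.un.un
  amap f := f
  pmap m := m
  smap φ := φ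
  amap_aid _ := rfl
  amap_acomp _ _ := rfl
  smap_sid _ := rfl
  smap_scomp _ _ := rfl
  mapComp {A _ E} m n := Iso.refl (show A.un.un ⟶ E.un.un from CategoryStruct.comp (obj := C) m n)
  mapId A := Iso.refl (𝟙 A.un.un)
  mapComp_naturality φ ψ := (DFunctor.id C).mapComp_naturality φ ψ
  mapId_naturality f := (DFunctor.id C).mapId_naturality f
  dmap_associator m n p := (DFunctor.id C).dmap_associator m n p
  dmap_leftUnitor m := (DFunctor.id C).dmap_leftUnitor m
  dmap_rightUnitor m := (DFunctor.id C).dmap_rightUnitor m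

variable (T : DFunctor (C ×ᵈ C) C)

/-- Stated for arbitrary `T`, so that it applies to the tensor product and to its flip. Flipping
interchanges the source and target expressions, which gives the laws of the reversed associator. -/
theorem assocTarget_mapId_hom (A B E : C) :
    (((DFunctor.prodAssoc C C C).comp (((DFunctor.id C).prodMap T).comp T)).mapId ⟨⟨A, B⟩, E⟩).hom =
      T.dmap (A := ⟨A, T.obj ⟨B, E⟩⟩) (B := ⟨A, T.obj ⟨B, E⟩⟩) (m := (𝟙 A, T.pmap (A := ⟨B, E⟩) (B := ⟨B, E⟩) (𝟙 B, 𝟙 E)))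
        (n := (𝟙 A, 𝟙 (T.obj ⟨B, E⟩))) (𝟙 (𝟙 A), (T.mapId ⟨B, E⟩).hom) ≫
        (T.mapId ⟨A, T.obj ⟨B, E⟩⟩).hom := by
  rw [comp_mapId_hom, prodAssoc_mapId_hom]
  refine ((congrArg (· ≫ ((((DFunctor.id C).prodMap T).comp T).mapId ⟨A, ⟨B, E⟩⟩).hom)
    ((((DFunctor.id C).prodMap T).comp T).dmap_id (A := ⟨A, ⟨B, E⟩⟩) (B := ⟨A, ⟨B, E⟩⟩)
      (𝟙 A, (𝟙 B, 𝟙 E)))).trans (Category.id_comp _)).trans ?_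
  rw [comp_mapId_hom, prodMap_mapId_hom]
  rfl

theorem assocSource_mapId_hom (A B E : C) :
    (((T.prodMap (DFunctor.id C)).comp T).mapId ⟨⟨A, B⟩, E⟩).hom =
      T.dmap (A := ⟨T.obj ⟨A, B⟩, E⟩) (B := ⟨T.obj ⟨A, B⟩, E⟩) (m := (T.pmap (A := ⟨A, B⟩) (B := ⟨A, B⟩) (𝟙 A, 𝟙 B), 𝟙 E))
        (n := (𝟙 (T.obj ⟨A, B⟩), 𝟙 E)) ((T.mapId ⟨A, B⟩).hom, 𝟙 (𝟙 E)) ≫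
        (T.mapId ⟨T.obj ⟨A, B⟩, E⟩).hom := by
  rw [comp_mapId_hom, prodMap_mapId_hom]
  rfl

theorem assocTarget_mapComp_hom {A B E A' B' E' A'' B'' E'' : C} (p : A ⟶ A') (r : A' ⟶ A'')
    (p' : B ⟶ B') (r' : B' ⟶ B'') (p'' : E ⟶ E') (r'' : E' ⟶ E'') :
    (((DFunctor.prodAssoc C C C).comp (((DFunctor.id C).prodMap T).comp T)).mapComp
      (A := ⟨⟨A, B⟩, E⟩) (B := ⟨⟨A', B'⟩, E'⟩) (E := ⟨⟨A'', B''⟩, E''⟩) ((p, p'), p'')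
      ((r, r'), r'')).hom = T.split (a := ⟨A, T.obj ⟨B, E⟩⟩) (b := ⟨A', T.obj ⟨B', E'⟩⟩)
        (c := ⟨A'', T.obj ⟨B'', E''⟩⟩) (s := (p ≫ r, T.pmap (p' ≫ r', p'' ≫ r'')))
        (p := (p, T.pmap (p', p''))) (r := (r, T.pmap (r', r'')))
        (𝟙 (p ≫ r), (T.mapComp (A := ⟨B, E⟩) (B := ⟨B', E'⟩) (E := ⟨B'', E''⟩) (p', p'')
          (r', r'')).hom) := by
  rw [← split_id, comp_split, comp_split, prodAssoc_split]
  have h := prodMap_split (DFunctor.id C) T (a := ⟨A, ⟨B, E⟩⟩)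
    (b := ⟨A', ⟨B', E'⟩⟩) (c := ⟨A'', ⟨B'', E''⟩⟩) (s := (p ≫ r, (p' ≫ r', p'' ≫ r'')))
    (p := (p, (p', p''))) (r := (r, (r', r''))) (𝟙 (p ≫ r), (𝟙 (p' ≫ r'), 𝟙 (p'' ≫ r'')))
  rw [id_split] at h
  refine (congrArg T.split h).trans (congrArg T.split (Prod.ext rfl ?_))
  exact T.split_id (a := ⟨B, E⟩) (b := ⟨B', E'⟩) (c := ⟨B'', E''⟩) (p', p'') (r', r'')

theorem assocSource_mapComp_hom {A B E A' B' E' A'' B'' E'' : C} (p : A ⟶ A') (r : A' ⟶ A'')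
    (p' : B ⟶ B') (r' : B' ⟶ B'') (p'' : E ⟶ E') (r'' : E' ⟶ E'') :
    (((T.prodMap (DFunctor.id C)).comp T).mapComp
      (A := ⟨⟨A, B⟩, E⟩) (B := ⟨⟨A', B'⟩, E'⟩) (E := ⟨⟨A'', B''⟩, E''⟩) ((p, p'), p'')
      ((r, r'), r'')).hom = T.split (a := ⟨T.obj ⟨A, B⟩, E⟩) (b := ⟨T.obj ⟨A', B'⟩, E'⟩)
        (c := ⟨T.obj ⟨A'', B''⟩, E''⟩) (s := (T.pmap (p ≫ r, p' ≫ r'), p'' ≫ r''))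
        (p := (T.pmap (p, p'), p'')) (r := (T.pmap (r, r'), r''))
        ((T.mapComp (A := ⟨A, B⟩) (B := ⟨A', B'⟩) (E := ⟨A'', B''⟩) (p, p')
          (r, r')).hom, 𝟙 (p'' ≫ r'')) := by
  rw [← split_id, comp_split, prodMap_split, id_split]
  refine congrArg T.split (Prod.ext ?_ rfl)
  exact T.split_id (a := ⟨A, B⟩) (b := ⟨A', B'⟩) (c := ⟨A'', B''⟩) (p, p') (r, r')

end DFunctor

section Reverse

variable {C : Type u} [DoubleCategory.{u, v, w, x} C] [MonoidalData C]

variable (C) in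
/-- The associator of the reversed tensor product. -/
def revAssocHom : ArrNat (((tensor (C := C)).flip.prodMap (DFunctor.id C)).comp (tensor (C := C)).flip)
    ((DFunctor.prodAssoc C C C).comp (((DFunctor.id C).prodMap (tensor (C := C)).flip).comp
      (tensor (C := C)).flip)) where
  app A := assocInvArr A.2 A.1.2 A.1.1
  appSq m := assocInvSq m.2 m.1.2 m.1.1
  naturality {A B} f := (assoc (C := C)).inv.naturality (A := ⟨⟨A.2, A.1.2⟩, A.1.1⟩)
    (B := ⟨⟨B.2, B.1.2⟩, B.1.1⟩) ((f.2, f.1.2), f.1.1)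
  sq_naturality {A B A' B' m n f g} φ := (assoc (C := C)).inv.sq_naturality
    (A := ⟨⟨A.2, A.1.2⟩, A.1.1⟩) (B := ⟨⟨B.2, B.1.2⟩, B.1.1⟩) (A' := ⟨⟨A'.2, A'.1.2⟩, A'.1.1⟩)
    (B' := ⟨⟨B'.2, B'.1.2⟩, B'.1.1⟩) (m := ((m.2, m.1.2), m.1.1)) (n := ((n.2, n.1.2), n.1.1))
    (f := ((f.2, f.1.2), f.1.1)) (g := ((g.2, g.1.2), g.1.1)) ((φ.2, φ.1.2), φ.1.1)
  appSq_id A := by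
    have h := (assoc (C := C)).inv.appSq_id ⟨⟨A.2, A.1.2⟩, A.1.1⟩
    have h₁ := (tensor (C := C)).flip.assocSource_mapId_hom A.1.1 A.1.2 A.2
    have h₂ := (tensor (C := C)).flip.assocTarget_mapId_hom A.1.1 A.1.2 A.2
    rw [DFunctor.assocSource_mapId_hom, DFunctor.assocTarget_mapId_hom] at h
    exact (congrArg (fun k => scomp (assocInvSq (𝟙 A.2) (𝟙 A.1.2) (𝟙 A.1.1)) k (acomp_aid _)
      (acomp_aid _)) h₂).trans (h.trans (congrArg (fun k => scomp k (unitSq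
        (assocInvArr A.2 A.1.2 A.1.1)) (aid_acomp _) (aid_acomp _)) h₁.symm))
  appSq_comp {A B E} m n := by
    have h := (assoc (C := C)).inv.appSq_comp (A := ⟨⟨A.2, A.1.2⟩, A.1.1⟩)
      (B := ⟨⟨B.2, B.1.2⟩, B.1.1⟩) (E := ⟨⟨E.2, E.1.2⟩, E.1.1⟩) ((m.2, m.1.2), m.1.1)
      ((n.2, n.1.2), n.1.1)
    have h₁ := (tensor (C := C)).flip.assocSource_mapComp_hom m.1.1 n.1.1 m.1.2 n.1.2 m.2 n.2
    have h₂ := (tensor (C := C)).flip.assocTarget_mapComp_hom m.1.1 n.1.1 m.1.2 n.1.2 m.2 n.2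
    rw [DFunctor.assocSource_mapComp_hom, DFunctor.assocTarget_mapComp_hom] at h
    exact (congrArg (fun k => scomp (assocInvSq (m.2 ≫ n.2) (m.1.2 ≫ n.1.2) (m.1.1 ≫ n.1.1)) k
      (acomp_aid _) (acomp_aid _)) h₂).trans (h.trans (congrArg (fun k => scomp k (pcomp
        (assocInvSq m.2 m.1.2 m.1.1) (assocInvSq n.2 n.1.2 n.1.1)) (aid_acomp _)
          (aid_acomp _)) h₁.symm))

variable (C) in
/-- The inverse associator of the reversed tensor product. -/
def revAssocInv : ArrNat ((DFunctor.prodAssoc C C C).comp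
      (((DFunctor.id C).prodMap (tensor (C := C)).flip).comp (tensor (C := C)).flip))
    (((tensor (C := C)).flip.prodMap (DFunctor.id C)).comp (tensor (C := C)).flip) where
  app A := assocArr A.2 A.1.2 A.1.1
  appSq m := assocSq m.2 m.1.2 m.1.1
  naturality {A B} f := (assoc (C := C)).hom.naturality (A := ⟨⟨A.2, A.1.2⟩, A.1.1⟩)
    (B := ⟨⟨B.2, B.1.2⟩, B.1.1⟩) ((f.2, f.1.2), f.1.1)
  sq_naturality {A B A' B' m n f g} φ := (assoc (C := C)).hom.sq_naturality
    (A := ⟨⟨A.2, A.1.2⟩, A.1.1⟩) (B := ⟨⟨B.2, B.1.2⟩, B.1.1⟩) (A' := ⟨⟨A'.2, A'.1.2⟩, A'.1.1⟩)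
    (B' := ⟨⟨B'.2, B'.1.2⟩, B'.1.1⟩) (m := ((m.2, m.1.2), m.1.1)) (n := ((n.2, n.1.2), n.1.1))
    (f := ((f.2, f.1.2), f.1.1)) (g := ((g.2, g.1.2), g.1.1)) ((φ.2, φ.1.2), φ.1.1)
  appSq_id A := by
    have h := (assoc (C := C)).hom.appSq_id ⟨⟨A.2, A.1.2⟩, A.1.1⟩
    have h₁ := (tensor (C := C)).flip.assocSource_mapId_hom A.1.1 A.1.2 A.2
    have h₂ := (tensor (C := C)).flip.assocTarget_mapId_hom A.1.1 A.1.2 A.2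
    rw [DFunctor.assocSource_mapId_hom, DFunctor.assocTarget_mapId_hom] at h
    exact (congrArg (fun k => scomp (assocSq (𝟙 A.2) (𝟙 A.1.2) (𝟙 A.1.1)) k (acomp_aid _)
      (acomp_aid _)) h₁).trans (h.trans (congrArg (fun k => scomp k (unitSq
        (assocArr A.2 A.1.2 A.1.1)) (aid_acomp _) (aid_acomp _)) h₂.symm))
  appSq_comp {A B E} m n := by
    have h := (assoc (C := C)).hom.appSq_comp (A := ⟨⟨A.2, A.1.2⟩, A.1.1⟩)
      (B := ⟨⟨B.2, B.1.2⟩, B.1.1⟩) (E := ⟨⟨E.2, E.1.2⟩, E.1.1⟩) ((m.2, m.1.2), m.1.1)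
      ((n.2, n.1.2), n.1.1)
    have h₁ := (tensor (C := C)).flip.assocSource_mapComp_hom m.1.1 n.1.1 m.1.2 n.1.2 m.2 n.2
    have h₂ := (tensor (C := C)).flip.assocTarget_mapComp_hom m.1.1 n.1.1 m.1.2 n.1.2 m.2 n.2
    rw [DFunctor.assocSource_mapComp_hom, DFunctor.assocTarget_mapComp_hom] at h
    exact (congrArg (fun k => scomp (assocSq (m.2 ≫ n.2) (m.1.2 ≫ n.1.2) (m.1.1 ≫ n.1.1)) k
      (acomp_aid _) (acomp_aid _)) h₁).trans (h.trans (congrArg (fun k => scomp k (pcomp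
        (assocSq m.2 m.1.2 m.1.1) (assocSq n.2 n.1.2 n.1.1)) (aid_acomp _)
          (aid_acomp _)) h₂.symm))

end Reverse

end DoubleCategory

/-! ### The reversed tensor product and the second zigzag -/

namespace DoubleCategory

open MonoidalData

section Inverse

variable {C : Type u} [DoubleCategory.{u, v, w, x} C]

theorem Companion.diskInv_lact {A B A' B' : C} {m : A ⟶ A'} {n n' : B ⟶ B'} {s : Arr A B}
    {t : Arr A' B'} (hs : Companion s) (ht : Companion t) {s' : Arr B A} {t' : Arr B' A'}
    (es : acomp s s' = aid A) (et : acomp t' t = aid B') (d : n' ⟶ n)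
    (φ : Sq n m s' t') :
    diskInv hs ht es et (lact d φ) = hs.pro ◁ d ≫ diskInv hs ht es et φ := by
  unfold diskInv
  rw [pcomp_lact_left, pcomp_lact_right]
  simp only [lact_disk]
  simp

theorem Companion.diskInv_ract {A B A' B' : C} {m m' : A ⟶ A'} {n : B ⟶ B'} {s : Arr A B}
    {t : Arr A' B'} (hs : Companion s) (ht : Companion t) {s' : Arr B A} {t' : Arr B' A'}
    (es : acomp s s' = aid A) (et : acomp t' t = aid B') (φ : Sq n m s' t') (e : m ⟶ m') :
    diskInv hs ht es et (ract φ e) = diskInv hs ht es et φ ≫ e ▷ ht.pro := by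
  unfold diskInv
  rw [pcomp_ract_left, pcomp_ract_right]
  simp only [ract_disk]
  simp

end Inverse

section Reverse

variable {C : Type u} [DoubleCategory.{u, v, w, x} C] [MonoidalData C]

variable (C) in
/-- The left unitor of the reversed tensor product. -/
def revLeftHom : ArrNat ((DFunctor.pair (DFunctor.const C (one : C)) (DFunctor.id C)).comp
    (tensor (C := C)).flip) (DFunctor.id C) where
  app A := rightArr A
  appSq m := rightSq m
  naturality f := (right (C := C)).hom.naturality f
  sq_naturality φ := (right (C := C)).hom.sq_naturality φ
  appSq_id A := (right (C := C)).hom.appSq_id A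
  appSq_comp m n := (right (C := C)).hom.appSq_comp m n

variable (C) in
/-- The inverse left unitor of the reversed tensor product. -/
def revLeftInv : ArrNat (DFunctor.id C) ((DFunctor.pair (DFunctor.const C (one : C))
    (DFunctor.id C)).comp (tensor (C := C)).flip) where
  app A := rightInvArr A
  appSq m := rightInvSq m
  naturality f := (right (C := C)).inv.naturality f
  sq_naturality φ := (right (C := C)).inv.sq_naturality φ
  appSq_id A := (right (C := C)).inv.appSq_id A
  appSq_comp m n := (right (C := C)).inv.appSq_comp m n

variable (C) in
/-- The right unitor of the reversed tensor product. -/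
def revRightHom : ArrNat ((DFunctor.pair (DFunctor.id C) (DFunctor.const C (one : C))).comp
    (tensor (C := C)).flip) (DFunctor.id C) where
  app A := leftArr A
  appSq m := leftSq m
  naturality f := (left (C := C)).hom.naturality f
  sq_naturality φ := (left (C := C)).hom.sq_naturality φ
  appSq_id A := (left (C := C)).hom.appSq_id A
  appSq_comp m n := (left (C := C)).hom.appSq_comp m n

variable (C) in
/-- The inverse right unitor of the reversed tensor product. -/
def revRightInv : ArrNat (DFunctor.id C) ((DFunctor.pair (DFunctor.id C)
    (DFunctor.const C (one : C))).comp (tensor (C := C)).flip) where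
  app A := leftInvArr A
  appSq m := leftInvSq m
  naturality f := (left (C := C)).inv.naturality f
  sq_naturality φ := (left (C := C)).inv.sq_naturality φ
  appSq_id A := (left (C := C)).inv.appSq_id A
  appSq_comp m n := (left (C := C)).inv.appSq_comp m n

variable (C) in
/-- The monoidal structure with reversed tensor product. -/
abbrev revMonoidalData : MonoidalData C where
  tensor := (tensor (C := C)).flip
  one := one
  assoc :=
    { hom := revAssocHom C
      inv := revAssocInv C
      hom_inv A := (assoc (C := C)).inv_hom ⟨⟨A.2, A.1.2⟩, A.1.1⟩
      inv_hom A := (assoc (C := C)).hom_inv ⟨⟨A.2, A.1.2⟩, A.1.1⟩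
      hom_inv_sq {A B} m := (assoc (C := C)).inv_hom_sq (A := ⟨⟨A.2, A.1.2⟩, A.1.1⟩)
        (B := ⟨⟨B.2, B.1.2⟩, B.1.1⟩) ((m.2, m.1.2), m.1.1)
      inv_hom_sq {A B} m := (assoc (C := C)).hom_inv_sq (A := ⟨⟨A.2, A.1.2⟩, A.1.1⟩)
        (B := ⟨⟨B.2, B.1.2⟩, B.1.1⟩) ((m.2, m.1.2), m.1.1) }
  left :=
    { hom := revLeftHom C
      inv := revLeftInv C
      hom_inv A := (right (C := C)).hom_inv A
      inv_hom A := (right (C := C)).inv_hom A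
      hom_inv_sq m := (right (C := C)).hom_inv_sq m
      inv_hom_sq m := (right (C := C)).inv_hom_sq m }
  right :=
    { hom := revRightHom C
      inv := revRightInv C
      hom_inv A := (left (C := C)).hom_inv A
      inv_hom A := (left (C := C)).inv_hom A
      hom_inv_sq m := (left (C := C)).hom_inv_sq m
      inv_hom_sq m := (left (C := C)).inv_hom_sq m }

/-- The companions for the reversed tensor product. -/
def CoherenceCompanions.rev (K : CoherenceCompanions C) :
    @CoherenceCompanions C _ (revMonoidalData C) :=
  @CoherenceCompanions.mk C _ (revMonoidalData C) (fun X Y Z => K.assocInv Z Y X)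
    (fun X Y Z => K.assoc Z Y X) K.right K.rightInv K.left K.leftInv

/-- For the flipped product `interchanger_hom` gives the two unit slides with the tensor factors
exchanged, and this is `interchanger_inv` for the original product. -/
theorem rev_interchanger_hom {A B A' B' : C} (m : A ⟶ B) (n : A' ⟶ B') :
    (@interchanger C _ (revMonoidalData C) _ _ _ _ m n).hom = (interchanger n m).inv :=
  (@interchanger_hom C _ (revMonoidalData C) _ _ _ _ m n).trans (interchanger_inv n m).symm

theorem rev_interchanger_inv {A B A' B' : C} (m : A ⟶ B) (n : A' ⟶ B') :
    (@interchanger C _ (revMonoidalData C) _ _ _ _ m n).inv = (interchanger n m).hom :=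
  (@interchanger_inv C _ (revMonoidalData C) _ _ _ _ m n).trans (interchanger_hom n m).symm

variable {S : DFunctor (Co C) C}

/-- The turning of dual proarrows around a cap, for the reversed tensor product. -/
def Cap.revCapData (cap : Cap S) :
    @CapData C _ (revMonoidalData C) (Co C) _ (DFunctor.coCo C) S :=
  @CapData.mk C _ (revMonoidalData C) (Co C) _ (DFunctor.coCo C) S
    (fun A => Cap.pro cap A.un) (fun {A B} f => Cap.sq cap (A := A.un) (B := B.un) f)
    (fun A _ => Dinat.appSq_aid cap A.un)
    (fun {A B E} f g _ => Dinat.appSq_acomp cap (A := A.un) (B := B.un) (E := E.un) f g)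
    (fun {A B} m => (Cap.diskIso cap (A := B.un) (B := A.un) m).symm)
    (fun {A B A' B' m n f g} φ => DiskNat.inv (Cap.disk_naturality cap (A := B.un) (B := A.un)
      (A' := B'.un) (B' := A'.un) (m := m) (n := n) (f := g) (g := f) φ))
    (fun {A B E} m n => by
      -- The composite of `m` and `n` in `Co C` is `n` followed by `m` in `C`; the law of the cap
      -- for that composite is the one to be inverted.
      have h := capPaste_inv (κ := Cap.diskIso cap (A := E.un) (B := A.un)
        (CategoryStruct.comp (obj := C) n m)) (κm := Cap.diskIso cap (A := E.un) (B := B.un) n)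
        (κn := Cap.diskIso cap (A := B.un) (B := A.un) m)
        (τ := (interchanger (cpro S (J := C) n) (show B.un ⟶ A.un from m)).symm)
        (Cap.disk_comp cap (A := E.un) (B := B.un) (E := A.un) n m)
      have e : MonoidalData.disk (𝟙 (𝟙 (dobj S E.un))) (𝟙 (CategoryStruct.comp (obj := C) n m)) ≫
          (leftComp (dobj S E.un) (show E.un ⟶ B.un from n) (show B.un ⟶ A.un from m)).hom =
          (leftComp (dobj S E.un) (show E.un ⟶ B.un from n) (show B.un ⟶ A.un from m)).hom := by
        rw [disk_id]; exact Category.id_comp _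
      rw [← e] at h
      rw [rev_interchanger_inv]
      exact h)

/-- The turning of dual proarrows around a cup, for the reversed tensor product. -/
def Cup.revCupData (cup : Cup S) :
    @CupData C _ (revMonoidalData C) (Co C) _ (DFunctor.coCo C) S :=
  @CupData.mk C _ (revMonoidalData C) (Co C) _ (DFunctor.coCo C) S
    (fun A => Cup.pro cup A.un) (fun {A B} f => Cup.sq cup (A := A.un) (B := B.un) f)
    (fun A _ => Dinat.appSq_aid cup A.un)
    (fun {A B E} f g _ => Dinat.appSq_acomp cup (A := A.un) (B := B.un) (E := E.un) f g)
    (fun {A B} m => (Cup.diskIso cup (A := B.un) (B := A.un) m).symm)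
    (fun {A B A' B' m n f g} φ => DiskNat.inv (Cup.disk_naturality cup (A := B.un) (B := A.un)
      (A' := B'.un) (B' := A'.un) (m := m) (n := n) (f := g) (g := f) φ))
    (fun {A B E} m n => by
      have h := cupPaste_inv (κ := Cup.diskIso cup (A := E.un) (B := A.un)
        (CategoryStruct.comp (obj := C) n m)) (κm := Cup.diskIso cup (A := E.un) (B := B.un) n)
        (κn := Cup.diskIso cup (A := B.un) (B := A.un) m)
        (σ := interchanger (show E.un ⟶ B.un from n) (cpro S (J := C) (A := B.un) (B := A.un) m))
        (Cup.disk_comp cup (A := E.un) (B := B.un) (E := A.un) n m)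
      have e : MonoidalData.disk (𝟙 (CategoryStruct.comp (obj := C) n m)) (𝟙 (𝟙 (dobj S A.un))) ≫
          (rightComp (show E.un ⟶ B.un from n) (show B.un ⟶ A.un from m) (dobj S A.un)).hom =
          (rightComp (show E.un ⟶ B.un from n) (show B.un ⟶ A.un from m) (dobj S A.un)).hom := by
        rw [disk_id]; exact Category.id_comp _
      rw [← e] at h
      rw [rev_interchanger_hom]
      exact h)

/-- Under reversal the associator trades places with its inverse, the left unitor with the right
one, and tensoring on the left with tensoring on the right. Each inverse cell of the general zigzag
thereby becomes a cell of `zigzagZDisk`, in the prescribed order. -/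
theorem zigzagDisk_revCapData_revCupData (K : CoherenceCompanions C) (cap : Cap S) (cup : Cup S)
    {A B : C} (m : A ⟶ B) :
    (@zigzagDisk C _ (revMonoidalData C) K.rev (Co C) _ (DFunctor.coCo C) S (Cap.revCapData cap)
      (Cup.revCupData cup) (Co.mk B) (Co.mk A) m).inv = zigzagZDisk K cap cup m := by
  have hX : (@CoherenceCompanions.assocIsoX C _ (revMonoidalData C) K.rev _ _ (dpro S m) A
      (dobj S A)).inv = Companion.diskInv (K.assoc (dobj S A) A (dobj S B))
        (K.assoc (dobj S A) A (dobj S A)) ((assoc (C := C)).hom_inv ⟨⟨dobj S A, A⟩, dobj S B⟩)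
        ((assoc (C := C)).inv_hom ⟨⟨dobj S A, A⟩, dobj S A⟩)
        (assocInvSq (𝟙 (dobj S A)) (𝟙 A) (dpro S m)) ≫
      disk (unitIso (dobj S A) A).hom (𝟙 (dpro S m)) ▷ (K.assoc (dobj S A) A (dobj S A)).pro :=
    Companion.diskInv_ract _ _ _ _ _ _
  have hZ : (@CoherenceCompanions.assocIsoZ C _ (revMonoidalData C) K.rev (dobj S B) B _ _
      (dpro S m)).inv =
      (K.assoc (dobj S B) B (dobj S B)).pro ◁ disk (𝟙 (dpro S m)) (unitIso B (dobj S B)).inv ≫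
      Companion.diskInv (K.assoc (dobj S B) B (dobj S B)) (K.assoc (dobj S A) B (dobj S B))
        ((assoc (C := C)).hom_inv ⟨⟨dobj S B, B⟩, dobj S B⟩)
        ((assoc (C := C)).inv_hom ⟨⟨dobj S A, B⟩, dobj S B⟩)
        (assocInvSq (dpro S m) (𝟙 B) (𝟙 (dobj S B))) :=
    Companion.diskInv_lact _ _ _ _ _ _
  have he : (@tensorObjIso C _ (revMonoidalData C) _ _ _ _ _ _ _ _ (Cup.diskIso cup m).symm
      (dobj S A)).inv = objTensor (dobj S A) (Cup.disk cup m) :=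
    @tensorObjIso_inv C _ (revMonoidalData C) _ _ _ _ _ _ _ _ (Cup.diskIso cup m).symm (dobj S A)
  have hh : (@objTensorIso C _ (revMonoidalData C) (dobj S B) _ _ _ _ _ _ _ _
      (Cap.diskIso cap m).symm).inv = tensorObj (Cap.disk cap m) (dobj S B) :=
    @objTensorIso_inv C _ (revMonoidalData C) (dobj S B) _ _ _ _ _ _ _ _ (Cap.diskIso cap m).symm
  have hi := rev_interchanger_inv (dpro S m) (Cap.pro cap A)
  have hi' : (@interchanger C _ (revMonoidalData C) _ _ _ _ (Cup.pro cup B) (dpro S m)).symm.inv =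
    (interchanger (dpro S m) (Cup.pro cup B)).inv := rev_interchanger_hom _ _
  refine (zigzagCell_inv (@CoherenceCompanions.rightInvIso C _ (revMonoidalData C) K.rev _ _ (dpro S m))
    (@interchanger C _ (revMonoidalData C) _ _ _ _ (dpro S m) (Cap.pro cap A))
    (@CoherenceCompanions.assocIsoX C _ (revMonoidalData C) K.rev _ _ (dpro S m) A (dobj S A))
    (@tensorObjIso C _ (revMonoidalData C) _ _ _ _ _ _ _ _ (Cup.diskIso cup m).symm (dobj S A))
    (@CoherenceCompanions.assocIsoY C _ (revMonoidalData C) K.rev (dobj S B) _ _ m (dobj S A))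
    (@objTensorIso C _ (revMonoidalData C) (dobj S B) _ _ _ _ _ _ _ _ (Cap.diskIso cap m).symm)
    (@CoherenceCompanions.assocIsoZ C _ (revMonoidalData C) K.rev (dobj S B) B _ _ (dpro S m))
    (@interchanger C _ (revMonoidalData C) _ _ _ _ (Cup.pro cup B) (dpro S m)).symm
    (@CoherenceCompanions.leftIso C _ (revMonoidalData C) K.rev _ _ (dpro S m)) hi hX he hh hZ hi').trans ?_
  -- The cells that were not rewritten agree on unfolding the reversed structure.
  rfl

end Reverse

end DoubleCategory

theorem mainTheorem1 {C : Type u} [DoubleCategory.{u, v, w, x} C] [MonoidalDoubleCategory C]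
    (K : CoherenceCompanions C) (S : DFunctor (Co C) C) (cap : Cap S) (cup : Cup S) :
    (∃ s : PseudoNat (zigzagS K cap cup),
      ∀ {A B : C} (m : A ⟶ B), (s.disk m).hom = zigzagSDisk K cap cup m) ∧
    (∃ z : PseudoNat (zigzagZ K cap cup),
      ∀ {A B : C} (m : A ⟶ B),
        (z.disk (A := Co.mk B) (B := Co.mk A) m).inv = zigzagZDisk K cap cup m) := by
  refine ⟨⟨zigzagPseudoNat K (Cap.capData cap) (Cup.cupData cup),
    fun m => zigzagDisk_capData_cupData K cap cup m⟩,
    -- As a proarrow of `Co C`, `m` runs from `Co.mk B` to `Co.mk A`, so the disk of the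
    -- transformation goes from `m* ≫ Z_A` to `Z_B ≫ m*`, and its inverse is the disk to be
    -- exhibited. The components agree with `zigzagZ` on unfolding the reversed structure.
    @zigzagPseudoNat C _ (revMonoidalData C) K.rev (Co C) _ (DFunctor.coCo C) S
      (Cap.revCapData cap) (Cup.revCupData cup),
    fun m => zigzagDisk_revCapData_revCupData K cap cup m⟩
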